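/- Theorem (fast classical random walk). Setting. Let $d\ge 1$, $L,T,\alpha>0$, $\epsilon\in(0,1)$, and let $u(\mathbf x,t)$ be four times differentiable on $\mathbb R^d\times[0,T]$, of period $L$ in each coordinate $x_j$, with $\partial u/\partial t=\alpha\sum_{j=1}^d\partial^2u/\partial x_j^2$ for $0<t<T$ and $u(\cdot,0)=u_0\ge 0$. For a smoothness parameter $\zeta$ assume, for all $i,j$ and on $[0,L]^d\times[0,T]$, that $|\partial^4u/\partial x_i^2\partial x_j^2|\le\zeta/L^d$, $|\partial^2u/\partial x_i^2|\le\zeta/L^{d-2}$ and $|\partial u/\partial x_i|\le\zeta/L^{d-3}$. Let $A\ge1$, put $X=L\sqrt{d\zeta(\alpha T+L^2)/\epsilon}$, let $n\ge 1$ be an integer with $X\le n\le AX$, let $\Delta x=L/n$ and $\Delta t=\Delta x^2/(2d\alpha)$, and assume $\Delta t\le T$ and the normalisation $\sum_{\mathbf k\in\mathbb Z_n^d}u_0(\Delta x\,\mathbf k)=(n/L)^d$. Let $t=m\Delta t\le T$ with $m\ge0$ an integer, and let $S=\prod_{j=1}^d[(a_j+\tfrac12)\Delta x,(b_j+\tfrac12)\Delta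 x]\subseteq[0,L]^d$ with integers $0\le a_j\le b_j<n$ be a rectangular region whose corners are integer multiples of $\Delta x$ shifted by $\Delta x/2$. Model. Programs are fixed (they do not depend on any of the parameters) and run on a randomised word RAM with word length $w$, at unit cost per step. The machine can draw uniformly random words; it can query, at unit cost, the exact sum of $u_0$ over any axis-parallel box of grid points, and toss a coin whose bias is a quotient of two such sums, but can use these real numbers in no other way. The inputs are the integers $d,n,m,K,a_j,b_j$, and $w$ is any number with $2^w\ge(d+n+m+K+2)^c$, where $c$ is an absolute constant (for the binomial sampler below: $2^w\ge(l+b+2)^c$). Claim. There are absolute constants $c\in\mathbb N$ and $C_0,\kappa>0$ and three programs such that the following holds. (a) The first program samples exactly from the binomial distribution with parameters $(l,a/b)$, for all integers $l\ge 0$, $b\ge1$, $0\le a\le b$, in expected time at most $C_0\log(2+l)$. (b) The endpoint of $m$ steps of the simple random walk on $\mathbb Z_n^d$ (each step changes a uniformly random coordinate by $\pm1$ with equal probability) has the law obtained by $d$ nested binomial samples: for $j=1,\dots,d$ draw $s_j\sim\mathrm{Bin}(m-s_1-\dots-s_{j-1},1/(d-j+1))$, then the number $h_j\sim\mathrm{Bin}(s_j,1/2)$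 of increments, and add $h_j-(s_j-h_j)$ to coordinate $j$ modulo $n$. If the values on the grid are proportional to a probability distribution $p_0$ on $\mathbb Z_n^d$, the second program samples exactly from the endpoint of this $m$-step walk started from $p_0$, in expected time at most $C_0d(\log(2+n)+\log(2+m))$, and the expected number of times that it calls the first program is exactly $2d$. (c) The third program outputs the number of those among $K$ independent such endpoints $\mathbf k$ that satisfy $a_j<k_j\le b_j$ for all $j$ (its output has exactly this law); the expected number of times that it calls the second program is exactly $K$. (d) For every $A\ge1$ there is a constant $C>0$, depending only on $A$, such that in the setting above, with $K=\lceil\kappa/\epsilon^2\rceil$ samples and $$\tau=C\,\frac{d}{\epsilon^2}\,\log\!\left(2+TL\alpha\,d^{5/2}\zeta^{3/2}\Big(\frac{\alpha T+L^2}{\epsilon}\Big)^{3/2}\right),$$ the expected running time of the third program is at most $\tau$, and with probability at least $0.99$ it halts within $\tau$ steps and its output, divided by $K$, is a number $\overline u(S)$ with $\left|\overline u(S)-\int_Su(\mathbf x,t)\,d\mathbf x\right|\le\epsilon$. -/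

import Mathlib

open scoped ENNReal

noncomputable section

namespace HeatWalk

/-! ### Randomised word RAM -/

/-- Unit-cost operations on words. -/
inductive BinOp where
  | add | sub | mul | div | mod | shl | shr | land | lor | xor | lt | eq

/-- Value of an operation, before reduction modulo `2 ^ w` (`sub` is truncated subtraction,
`div` and `mod` are the integer operations with `x / 0 = 0` and `x % 0 = x`). -/
def BinOp.eval : BinOp → ℕ → ℕ → ℕ
  | .add, x, y => x + y
  | .sub, x, y => x - y
  | .mul, x, y => x * y
  | .div, x, y => x / y
  | .mod, x, y => x % y
  | .shl, x, y => x <<< y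
  | .shr, x, y => x >>> y
  | .land, x, y => x &&& y
  | .lor, x, y => x ||| y
  | .xor, x, y => x ^^^ y
  | .lt, x, y => if x < y then 1 else 0
  | .eq, x, y => if x = y then 1 else 0

/-- Elementary instructions. Registers are named by numerals (a program mentions only finitely
many of them); `load` and `store` are the indirect memory accesses. -/
inductive Instr where
  /-- `reg x := c mod 2 ^ w` -/
  | const (x c : ℕ)
  /-- `reg x := o (reg y) (reg z) mod 2 ^ w` -/
  | bin (o : BinOp) (x y z : ℕ)
  /-- `reg x := mem (reg y)` -/
  | load (x y : ℕ)
  /-- `mem (reg x) := reg y` -/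
  | store (x y : ℕ)
  /-- `reg x :=` a uniformly random word -/
  | rand (x : ℕ)
  /-- `real r :=` the exact sum of the initial data over the grid box whose lower corner is stored
  at the addresses `reg y, …, reg y + d - 1` and whose (exclusive) upper corner is stored at
  `reg y + d, …, reg y + 2 d - 1` -/
  | query (r y : ℕ)
  /-- `reg x :=` a coin with bias `real r / real s` -/
  | flip (x r s : ℕ)

/-- Programs: finite structured code over the instructions. -/
inductive Prog where
  | instr (o : Instr)
  | seq (p q : Prog)
  /-- run `p` if `reg x ≠ 0`, and `q` otherwise -/
  | ite (x : ℕ) (p q : Prog)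
  /-- run `p` as long as `reg x ≠ 0` -/
  | while (x : ℕ) (p : Prog)

/-- The state of the machine. The real-valued cells only receive answers to queries and are only
read by coin flips: no arithmetic, no comparison, no branching on reals. -/
@[ext] structure State where
  reg : ℕ → ℕ
  mem : ℕ → ℕ
  real : ℕ → ℝ

/-- The environment: word length, dimension, and the table of sums of the initial data over
discretised boxes (lower corner inclusive, upper corner exclusive). -/
structure Env where
  w : ℕ
  d : ℕ
  boxSum : (Fin d → ℕ) → (Fin d → ℕ) → ℝ

def State.setReg (M : Env) (s : State) (x v : ℕ) : State :=
  { s with reg := Function.update s.reg x (v % 2 ^ M.w) }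

/-- A coin in `{0, 1}` with success probability `p`, clamped to `[0, 1]`. -/
def coin (p : ℝ) : PMF ℕ :=
  (ProbabilityTheory.bernoulliMeasure 1 0 (Set.projIcc 0 1 zero_le_one p)).toPMF

def Instr.exec (M : Env) (s : State) : Instr → PMF State
  | .const x c => PMF.pure (s.setReg M x c)
  | .bin o x y z => PMF.pure (s.setReg M x (o.eval (s.reg y) (s.reg z)))
  | .load x y => PMF.pure (s.setReg M x (s.mem (s.reg y)))
  | .store x y => PMF.pure { s with mem := Function.update s.mem (s.reg x) (s.reg y) }
  | .rand x => (PMF.uniformOfFintype (Fin (2 ^ M.w))).map fun v => s.setReg M x v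
  | .query r y => PMF.pure { s with
      real := Function.update s.real r
        (M.boxSum (fun j => s.mem (s.reg y + j)) (fun j => s.mem (s.reg y + M.d + j))) }
  | .flip x r t => (coin (s.real r / s.real t)).map fun v => s.setReg M x v

/-- A configuration: the code still to be executed, and the state. The machine has halted when no
code is left. -/
abbrev Config := List Prog × State

/-- One step of the machine, at cost one. -/
def step (M : Env) : Config → PMF Config
  | ([], s) => PMF.pure ([], s)
  | (.instr o :: k, s) => (o.exec M s).map fun s' => (k, s')
  | (.seq p q :: k, s) => PMF.pure (p :: q :: k, s)
  | (.ite x p q :: k, s) => PMF.pure (if s.reg x ≠ 0 then (p :: k, s) else (q :: k, s))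
  | (.while x p :: k, s) => PMF.pure (if s.reg x ≠ 0 then (p :: .while x p :: k, s) else (k, s))

/-- Law of the configuration after `N` steps. -/
def run (M : Env) : ℕ → Config → PMF Config
  | 0, c => PMF.pure c
  | N + 1, c => (step M c).bind (run M N)

/-- Probability that `P`, started in `s`, halts after at most `N` steps in a state in `E`. -/
def haltProbWithin (M : Env) (P : Prog) (s : State) (N : ℕ) (E : Set State) : ℝ≥0∞ :=
  (run M N ([P], s)).toOuterMeasure {c | c.1 = [] ∧ c.2 ∈ E}

/-- Probability that `P`, started in `s`, ever halts and does so in a state in `E`. -/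
def haltProb (M : Env) (P : Prog) (s : State) (E : Set State) : ℝ≥0∞ :=
  ⨆ N, haltProbWithin M P s N E

/-- Expected running time, as the sum over `N` of the probabilities of needing more than `N`
steps. -/
def expectedTime (M : Env) (P : Prog) (s : State) : ℝ≥0∞ :=
  ∑' N, (run M N ([P], s)).toOuterMeasure {c | c.1 ≠ []}

/-- Expected number of times that a run of `P` starts executing the subprogram `Q`. -/
def expectedCalls (M : Env) (P : Prog) (s : State) (Q : Prog) : ℝ≥0∞ :=
  ∑' N, (run M N ([P], s)).toOuterMeasure {c | c.1.head? = some Q}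

/-- Initial state of a binomial sampler: parameters `l`, `a`, `b` (success probability `a / b`) in
the registers 4, 5, 6, and zero everywhere else. -/
def binomInput (l a b : ℕ) : State where
  reg x := if x = 4 then l else if x = 5 then a else if x = 6 then b else 0
  mem _ := 0
  real _ := 0

/-- Initial state of the walk and of the estimator: dimension `d`, grid size `n`, number of time
steps `m` and number of samples `K` in the registers 0, 1, 2, 3; the index vectors `lo`, `hi` that
describe the region at the addresses `0, …, d - 1` and `d, …, 2 d - 1`; zero everywhere else. -/
def walkInput (d n m K : ℕ) (lo hi : Fin d → ℕ) : State where
  reg x := if x = 0 then d else if x = 1 then n else if x = 2 then m else if x = 3 then K else 0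
  mem a := if h : a < d then lo ⟨a, h⟩ else if h : a - d < d then hi ⟨a - d, h⟩ else 0
  real _ := 0

/-! ### Grid, random walk, binomial sampling -/

/-- The point of the grid of spacing `L / n` with index `k`. -/
def gridPoint (L : ℝ) {d n : ℕ} (k : Fin d → ZMod n) : Fin d → ℝ := fun j => (k j).val * (L / n)

/-- The environment with word length `w` whose queries are answered from the table `f` of values
on the grid. -/
def gridEnv (w : ℕ) {d n : ℕ} [NeZero n] (f : (Fin d → ZMod n) → ℝ) : Env where
  w := w
  d := d
  boxSum lo hi := ∑ k with ∀ j, lo j ≤ (k j).val ∧ (k j).val < hi j, f k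

/-- Law of the endpoint of `m` steps of the simple random walk on `ℤ_n ^ d` started at `x`: in each
step a coordinate is chosen uniformly and changed by `1` or `-1` with equal probability. -/
def simpleWalk (d n : ℕ) [NeZero d] : ℕ → (Fin d → ZMod n) → PMF (Fin d → ZMod n)
  | 0, x => PMF.pure x
  | m + 1, x => (PMF.uniformOfFintype (Fin d × Bool)).bind fun p =>
      simpleWalk d n m (Function.update x p.1 (x p.1 + if p.2 then 1 else -1))

/-- The binomial distribution with parameters `l` and `p`, for `0 ≤ p ≤ 1`. -/
def binomialLaw (l : ℕ) (p : ℝ) : PMF ℕ :=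
  (ProbabilityTheory.binomial l (Set.projIcc 0 1 zero_le_one p)).toPMF

/-- Nested binomial sampling in the last `r` coordinates, with `m` steps left to distribute: the
number `s` of steps in the first of these coordinates is binomial with parameters `m` and `1 / r`,
the number `h` of increments among them is binomial with parameters `s` and `1 / 2`, and the other
`m - s` steps are distributed over the remaining `r - 1` coordinates in the same way. -/
def nestedBinomial (d n : ℕ) : ℕ → ℕ → (Fin d → ZMod n) → PMF (Fin d → ZMod n)
  | 0, _, x => PMF.pure x
  | r + 1, m, x => (binomialLaw m (1 / (r + 1))).bind fun s => (binomialLaw s (1 / 2)).bind fun h =>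
      nestedBinomial d n r (m - s)
        (fun j => if (j : ℕ) + (r + 1) = d then x j + (h - ((s - h : ℕ) : ZMod n)) else x j)

open Classical in
/-- Law of the number of hits of `S` among `K` independent samples from `p`. -/
def hitCount {X : Type*} (p : PMF X) (S : Set X) : ℕ → PMF ℕ
  | 0 => PMF.pure 0
  | K + 1 => p.bind fun x => (hitCount p S K).map fun h => h + if x ∈ S then 1 else 0

/-! ### The heat equation -/

/-- The partial derivative in the `i`-th spatial coordinate. -/
def pd {d : ℕ} (i : Fin d) (f : (Fin d → ℝ) → ℝ) (x : Fin d → ℝ) : ℝ :=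
  lineDeriv ℝ f x (Pi.single i 1)

/-- `u` solves the heat equation `∂u/∂t = α Δu` for times in `[0, T]`, with period `L` in every
coordinate and with non-negative initial data `u₀`; it is four times differentiable on
`ℝ ^ d × [0, T]`, and satisfies the derivative bounds with smoothness parameter `ζ`. -/
structure IsHeatSolution (d : ℕ) (L T α ζ : ℝ) (u₀ : (Fin d → ℝ) → ℝ)
    (u : (Fin d → ℝ) → ℝ → ℝ) : Prop where
  differentiable : ∀ k : ℕ, k < 4 → DifferentiableOn ℝ
    (iteratedFDerivWithin ℝ k (fun p : (Fin d → ℝ) × ℝ => u p.1 p.2) (Set.univ ×ˢ Set.Icc 0 T))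
    (Set.univ ×ˢ Set.Icc 0 T)
  periodic : ∀ t ∈ Set.Icc 0 T, ∀ x i, u (x + Pi.single i L) t = u x t
  initial : ∀ x, u x 0 = u₀ x
  nonneg : ∀ x, 0 ≤ u₀ x
  heat : ∀ x, ∀ t ∈ Set.Ioo 0 T,
    deriv (fun s => u x s) t = α * ∑ i, pd i (pd i (fun y => u y t)) x
  bound_four : ∀ x ∈ Set.Icc (0 : Fin d → ℝ) (fun _ => L), ∀ t ∈ Set.Icc 0 T, ∀ i j,
    |pd i (pd i (pd j (pd j (fun y => u y t)))) x| ≤ ζ / L ^ (d : ℤ)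
  bound_two : ∀ x ∈ Set.Icc (0 : Fin d → ℝ) (fun _ => L), ∀ t ∈ Set.Icc 0 T, ∀ i,
    |pd i (pd i (fun y => u y t)) x| ≤ ζ / L ^ ((d : ℤ) - 2)
  bound_one : ∀ x ∈ Set.Icc (0 : Fin d → ℝ) (fun _ => L), ∀ t ∈ Set.Icc 0 T, ∀ i,
    |pd i (fun y => u y t) x| ≤ ζ / L ^ ((d : ℤ) - 3)

/-- `(d / ε²) log (2 + T L α d^{5/2} ζ^{3/2} ((α T + L²) / ε)^{3/2})` -/
def timeBound (d : ℕ) (L T α ζ ε : ℝ) : ℝ :=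
  d / ε ^ 2 * Real.log (2 + T * L * α * (d : ℝ) ^ (5 / 2 : ℝ) * ζ ^ (3 / 2 : ℝ) *
    ((α * T + L ^ 2) / ε) ^ (3 / 2 : ℝ))

end HeatWalk

end

noncomputable section

namespace HeatWalk

/-! ### Expected values under a probability mass function -/

/-! Heat and walks. With Δt = Δx²/(2dα) the coefficient of `u x t` in the explicit finite difference
scheme vanishes, and one time step replaces a grid function by its mean over neighbours. This is the
transition operator of the simple random walk. So the heat in the region is, up to discretisation,
the probability that an m-step walk started from the normalised initial data ends there. Taylor's
formula gives the local error of the scheme (`IsHeatSolution.abs_scheme_le`). Since neighbour means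
are self-adjoint and hitting probabilities lie in [0, 1], local errors only add up
(`abs_sum_sub_le`). The midpoint rule passes from the integral to the sum over the grid. The total
bias is at most 7ε/12, and Chebyshev's inequality for the number of hits leaves 5ε/12 for the
sampling error.

Fast endpoints. An endpoint is sampled in about d (log n + log m) expected steps instead of m. The
starting point is found by bisection with box sums. The displacements come from nested binomials:
conditioning on one step shows that their law satisfies the recursion of the walk (`mul_nex_succ`,
`nestedBinomial_eq_simpleWalk`).

Exact binomials. Reading a/b in binary reduces Bin(l, a/b) to fair binomials: Bin(l, p/2) is a
p-thinning of Bin(l, 1/2), and Bin(l, (1+p)/2) is Bin(l, 1/2) plus a p-thinning of the rest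
(`bex_half_mul`, `bex_half_add`). The number of trials halves on average, so about log l rounds
suffice. A fair binomial is sampled in bounded expected time by rejection over blocks of deviations
whose length is at most about √m. The acceptance probabilities are ratios of binomial coefficients.
By the Chu-Vandermonde identity such a ratio is an alternating sum, and this sum is the probability
that a sequence of coins with small rational biases has an even number of successes before its first
failure (`sum_vnTerm`, `cwt_mul_vn`). Only integers of polynomial size occur.

Programs. `ex` is the expected cost plus final reward of a run: the reward 0 gives running times and
numbers of calls, the cost 0 gives halting probabilities. It composes along sequences (`ex_append`),
and a loop is bounded by any super-solution of its equation (`ex_while_le`). Upper bounds that hold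
for every reward determine the law: a reward multiplied by a large number makes the running time
negligible, and because the total mass is one, upper bounds on all outcomes are equalities
(`Samples.law_eq`). Hence each sampler is verified by one potential function that carries time and
distribution together. -/

/-- The expected value of `f` under `p`. -/
def avg {α : Type*} (p : PMF α) (f : α → ℝ≥0∞) : ℝ≥0∞ := ∑' x, p x * f x

section avg
variable {α β : Type*}

lemma avg_pure (a : α) (f : α → ℝ≥0∞) : avg (PMF.pure a) f = f a := by
  classical
  rw [avg, tsum_eq_single a]
  · simp
  · intro b hb
    simp [hb]

lemma avg_bind (p : PMF α) (q : α → PMF β) (f : β → ℝ≥0∞) :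
    avg (p.bind q) f = avg p fun a => avg (q a) f := by
  simp only [avg, PMF.bind_apply, ← ENNReal.tsum_mul_right, ← ENNReal.tsum_mul_left]
  rw [ENNReal.tsum_comm]
  simp only [mul_assoc]

lemma avg_map (p : PMF α) (g : α → β) (f : β → ℝ≥0∞) :
    avg (p.map g) f = avg p fun a => f (g a) := by
  simp only [PMF.map, avg_bind, Function.comp, avg_pure]

lemma avg_add (p : PMF α) (f g : α → ℝ≥0∞) :
    avg p (fun a => f a + g a) = avg p f + avg p g := by
  simp only [avg, mul_add, ENNReal.tsum_add]

lemma avg_const (p : PMF α) (c : ℝ≥0∞) : avg p (fun _ => c) = c := by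
  simp [avg, ENNReal.tsum_mul_right, p.tsum_coe]

lemma avg_const_mul (p : PMF α) (c : ℝ≥0∞) (f : α → ℝ≥0∞) :
    avg p (fun a => c * f a) = c * avg p f := by
  simp only [avg, ← ENNReal.tsum_mul_left]
  exact tsum_congr fun a => mul_left_comm _ _ _

lemma avg_mono {p : PMF α} {f g : α → ℝ≥0∞} (h : ∀ a, f a ≤ g a) : avg p f ≤ avg p g :=
  ENNReal.tsum_le_tsum fun a => mul_le_mul_right (h a) _

lemma avg_tsum {ι : Type*} (p : PMF α) (f : ι → α → ℝ≥0∞) :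
    avg p (fun a => ∑' i, f i a) = ∑' i, avg p (f i) := by
  simp only [avg, ← ENNReal.tsum_mul_left]
  exact ENNReal.tsum_comm

/-- Monotone convergence for the counting measure on the discrete σ-algebra. -/
lemma tsum_iSup_of_monotone (f : ℕ → α → ℝ≥0∞) (hf : Monotone f) :
    ∑' a, ⨆ n, f n a = ⨆ n, ∑' a, f n a := by
  let _ : MeasurableSpace α := ⊤
  simp only [← MeasureTheory.lintegral_count]
  exact MeasureTheory.lintegral_iSup (fun n => measurable_from_top) hf

lemma avg_iSup (p : PMF α) (f : ℕ → α → ℝ≥0∞) (hf : Monotone f) :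
    avg p (fun a => ⨆ n, f n a) = ⨆ n, avg p (f n) := by
  simp only [avg, ENNReal.mul_iSup]
  exact tsum_iSup_of_monotone _ fun m n h a => mul_le_mul_right (hf h a) _

lemma avg_indicator [DecidableEq α] (p : PMF α) (x : α) :
    avg p (fun a => if a = x then 1 else 0) = p x := by
  rw [avg, tsum_eq_single x]
  · simp
  · intro b hb
    simp [hb]

lemma avg_uniform [Fintype α] [Nonempty α] (f : α → ℝ≥0∞) :
    avg (PMF.uniformOfFintype α) f = (Fintype.card α : ℝ≥0∞)⁻¹ * ∑ a, f a := by
  simp [avg, tsum_fintype, Finset.mul_sum]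

lemma toOuterMeasure_eq_avg (p : PMF α) (s : Set α) [DecidablePred (· ∈ s)] :
    p.toOuterMeasure s = avg p fun a => if a ∈ s then 1 else 0 := by
  rw [PMF.toOuterMeasure_apply, avg]
  refine tsum_congr fun a => ?_
  by_cases h : a ∈ s <;> simp [h]

end avg

/-! ### Expected cost plus final reward of a run -/

/-- The cost of the next step. -/
def headCost (γ : Prog → ℝ≥0∞) : List Prog → ℝ≥0∞
  | [] => 0
  | p :: _ => γ p

/-- Expected cost of the first `N` steps, plus the reward `F` if the machine has halted by then. -/
def exN (M : Env) (γ : Prog → ℝ≥0∞) (F : State → ℝ≥0∞) : ℕ → Config → ℝ≥0∞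
  | 0, ([], s) => F s
  | 0, (_ :: _, _) => 0
  | N + 1, c => headCost γ c.1 + avg (step M c) (exN M γ F N)

/-- Expected total cost plus final reward, for the code `k` started in `s`. -/
def ex (M : Env) (γ : Prog → ℝ≥0∞) (k : List Prog) (F : State → ℝ≥0∞) (s : State) : ℝ≥0∞ :=
  ⨆ N, exN M γ F N (k, s)

section ex
variable {M : Env} {γ : Prog → ℝ≥0∞} {F : State → ℝ≥0∞}

lemma exN_nil (N : ℕ) (s : State) : exN M γ F N ([], s) = F s := by
  induction N with
  | zero => rfl
  | succ N ih => simp [exN, headCost, step, avg_pure, ih]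

lemma exN_le_succ (N : ℕ) (c : Config) : exN M γ F N c ≤ exN M γ F (N + 1) c := by
  induction N generalizing c with
  | zero =>
    obtain ⟨_ | ⟨p, k⟩, s⟩ := c
    · simp [exN_nil]
    · simp [exN]
  | succ N ih =>
    rw [exN, exN]
    exact add_le_add_right (avg_mono ih) _

lemma exN_monotone : Monotone (exN M γ F) :=
  monotone_nat_of_le_succ fun N c => exN_le_succ N c

@[simp] lemma ex_nil (s : State) : ex M γ [] F s = F s := by simp [ex, exN_nil]

/-- The fixed-point equation: the supremum may start at budget one, and monotone convergence moves
it inside the average. All rules for single constructs follow from it. -/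
lemma ex_step (p : Prog) (k : List Prog) (s : State) :
    ex M γ (p :: k) F s = γ p + avg (step M (p :: k, s)) fun c => ex M γ c.1 F c.2 := by
  have h : ex M γ (p :: k) F s = ⨆ N, exN M γ F (N + 1) (p :: k, s) := by
    refine le_antisymm (iSup_le fun N => ?_) (iSup_le fun N => le_iSup_of_le (N + 1) le_rfl)
    exact le_iSup_of_le N (exN_le_succ N _)
  rw [h]
  simp only [exN, headCost, ← ENNReal.add_iSup]
  rw [← avg_iSup _ _ exN_monotone]
  rfl

lemma step_append (p : Prog) (k k' : List Prog) (s : State) :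
    step M (p :: (k ++ k'), s) = (step M (p :: k, s)).map fun c => (c.1 ++ k', c.2) := by
  rcases p with o | ⟨p, q⟩ | ⟨x, p, q⟩ | ⟨x, p⟩
  · simp [step, PMF.map_comp, Function.comp_def]
  · simp [step, PMF.pure_map]
  · by_cases h : s.reg x = 0 <;> simp [step, PMF.pure_map, h]
  · by_cases h : s.reg x = 0 <;> simp [step, PMF.pure_map, h]

/-- Granting the second piece of code a fresh budget of `N` steps, and the first an unlimited one,
can only increase the value. -/
lemma exN_append_le (N : ℕ) (k k' : List Prog) (s : State) :
    exN M γ F N (k ++ k', s) ≤ ex M γ k (fun s' => exN M γ F N (k', s')) s := by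
  induction N generalizing k s with
  | zero =>
    cases k with
    | nil => simp
    | cons p k => simp [exN]
  | succ N ih =>
    cases k with
    | nil => simp
    | cons p k =>
      rw [List.cons_append, exN, step_append, avg_map, ex_step]
      refine add_le_add_right (avg_mono fun c => (ih _ _).trans ?_) _
      refine iSup_mono fun n => ?_
      have : ∀ (n : ℕ) (c : Config) (F G : State → ℝ≥0∞), (∀ s, F s ≤ G s) →
          exN M γ F n c ≤ exN M γ G n c := by
        intro n
        induction n with
        | zero => rintro ⟨_ | ⟨p, k⟩, s⟩ F G h <;> simp [exN, h]
        | succ n ihn => exact fun c F G h => add_le_add_right (avg_mono fun c => ihn c F G h) _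
      exact this _ _ _ _ fun s => exN_le_succ _ _

lemma exN_mono (N : ℕ) (c : Config) {G : State → ℝ≥0∞} (h : ∀ s, F s ≤ G s) :
    exN M γ F N c ≤ exN M γ G N c := by
  induction N generalizing c with
  | zero => obtain ⟨_ | ⟨p, k⟩, s⟩ := c <;> simp [exN, h]
  | succ n ih => exact add_le_add_right (avg_mono ih) _

lemma ex_mono {G : State → ℝ≥0∞} (h : ∀ s, F s ≤ G s) (k : List Prog) (s : State) :
    ex M γ k F s ≤ ex M γ k G s :=
  iSup_mono fun N => exN_mono N _ h

/-- The composition rule: the value of the second piece of code serves as the reward of the first.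
-/
lemma ex_append (k k' : List Prog) (s : State) :
    ex M γ (k ++ k') F s = ex M γ k (ex M γ k' F) s := by
  refine le_antisymm (iSup_le fun N => (exN_append_le N k k' s).trans
    (ex_mono (fun s' => le_iSup_of_le N le_rfl) k s)) (iSup_le fun N => ?_)
  induction N generalizing k s with
  | zero => obtain _ | ⟨p, k⟩ := k <;> simp [exN]
  | succ N ih =>
    cases k with
    | nil => simp [exN_nil]
    | cons p k =>
      rw [List.cons_append, exN, ex_step, step_append, avg_map]
      exact add_le_add_right (avg_mono fun c => ih _ _) _

lemma ex_cons (p : Prog) (k : List Prog) (s : State) :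
    ex M γ (p :: k) F s = ex M γ [p] (ex M γ k F) s := ex_append [p] k s

lemma ex_seq (p q : Prog) (k : List Prog) (s : State) :
    ex M γ (.seq p q :: k) F s = γ (.seq p q) + ex M γ (p :: q :: k) F s := by
  simp [ex_step (.seq p q), step, avg_pure]

lemma ex_ite (x : ℕ) (p q : Prog) (k : List Prog) (s : State) :
    ex M γ (.ite x p q :: k) F s =
      γ (.ite x p q) + if s.reg x ≠ 0 then ex M γ (p :: k) F s else ex M γ (q :: k) F s := by
  rw [ex_step (.ite x p q)]
  by_cases h : s.reg x = 0 <;> simp [step, avg_pure, h]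

lemma ex_while (x : ℕ) (p : Prog) (k : List Prog) (s : State) :
    ex M γ (.while x p :: k) F s = γ (.while x p) +
      if s.reg x ≠ 0 then ex M γ (p :: .while x p :: k) F s else ex M γ k F s := by
  rw [ex_step (.while x p)]
  by_cases h : s.reg x = 0 <;> simp [step, avg_pure, h]

lemma ex_instr (o : Instr) (k : List Prog) (s : State) :
    ex M γ (.instr o :: k) F s = γ (.instr o) + avg (o.exec M s) (ex M γ k F) := by
  rw [ex_step, step, avg_map]

/-- Any super-solution of the loop equation bounds the expected cost and reward of the loop. -/
lemma ex_while_le {x : ℕ} {p : Prog} (V : State → ℝ≥0∞)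
    (h : ∀ s, γ (.while x p) + (if s.reg x ≠ 0 then ex M γ [p] V s else F s) ≤ V s) (s : State) :
    ex M γ [.while x p] F s ≤ V s := by
  -- Induction on the step budget: `V` dominates every truncation of the loop, whether or not it is
  -- the least solution.
  refine iSup_le fun N => ?_
  induction N generalizing s with
  | zero => simp [exN]
  | succ N ih =>
    refine le_trans ?_ (h s)
    rw [exN]
    refine add_le_add_right ?_ _
    by_cases hx : s.reg x = 0
    · simp [step, hx, avg_pure, exN_nil]
    · simp only [step, hx, avg_pure, ne_eq, not_false_eq_true, if_true]
      exact (exN_append_le N [p] [.while x p] s).trans (ex_mono (fun s' => ih s') _ _)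

/-- Linearity: cost and reward separate. From here on, laws are computed with cost zero. -/
lemma ex_eq_cost_add (k : List Prog) (s : State) :
    ex M γ k F s = ex M γ k 0 s + ex M 0 k F s := by
  have h : ∀ N c, exN M γ F N c = exN M γ 0 N c + exN M 0 F N c := by
    intro N
    induction N with
    | zero => rintro ⟨_ | ⟨p, k⟩, s⟩ <;> simp [exN]
    | succ N ih =>
      rintro ⟨k, s⟩
      have : headCost 0 k = 0 := by cases k <;> rfl
      rw [exN, exN, exN, funext ih, avg_add, this, zero_add, add_assoc]
  simp only [ex, h]
  exact (ENNReal.iSup_add_iSup_of_monotone (fun m n hmn => exN_monotone hmn _)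
    (fun m n hmn => exN_monotone hmn _)).symm

lemma ex_zero_const_mul (k : List Prog) (s : State) (c : ℝ≥0∞) :
    ex M 0 k (fun s => c * F s) s = c * ex M 0 k F s := by
  have h : ∀ N d, exN M 0 (fun s => c * F s) N d = c * exN M 0 F N d := by
    intro N
    induction N with
    | zero => rintro ⟨_ | ⟨p, k⟩, s⟩ <;> simp [exN]
    | succ N ih =>
      rintro ⟨k, s⟩
      have : headCost 0 k = 0 := by cases k <;> rfl
      rw [exN, exN, funext ih, avg_const_mul, this, zero_add, zero_add]
  simp only [ex, h, ENNReal.mul_iSup]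

lemma ex_zero_tsum {ι : Type*} (G : ι → State → ℝ≥0∞) (k : List Prog) (s : State) :
    ex M 0 k (fun s => ∑' i, G i s) s = ∑' i, ex M 0 k (G i) s := by
  have h : ∀ N d, exN M 0 (fun s => ∑' i, G i s) N d = ∑' i, exN M 0 (G i) N d := by
    intro N
    induction N with
    | zero => rintro ⟨_ | ⟨p, k⟩, s⟩ <;> simp [exN]
    | succ N ih =>
      rintro ⟨k, s⟩
      have : headCost 0 k = 0 := by cases k <;> rfl
      simp only [exN, funext ih, avg_tsum, this, zero_add]
  simp only [ex, h]
  exact (tsum_iSup_of_monotone (fun N i => exN M 0 (G i) N (k, s))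
    fun m n hmn i => exN_monotone hmn _).symm

lemma ex_zero_add (G : State → ℝ≥0∞) (k : List Prog) (s : State) :
    ex M 0 k (fun s => F s + G s) s = ex M 0 k F s + ex M 0 k G s := by
  have := ex_zero_tsum (M := M) (fun b : Bool => if b then F else G) k s
  simpa [tsum_fintype] using this

lemma ex_zero_zero (k : List Prog) (s : State) : ex M 0 k (fun _ => 0) s = 0 := by
  simpa using ex_zero_const_mul (M := M) (F := fun _ => 0) k s 0

/-! ### Halting probability, expected time and expected number of calls -/

lemma avg_run_eq (A : Config → ℝ≥0∞) (N : ℕ) (c : Config) :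
    avg (run M (N + 1) c) A = avg (step M c) fun c' => avg (run M N c') A := by
  rw [run, avg_bind]

open Classical in
lemma haltProb_eq_ex (P : Prog) (s : State) (E : Set State) :
    haltProb M P s E = ex M 0 [P] (fun s => if s ∈ E then 1 else 0) s := by
  have h : ∀ N c, (run M N c).toOuterMeasure {c | c.1 = [] ∧ c.2 ∈ E} =
      exN M 0 (fun s => if s ∈ E then 1 else 0) N c := by
    intro N
    induction N with
    | zero =>
      rintro ⟨_ | ⟨p, k⟩, s⟩ <;> simp [exN, toOuterMeasure_eq_avg, run, avg_pure]
    | succ N ih =>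
      rintro ⟨k, s⟩
      have : headCost 0 k = 0 := by cases k <;> rfl
      rw [exN, this, zero_add, toOuterMeasure_eq_avg, avg_run_eq]
      refine congrArg _ (funext fun c' => ?_)
      rw [← ih, toOuterMeasure_eq_avg]
  simp only [haltProb, haltProbWithin, h, ex]

/-- The partial sums of the series are the truncated costs `exN`. Expected time and expected number
of calls are both series of this form. -/
lemma tsum_avg_run_eq_ex (P : Prog) (s : State) :
    ∑' N, avg (run M N ([P], s)) (fun c => headCost γ c.1) = ex M γ [P] 0 s := by
  have h : ∀ N c, ∑ i ∈ Finset.range N, avg (run M i c) (fun c => headCost γ c.1) =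
      exN M γ 0 N c := by
    intro N
    induction N with
    | zero => rintro ⟨_ | ⟨p, k⟩, s⟩ <;> simp [exN]
    | succ N ih =>
      intro c
      rw [Finset.sum_range_succ', exN, ← funext ih, run, avg_pure, add_comm]
      simp only [avg_run_eq]
      congr 1
      simp only [avg]
      rw [← Summable.tsum_finsetSum fun _ _ => ENNReal.summable]
      simp only [Finset.mul_sum]
  rw [ENNReal.tsum_eq_iSup_nat]
  simp only [h, ex]

lemma expectedTime_eq_ex (P : Prog) (s : State) :
    expectedTime M P s = ex M (fun _ => 1) [P] 0 s := by
  classical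
  rw [← tsum_avg_run_eq_ex, expectedTime]
  refine tsum_congr fun N => ?_
  rw [toOuterMeasure_eq_avg]
  refine congrArg _ (funext fun c => ?_)
  obtain ⟨_ | ⟨p, k⟩, s⟩ := c <;> simp [headCost]

open Classical in
lemma expectedCalls_eq_ex (P : Prog) (s : State) (Q : Prog) :
    expectedCalls M P s Q = ex M (fun p => if p = Q then 1 else 0) [P] 0 s := by
  rw [← tsum_avg_run_eq_ex, expectedCalls]
  refine tsum_congr fun N => ?_
  rw [toOuterMeasure_eq_avg]
  refine congrArg _ (funext fun c => ?_)
  obtain ⟨_ | ⟨p, k⟩, s⟩ := c <;> simp [headCost]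

/-- Subprograms that do not contribute to the cost. -/
lemma ex_congr_cost {γ' : Prog → ℝ≥0∞} (S : Set Prog)
    (hseq : ∀ p q, .seq p q ∈ S → p ∈ S ∧ q ∈ S)
    (hite : ∀ x p q, .ite x p q ∈ S → p ∈ S ∧ q ∈ S)
    (hwhile : ∀ x p, .while x p ∈ S → p ∈ S)
    (hγ : ∀ p ∈ S, γ p = γ' p) (k : List Prog) (hk : ∀ p ∈ k, p ∈ S) (s : State) :
    ex M γ k F s = ex M γ' k F s := by
  have h : ∀ N k s, (∀ p ∈ k, p ∈ S) → exN M γ F N (k, s) = exN M γ' F N (k, s) := by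
    intro N
    induction N with
    | zero => rintro (_ | ⟨p, k⟩) s _ <;> simp [exN]
    | succ N ih =>
      rintro (_ | ⟨p, k⟩) s hk
      · simp [exN_nil]
      have hp := hk p (by simp)
      have hk' : ∀ q ∈ k, q ∈ S := fun q hq => hk q (by simp [hq])
      rw [exN, exN, headCost, headCost, hγ p hp]
      congr 1
      rcases p with o | ⟨p, q⟩ | ⟨x, p, q⟩ | ⟨x, p⟩
      · simp only [step, avg_map, ih k _ hk']
      · simp only [step, avg_pure]
        exact ih _ _ (by simpa [hseq _ _ hp] using hk')
      · simp only [step, avg_pure]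
        split_ifs
        · exact ih _ _ (by simpa [hite _ _ _ hp] using hk')
        · exact ih _ _ (by simpa [hite _ _ _ hp] using hk')
      · simp only [step, avg_pure]
        split_ifs
        · exact ih _ _ (by simpa [hwhile _ _ hp, hp] using hk')
        · exact ih _ _ hk'
  exact iSup_congr fun N => h N k s hk

end ex

/-! ### Almost sure halting, and Markov's inequality for the running time. -/

section halting
variable {M : Env} {γ : Prog → ℝ≥0∞} {F : State → ℝ≥0∞}

/-- The cost function that charges every step. -/
def unitCost : Prog → ℝ≥0∞ := fun _ => 1

lemma exN_zero_le_one (hF : ∀ s, F s ≤ 1) (N : ℕ) (c : Config) : exN M 0 F N c ≤ 1 := by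
  induction N generalizing c with
  | zero => obtain ⟨_ | ⟨p, k⟩, s⟩ := c <;> simp [exN, hF]
  | succ N ih =>
    obtain ⟨k, s⟩ := c
    have : headCost 0 k = 0 := by cases k <;> rfl
    rw [exN, this, zero_add]
    exact (avg_mono ih).trans (avg_const _ _).le

lemma ex_zero_le_one (hF : ∀ s, F s ≤ 1) (k : List Prog) (s : State) : ex M 0 k F s ≤ 1 :=
  iSup_le fun N => exN_zero_le_one hF N _

/-- A run that never halts pays for all of the first `N` steps; a run that halts is compensated by
the second term. -/
lemma natCast_le_exN (N : ℕ) (k : List Prog) (s : State) :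
    (N : ℝ≥0∞) ≤ exN M unitCost 0 N (k, s) + N * ex M 0 k (fun _ => 1) s := by
  induction N generalizing k s with
  | zero => simp
  | succ N ih =>
    cases k with
    | nil => simp
    | cons p k =>
      rw [exN, ex_step]
      have h := avg_mono (p := step M (p :: k, s)) fun c : Config => ih c.1 c.2
      rw [avg_const, avg_add, avg_const_mul] at h
      simp only [headCost, unitCost, Pi.zero_apply, zero_add]
      set X := avg (step M (p :: k, s)) fun c : Config => ex M 0 c.1 (fun _ => 1) c.2
      calc ((N + 1 : ℕ) : ℝ≥0∞) = 1 + N := by push_cast; ring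
        _ ≤ 1 + (avg (step M (p :: k, s)) (exN M unitCost 0 N) + N * X) := by gcongr
        _ ≤ 1 + avg (step M (p :: k, s)) (exN M unitCost 0 N) + ((N + 1 : ℕ) : ℝ≥0∞) * X := by
          rw [add_assoc]
          gcongr
          simp

/-- If the halting probability were a < 1, then `natCast_le_exN` would give N (1 - a) ≤ T for all N,
where T is the finite expected time. -/
lemma ex_zero_one_of_time_lt_top {k : List Prog} {s : State} (h : ex M unitCost k 0 s ≠ ∞) :
    ex M 0 k (fun _ => 1) s = 1 := by
  refine le_antisymm (ex_zero_le_one (fun _ => le_rfl) _ _) ?_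
  by_contra! hlt
  generalize ha : ex M 0 k (fun _ => 1) s = a at *
  have hT : ∃ T, T = ex M unitCost k 0 s := ⟨_, rfl⟩
  obtain ⟨T, hT⟩ := hT
  have hN : ∀ N : ℕ, (N : ℝ≥0∞) ≤ T + N * a := fun N =>
    (natCast_le_exN N k s).trans (by
      rw [ha, hT]
      exact add_le_add_left (le_iSup (fun N => exN M unitCost 0 N (k, s)) N) _)
  rw [← hT] at h
  lift a to NNReal using hlt.ne_top
  lift T to NNReal using h
  have ha1 : a < 1 := by exact_mod_cast hlt
  obtain ⟨N, hNlt⟩ := exists_nat_gt ((T : ℝ) / (1 - a))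
  have h1 : (N : ℝ) ≤ T + N * a := by exact_mod_cast hN N
  have h2 : (0 : ℝ) < 1 - a := sub_pos.2 (by exact_mod_cast ha1)
  rw [div_lt_iff₀ h2] at hNlt
  linarith

/-- Probability of not having halted after `N` steps. -/
def notHalted (M : Env) (N : ℕ) (c : Config) : ℝ≥0∞ :=
  avg (run M N c) fun c => headCost unitCost c.1

lemma notHalted_succ (N : ℕ) (c : Config) :
    notHalted M (N + 1) c = avg (step M c) (notHalted M N) := avg_run_eq _ _ _

lemma headCost_unitCost_le_one (k : List Prog) : headCost unitCost k ≤ 1 := by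
  cases k <;> simp [headCost, unitCost]

lemma notHalted_succ_le (N : ℕ) (c : Config) : notHalted M (N + 1) c ≤ notHalted M N c := by
  induction N generalizing c with
  | zero =>
    obtain ⟨_ | ⟨p, k⟩, s⟩ := c
    · simp [notHalted, run, step, avg_pure]
    · rw [notHalted_succ]
      have h1 : notHalted M 0 (p :: k, s) = 1 := by
        simp [notHalted, run, avg_pure, headCost, unitCost]
      have h2 : ∀ c, notHalted M 0 c ≤ 1 := fun c => by
        simpa [notHalted, run, avg_pure] using headCost_unitCost_le_one c.1
      rw [h1]
      exact (avg_mono h2).trans (avg_const _ _).le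
  | succ N ih =>
    rw [notHalted_succ, notHalted_succ N]
    exact avg_mono ih

/-- Only runs that are still active after `N` steps can collect a reward later, and that reward is
at most one. -/
lemma exN_le_add_notHalted (hF : ∀ s, F s ≤ 1) (n N : ℕ) (c : Config) :
    exN M 0 F n c ≤ exN M 0 F N c + notHalted M N c := by
  induction N generalizing c n with
  | zero =>
    obtain ⟨_ | ⟨p, k⟩, s⟩ := c
    · simp [exN_nil]
    · simpa [exN, notHalted, run, avg_pure, headCost, unitCost] using exN_zero_le_one hF n _
  | succ N ih =>
    cases n with
    | zero => exact (exN_monotone (Nat.zero_le _) c).trans le_self_add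
    | succ n =>
      obtain ⟨k, s⟩ := c
      have : headCost 0 k = 0 := by cases k <;> rfl
      rw [exN, exN, notHalted_succ, this, zero_add, zero_add, ← avg_add]
      exact avg_mono (ih n)

/-- Markov's inequality: the expected time is the sum of the tail probabilities, and the first `N +
1` of them are at least the last one of these. -/
lemma succ_mul_notHalted_le (N : ℕ) (P : Prog) (s : State) :
    ((N + 1 : ℕ) : ℝ≥0∞) * notHalted M N ([P], s) ≤ expectedTime M P s := by
  have hanti : Antitone fun N => notHalted M N ([P], s) :=
    antitone_nat_of_succ_le fun N => notHalted_succ_le N _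
  rw [expectedTime_eq_ex, ← tsum_avg_run_eq_ex]
  refine le_trans ?_ (ENNReal.sum_le_tsum (Finset.range (N + 1)))
  calc ((N + 1 : ℕ) : ℝ≥0∞) * notHalted M N ([P], s)
      = ∑ i ∈ Finset.range (N + 1), notHalted M N ([P], s) := by simp
    _ ≤ _ := Finset.sum_le_sum fun i hi => hanti (by simpa [Nat.lt_succ_iff] using hi)

open Classical in
lemma haltProb_le_within_add (N : ℕ) (P : Prog) (s : State) (E : Set State) :
    haltProb M P s E ≤ haltProbWithin M P s N E + notHalted M N ([P], s) := by
  have h : ∀ N c, (run M N c).toOuterMeasure {c | c.1 = [] ∧ c.2 ∈ E} =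
      exN M 0 (fun s => if s ∈ E then 1 else 0) N c := by
    intro N
    induction N with
    | zero =>
      rintro ⟨_ | ⟨p, k⟩, s⟩ <;> simp [exN, toOuterMeasure_eq_avg, run, avg_pure]
    | succ N ih =>
      rintro ⟨k, s⟩
      have : headCost 0 k = 0 := by cases k <;> rfl
      rw [exN, this, zero_add, toOuterMeasure_eq_avg, avg_run_eq]
      refine congrArg _ (funext fun c' => ?_)
      rw [← ih, toOuterMeasure_eq_avg]
  refine iSup_le fun n => ?_
  simp only [haltProbWithin, h]
  exact exN_le_add_notHalted (fun s => by split_ifs <;> simp) _ _ _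

end halting

/-! ### Sampling programs -/

/-- Started in `s`, the code `P` takes expected time at most `T` and halts in a state that is
`good v`, where `v` has the law `μ`. -/
def Samples (M : Env) (P : Prog) (s : State) {V : Type*} (μ : PMF V) (good : V → State → Prop)
    (T : ℝ≥0∞) : Prop :=
  ∀ (F : State → ℝ≥0∞) (G : V → ℝ≥0∞), (∀ v s', good v s' → F s' ≤ G v) →
    ex M unitCost [P] F s ≤ T + avg μ G

section samples
variable {M : Env} {P : Prog} {s : State} {V : Type*} {μ : PMF V} {good : V → State → Prop}
  {T : ℝ≥0∞} {F : State → ℝ≥0∞} {G : V → ℝ≥0∞}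

lemma Samples.time_le (h : Samples M P s μ good T) : ex M unitCost [P] 0 s ≤ T := by
  simpa [avg_const] using h 0 (fun _ => 0) fun _ _ _ => le_rfl

/-- The archimedean principle that removes a finite running time from a bound on time plus reward.
-/
lemma le_of_forall_nat_mul_le {a b T : ℝ≥0∞} (hT : T ≠ ∞) (h : ∀ n : ℕ, n * a ≤ T + n * b) :
    a ≤ b := by
  rcases eq_or_ne b ∞ with rfl | hb
  · simp
  have ha : a ≠ ∞ := by
    rintro rfl
    have := h 1
    simp [hT, hb] at this
  lift a to NNReal using ha
  lift b to NNReal using hb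
  lift T to NNReal using hT
  by_contra! hlt
  have hlt' : (b : ℝ) < a := by exact_mod_cast hlt
  obtain ⟨n, hn⟩ := exists_nat_gt ((T : ℝ) / (a - b))
  have h1 : (n : ℝ) * a ≤ T + n * b := by exact_mod_cast h n
  rw [div_lt_iff₀ (sub_pos.2 hlt')] at hn
  linarith

/-- `Samples` is applied to the rewards n F and n G; for large n the time is negligible. As F is
unrestricted off the good states, this also shows that those states have probability zero. -/
lemma Samples.law_le (h : Samples M P s μ good T) (hT : T ≠ ∞)
    (hFG : ∀ v s', good v s' → F s' ≤ G v) : ex M 0 [P] F s ≤ avg μ G := by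
  refine le_of_forall_nat_mul_le hT fun n => ?_
  rw [← ex_zero_const_mul, ← avg_const_mul]
  refine le_trans ?_ (h (fun s => n * F s) (fun v => n * G v)
    fun v s' hg => mul_le_mul_right (hFG v s' hg) _)
  rw [ex_eq_cost_add (γ := unitCost)]
  exact le_add_self

lemma Samples.ex_one (h : Samples M P s μ good T) (hT : T ≠ ∞) :
    ex M 0 [P] (fun _ => 1) s = 1 :=
  ex_zero_one_of_time_lt_top (h.time_le.trans_lt hT.lt_top).ne

/-- Upper bounds for F and for 1 - F suffice: the two values sum to one on the side of the program,
because it halts almost surely, and on the side of μ. -/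
lemma Samples.law_eq (h : Samples M P s μ good T) (hT : T ≠ ∞)
    (hFG : ∀ v s', good v s' → F s' = G v) (hF : ∀ s, F s ≤ 1) (hG : ∀ v, G v ≤ 1) :
    ex M 0 [P] F s = avg μ G := by
  refine le_antisymm (h.law_le hT fun v s' hg => (hFG v s' hg).le) ?_
  have h1 : ex M 0 [P] F s + ex M 0 [P] (fun s => 1 - F s) s = 1 := by
    rw [← ex_zero_add]
    simp only [add_tsub_cancel_of_le (hF _)]
    exact h.ex_one hT
  have h2 : avg μ G + avg μ (fun v => 1 - G v) = 1 := by
    rw [← avg_add]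
    simp only [add_tsub_cancel_of_le (hG _), avg_const]
  have h3 : ex M 0 [P] (fun s => 1 - F s) s ≤ avg μ (fun v => 1 - G v) :=
    h.law_le hT fun v s' hg => by rw [hFG v s' hg]
  have h4 : avg μ (fun v => 1 - G v) ≠ ∞ :=
    ((avg_mono fun v => tsub_le_self).trans (avg_const μ 1).le).trans_lt ENNReal.one_lt_top |>.ne
  refine (ENNReal.add_le_add_iff_right h4).1 ?_
  exact (h2.trans h1.symm).le.trans (add_le_add_right h3 _)

/-- Used with the cost that counts calls: if the code after `P` makes equally many calls from every
good state, expected calls simply add. The lower bound needs that good states have full probability.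
-/
lemma Samples.ex_const {γ : Prog → ℝ≥0∞} (h : Samples M P s μ good T) (hT : T ≠ ∞) {c : ℝ≥0∞}
    (hF : ∀ v s', good v s' → F s' = c) : ex M γ [P] F s = ex M γ [P] 0 s + c := by
  classical
  rw [ex_eq_cost_add]
  congr 1
  refine le_antisymm ((h.law_le hT fun v s' hg => (hF v s' hg).le).trans (avg_const μ c).le) ?_
  have h1 := h.law_eq (F := fun s' => if ∃ v, good v s' then 1 else 0) (G := fun _ => 1) hT
    (fun v s' hg => if_pos ⟨v, hg⟩) (fun s => by split_ifs <;> simp) fun _ => le_rfl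
  rw [avg_const] at h1
  calc c = c * ex M 0 [P] (fun s' => if ∃ v, good v s' then 1 else 0) s := by rw [h1, mul_one]
    _ = _ := (ex_zero_const_mul _ _ _).symm
    _ ≤ _ := ex_mono (fun s' => by
      split_ifs with hs
      · obtain ⟨v, hv⟩ := hs
        rw [hF v s' hv, mul_one]
      · simp) _ _

open Classical in
lemma Samples.haltProb_eq (h : Samples M P s μ good T) (hT : T ≠ ∞) (E : Set State) (A : Set V)
    (hE : ∀ v s', good v s' → (s' ∈ E ↔ v ∈ A)) :
    haltProb M P s E = μ.toOuterMeasure A := by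
  rw [haltProb_eq_ex, toOuterMeasure_eq_avg]
  exact h.law_eq hT (fun v s' hg => by simp [hE v s' hg]) (fun s => by split_ifs <;> simp)
    fun v => by split_ifs <;> simp

/-- It suffices to bound the time and the probability of every outcome. -/
lemma Samples.of_forall_singleton (htime : ex M unitCost [P] 0 s ≤ T)
    (huniq : ∀ v v' s', good v s' → good v' s' → v = v')
    (hlaw : ∀ v (F : State → ℝ≥0∞), (∀ s', good v s' → F s' ≤ 1) →
      (∀ v' s', v' ≠ v → good v' s' → F s' = 0) → ex M 0 [P] F s ≤ μ v) :
    Samples M P s μ good T := by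
  classical
  intro F G hFG
  rw [ex_eq_cost_add]
  refine add_le_add htime ?_
  -- The reward is split according to the outcome, with value ∞ on the states that are good for no
  -- outcome.
  have h1 : ∀ s', F s' ≤ (∑' v, G v * if good v s' then 1 else 0) +
      ∞ * if ∃ v, good v s' then 0 else 1 := by
    intro s'
    by_cases hs : ∃ v, good v s'
    · obtain ⟨v, hv⟩ := hs
      refine le_trans ?_ le_self_add
      refine le_trans ?_ (ENNReal.le_tsum v)
      simpa [hv] using hFG v s' hv
    · simp [hs]
  refine (ex_mono h1 _ _).trans ?_
  rw [ex_zero_add, ex_zero_tsum, ex_zero_const_mul]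
  -- Every multiple of the indicator of the bad states is admissible in `hlaw`, so all multiples of
  -- its expectation stay below the finite number `μ v`.
  have h2 : ex M 0 [P] (fun s' => if ∃ v, good v s' then 0 else 1) s = 0 := by
    obtain ⟨v, hv⟩ := μ.support_nonempty
    rw [← nonpos_iff_eq_zero]
    by_contra! hpos
    set e := ex M 0 [P] (fun s' => if ∃ v, good v s' then 0 else 1) s with he
    have h3 : ∀ n : ℕ, n * e ≤ μ v := fun n => by
      rw [he, ← ex_zero_const_mul]
      exact hlaw v _ (fun s' hs' => by rw [if_pos ⟨v, hs'⟩]; simp)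
        fun v' s' _ hs' => by rw [if_pos ⟨v', hs'⟩]; simp
    exact hpos.not_ge (le_of_forall_nat_mul_le (T := μ v) (μ.apply_ne_top v) fun n => by
      simpa using h3 n)
  rw [h2, mul_zero, add_zero, avg]
  refine ENNReal.tsum_le_tsum fun v => ?_
  rw [ex_zero_const_mul, mul_comm]
  refine mul_le_mul_left (hlaw v _ (fun s' _ => by split_ifs; all_goals simp) fun v' s' hne hs' => ?_) _
  rw [if_neg]
  exact fun hv => hne (huniq _ _ _ hs' hv)

end samples

/-! ### Upper bounds for expected cost plus reward -/

section bounds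
variable {M : Env} {γ : Prog → ℝ≥0∞} {k : List Prog} {F : State → ℝ≥0∞} {s : State} {t t' : ℝ}

/-- Running the code `k` from `s` has expected time plus reward at most `t`. -/
def Bounded (M : Env) (k : List Prog) (F : State → ℝ≥0∞) (s : State) (t : ℝ) : Prop :=
  0 ≤ t ∧ ex M unitCost k F s ≤ ENNReal.ofReal t

lemma Bounded.mono (h : Bounded M k F s t) (ht : t ≤ t') : Bounded M k F s t' :=
  ⟨h.1.trans ht, h.2.trans (ENNReal.ofReal_le_ofReal ht)⟩

lemma Bounded.nil (h0 : 0 ≤ t) (h : F s ≤ ENNReal.ofReal t) : Bounded M [] F s t :=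
  ⟨h0, by simpa using h⟩

lemma Bounded.cons {p : Prog} (h : Bounded M [p] (ex M unitCost k F) s t) :
    Bounded M (p :: k) F s t := ⟨h.1, by rw [ex_cons]; exact h.2⟩

lemma ofReal_one_add_le {x : ℝ≥0∞} (h0 : 0 ≤ t - 1) (h : x ≤ ENNReal.ofReal (t - 1)) :
    1 + x ≤ ENNReal.ofReal t := by
  calc 1 + x ≤ ENNReal.ofReal 1 + ENNReal.ofReal (t - 1) := by simpa using h
    _ = ENNReal.ofReal t := by rw [← ENNReal.ofReal_add zero_le_one h0]; congr 1; ring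

lemma Bounded.seq {p q : Prog} (h : Bounded M (p :: q :: k) F s (t - 1)) :
    Bounded M (.seq p q :: k) F s t :=
  ⟨by linarith [h.1], by rw [ex_seq]; exact ofReal_one_add_le h.1 h.2⟩

lemma Bounded.ite {x : ℕ} {p q : Prog} (h1 : s.reg x ≠ 0 → Bounded M (p :: k) F s (t - 1))
    (h0 : s.reg x = 0 → Bounded M (q :: k) F s (t - 1)) : Bounded M (.ite x p q :: k) F s t := by
  by_cases hx : s.reg x = 0
  · have h := h0 hx
    refine ⟨by linarith [h.1], ?_⟩
    rw [ex_ite, if_neg (not_not.2 hx)]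
    exact ofReal_one_add_le h.1 h.2
  · have h := h1 hx
    refine ⟨by linarith [h.1], ?_⟩
    rw [ex_ite, if_pos hx]
    exact ofReal_one_add_le h.1 h.2

open Classical in
/-- The bound `v` on the states that satisfy the invariant `I`. -/
def boundOn (I : State → Prop) (v : State → ℝ) (s : State) : ℝ≥0∞ :=
  if I s then ENNReal.ofReal (v s) else ∞

lemma boundOn_eq {I : State → Prop} {v : State → ℝ} (h : I s) :
    boundOn I v s = ENNReal.ofReal (v s) := if_pos h

lemma Bounded.nil_boundOn {I : State → Prop} {v : State → ℝ} (hI : I s) (h0 : 0 ≤ v s)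
    (h : v s ≤ t) : Bounded M [] (boundOn I v) s t :=
  Bounded.nil (h0.trans h) (by rw [boundOn_eq hI]; exact ENNReal.ofReal_le_ofReal h)

/-- `I` is a loop invariant and `v` a potential that pays one unit for each test. The super-solution
is ∞ off `I`, so a finite bound for the body forces it to restore `I`. -/
lemma Bounded.while {x : ℕ} {p : Prog} (I : State → Prop) (v : State → ℝ)
    (h1 : ∀ s, I s → s.reg x ≠ 0 → Bounded M [p] (boundOn I v) s (v s - 1))
    (h0 : ∀ s, I s → s.reg x = 0 → Bounded M k F s (v s - 1)) (hI : I s) (ht : v s ≤ t) :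
    Bounded M (.while x p :: k) F s t := by
  have hv : 0 ≤ v s := by
    by_cases hx : s.reg x = 0
    · linarith [(h0 s hI hx).1]
    · linarith [(h1 s hI hx).1]
  refine Bounded.mono (t := v s) (Bounded.cons ⟨hv, ?_⟩) ht
  rw [← boundOn_eq (v := v) hI]
  refine ex_while_le _ (fun s => ?_) s
  by_cases hI : I s
  · rw [boundOn_eq hI]
    by_cases hx : s.reg x = 0
    · rw [if_neg (not_not.2 hx)]
      exact ofReal_one_add_le (h0 s hI hx).1 (h0 s hI hx).2
    · rw [if_pos hx]
      exact ofReal_one_add_le (h1 s hI hx).1 (h1 s hI hx).2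
  · simp [boundOn, hI]

/-! ### Straight-line code -/

/-- The effect of a deterministic instruction. -/
def Instr.detExec (M : Env) (s : State) : Instr → State
  | .const x c => s.setReg M x c
  | .bin o x y z => s.setReg M x (o.eval (s.reg y) (s.reg z))
  | .load x y => s.setReg M x (s.mem (s.reg y))
  | .store x y => { s with mem := Function.update s.mem (s.reg x) (s.reg y) }
  | .query r y => { s with
      real := Function.update s.real r
        (M.boxSum (fun j => s.mem (s.reg y + j)) (fun j => s.mem (s.reg y + M.d + j))) }
  | .rand _ => s
  | .flip _ _ _ => s

/-- Instructions that are not random. -/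
def Instr.IsDet : Instr → Prop
  | .rand _ => False
  | .flip _ _ _ => False
  | _ => True

/-- A block of instructions. -/
def blk (i : Instr) : List Instr → Prog
  | [] => .instr i
  | j :: js => .seq (.instr i) (blk j js)

/-- The cost of a block. -/
def blkCost (γ : Prog → ℝ≥0∞) (i : Instr) : List Instr → ℝ≥0∞
  | [] => γ (.instr i)
  | j :: js => γ (.seq (.instr i) (blk j js)) + (γ (.instr i) + blkCost γ j js)

lemma Instr.exec_eq_pure {i : Instr} (hi : i.IsDet) : i.exec M s = PMF.pure (i.detExec M s) := by
  cases i <;> simp_all [Instr.IsDet, Instr.exec, Instr.detExec]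

lemma ex_instr_det {i : Instr} (hi : i.IsDet) :
    ex M γ (.instr i :: k) F s = γ (.instr i) + ex M γ k F (i.detExec M s) := by
  rw [ex_instr, Instr.exec_eq_pure hi, avg_pure]

lemma ex_blk {i : Instr} {is : List Instr} (h : ∀ j ∈ i :: is, j.IsDet) :
    ex M γ (blk i is :: k) F s =
      blkCost γ i is + ex M γ k F ((i :: is).foldl (Instr.detExec M) s) := by
  induction is generalizing i s with
  | nil => exact ex_instr_det (h i (by simp))
  | cons j js ih =>
    rw [blk, ex_seq, ex_instr_det (h i (by simp)), ih fun j' hj' => h j' (by simp_all), blkCost]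
    simp only [add_assoc, List.foldl_cons]

lemma blkCost_unitCost (i : Instr) (is : List Instr) :
    blkCost unitCost i is = 2 * is.length + 1 := by
  induction is generalizing i with
  | nil => simp [blkCost, unitCost]
  | cons j js ih =>
    simp only [blkCost, ih, unitCost, List.length_cons]
    push_cast
    ring

lemma Bounded.blk {i : Instr} {is : List Instr} (h : ∀ j ∈ i :: is, j.IsDet)
    (hB : Bounded M k F ((i :: is).foldl (Instr.detExec M) s) (t - (2 * is.length + 1))) :
    Bounded M (blk i is :: k) F s t := by
  have h0 : (0 : ℝ) ≤ 2 * is.length + 1 := by positivity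
  refine ⟨by linarith [hB.1], ?_⟩
  rw [ex_blk h, blkCost_unitCost]
  calc _ ≤ ENNReal.ofReal (2 * is.length + 1) + ENNReal.ofReal (t - (2 * is.length + 1)) := by
        refine add_le_add (le_of_eq ?_) hB.2
        rw [ENNReal.ofReal_add (by positivity) zero_le_one, ENNReal.ofReal_mul zero_le_two]
        simp
    _ = ENNReal.ofReal t := by rw [← ENNReal.ofReal_add h0 hB.1]; congr 1; ring

/-- `s'` arises from `s` by changing registers in `[lo, hi)` only. -/
structure Agree (lo hi : ℕ) (s s' : State) : Prop where
  mem : s'.mem = s.mem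
  real : s'.real = s.real
  reg : ∀ x, x < lo ∨ hi ≤ x → s'.reg x = s.reg x

lemma Agree.refl (lo hi : ℕ) (s : State) : Agree lo hi s s := ⟨rfl, rfl, fun _ _ => rfl⟩

lemma Agree.trans {lo hi lo' hi' lo'' hi'' : ℕ} {s s' s'' : State} (h : Agree lo hi s s')
    (h' : Agree lo' hi' s' s'') (hlo : lo'' ≤ lo ∧ lo'' ≤ lo')
    (hhi : hi ≤ hi'' ∧ hi' ≤ hi'') : Agree lo'' hi'' s s'' where
  mem := h'.mem.trans h.mem
  real := h'.real.trans h.real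
  reg x hx := (h'.reg x (by omega)).trans (h.reg x (by omega))

lemma State.setReg_reg (s : State) (x v y : ℕ) :
    (s.setReg M x v).reg y = if y = x then v % 2 ^ M.w else s.reg y := by
  simp [State.setReg, Function.update_apply]

lemma Agree.setReg {lo hi x : ℕ} {s s' : State} (h : Agree lo hi s s') (hx : lo ≤ x ∧ x < hi)
    (v : ℕ) : Agree lo hi s (s'.setReg M x v) where
  mem := h.mem
  real := h.real
  reg y hy := by rw [State.setReg_reg, if_neg (by omega), h.reg y hy]

/-- Assignment to a register, without reduction. -/
def State.put (s : State) (x v : ℕ) : State := { s with reg := Function.update s.reg x v }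

lemma State.put_reg (s : State) (x v y : ℕ) :
    (s.put x v).reg y = if y = x then v else s.reg y := by
  simp [State.put, Function.update_apply]

@[simp] lemma State.put_mem (s : State) (x v : ℕ) : (s.put x v).mem = s.mem := rfl

lemma Agree.put {lo hi x v : ℕ} {s s' : State} (h : Agree lo hi s s') (hx : lo ≤ x ∧ x < hi) :
    Agree lo hi s (s'.put x v) where
  mem := h.mem
  real := h.real
  reg y hy := by rw [State.put_reg, if_neg (by omega), h.reg y hy]

lemma Instr.detExec_const {x c : ℕ} (h : c < 2 ^ M.w) :
    (Instr.const x c).detExec M s = s.put x c := by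
  rw [Instr.detExec, State.setReg, Nat.mod_eq_of_lt h, State.put]

lemma Instr.detExec_bin {o : BinOp} {x y z a b v : ℕ} (hy : s.reg y = a) (hz : s.reg z = b)
    (hv : o.eval a b = v) (h : v < 2 ^ M.w) :
    (Instr.bin o x y z).detExec M s = s.put x v := by
  rw [Instr.detExec, hy, hz, hv, State.setReg, Nat.mod_eq_of_lt h, State.put]

lemma Instr.detExec_load {x y a v : ℕ} (hy : s.reg y = a) (hv : s.mem a = v) (h : v < 2 ^ M.w) :
    (Instr.load x y).detExec M s = s.put x v := by
  rw [Instr.detExec, hy, hv, State.setReg, Nat.mod_eq_of_lt h, State.put]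

lemma Bounded.blk_cons {i j : Instr} {js : List Instr} {s' : State} (hi : i.IsDet)
    (hs : i.detExec M s = s') (h : Bounded M (HeatWalk.blk j js :: k) F s' (t - 2)) :
    Bounded M (HeatWalk.blk i (j :: js) :: k) F s t := by
  subst hs
  refine .seq ⟨by linarith [h.1], ?_⟩
  rw [ex_instr_det hi]
  exact ofReal_one_add_le (by linarith [h.1]) (by convert h.2 using 2; ring)

lemma Bounded.blk_one {i : Instr} {s' : State} (hi : i.IsDet)
    (hs : i.detExec M s = s') (h : Bounded M k F s' (t - 1)) :
    Bounded M (HeatWalk.blk i [] :: k) F s t := by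
  subst hs
  refine ⟨by linarith [h.1], ?_⟩
  rw [HeatWalk.blk, ex_instr_det hi]
  exact ofReal_one_add_le h.1 h.2

/-! ### Uniform random numbers -/

lemma Bounded.rand {x : ℕ} (g : ℕ → ℝ)
    (h : ∀ v < 2 ^ M.w, Bounded M k F (s.setReg M x v) (g v))
    (ht : (∑ v ∈ Finset.range (2 ^ M.w), g v) / 2 ^ M.w ≤ t - 1) :
    Bounded M (.instr (.rand x) :: k) F s t := by
  have hg : 0 ≤ ∑ v ∈ Finset.range (2 ^ M.w), g v :=
    Finset.sum_nonneg fun v hv => (h v (Finset.mem_range.1 hv)).1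
  have h0 : 0 ≤ t - 1 := le_trans (by positivity) ht
  refine ⟨by linarith, ?_⟩
  have e : avg ((Instr.rand x).exec M s) (ex M unitCost k F) =
      avg (PMF.uniformOfFintype (Fin (2 ^ M.w))) fun v : Fin (2 ^ M.w) => ex M unitCost k F (s.setReg M x v) := by
    rw [Instr.exec, avg_map]
    refine (avg_bind _ _ _).trans ?_
    exact congrArg _ (funext fun v => avg_pure _ _)
  rw [ex_instr, e, avg_uniform]
  refine ofReal_one_add_le h0 (le_trans ?_ (ENNReal.ofReal_le_ofReal ht))
  rw [ENNReal.ofReal_div_of_pos (by positivity), div_eq_mul_inv, mul_comm,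
    ENNReal.ofReal_sum_of_nonneg fun v hv => (h v (Finset.mem_range.1 hv)).1,
    ← Fin.sum_univ_eq_sum_range (fun v => ENNReal.ofReal (g v))]
  have : ENNReal.ofReal (2 ^ M.w) = ((2 ^ M.w : ℕ) : ℝ≥0∞) := by
    rw [← ENNReal.ofReal_natCast]; push_cast; rfl
  rw [this, Fintype.card_fin]
  refine mul_le_mul_left ?_ _
  exact Finset.sum_le_sum fun (v : Fin (2 ^ M.w)) _ => (h v v.2).2

/-- One attempt at drawing a uniform number. -/
def unifBody : Prog :=
  .seq (.instr (.rand 22)) (blk (.bin .mod 21 22 20)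
    [.bin .sub 23 22 21, .const 24 1, .bin .sub 24 20 24, .bin .add 24 23 24, .bin .lt 25 24 23])

/-- `reg 21 :=` a uniformly random number below `reg 20`. -/
def unif : Prog := .seq (blk (.const 25 1) []) (.while 25 unifBody)

/-- Below a multiple of `b`, all residues are equally frequent. -/
lemma sum_range_mul_mod (b q : ℕ) (g : ℕ → ℝ) :
    ∑ v ∈ Finset.range (b * q), g (v % b) = q * ∑ r ∈ Finset.range b, g r := by
  induction q with
  | zero => simp
  | succ q ih =>
    rw [mul_add, mul_one, Finset.sum_range_add, ih, Nat.cast_succ, add_mul, one_mul]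
    congr 1
    refine Finset.sum_congr rfl fun r hr => ?_
    rw [Nat.mul_add_mod, Nat.mod_eq_of_lt (Finset.mem_range.1 hr)]

/-- Rejection sampling: a random word is reduced modulo `b`, and accepted if it lies below the
largest multiple of `b` that does not exceed the number of words. -/
lemma Bounded.unif {b : ℕ} (hb : s.reg 20 = b) (hb1 : 1 ≤ b) (hbw : b < 2 ^ M.w) (G : ℕ → ℝ)
    (h : ∀ r < b, ∀ s', Agree 21 26 s s' → s'.reg 21 = r → Bounded M k F s' (G r))
    (ht : 45 + (∑ r ∈ Finset.range b, G r) / b ≤ t) : Bounded M (unif :: k) F s t := by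
  have hb0 : (0 : ℝ) < b := by exact_mod_cast hb1
  have h1w : 1 < 2 ^ M.w := by omega
  set A := (∑ r ∈ Finset.range b, G r) / b with hA
  have hG : ∀ r < b, 0 ≤ G r := fun r hr =>
    (h r hr _ ((Agree.refl 21 26 s).setReg (M := M) (x := 21) (by omega) r)
      (by rw [State.setReg_reg, if_pos rfl, Nat.mod_eq_of_lt (by omega)])).1
  have hA0 : 0 ≤ A := div_nonneg (Finset.sum_nonneg fun r hr => hG r (Finset.mem_range.1 hr)) hb0.le
  refine .seq (.blk (by simp [Instr.IsDet]) ?_)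
  -- Register 25 is zero exactly after acceptance. Before that, the potential is the mean `A` of the
  -- continuation plus 38: an attempt costs 14 including the loop test, and at least half of the 38
  -- is released on average.
  refine .while (fun s' => Agree 21 26 s s' ∧ (s'.reg 25 = 0 → s'.reg 21 < b))
    (fun s' => if s'.reg 25 = 0 then 1 + G (s'.reg 21) else 38 + A) ?_ ?_ ?_ ?_
  · rintro s' ⟨hs', -⟩ hx
    rw [if_neg hx]
    have hq : b * (2 ^ M.w / b) ≤ 2 ^ M.w := Nat.mul_div_le _ _
    set q := 2 ^ M.w / b with hqdef
    have hs20 : s'.reg 20 = b := (hs'.reg 20 (by omega)).trans hb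
    refine .seq (.rand (fun v => (if v < b * q then 1 + G (v % b) else 38 + A) + 11) ?_ ?_)
    · intro v hv
      refine .blk (by simp [Instr.IsDet]) ?_
      have hvb : v % b < b := Nat.mod_lt _ hb1
      have hvb' : v % b ≤ v := Nat.mod_le _ _
      have e1 : (b - 1) % 2 ^ M.w = b - 1 := Nat.mod_eq_of_lt (by omega)
      have e2 : (v % b) % 2 ^ M.w = v % b := Nat.mod_eq_of_lt (by omega)
      have e3 : (v - v % b) % 2 ^ M.w = v - v % b := Nat.mod_eq_of_lt (by omega)
      have e4 : 1 % 2 ^ M.w = 1 := Nat.mod_eq_of_lt h1w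
      have e5 : v % 2 ^ M.w = v := Nat.mod_eq_of_lt hv
      -- The program cannot represent the number of words, so it tests whether the last element of
      -- the residue block of `v` overflows.
      have key : (v - v % b + (b - 1)) % 2 ^ M.w < v - v % b ↔ ¬ v < b * q := by
        have hv' : v - v % b = b * (v / b) := by
          have := Nat.div_add_mod v b; omega
        have hlt : v < b * q ↔ v / b < q := by
          rw [Nat.div_lt_iff_lt_mul hb1, mul_comm]
        have hle : v / b < q ↔ b * (v / b) + b ≤ 2 ^ M.w := by
          rw [hqdef, Nat.lt_iff_add_one_le, Nat.le_div_iff_mul_le hb1, add_mul, one_mul, mul_comm]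
        rw [hlt, hle, hv']
        have hvw : b * (v / b) ≤ v := Nat.mul_div_le _ _
        rcases lt_or_ge (b * (v / b) + (b - 1)) (2 ^ M.w) with hc | hc
        · rw [Nat.mod_eq_of_lt hc]; omega
        · rw [Nat.mod_eq_sub_mod hc, Nat.mod_eq_of_lt (by omega)]; omega
      have e6 : ∀ (p : Prop) [Decidable p],
          (if p then 1 else 0) % 2 ^ M.w = if p then 1 else 0 := fun p _ => by
        split_ifs <;> simp [e4]
      have hval : ∀ S : State, S.reg 21 = v % b → (S.reg 25 = 0 ↔ v < b * q) →
          (if S.reg 25 = 0 then 1 + G (S.reg 21) else 38 + A) =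
            if v < b * q then 1 + G (v % b) else 38 + A := fun S h1 h2 => by
        simp only [h1, h2]
      refine .nil_boundOn ⟨?_, ?_⟩ ?_ ?_
      · simp only [List.foldl, Instr.detExec]
        repeat' refine Agree.setReg ?_ (by omega) _
        exact hs'
      · intro _
        simp [Instr.detExec, State.setReg_reg, BinOp.eval, hs20, e2, e5, hvb]
      · rw [hval]
        · split_ifs
          · linarith [hG _ hvb]
          · positivity
        · simp [Instr.detExec, State.setReg_reg, BinOp.eval, hs20, e2, e5]
        · simp [Instr.detExec, State.setReg_reg, BinOp.eval, hs20, e1, e2, e3, e4, e5, e6, key]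
      · rw [hval]
        · norm_num
        · simp [Instr.detExec, State.setReg_reg, BinOp.eval, hs20, e2, e5]
        · simp [Instr.detExec, State.setReg_reg, BinOp.eval, hs20, e1, e2, e3, e4, e5, e6, key]
    · rw [Finset.sum_add_distrib, ← Finset.sum_range_add_sum_Ico _ hq]
      have s1 : ∑ v ∈ Finset.range (b * q), (if v < b * q then 1 + G (v % b) else 38 + A) =
          (b * q : ℝ) * (1 + A) := by
        rw [Finset.sum_congr rfl fun v hv => if_pos (Finset.mem_range.1 hv),
          sum_range_mul_mod b q fun r => 1 + G r, Finset.sum_add_distrib, hA]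
        simp
        field_simp
      have s2 : ∑ v ∈ Finset.Ico (b * q) (2 ^ M.w), (if v < b * q then 1 + G (v % b) else 38 + A) =
          ((2 : ℝ) ^ M.w - b * q) * (38 + A) := by
        rw [Finset.sum_congr rfl fun v hv => if_neg (not_lt.2 (Finset.mem_Ico.1 hv).1)]
        simp only [Finset.sum_const, Nat.card_Ico, nsmul_eq_mul, Nat.cast_sub hq]
        push_cast
        ring
      -- Acceptance has probability at least 1/2, because the rejected words are fewer than `b`.
      have hhalf : (2 : ℝ) ^ M.w ≤ 2 * (b * q) := by
        have : 2 ^ M.w < b * q + b := by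
          have := Nat.lt_mul_div_succ (2 ^ M.w) hb1
          rw [← hqdef, mul_add, mul_one] at this
          exact this
        have h1q : 1 ≤ q := (Nat.one_le_div_iff hb1).2 hbw.le
        have : 2 ^ M.w ≤ 2 * (b * q) := by nlinarith
        exact_mod_cast this
      rw [s1, s2, div_le_iff₀ (by positivity)]
      simp
      nlinarith
  · rintro s' ⟨hs', hlt⟩ hx
    rw [if_pos hx]
    simpa using h _ (hlt hx) s' hs' rfl
  · refine ⟨(Agree.refl _ _ _).setReg (by omega) _, ?_⟩
    simp [Instr.detExec, State.setReg_reg, Nat.mod_eq_of_lt h1w]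
  · simp [Instr.detExec, State.setReg_reg, Nat.mod_eq_of_lt h1w]
    linarith

lemma sum_range_ite_lt {a b : ℕ} (hab : a ≤ b) (x y : ℝ) :
    ∑ r ∈ Finset.range b, (if r < a then x else y) = a * x + (b - a) * y := by
  rw [← Finset.sum_range_add_sum_Ico _ hab,
    Finset.sum_congr rfl fun v hv => if_pos (Finset.mem_range.1 hv),
    Finset.sum_congr rfl fun v hv => if_neg (not_lt.2 (Finset.mem_Ico.1 hv).1)]
  simp [Nat.cast_sub hab]

/-- A uniform number below `b` that is only compared with `a`. -/
lemma Bounded.unif_coin {a b : ℕ} {x y : ℝ} (hb : s.reg 20 = b) (hb1 : 1 ≤ b) (hab : a ≤ b)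
    (hbw : b < 2 ^ M.w)
    (hx : ∀ r < a, ∀ s', Agree 21 26 s s' → s'.reg 21 = r → Bounded M k F s' x)
    (hy : ∀ r, a ≤ r → r < b → ∀ s', Agree 21 26 s s' → s'.reg 21 = r → Bounded M k F s' y)
    (ht : 45 + (a / b * x + (1 - a / b) * y) ≤ t) : Bounded M (HeatWalk.unif :: k) F s t := by
  refine .unif hb hb1 hbw (fun r => if r < a then x else y) (fun r hr s' hs' hr' => ?_) ?_
  · split_ifs with hc
    · exact hx r hc s' hs' hr'
    · exact hy r (not_lt.1 hc) hr s' hs' hr'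
  · rw [sum_range_ite_lt hab]
    have hb0 : (0 : ℝ) < b := by exact_mod_cast hb1
    refine le_of_eq_of_le ?_ ht
    field_simp

end bounds

/-! ### Coins whose bias is a quotient of rising factorials -/

/-- The value of the alternating series that is simulated by `chain`, from index `i` on, when `r`
more terms are left. -/
def vn (a c : ℝ) : ℕ → ℕ → ℝ
  | 0, _ => 1
  | r + 1, i => 1 - (r + 1) * (a + i) / ((i + 1) * (c + i)) * vn a c r (i + 1)

/-- With n = r + i, the conditions n ≤ a and n a ≤ c make all factors of the nested form biases of
coins. Then 1 - ρ₀ (1 - ρ₁ (1 - …)) is the probability that the number of successes before the first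
failure is even. -/
lemma vn_mem {a c : ℝ} (hc : 0 < c) {r i : ℕ} (hra : (r + i : ℕ) ≤ a) (h : (r + i : ℕ) * a ≤ c) :
    0 ≤ vn a c r i ∧ vn a c r i ≤ 1 := by
  induction r generalizing i with
  | zero => simp [vn]
  | succ r ih =>
    obtain ⟨h1, h2⟩ := ih (i := i + 1) (by convert hra using 2; ring) (by convert h using 3; ring)
    push_cast at hra h
    have hi : (0 : ℝ) ≤ i := i.cast_nonneg
    have hr : (0 : ℝ) ≤ r := r.cast_nonneg
    have h3 : 0 ≤ (r + 1) * (a + i) / ((i + 1) * (c + i)) := by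
      have : 0 ≤ a := le_trans (by positivity) hra
      positivity
    have h4 : (r + 1) * (a + i) / ((i + 1) * (c + i)) ≤ 1 := by
      rw [div_le_one (by positivity)]
      nlinarith [mul_nonneg hi hi, mul_nonneg hi hr, mul_nonneg hi hc.le,
        mul_nonneg hi (sub_nonneg.2 hra)]
    rw [vn]
    constructor <;> nlinarith [mul_nonneg h3 h1]

/-- Terms of the alternating series. -/
def vnTerm (a c : ℝ) (n i : ℕ) : ℝ :=
  n.choose i * ∏ j ∈ Finset.range i, ((a + j) / (c + j))

/-- The quotient of consecutive terms is the bias of the coin with index `i`, so the terms are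
products of biases. -/
lemma vnTerm_succ_mul {a c : ℝ} (hc : 0 < c) (r i : ℕ) :
    vnTerm a c (r + 1 + i) (i + 1) =
      vnTerm a c (r + 1 + i) i * ((r + 1) * (a + i) / ((i + 1) * (c + i))) := by
  have h := Nat.choose_succ_right_eq (r + 1 + i) i
  have h' : ((r + 1 + i).choose (i + 1) : ℝ) * (i + 1) = (r + 1 + i).choose i * (r + 1) := by
    have : r + 1 + i - i = r + 1 := by omega
    rw [this] at h
    exact_mod_cast h
  have hi : (0 : ℝ) < i + 1 := by positivity
  have hci : (0 : ℝ) < c + i := by positivity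
  rw [vnTerm, vnTerm, Finset.prod_range_succ]
  rw [eq_div_of_mul_eq hi.ne' h']
  field_simp

/-- Expanding the nested form turns it into a tail of the alternating series, normalised by the
first term of the tail. -/
lemma vnTerm_mul_vn {a c : ℝ} (hc : 0 < c) (r i : ℕ) :
    vnTerm a c (r + i) i * vn a c r i =
      ∑ j ∈ Finset.range (r + 1), (-1) ^ j * vnTerm a c (r + i) (i + j) := by
  induction r generalizing i with
  | zero => simp [vn]
  | succ r ih =>
    rw [Finset.sum_range_succ', vn, mul_sub, ← mul_assoc, ← vnTerm_succ_mul hc]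
    have h := ih (i + 1)
    rw [show r + (i + 1) = r + 1 + i by ring] at h
    rw [h]
    simp only [pow_succ, pow_zero, add_zero]
    have e : ∀ j, vnTerm a c (r + 1 + i) (i + (j + 1)) = vnTerm a c (r + 1 + i) (i + 1 + j) :=
      fun j => by congr 1; ring
    simp only [e, mul_neg, mul_one, neg_mul, Finset.sum_neg_distrib, one_mul]
    ring

/-- Raising `a` and `c` by one keeps c - a and shifts only the denominators, whose product
telescopes. -/
lemma prod_shift_div {a c : ℝ} (hc : 0 < c) (n : ℕ) :
    ∏ j ∈ Finset.range n, ((c + 1 - (a + 1) + j) / (c + 1 + j)) =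
      (∏ j ∈ Finset.range n, ((c - a + j) / (c + j))) * (c / (c + n)) := by
  induction n with
  | zero => simp [hc.ne']
  | succ n ih =>
    have h1 : (0 : ℝ) < c + n := by positivity
    have h3 : (0 : ℝ) < c + 1 + n := by positivity
    have h4 : (0 : ℝ) < c + (n + 1) := by positivity
    rw [Finset.prod_range_succ, Finset.prod_range_succ, ih]
    push_cast
    field_simp
    ring

/-- The Chu-Vandermonde identity. Pascal's rule splits the sum for n + 1 into the sum for n with
parameters (a, c) and a/c times the one with (a + 1, c + 1). -/
lemma sum_vnTerm {a c : ℝ} (hc : 0 < c) (n : ℕ) :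
    ∑ j ∈ Finset.range (n + 1), (-1) ^ j * vnTerm a c n j =
      ∏ j ∈ Finset.range n, ((c - a + j) / (c + j)) := by
  induction n generalizing a c with
  | zero => simp [vnTerm]
  | succ n ih =>
    have key : ∑ j ∈ Finset.range (n + 2), (-1) ^ j * vnTerm a c (n + 1) j =
        ∑ j ∈ Finset.range (n + 1), (-1) ^ j * vnTerm a c n j -
          a / c * ∑ j ∈ Finset.range (n + 1), (-1) ^ j * vnTerm (a + 1) (c + 1) n j := by
      rw [Finset.sum_range_succ']
      have h0 : ∑ j ∈ Finset.range (n + 1), (-1) ^ j * vnTerm a c n j =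
          ∑ j ∈ Finset.range (n + 1), (-1) ^ (j + 1) * vnTerm a c n (j + 1) +
            (-1) ^ 0 * vnTerm a c n 0 := by
        rw [← Finset.sum_range_succ' (fun j => (-1) ^ j * vnTerm a c n j),
          Finset.sum_range_succ _ (n + 1)]
        simp [vnTerm]
      rw [h0, Finset.mul_sum]
      have h1 : ∀ j, (-1) ^ (j + 1) * vnTerm a c (n + 1) (j + 1) =
          (-1) ^ (j + 1) * vnTerm a c n (j + 1) -
            a / c * ((-1) ^ j * vnTerm (a + 1) (c + 1) n j) := by
        intro j
        have hp : ∏ i ∈ Finset.range (j + 1), ((a + i) / (c + i)) =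
            a / c * ∏ i ∈ Finset.range j, ((a + 1 + i) / (c + 1 + i)) := by
          rw [Finset.prod_range_succ', mul_comm]
          simp [add_assoc, add_comm (1 : ℝ)]
        simp only [vnTerm, hp, Nat.choose_succ_succ, pow_succ]
        push_cast
        ring
      rw [Finset.sum_congr rfl fun j _ => h1 j, Finset.sum_sub_distrib]
      simp [vnTerm]
      ring
    rw [key, ih hc, ih (by linarith : 0 < c + 1)]
    have hcn : (0 : ℝ) < c + n := by positivity
    rw [prod_shift_div hc, Finset.prod_range_succ]
    field_simp
    ring

/-- One round of the coin `chain`. -/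
def chainBody : Prog :=
  .seq (blk (.const 36 1) [.bin .add 37 33 36, .bin .add 38 32 33, .bin .mul 20 37 38])
    (.seq unif (.seq (blk (.bin .sub 38 30 33) [.bin .add 39 31 33, .bin .mul 38 38 39,
        .bin .lt 36 21 38])
      (.ite 36 (blk (.const 39 1) [.bin .add 33 33 39, .bin .sub 34 39 34])
        (blk (.const 39 0) []))))

/-- With `n`, `a`, `c`, `i` and a parity in the registers 30 to 34, flip the parity until the first
failure of a coin with bias `(n - i) (a + i) / ((i + 1) (c + i))`, increasing `i` in each round. -/
def chain : Prog := .seq (blk (.const 36 1) []) (.while 36 chainBody)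

section chain
variable {M : Env} {k : List Prog} {F : State → ℝ≥0∞} {s : State} {t : ℝ} {n a c j q : ℕ}

/-- Without the factor j + 1 in the denominator the quotient is still at most one. The actual coin
therefore has bias at most 1/(j + 1). -/
lemma coin_le (hj : j ≤ n) (hna : n ≤ a) (hnac : n * a ≤ c) : (n - j) * (a + j) ≤ c + j := by
  obtain ⟨r, rfl⟩ := Nat.exists_eq_add_of_le hj
  rw [Nat.add_sub_cancel_left]
  nlinarith [Nat.zero_le (j * r), Nat.zero_le (j * j), Nat.mul_le_mul_left j hna]

/-- Biases of at most 1/(j + 1) keep the expected length of the chain bounded, whatever `n` is. -/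
lemma coin_div_le (hj : j ≤ n) (hna : n ≤ a) (hc1 : 1 ≤ c) (hnac : n * a ≤ c) :
    ((j : ℝ) + 1) * (((n - j) * (a + j) : ℕ) / ((j + 1) * (c + j) : ℕ)) ≤ 1 := by
  have h2 : ((n - j) * (a + j) : ℕ) ≤ ((c + j : ℕ) : ℝ) := by
    exact_mod_cast coin_le hj hna hnac
  have h3 : (0 : ℝ) < (c + j : ℕ) := by exact_mod_cast (by omega : 0 < c + j)
  have h4 : (0 : ℝ) < j + 1 := by positivity
  rw [Nat.cast_mul (j + 1), Nat.cast_add j, Nat.cast_one, ← mul_div_assoc,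
    mul_div_mul_left _ _ h4.ne', div_le_one h3]
  exact h2

/-- At j = n the bias is zero, so the recursion stays true there and the loop needs no separate
stopping rule. -/
lemma vn_eq (hj : j ≤ n) : vn a c (n - j) j =
    1 - ((n - j) * (a + j) : ℕ) / ((j + 1) * (c + j) : ℕ) * vn a c (n - (j + 1)) (j + 1) := by
  rcases hj.lt_or_eq with hjn | rfl
  · have e : n - j = n - (j + 1) + 1 := by omega
    rw [e, vn]
    push_cast
    rfl
  · simp [vn]

lemma Bounded.chainBody (h30 : s.reg 30 = n) (h31 : s.reg 31 = a) (h32 : s.reg 32 = c)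
    (h33 : s.reg 33 = j) (h34 : s.reg 34 = q) (hq : q ≤ 1) (hj : j ≤ n) (hna : n ≤ a)
    (hc1 : 1 ≤ c) (hnac : n * a ≤ c) (hw : (n + 1) * (c + n) < 2 ^ M.w) (haw : a + n < 2 ^ M.w)
    {x y : ℝ}
    (hx : j < n → ∀ s', Agree 20 40 s s' → s'.reg 30 = n → s'.reg 31 = a → s'.reg 32 = c →
      s'.reg 33 = j + 1 → s'.reg 34 = 1 - q → s'.reg 36 = 1 → Bounded M k F s' x)
    (hy : ∀ s', Agree 20 40 s s' → s'.reg 30 = n → s'.reg 31 = a → s'.reg 32 = c →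
      s'.reg 33 = j → s'.reg 34 = q → s'.reg 36 = 0 → Bounded M k F s' y)
    (ht : 70 + (((n - j) * (a + j) : ℕ) / ((j + 1) * (c + j) : ℕ) * x +
      (1 - ((n - j) * (a + j) : ℕ) / ((j + 1) * (c + j) : ℕ)) * y) ≤ t) :
    Bounded M (chainBody :: k) F s t := by
  have hcn : c + n < 2 ^ M.w := by nlinarith
  have hnw : n + 1 < 2 ^ M.w := by nlinarith
  have hprod : (j + 1) * (c + j) ≤ (n + 1) * (c + n) := Nat.mul_le_mul (by omega) (by omega)
  have hc' := coin_le hj hna hnac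
  have hcoin : (n - j) * (a + j) ≤ (j + 1) * (c + j) :=
    hc'.trans (Nat.le_mul_of_pos_left _ (by omega))
  refine .seq (.blk_cons trivial (Instr.detExec_const (by omega)) <|
    .blk_cons trivial (Instr.detExec_bin (v := j + 1) h33 rfl rfl (by omega)) <|
    .blk_cons trivial (Instr.detExec_bin (v := c + j) h32 h33 rfl (by omega)) <|
    .blk_one trivial (Instr.detExec_bin (v := (j + 1) * (c + j)) rfl rfl rfl (by omega)) ?_)
  refine .seq (.unif_coin (a := (n - j) * (a + j)) (b := (j + 1) * (c + j)) rfl (by nlinarith) hcoin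
    (by omega) (x := x + 16) (y := y + 16) (fun r hr S hS hr21 => ?_)
    (fun r hr _ S hS hr21 => ?_) ?_)
  · have hA : Agree 20 40 s S := by
      refine Agree.trans (lo := 20) (hi := 40) ?_ hS (by omega) (by omega)
      exact ((((Agree.refl 20 40 s).put (by omega)).put (by omega)).put (by omega)).put (by omega)
    have r30 : S.reg 30 = n := by simpa [State.put_reg, h30] using hS.reg 30 (by omega)
    have r31 : S.reg 31 = a := by simpa [State.put_reg, h31] using hS.reg 31 (by omega)
    have r32 : S.reg 32 = c := by simpa [State.put_reg, h32] using hS.reg 32 (by omega)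
    have r33 : S.reg 33 = j := by simpa [State.put_reg, h33] using hS.reg 33 (by omega)
    have r34 : S.reg 34 = q := by simpa [State.put_reg, h34] using hS.reg 34 (by omega)
    have hjn : j < n := by
      by_contra hc
      have : n - j = 0 := by omega
      simp [this] at hr
    refine .seq <| .blk_cons trivial (Instr.detExec_bin (v := n - j) r30 r33 rfl (by omega)) <|
      .blk_cons trivial (Instr.detExec_bin (v := a + j) r31 r33 rfl (by omega)) <|
      .blk_cons trivial (Instr.detExec_bin (v := (n - j) * (a + j)) rfl rfl rfl (by omega)) <|
      .blk_one trivial (Instr.detExec_bin (v := 1) hr21 rfl (if_pos hr) (by omega)) <|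
      .ite (fun _ => .blk_cons trivial (Instr.detExec_const (by omega)) <|
        .blk_cons trivial (Instr.detExec_bin (v := j + 1) r33 rfl rfl (by omega)) <|
        .blk_one trivial (Instr.detExec_bin (v := 1 - q) rfl r34 rfl (by omega)) ?_)
        (fun h => absurd h one_ne_zero)
    refine (hx hjn _ ?_ ?_ ?_ ?_ rfl rfl rfl).mono ?_
    · exact ((((((hA.put (by omega)).put (by omega)).put (by omega)).put (by omega)).put
        (by omega)).put (by omega)).put (by omega)
    · exact r30
    · exact r31
    · exact r32
    · linarith
  · have hA : Agree 20 40 s S := by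
      refine Agree.trans (lo := 20) (hi := 40) ?_ hS (by omega) (by omega)
      exact ((((Agree.refl 20 40 s).put (by omega)).put (by omega)).put (by omega)).put (by omega)
    have r30 : S.reg 30 = n := by simpa [State.put_reg, h30] using hS.reg 30 (by omega)
    have r31 : S.reg 31 = a := by simpa [State.put_reg, h31] using hS.reg 31 (by omega)
    have r32 : S.reg 32 = c := by simpa [State.put_reg, h32] using hS.reg 32 (by omega)
    have r33 : S.reg 33 = j := by simpa [State.put_reg, h33] using hS.reg 33 (by omega)
    have r34 : S.reg 34 = q := by simpa [State.put_reg, h34] using hS.reg 34 (by omega)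
    refine .seq <| .blk_cons trivial (Instr.detExec_bin (v := n - j) r30 r33 rfl (by omega)) <|
      .blk_cons trivial (Instr.detExec_bin (v := a + j) r31 r33 rfl (by omega)) <|
      .blk_cons trivial (Instr.detExec_bin (v := (n - j) * (a + j)) rfl rfl rfl (by omega)) <|
      .blk_one trivial (Instr.detExec_bin (b := (n - j) * (a + j)) (v := 0) hr21 rfl
        (if_neg (not_lt.2 hr)) (by omega)) <|
      .ite (fun h => absurd rfl h)
        (fun _ => .blk_one trivial (Instr.detExec_const (by omega)) ?_)
    refine (hy _ ?_ ?_ ?_ ?_ ?_ ?_ rfl).mono ?_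
    · exact ((((hA.put (by omega)).put (by omega)).put (by omega)).put (by omega)).put (by omega)
    · exact r30
    · exact r31
    · exact r32
    · exact r33
    · exact r34
    · linarith
  · norm_num at ht ⊢
    linarith

/-- Each success flips the parity, so the initial parity survives with the probability of an even
number of successes, which is `vn`. A start at i > 0 allows the first coins to be tossed elsewhere.
-/
lemma Bounded.chain {i p : ℕ} (hn : s.reg 30 = n) (ha : s.reg 31 = a) (hc : s.reg 32 = c)
    (hi : s.reg 33 = i) (hp : s.reg 34 = p) (hp1 : p ≤ 1) (hin : i ≤ n) (hna : n ≤ a)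
    (hc1 : 1 ≤ c) (hnac : n * a ≤ c) (hw : (n + 1) * (c + n) < 2 ^ M.w) (haw : a + n < 2 ^ M.w)
    (x : ℕ → ℝ) (h : ∀ q ≤ 1, ∀ s', Agree 20 40 s s' → s'.reg 34 = q → Bounded M k F s' (x q))
    (ht : 245 + (vn a c (n - i) i * x p + (1 - vn a c (n - i) i) * x (1 - p)) ≤ t) :
    Bounded M (chain :: k) F s t := by
  have h1w : 1 < 2 ^ M.w := by nlinarith
  have hx : ∀ q ≤ 1, 0 ≤ x q := fun q hq =>
    (h q hq (s.put 34 q) ((Agree.refl _ _ _).put (by omega)) rfl).1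
  have hc0 : (0 : ℝ) < c := by exact_mod_cast hc1
  have hvn : ∀ i ≤ n, 0 ≤ vn a c (n - i) i ∧ vn a c (n - i) i ≤ 1 := fun i hi =>
    vn_mem hc0 (by rw [Nat.sub_add_cancel hi]; exact_mod_cast hna)
      (by rw [Nat.sub_add_cancel hi]; exact_mod_cast hnac)
  refine .seq (.blk_one trivial (Instr.detExec_const h1w) ?_)
  refine .while (fun s' => Agree 20 40 s s' ∧ s'.reg 30 = n ∧ s'.reg 31 = a ∧ s'.reg 32 = c ∧
      s'.reg 33 ≤ n ∧ s'.reg 34 ≤ 1)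
    -- A round costs at most 71 with its test. From the second coin on the bias is at most 1/2, and
    -- 160 suffices; the first coin may always succeed, which requires 240.
    (fun s' => if s'.reg 36 = 0 then 1 + x (s'.reg 34) else
      (if s'.reg 33 = 0 then 240 else 160) + (vn a c (n - s'.reg 33) (s'.reg 33) * x (s'.reg 34) +
        (1 - vn a c (n - s'.reg 33) (s'.reg 33)) * x (1 - s'.reg 34))) ?_ ?_ ?_ ?_
  · rintro s₁ ⟨hs₁, h30, h31, h32, h33, h34⟩ hx36
    rw [if_neg hx36]
    generalize hj : s₁.reg 33 = j at *
    generalize hq : s₁.reg 34 = q at *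
    have hqq : 1 - (1 - q) = q := by omega
    refine .chainBody h30 h31 h32 hj hq h34 h33 hna hc1 hnac hw haw
      (x := 160 + (vn a c (n - (j + 1)) (j + 1) * x (1 - q) +
        (1 - vn a c (n - (j + 1)) (j + 1)) * x q)) (y := 1 + x q)
      (fun hjn s' hs' r30 r31 r32 r33 r34 r36 => ?_) (fun s' hs' r30 r31 r32 r33 r34 r36 => ?_) ?_
    · have hv := hvn (j + 1) (by omega)
      have h1 := mul_nonneg hv.1 (hx (1 - q) (by omega))
      have h2 := mul_nonneg (sub_nonneg.2 hv.2) (hx q (by omega))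
      refine .nil_boundOn ⟨hs₁.trans hs' (by omega) (by omega), r30, r31, r32, by omega, by omega⟩
        ?_ ?_
      · simp only [r36, r33, r34, hqq]
        norm_num
        linarith
      · simp only [r36, r33, r34, hqq]
        norm_num
    · refine .nil_boundOn ⟨hs₁.trans hs' (by omega) (by omega), r30, r31, r32, by omega, by omega⟩
        ?_ ?_
      · simp only [r36, if_true, r34]
        linarith [hx q h34]
      · simp only [r36, if_true, r34, le_refl]
    · have hρ1 := coin_div_le h33 hna hc1 hnac
      rw [vn_eq h33]
      have hρ0 : (0 : ℝ) ≤ ((n - j) * (a + j) : ℕ) / ((j + 1) * (c + j) : ℕ) := by positivity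
      generalize (((n - j) * (a + j) : ℕ) / ((j + 1) * (c + j) : ℕ) : ℝ) = ρ at *
      generalize vn a c (n - (j + 1)) (j + 1) = V
      rcases Nat.eq_zero_or_pos j with rfl | hj
      · norm_num at hρ1 ⊢
        linarith
      · have h1j : (1 : ℝ) ≤ j := by exact_mod_cast hj
        have : 2 * ρ ≤ 1 := by nlinarith
        rw [if_neg (by omega)]
        linarith
  · rintro s' ⟨hs', -, -, -, -, h34⟩ hx36
    rw [if_pos hx36]
    simpa using h _ h34 s' hs' rfl
  · exact ⟨(Agree.refl _ _ _).put (by omega), hn, ha, hc, hi.trans_le hin, hp.trans_le hp1⟩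
  · simp only [State.put_reg]
    norm_num [hi, hp]
    split_ifs <;> linarith

end chain

/-! ### Symmetric binomial weights -/

/-- The weights `C(2 m, m + j) / C(2 m, m)`. -/
def cwt (m j : ℕ) : ℝ := (2 * m).choose (m + j) / (2 * m).choose m

lemma centralChoose_pos (m : ℕ) : (0 : ℝ) < (2 * m).choose m := by
  exact_mod_cast Nat.choose_pos (by omega)

lemma cwt_zero (m : ℕ) : cwt m 0 = 1 := div_self (centralChoose_pos m).ne'

lemma cwt_pos {m j : ℕ} (h : j ≤ m) : 0 < cwt m j :=
  div_pos (by exact_mod_cast Nat.choose_pos (by omega)) (centralChoose_pos m)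

lemma cwt_succ (m j : ℕ) : cwt m (j + 1) * (m + j + 1) = cwt m j * (m - j) := by
  have h := Nat.choose_succ_right_eq (2 * m) (m + j)
  have h' : ((2 * m).choose (m + (j + 1)) : ℝ) * (m + j + 1) =
      (2 * m).choose (m + j) * (m - j) := by
    rcases le_or_gt j m with hj | hj
    · have e : 2 * m - (m + j) = m - j := by omega
      rw [e] at h
      have h2 : (((m - j : ℕ) : ℕ) : ℝ) = m - j := by rw [Nat.cast_sub hj]
      rw [← h2]
      exact_mod_cast h
    · rw [Nat.choose_eq_zero_of_lt (by omega : 2 * m < m + (j + 1)),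
        Nat.choose_eq_zero_of_lt (by omega : 2 * m < m + j)]
      simp
  rw [cwt, cwt, div_mul_eq_mul_div, h', div_mul_eq_mul_div]

lemma cwt_add (m i n : ℕ) :
    cwt m (i + n) = cwt m i * ∏ l ∈ Finset.range n, (((m : ℝ) - i - l) / (m + i + 1 + l)) := by
  induction n with
  | zero => simp
  | succ n ih =>
    have h := cwt_succ m (i + n)
    have hp : (0 : ℝ) < m + i + 1 + n := by positivity
    rw [Finset.prod_range_succ, ← mul_assoc, ← ih, ← add_assoc, ← mul_div_assoc, eq_div_iff hp.ne']
    push_cast at h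
    rw [show (m : ℝ) + i + 1 + n = m + (i + n) + 1 by ring, h]
    ring

/-- The whole chain realises a quotient of rising factorials as a probability. -/
lemma vn_zero_eq_prod {a c : ℝ} (hc : 0 < c) (n : ℕ) :
    vn a c n 0 = ∏ j ∈ Finset.range n, ((c - a + j) / (c + j)) := by
  rw [← sum_vnTerm hc]
  have := vnTerm_mul_vn (a := a) hc n 0
  simpa [vnTerm] using this

/-- The ratio of two central weights is (m - i)⋯(m - i - n + 1) divided by (m + i + 1)⋯(m + i + n).
This is the rising factorial quotient for c = m + i + 1 and a = 2 i + n, with the numerator read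
backwards. -/
lemma cwt_mul_vn (m i n : ℕ) :
    cwt m i * vn ((2 * i + n : ℕ) : ℝ) ((m + i + 1 : ℕ) : ℝ) n 0 = cwt m (i + n) := by
  have hc : (0 : ℝ) < ((m + i + 1 : ℕ) : ℝ) := by positivity
  rw [vn_zero_eq_prod hc, cwt_add]
  congr 1
  rw [Finset.prod_div_distrib, Finset.prod_div_distrib]
  congr 1
  · rw [← Finset.prod_range_reflect]
    refine Finset.prod_congr rfl fun l hl => ?_
    have hl := Finset.mem_range.1 hl
    rw [Nat.cast_sub (by omega), Nat.cast_sub (by omega)]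
    push_cast
    ring
  · push_cast
    rfl

lemma vn_eq_cwt_div {m i n : ℕ} (h : i ≤ m) :
    vn ((2 * i + n : ℕ) : ℝ) ((m + i + 1 : ℕ) : ℝ) n 0 = cwt m (i + n) / cwt m i := by
  rw [eq_div_iff (cwt_pos h).ne', mul_comm, cwt_mul_vn]

/-- Truncating the alternating form after its first coin, as the remaining factor is at most one. -/
lemma one_sub_le_cwt {m o : ℕ} (h : o * o ≤ m + 1) : 1 - (o : ℝ) * o / (m + 1) ≤ cwt m o := by
  have h1 := cwt_mul_vn m 0 o
  rw [cwt_zero, one_mul, zero_add] at h1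
  rw [← h1]
  cases o with
  | zero => simp [vn]
  | succ o =>
    rw [vn]
    have h2 := (vn_mem (a := ((2 * 0 + (o + 1) : ℕ) : ℝ)) (c := ((m + 0 + 1 : ℕ) : ℝ)) (r := o)
      (i := 0 + 1) (by positivity) (by push_cast; linarith) (by push_cast; norm_cast; simpa using h))
    have h3 : (0 : ℝ) ≤ (o + 1) * (o + 1) / (m + 1) := by positivity
    push_cast at h2 ⊢
    simp only [zero_add, add_zero, one_mul] at h2 ⊢
    nlinarith [h2.1, h2.2]

/-! ### Expectations under binomial distributions -/

/-- The expected value of `G` under the binomial distribution with parameters `l` and `p`. -/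
def bex (p : ℝ) : ℕ → (ℕ → ℝ) → ℝ
  | 0, G => G 0
  | l + 1, G => (1 - p) * bex p l G + p * bex p l fun v => G (v + 1)

lemma bex_congr {p : ℝ} {l : ℕ} {G G' : ℕ → ℝ} (h : ∀ v ≤ l, G v = G' v) :
    bex p l G = bex p l G' := by
  induction l generalizing G G' with
  | zero => exact h 0 le_rfl
  | succ l ih =>
    rw [bex, bex, ih fun v hv => h v (by omega),
      ih (G := fun v => G (v + 1)) (G' := fun v => G' (v + 1)) fun v hv => h (v + 1) (by omega)]

lemma bex_mono {p : ℝ} (h0 : 0 ≤ p) (h1 : p ≤ 1) {l : ℕ} {G G' : ℕ → ℝ}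
    (h : ∀ v ≤ l, G v ≤ G' v) : bex p l G ≤ bex p l G' := by
  induction l generalizing G G' with
  | zero => exact h 0 le_rfl
  | succ l ih =>
    have h2 := ih (G := G) (G' := G') fun v hv => h v (by omega)
    have h3 := ih (G := fun v => G (v + 1)) (G' := fun v => G' (v + 1))
      fun v hv => h (v + 1) (by omega)
    rw [bex, bex]
    nlinarith

lemma bex_add (p : ℝ) (l : ℕ) (G G' : ℕ → ℝ) :
    bex p l (fun v => G v + G' v) = bex p l G + bex p l G' := by
  induction l generalizing G G' with
  | zero => rfl
  | succ l ih => rw [bex, bex, bex, ih, ih (fun v => G (v + 1))]; ring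

lemma bex_const_mul (p : ℝ) (l : ℕ) (c : ℝ) (G : ℕ → ℝ) :
    bex p l (fun v => c * G v) = c * bex p l G := by
  induction l generalizing G with
  | zero => rfl
  | succ l ih => rw [bex, bex, ih, ih (fun v => G (v + 1))]; ring

lemma bex_const (p : ℝ) (l : ℕ) (c : ℝ) : bex p l (fun _ => c) = c := by
  induction l with
  | zero => rfl
  | succ l ih => rw [bex, ih]; ring

lemma bex_id (p : ℝ) (l : ℕ) : bex p l (fun v => (v : ℝ)) = l * p := by
  induction l with
  | zero => simp [bex]
  | succ l ih =>
    rw [bex]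
    simp only [Nat.cast_add, Nat.cast_one]
    rw [bex_add, bex_const, ih]
    ring

lemma bex_eq_sum (p : ℝ) (l : ℕ) (G : ℕ → ℝ) :
    bex p l G = ∑ k ∈ Finset.range (l + 1), l.choose k * p ^ k * (1 - p) ^ (l - k) * G k := by
  induction l generalizing G with
  | zero => simp [bex]
  | succ l ih =>
    rw [bex, ih, ih, Finset.sum_range_succ' _ (l + 1)]
    have h1 : ∀ k, ((l + 1).choose (k + 1) : ℝ) * p ^ (k + 1) * (1 - p) ^ (l + 1 - (k + 1)) *
        G (k + 1) = p * (l.choose k * p ^ k * (1 - p) ^ (l - k) * G (k + 1)) +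
          l.choose (k + 1) * p ^ (k + 1) * (1 - p) ^ (l - k) * G (k + 1) := by
      intro k
      rw [Nat.choose_succ_succ, Nat.succ_sub_succ, pow_succ]
      push_cast
      ring
    rw [Finset.sum_congr rfl fun k _ => h1 k, Finset.sum_add_distrib, ← Finset.mul_sum,
      Finset.sum_range_succ (fun k => (l.choose (k + 1) : ℝ) * p ^ (k + 1) * (1 - p) ^ (l - k) *
        G (k + 1)) l, Finset.sum_range_succ' _ l]
    have h2 : ∀ k ∈ Finset.range l, (l.choose (k + 1) : ℝ) * p ^ (k + 1) * (1 - p) ^ (l - k) *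
        G (k + 1) = (1 - p) * (l.choose (k + 1) * p ^ (k + 1) * (1 - p) ^ (l - (k + 1)) *
          G (k + 1)) := by
      intro k hk
      have hk := Finset.mem_range.1 hk
      rw [show l - k = l - (k + 1) + 1 by omega, pow_succ]
      ring
    rw [Finset.sum_congr rfl h2, ← Finset.mul_sum]
    simp [pow_succ]
    ring

/-- Thinning: a trial of probability p/2 is a fair trial followed, after a success, by one of
probability p. -/
lemma bex_half_mul (p : ℝ) (l : ℕ) (G : ℕ → ℝ) :
    bex (p / 2) l G = bex (1 / 2) l fun v => bex p v G := by
  induction l generalizing G with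
  | zero => rfl
  | succ l ih =>
    rw [bex, bex, ih, ih]
    simp only [bex]
    rw [bex_add, bex_const_mul, bex_const_mul]
    ring

/-- A trial of probability (1 + p)/2 succeeds if a fair trial does, and otherwise gets a second
chance p. -/
lemma bex_half_add (p : ℝ) (l : ℕ) (G : ℕ → ℝ) :
    bex ((1 + p) / 2) l G = bex (1 / 2) l fun v => bex p (l - v) fun k => G (v + k) := by
  induction l generalizing G with
  | zero => rfl
  | succ l ih =>
    rw [bex, bex, ih, ih]
    have h : bex (1 / 2) l (fun v => bex p (l + 1 - v) fun k => G (v + k)) =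
        bex (1 / 2) l (fun v => (1 - p) * bex p (l - v) (fun k => G (v + k)) +
          p * bex p (l - v) fun k => G (v + k + 1)) := by
      refine bex_congr fun v hv => ?_
      rw [show l + 1 - v = l - v + 1 by omega, bex]
      rfl
    have h' : bex (1 / 2) l (fun v => bex p (l + 1 - (v + 1)) fun k => G (v + 1 + k)) =
        bex (1 / 2) l (fun v => bex p (l - v) fun k => G (v + k + 1)) := by
      refine bex_congr fun v _ => ?_
      simp only [Nat.add_sub_add_right, add_right_comm]
    rw [h, h', bex_add, bex_const_mul, bex_const_mul]
    ring

lemma bex_half_even (m : ℕ) (G : ℕ → ℝ) :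
    bex (1 / 2) (2 * m) G = (∑ k ∈ Finset.range (2 * m + 1), (2 * m).choose k * G k) / 4 ^ m := by
  rw [bex_eq_sum, Finset.sum_div]
  refine Finset.sum_congr rfl fun k hk => ?_
  have hk := Finset.mem_range.1 hk
  have h : (1 / 2 : ℝ) ^ k * (1 / 2) ^ (2 * m - k) = 1 / 4 ^ m := by
    rw [← pow_add, show k + (2 * m - k) = 2 * m by omega, pow_mul,
      show (1 / 2 : ℝ) ^ 2 = 1 / 4 by norm_num, one_div_pow]
  rw [show (1 : ℝ) - 1 / 2 = 1 / 2 by norm_num, mul_assoc ((2 * m).choose k : ℝ), h]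
  ring

/-! ### Symmetrisation -/

/-- Half the sum of `G` over the points `m ± j`. -/
def symH (m : ℕ) (G : ℕ → ℝ) (j : ℕ) : ℝ :=
  if j = 0 then G m / 2 else (G (m + j) + G (m - j)) / 2

lemma sum_range_symm (m : ℕ) (f : ℕ → ℝ) :
    ∑ k ∈ Finset.range (2 * m + 1), f k = 2 * ∑ j ∈ Finset.range (m + 1), symH m f j := by
  have h1 : ∑ k ∈ Finset.range (2 * m + 1), f k =
      ∑ j ∈ Finset.range m, f (m - (j + 1)) + (f m + ∑ j ∈ Finset.range m, f (m + (j + 1))) := by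
    rw [show 2 * m + 1 = m + (m + 1) by ring, Finset.sum_range_add, ← Finset.sum_range_reflect,
      Finset.sum_range_succ' (fun j => f (m + j))]
    rw [add_comm (∑ k ∈ Finset.range m, f (m + (k + 1)))]
    congr 1
    exact Finset.sum_congr rfl fun j _ => by congr 1; omega
  rw [h1, Finset.sum_range_succ']
  simp only [symH, Nat.add_eq_zero_iff, one_ne_zero, and_false, if_false, if_true]
  rw [← Finset.sum_div, Finset.sum_add_distrib]
  ring

lemma sum_cwt_symH (m : ℕ) (G : ℕ → ℝ) :
    ∑ j ∈ Finset.range (m + 1), cwt m j * symH m G j =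
      4 ^ m / (2 * (2 * m).choose m) * bex (1 / 2) (2 * m) G := by
  rw [bex_half_even, sum_range_symm]
  have h := centralChoose_pos m
  have e : ∀ j ∈ Finset.range (m + 1), cwt m j * symH m G j =
      symH m (fun k => (2 * m).choose k * G k) j / (2 * m).choose m := by
    intro j hj
    have hj := Finset.mem_range.1 hj
    rw [symH, symH, cwt]
    split_ifs with h0
    · subst h0; simp; field_simp
    · rw [← Nat.choose_symm_of_eq_add (show 2 * m = (m + j) + (m - j) by omega)]
      field_simp
  rw [Finset.sum_congr rfl e, ← Finset.sum_div]
  field_simp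

/-- The centred reward has total weight zero. This makes the value of the sampler at a restart equal
to the binomial expectation of `G`. -/
lemma sum_cwt_symH_sub (m : ℕ) (G : ℕ → ℝ) :
    ∑ j ∈ Finset.range (m + 1),
      cwt m j * (symH m G j - symH m (fun _ => 1) j * bex (1 / 2) (2 * m) G) = 0 := by
  have h1 := sum_cwt_symH m fun _ => 1
  rw [bex_const] at h1
  simp only [mul_sub, Finset.sum_sub_distrib, sum_cwt_symH, ← mul_assoc, ← Finset.sum_mul, h1]
  ring

/-! ### Sampling from the symmetric binomial distribution -/

/-- Restart the sampler. -/
def setZero : Prog := blk (.const 42 0) []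

/-- Proceed to the next block of weights. -/
def advance : Prog := blk (.bin .add 42 42 43) []

/-- Choose the sign of the deviation, and output. -/
def signBranch : Prog :=
  .seq (blk (.bin .add 53 53 42) [.const 20 2]) (.seq unif (.ite 21
    (.ite 53 (blk (.bin .sub 46 40 53) [.const 44 0]) setZero)
    (blk (.bin .add 46 40 53) [.const 44 0])))

/-- Choose a deviation in the current block. -/
def accBranch : Prog :=
  .seq (blk (.bin .add 20 43 52) []) (.seq unif (.seq (blk (.bin .add 53 21 52)
    [.bin .add 30 21 52, .bin .add 31 47 21, .const 33 0, .const 34 1])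
    (.seq chain (.ite 34 signBranch setZero))))

/-- Try to stop in the current block. -/
def stopBranch : Prog :=
  .seq (blk (.const 37 4) [.bin .mul 37 37 45, .bin .mul 20 37 31]) (.seq unif
    (.seq (blk (.bin .lt 36 21 32) []) (.ite 36 accBranch setZero)))

/-- Try to proceed to the next block. -/
def contBranch : Prog :=
  .seq (blk (.bin .add 30 43 52) [.const 33 2, .const 34 1, .bin .add 20 32 50]) (.seq unif
    (.seq (blk (.bin .sub 37 43 50) [.bin .add 38 31 50, .bin .mul 37 37 38, .bin .lt 36 21 37])
      (.ite 36 (.seq chain (.ite 34 advance setZero)) setZero)))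

/-- One round of the sampler `half`. -/
def halfBody : Prog :=
  .seq (blk (.const 50 1) [.const 51 2, .bin .add 45 41 50, .bin .mul 47 51 42, .bin .add 48 47 45,
      .bin .add 48 48 50, .bin .sub 43 40 42, .bin .div 43 43 48, .const 52 0, .bin .lt 49 43 41])
    (.seq (.ite 49 (blk (.const 48 0) []) (blk (.bin .add 43 41 52) []))
      (.seq (blk (.bin .add 43 43 50) [.bin .add 31 47 43, .bin .add 32 40 42, .bin .add 32 32 50,
          .bin .add 20 32 52])
        (.seq unif (.seq (blk (.bin .mul 35 43 31) [.bin .lt 36 21 35])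
          (.ite 36 (.seq (blk (.const 20 2) []) (.seq unif (.ite 21 contBranch stopBranch)))
            advance)))))

/-- `reg 46 :=` a binomial random number with parameters `2 (reg 40)` and `1 / 2`, where
`reg 41 + 1` is comparable to the square root of `reg 40 + 1`. -/
def half : Prog := .seq (blk (.const 42 0) [.const 44 1]) (.while 44 halfBody)

/-- The registers during a round of `half`. -/
structure HalfSt (m z i n : ℕ) (s : State) : Prop where
  r40 : s.reg 40 = m
  r41 : s.reg 41 = z
  r42 : s.reg 42 = i
  r43 : s.reg 43 = n
  r44 : s.reg 44 = 1
  r45 : s.reg 45 = z + 1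
  r47 : s.reg 47 = 2 * i
  r50 : s.reg 50 = 1
  r52 : s.reg 52 = 0

/-- The registers after a round of `half`. -/
structure HalfPost (m z : ℕ) (s s' : State) : Prop where
  agree : Agree 20 60 s s'
  r40 : s'.reg 40 = m
  r41 : s'.reg 41 = z

/-- Bounds for the continuation after a round of `half` that ends with a restart or an output. -/
structure HalfCont (M : Env) (k : List Prog) (F : State → ℝ≥0∞) (m z : ℕ) (s : State) (xr : ℝ)
    (y : ℕ → ℝ) : Prop where
  restart : ∀ s', HalfPost m z s s' → s'.reg 42 = 0 → s'.reg 44 = 1 → Bounded M k F s' xr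
  accept : ∀ v ≤ 2 * m, ∀ s', HalfPost m z s s' → s'.reg 46 = v → s'.reg 44 = 0 →
    Bounded M k F s' (y v)

section half
variable {M : Env} {k : List Prog} {F : State → ℝ≥0∞} {s s' : State} {t xr xc : ℝ} {y : ℕ → ℝ}
  {m z i n o : ℕ}

lemma HalfSt.put (h : HalfSt m z i n s) {x v : ℕ}
    (hx : x ∉ [40, 41, 42, 43, 44, 45, 47, 50, 52]) : HalfSt m z i n (s.put x v) := by
  simp only [List.mem_cons, List.not_mem_nil, or_false, not_or] at hx
  constructor <;> rw [State.put_reg, if_neg (by omega)]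
  exacts [h.r40, h.r41, h.r42, h.r43, h.r44, h.r45, h.r47, h.r50, h.r52]

lemma HalfSt.agree (h : HalfSt m z i n s) (hs : Agree 20 40 s s') : HalfSt m z i n s' := by
  constructor <;> rw [hs.reg _ (by omega)]
  exacts [h.r40, h.r41, h.r42, h.r43, h.r44, h.r45, h.r47, h.r50, h.r52]

lemma Agree.to_scratch {lo hi : ℕ} (h : Agree lo hi s s') (hlo : 20 ≤ lo) (hhi : hi ≤ 60) :
    Agree 20 60 s s' :=
  ⟨h.mem, h.real, fun x hx => h.reg x (by omega)⟩

lemma HalfCont.trans (h : HalfCont M k F m z s xr y) (hs : Agree 20 60 s s') :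
    HalfCont M k F m z s' xr y where
  restart s'' h' := h.restart s'' ⟨hs.trans h'.agree (by omega) (by omega), h'.r40, h'.r41⟩
  accept v hv s'' h' := h.accept v hv s'' ⟨hs.trans h'.agree (by omega) (by omega), h'.r40, h'.r41⟩

lemma HalfCont.put (h : HalfCont M k F m z s xr y) {x v : ℕ} (hx : 20 ≤ x ∧ x < 60) :
    HalfCont M k F m z (s.put x v) xr y :=
  h.trans ((Agree.refl _ _ _).put hx)

lemma Bounded.setZero (hw : 0 < 2 ^ M.w) (h : HalfSt m z i n s) (hk : HalfCont M k F m z s xr y)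
    (ht : xr + 1 ≤ t) : Bounded M (setZero :: k) F s t :=
  .blk_one trivial (Instr.detExec_const hw) <|
    (hk.restart _ ⟨(Agree.refl _ _ _).put (by omega), by exact h.r40, by exact h.r41⟩ rfl (by exact h.r44)).mono (by linarith)

lemma Bounded.advance (hw : i + n < 2 ^ M.w) (h : HalfSt m z i n s)
    (hk : ∀ s', HalfPost m z s s' → s'.reg 42 = i + n → s'.reg 44 = 1 → Bounded M k F s' xc)
    (ht : xc + 1 ≤ t) : Bounded M (advance :: k) F s t :=
  .blk_one trivial (Instr.detExec_bin h.r42 h.r43 rfl hw) <|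
    (hk _ ⟨(Agree.refl _ _ _).put (by omega), by exact h.r40, by exact h.r41⟩ rfl (by exact h.r44)).mono (by linarith)

/-- The deviation zero has only one point instead of two, so it is accepted for one of the two signs
only; the other sign restarts. This is the case distinction in `symH`. -/
lemma Bounded.signBranch (hw : 100 * (m + z + 2) ^ 2 < 2 ^ M.w) (h : HalfSt m z i n s)
    (hk : HalfCont M k F m z s xr y) (ho : s.reg 53 = o) (hio : i + o ≤ m)
    (ht : 60 + (symH m y (i + o) + (1 - symH m (fun _ => 1) (i + o)) * xr) ≤ t) :
    Bounded M (signBranch :: k) F s t := by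
  have hw' : 100 * (m + z + 2) < 2 ^ M.w := by nlinarith
  refine .seq (.blk_cons trivial (Instr.detExec_bin (v := o + i) ho h.r42 rfl (by omega)) <|
    .blk_one trivial (Instr.detExec_const (by omega)) ?_)
  refine .seq (.unif_coin (a := 1) (b := 2) rfl (by norm_num) (by norm_num) (by omega)
    (x := y (m + (i + o)) + 5) (y := (if i + o = 0 then xr else y (m - (i + o))) + 6) ?_ ?_ ?_)
  · intro r hr S hS h21
    have h' : HalfSt m z i n S := ((h.put (by decide)).put (by decide)).agree
      ⟨hS.mem, hS.real, fun x hx => hS.reg x (by omega)⟩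
    have hk' := (HalfCont.put (HalfCont.put hk (x := 53) (v := o + i) (by omega)) (x := 20) (v := 2)
      (by omega)).trans (hS.to_scratch (by omega) (by omega))
    have r53 : S.reg 53 = o + i := hS.reg 53 (by omega)
    refine .ite (fun hc => absurd (by omega) hc) fun _ => ?_
    refine .blk_cons trivial (Instr.detExec_bin (v := m + (o + i)) h'.r40 r53 rfl (by omega)) <|
      .blk_one trivial (Instr.detExec_const (by omega)) ?_
    refine (hk'.accept (m + (i + o)) (by omega) _
      ⟨((Agree.refl _ _ _).put (by omega)).put (by omega), by exact h'.r40, by exact h'.r41⟩ ?_ rfl).mono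
      (by linarith)
    rw [add_comm i o]
    rfl
  · intro r hr hr2 S hS h21
    have h' : HalfSt m z i n S := ((h.put (by decide)).put (by decide)).agree
      ⟨hS.mem, hS.real, fun x hx => hS.reg x (by omega)⟩
    have hk' := (HalfCont.put (HalfCont.put hk (x := 53) (v := o + i) (by omega)) (x := 20) (v := 2)
      (by omega)).trans (hS.to_scratch (by omega) (by omega))
    have r53 : S.reg 53 = o + i := hS.reg 53 (by omega)
    refine .ite (fun _ => .ite (fun hj => ?_) (fun hj => ?_)) (fun hc => absurd hc (by omega))
    · refine .blk_cons trivial (Instr.detExec_bin (v := m - (o + i)) h'.r40 r53 rfl (by omega)) <|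
        .blk_one trivial (Instr.detExec_const (by omega)) ?_
      rw [if_neg (by omega)]
      refine (hk'.accept (m - (i + o)) (by omega) _
        ⟨((Agree.refl _ _ _).put (by omega)).put (by omega), by exact h'.r40, by exact h'.r41⟩ ?_ rfl).mono
        (by linarith)
      rw [add_comm i o]
      rfl
    · rw [if_pos (by omega)]
      exact .setZero (by omega) h' hk' (by linarith)
  · by_cases h0 : i + o = 0
    · simp only [symH, h0, if_true, add_zero] at ht ⊢
      norm_num at ht ⊢
      linarith
    · simp only [symH, if_neg h0] at ht ⊢
      norm_num at ht ⊢
      linarith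

/-- A uniform offset o is kept with probability `cwt m (i + o) / cwt m i`, realised by a chain with
n replaced by o. -/
lemma Bounded.accBranch (hw : 100 * (m + z + 2) ^ 2 < 2 ^ M.w) (h : HalfSt m z i n s)
    (hk : HalfCont M k F m z s xr y) (h32 : s.reg 32 = m + i + 1) (hn1 : 1 ≤ n)
    (hin : i + n ≤ m + 1) (hna : n * (2 * i + n) ≤ m + i + 1)
    (ht : 400 + (∑ o ∈ Finset.range n,
      (vn ((2 * i + o : ℕ) : ℝ) ((m + i + 1 : ℕ) : ℝ) o 0 *
        (symH m y (i + o) + (1 - symH m (fun _ => 1) (i + o)) * xr) +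
      (1 - vn ((2 * i + o : ℕ) : ℝ) ((m + i + 1 : ℕ) : ℝ) o 0) * xr)) / n ≤ t) :
    Bounded M (accBranch :: k) F s t := by
  have hw' : 100 * (m + z + 2) < 2 ^ M.w := by nlinarith
  have hn0 : (0 : ℝ) < n := by exact_mod_cast hn1
  refine .seq (.blk_one trivial (Instr.detExec_bin (v := n) h.r43 h.r52 rfl (by omega)) ?_)
  refine .seq (.unif (b := n) rfl hn1 (by omega) (fun o => 340 +
    (vn ((2 * i + o : ℕ) : ℝ) ((m + i + 1 : ℕ) : ℝ) o 0 *
        (symH m y (i + o) + (1 - symH m (fun _ => 1) (i + o)) * xr) +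
      (1 - vn ((2 * i + o : ℕ) : ℝ) ((m + i + 1 : ℕ) : ℝ) o 0) * xr)) ?_ ?_)
  · intro o ho S hS h21
    have h' : HalfSt m z i n S := (h.put (by decide)).agree
      ⟨hS.mem, hS.real, fun x hx => hS.reg x (by omega)⟩
    have hk' := (HalfCont.put hk (x := 20) (v := n) (by omega)).trans
      (hS.to_scratch (by omega) (by omega))
    have r32 : S.reg 32 = m + i + 1 := (hS.reg 32 (by omega)).trans h32
    refine .seq (.blk_cons trivial (Instr.detExec_bin (v := o) h21 h'.r52 rfl (by omega)) <|
      .blk_cons trivial (Instr.detExec_bin (v := o) h21 h'.r52 rfl (by omega)) <|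
      .blk_cons trivial (Instr.detExec_bin (v := 2 * i + o) h'.r47 h21 rfl (by omega)) <|
      .blk_cons trivial (Instr.detExec_const (by omega)) <|
      .blk_one trivial (Instr.detExec_const (by omega)) ?_)
    have hoa : o * (2 * i + o) ≤ m + i + 1 :=
      (Nat.mul_le_mul ho.le (by omega)).trans hna
    have hbig : (o + 1) * (m + i + 1 + o) < 2 ^ M.w := by
      have : (o + 1) * (m + i + 1 + o) ≤ (m + z + 2) * (3 * (m + z + 2)) :=
        Nat.mul_le_mul (by omega) (by omega)
      nlinarith
    refine .seq (.chain (n := o) (a := 2 * i + o) (c := m + i + 1) (i := 0) (p := 1) rfl rfl r32 rfl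
      rfl le_rfl (by omega) (by omega) (by omega) hoa hbig (by omega)
      (fun q => if q = 1 then 61 + (symH m y (i + o) + (1 - symH m (fun _ => 1) (i + o)) * xr)
        else 61 + xr) (fun q hq S' hS' h34 => ?_) ?_)
    · have h'' : HalfSt m z i n S' := (((((h'.put (by decide)).put (by decide)).put
        (by decide)).put (by decide)).put (by decide)).agree hS'
      have hA : Agree 20 60 S S' := Agree.trans (lo := 20) (hi := 60)
        ((((((Agree.refl _ _ _).put (by omega)).put (by omega)).put (by omega)).put (by omega)).put
          (by omega)) hS' (by omega) (by omega)
      have r53 : S'.reg 53 = o := hS'.reg 53 (by omega)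
      refine .ite (fun hc => ?_) (fun hc => ?_)
      · rw [if_pos (by omega)]
        exact .signBranch hw h'' (hk'.trans hA) r53 (by omega) (by linarith)
      · rw [if_neg (by omega)]
        exact .setZero (by omega) h'' (hk'.trans hA) (by linarith)
    · norm_num
      linarith
  · rw [Finset.sum_add_distrib, add_div]
    simp only [Finset.sum_const, Finset.card_range, nsmul_eq_mul]
    rw [mul_div_cancel_left₀ _ hn0.ne']
    linarith

/-- The additional coin corrects the probability of arriving here, so that each offset is proposed
at the same rate 1/(8 (z + 1)) in every block. -/
lemma Bounded.stopBranch (hw : 100 * (m + z + 2) ^ 2 < 2 ^ M.w) (h : HalfSt m z i n s)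
    (hk : HalfCont M k F m z s xr y) (h31 : s.reg 31 = 2 * i + n) (h32 : s.reg 32 = m + i + 1)
    (hn1 : 1 ≤ n) (hin : i + n ≤ m + 1) (hna : n * (2 * i + n) ≤ m + i + 1)
    (hs : m + i + 1 ≤ 4 * (z + 1) * (2 * i + n))
    (ht : 500 + (((m + i + 1 : ℕ) / (4 * (z + 1) * (2 * i + n) : ℕ) : ℝ) *
      ((∑ o ∈ Finset.range n, (vn ((2 * i + o : ℕ) : ℝ) ((m + i + 1 : ℕ) : ℝ) o 0 *
        (symH m y (i + o) + (1 - symH m (fun _ => 1) (i + o)) * xr) +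
      (1 - vn ((2 * i + o : ℕ) : ℝ) ((m + i + 1 : ℕ) : ℝ) o 0) * xr)) / n) +
      (1 - ((m + i + 1 : ℕ) / (4 * (z + 1) * (2 * i + n) : ℕ) : ℝ)) * xr) ≤ t) :
    Bounded M (stopBranch :: k) F s t := by
  have hw' : 100 * (m + z + 2) < 2 ^ M.w := by nlinarith
  have hbig : 4 * (z + 1) * (2 * i + n) < 2 ^ M.w := by
    have : 4 * (z + 1) * (2 * i + n) ≤ (4 * (m + z + 2)) * (2 * (m + z + 2)) :=
      Nat.mul_le_mul (by omega) (by omega)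
    nlinarith
  refine .seq (.blk_cons trivial (Instr.detExec_const (by omega)) <|
    .blk_cons trivial (Instr.detExec_bin (v := 4 * (z + 1)) rfl h.r45 rfl (by omega)) <|
    .blk_one trivial (Instr.detExec_bin (v := 4 * (z + 1) * (2 * i + n)) rfl h31 rfl hbig) ?_)
  have key : ∀ r (S : State), Agree 21 26 (((s.put 37 4).put 37 (4 * (z + 1))).put 20
      (4 * (z + 1) * (2 * i + n))) S → S.reg 21 = r → ∀ b, (if r < m + i + 1 then 1 else 0) = b →
      S.reg 32 = m + i + 1 ∧ HalfSt m z i n (S.put 36 b) ∧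
      HalfCont M k F m z (S.put 36 b) xr y := by
    intro r S hS h21 b hb
    refine ⟨(hS.reg 32 (by omega)).trans h32, ?_, ?_⟩
    · exact ((((h.put (by decide)).put (by decide)).put (by decide)).agree
        ⟨hS.mem, hS.real, fun x hx => hS.reg x (by omega)⟩).put (by decide)
    · exact ((((hk.put (by omega)).put (by omega)).put (by omega)).trans
        (hS.to_scratch (by omega) (by omega))).put (by omega)
  have hb1 : 1 ≤ 4 * (z + 1) * (2 * i + n) := by nlinarith
  refine .seq (.unif_coin (a := m + i + 1) (b := 4 * (z + 1) * (2 * i + n)) rfl hb1 hs hbig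
    (x := 404 + (∑ o ∈ Finset.range n, (vn ((2 * i + o : ℕ) : ℝ) ((m + i + 1 : ℕ) : ℝ) o 0 *
        (symH m y (i + o) + (1 - symH m (fun _ => 1) (i + o)) * xr) +
      (1 - vn ((2 * i + o : ℕ) : ℝ) ((m + i + 1 : ℕ) : ℝ) o 0) * xr)) / n)
    (y := 404 + xr) ?_ ?_ ?_)
  · intro r hr S hS h21
    obtain ⟨e1, e2, e3⟩ := key r S hS h21 1 (if_pos hr)
    refine .seq <| .blk_one trivial (Instr.detExec_bin (v := 1) h21 e1 (if_pos hr) (by omega)) <|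
      .ite (fun _ => ?_) (fun hc => absurd hc one_ne_zero)
    exact .accBranch hw e2 e3 e1 hn1 hin hna (by linarith)
  · intro r hr _ S hS h21
    obtain ⟨e1, e2, e3⟩ := key r S hS h21 0 (if_neg (not_lt.2 hr))
    refine .seq <| .blk_one trivial (Instr.detExec_bin (v := 0) h21 e1 (if_neg (not_lt.2 hr))
      (by omega)) <| .ite (fun hc => absurd rfl hc) (fun _ => ?_)
    exact .setZero (by omega) e2 e3 (by linarith)
  · norm_num at ht ⊢
    linarith

/-- The second coin of the chain has bias (n - 1)(a + 1)/(2 (c + 1)). Its factor 1/2 is the fair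
coin that selects this branch, so only the remaining quotient is tossed here. -/
lemma Bounded.contBranch (hw : 100 * (m + z + 2) ^ 2 < 2 ^ M.w) (h : HalfSt m z i n s)
    (hk : HalfCont M k F m z s xr y) (h31 : s.reg 31 = 2 * i + n) (h32 : s.reg 32 = m + i + 1)
    (hn1 : 1 ≤ n) (hin : i + n ≤ m + 1) (hin2 : 2 ≤ n → i + n ≤ m)
    (hna : n * (2 * i + n) ≤ m + i + 1)
    (hc : i + n ≤ m → ∀ s', HalfPost m z s s' → s'.reg 42 = i + n → s'.reg 44 = 1 →
      Bounded M k F s' xc)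
    (ht : 500 + (((n - 1) * (2 * i + n + 1) : ℕ) / (m + i + 1 + 1 : ℕ) *
      (vn ((2 * i + n : ℕ) : ℝ) ((m + i + 1 : ℕ) : ℝ) (n - 2) 2 * xc +
        (1 - vn ((2 * i + n : ℕ) : ℝ) ((m + i + 1 : ℕ) : ℝ) (n - 2) 2) * xr) +
      (1 - ((n - 1) * (2 * i + n + 1) : ℕ) / (m + i + 1 + 1 : ℕ)) * xr) ≤ t) :
    Bounded M (contBranch :: k) F s t := by
  have hw' : 100 * (m + z + 2) < 2 ^ M.w := by nlinarith
  have hcoin : (n - 1) * (2 * i + n + 1) ≤ m + i + 1 + 1 :=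
    coin_le (n := n) (a := 2 * i + n) (c := m + i + 1) (j := 1) hn1 (by omega) hna
  refine .seq (.blk_cons trivial (Instr.detExec_bin (v := n) h.r43 h.r52 rfl (by omega)) <|
    .blk_cons trivial (Instr.detExec_const (by omega)) <|
    .blk_cons trivial (Instr.detExec_const (by omega)) <|
    .blk_one trivial (Instr.detExec_bin (v := m + i + 1 + 1) h32 h.r50 rfl (by omega)) ?_)
  refine .seq (.unif_coin (a := (n - 1) * (2 * i + n + 1)) (b := m + i + 1 + 1) rfl (by omega) hcoin
    (by omega) (x := 400 + (vn ((2 * i + n : ℕ) : ℝ) ((m + i + 1 : ℕ) : ℝ) (n - 2) 2 * xc +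
        (1 - vn ((2 * i + n : ℕ) : ℝ) ((m + i + 1 : ℕ) : ℝ) (n - 2) 2) * xr))
    (y := 400 + xr) ?_ ?_ ?_)
  · intro r hr S hS h21
    have hn2 : 2 ≤ n := by
      by_contra hc
      have : n - 1 = 0 := by omega
      simp [this] at hr
    have h' : HalfSt m z i n S := ((((h.put (by decide)).put (by decide)).put (by decide)).put
      (by decide)).agree ⟨hS.mem, hS.real, fun x hx => hS.reg x (by omega)⟩
    have hA : Agree 20 60 s S := Agree.trans (lo := 20) (hi := 60)
      (((((Agree.refl _ _ _).put (by omega)).put (by omega)).put (by omega)).put (by omega))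
      hS (by omega) (by omega)
    have r30 : S.reg 30 = n := hS.reg 30 (by omega)
    have r31 : S.reg 31 = 2 * i + n := (hS.reg 31 (by omega)).trans h31
    have r32 : S.reg 32 = m + i + 1 := (hS.reg 32 (by omega)).trans h32
    have r33 : S.reg 33 = 2 := hS.reg 33 (by omega)
    have r34 : S.reg 34 = 1 := hS.reg 34 (by omega)
    refine .seq <| .blk_cons trivial (Instr.detExec_bin (v := n - 1) h'.r43 h'.r50 rfl
        (by omega)) <|
      .blk_cons trivial (Instr.detExec_bin (v := 2 * i + n + 1) r31 h'.r50 rfl (by omega)) <|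
      .blk_cons trivial (Instr.detExec_bin (v := (n - 1) * (2 * i + n + 1)) rfl rfl rfl
        (by omega)) <|
      .blk_one trivial (Instr.detExec_bin (v := 1) h21 rfl (if_pos hr) (by omega)) <|
      .ite (fun _ => .seq ?_) (fun hc => absurd hc one_ne_zero)
    have hbig : (n + 1) * (m + i + 1 + n) < 2 ^ M.w := by
      have : (n + 1) * (m + i + 1 + n) ≤ (m + z + 2) * (3 * (m + z + 2)) :=
        Nat.mul_le_mul (by omega) (by omega)
      nlinarith
    -- Two coins have already succeeded; the chain resumes at index 2 with even parity.
    refine .chain (n := n) (a := 2 * i + n) (c := m + i + 1) (i := 2) (p := 1) r30 r31 r32 r33 r34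
      le_rfl hn2 (by omega) (by omega) hna hbig (by omega)
      (fun q => if q = 1 then 2 + xc else 2 + xr) (fun q hq S' hS' h34 => ?_) ?_
    · have h'' : HalfSt m z i n S' := ((((h'.put (by decide)).put (by decide)).put
        (by decide)).put (by decide)).agree hS'
      have hA' : Agree 20 60 s S' := Agree.trans (lo := 20) (hi := 60)
        ((((hA.put (by omega)).put (by omega)).put (by omega)).put (by omega))
          hS' (by omega) (by omega)
      refine .ite (fun _ => ?_) (fun _ => ?_)
      · rw [if_pos (by omega)]
        exact .advance (by omega) h'' (fun s' hs' => hc (hin2 hn2) s'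
          ⟨hA'.trans hs'.agree (by omega) (by omega), hs'.r40, hs'.r41⟩) (by linarith)
      · rw [if_neg (by omega)]
        exact .setZero (by omega) h'' (hk.trans hA') (by linarith)
    · norm_num
      linarith
  · intro r hr _ S hS h21
    have h' : HalfSt m z i n S := ((((h.put (by decide)).put (by decide)).put (by decide)).put
      (by decide)).agree ⟨hS.mem, hS.real, fun x hx => hS.reg x (by omega)⟩
    have hA : Agree 20 60 s S := Agree.trans (lo := 20) (hi := 60)
      (((((Agree.refl _ _ _).put (by omega)).put (by omega)).put (by omega)).put (by omega))
      hS (by omega) (by omega)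
    have r31 : S.reg 31 = 2 * i + n := (hS.reg 31 (by omega)).trans h31
    refine .seq <| .blk_cons trivial (Instr.detExec_bin (v := n - 1) h'.r43 h'.r50 rfl
        (by omega)) <|
      .blk_cons trivial (Instr.detExec_bin (v := 2 * i + n + 1) r31 h'.r50 rfl (by omega)) <|
      .blk_cons trivial (Instr.detExec_bin (v := (n - 1) * (2 * i + n + 1)) rfl rfl rfl
        (by omega)) <|
      .blk_one trivial (Instr.detExec_bin (b := (n - 1) * (2 * i + n + 1)) (v := 0) h21 rfl
        (if_neg (not_lt.2 hr)) (by omega)) <|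
      .ite (fun hc => absurd rfl hc) (fun _ => ?_)
    exact .setZero (by omega) ((((h'.put (by decide)).put (by decide)).put
        (by decide)).put (by decide)) (hk.trans ((((hA.put (by omega)).put (by omega)).put
        (by omega)).put (by omega))) (by linarith)
  · norm_num at ht ⊢
    linarith

end half

/-! ### Block sizes, and one round of the symmetric sampler. -/

section half
variable {M : Env} {k : List Prog} {F : State → ℝ≥0∞} {s s' : State} {t xr xc : ℝ} {y : ℕ → ℝ}
  {m z i n : ℕ}

/-- The size of the block of weights that starts at `i`. -/
def blockSize (m z i : ℕ) : ℕ := min z ((m - i) / (2 * i + z + 2)) + 1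

lemma one_le_blockSize : 1 ≤ blockSize m z i := Nat.le_add_left 1 _

/-- The block is short enough for the chain that passes from `i` to the next block: this is n a ≤ c
with a = 2 i + n and c = m + i + 1. -/
lemma blockSize_mul_le (hi : i ≤ m) :
    blockSize m z i * (2 * i + blockSize m z i) ≤ m + i + 1 := by
  have h1 : min z ((m - i) / (2 * i + z + 2)) * (2 * i + z + 2) ≤ m - i :=
    (Nat.mul_le_mul_right _ (min_le_right _ _)).trans (Nat.div_mul_le_self _ _)
  have h2 : min z ((m - i) / (2 * i + z + 2)) ≤ z := min_le_left _ _
  rw [blockSize]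
  generalize min z ((m - i) / (2 * i + z + 2)) = q at *
  have h3 : q * (2 * i + 2 + q) ≤ m - i := (Nat.mul_le_mul_left _ (by omega)).trans h1
  nlinarith [Nat.sub_add_cancel hi]

/-- No block goes beyond the largest deviation `m`, and only the block that starts at `m` contains
it. -/
lemma add_blockSize_le (hi : i ≤ m) : i + blockSize m z i ≤ m + 1 ∧
    (i < m → i + blockSize m z i ≤ m) := by
  have h1 : (m - i) / (2 * i + z + 2) ≤ (m - i) / 2 :=
    Nat.div_le_div_left (by omega) (by norm_num)
  have h2 : min z ((m - i) / (2 * i + z + 2)) ≤ (m - i) / 2 := (min_le_right _ _).trans h1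
  rw [blockSize]
  omega

lemma blockSize_self : blockSize m z m = 1 := by
  rw [blockSize, Nat.sub_self, Nat.zero_div, Nat.min_zero]

lemma blockSize_zero (h : (z + 1) * (z + 1) ≤ m + 1) : blockSize m z 0 = z + 1 := by
  have : z ≤ (m - 0) / (2 * 0 + z + 2) := by
    rw [Nat.le_div_iff_mul_le (by omega)]
    simp only [Nat.sub_zero]
    nlinarith
  rw [blockSize, min_eq_left this]

/-- The starting points of the blocks. -/
def BlockStart (m z i : ℕ) : Prop := i ≤ m ∧ (i = 0 ∨ z + 1 ≤ i)

/-- The correcting coin in `stopBranch` has bias at most one. This requires m + 1 ≤ 4 (z + 1)² and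
that i is zero or beyond the first block. -/
lemma BlockStart.le_mul (h : BlockStart m z i) (h1 : (z + 1) * (z + 1) ≤ m + 1)
    (h2 : m + 1 ≤ 4 * ((z + 1) * (z + 1))) :
    m + i + 1 ≤ 4 * (z + 1) * (2 * i + blockSize m z i) := by
  rcases h.2 with rfl | hi
  · rw [blockSize_zero h1]
    nlinarith
  · have : (z + 1) * (z + 1) ≤ (z + 1) * i := Nat.mul_le_mul_left _ hi
    nlinarith [Nat.zero_le ((z + 1) * blockSize m z i), Nat.zero_le (z * i)]

/-- The block is also long enough: the first coin of the chain succeeds with probability at least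
1/4, so the sampler leaves the sequence of blocks after boundedly many on average. -/
lemma BlockStart.le_four_mul (h : BlockStart m z i) (h1 : (z + 1) * (z + 1) ≤ m + 1)
    (h2 : m + 1 ≤ 4 * ((z + 1) * (z + 1))) :
    m + i + 1 ≤ 4 * (blockSize m z i * (2 * i + blockSize m z i)) := by
  rcases le_total z ((m - i) / (2 * i + z + 2)) with hq | hq
  · have hn : blockSize m z i = z + 1 := by rw [blockSize, min_eq_left hq]
    have := h.le_mul h1 h2
    rw [hn] at this ⊢
    linarith
  · have hn : blockSize m z i = (m - i) / (2 * i + z + 2) + 1 := by rw [blockSize, min_eq_right hq]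
    rcases h.2 with rfl | hi
    · rw [blockSize_zero h1]
      linarith
    · have h3 : m - i < (2 * i + z + 2) * blockSize m z i := by
        rw [hn]
        exact Nat.lt_mul_div_succ _ (by omega)
      have h4 : 1 ≤ blockSize m z i := one_le_blockSize
      generalize blockSize m z i = n at *
      have h5 : (2 * i + z + 2) * n ≤ (3 * i + 1) * n := Nat.mul_le_mul_right _ (by omega)
      have h6 : m + 1 ≤ (3 * i + 1) * n + i := by omega
      nlinarith

lemma BlockStart.next (h : BlockStart m z i) (h1 : (z + 1) * (z + 1) ≤ m + 1)
    (h3 : i + blockSize m z i ≤ m) : BlockStart m z (i + blockSize m z i) := by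
  refine ⟨h3, Or.inr ?_⟩
  rcases h.2 with rfl | hi
  · rw [blockSize_zero h1]
    omega
  · omega

/-- The first two coins are written out, with the factor 1/2 of the second one isolated; the program
uses that fair coin to decide between stopping and continuing. -/
lemma vn_zero_eq_sub (hn1 : 1 ≤ n) (c : ℕ) : vn ((2 * i + n : ℕ) : ℝ) (c : ℝ) n 0 =
    1 - (n * (2 * i + n) : ℕ) / (c : ℕ) * (1 - ((n - 1) * (2 * i + n + 1) : ℕ) / (c + 1 : ℕ) / 2 *
      vn ((2 * i + n : ℕ) : ℝ) (c : ℝ) (n - 2) 2) := by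
  have e0 := vn_eq (n := n) (a := 2 * i + n) (c := c) (j := 0) (by omega)
  have e1 := vn_eq (n := n) (a := 2 * i + n) (c := c) (j := 1) hn1
  simp only [Nat.sub_zero, zero_add, add_zero, one_mul] at e0
  rw [show 1 + 1 = 2 from rfl] at e1
  rw [e0, e1, Nat.cast_mul 2 (c + 1), mul_comm ((2 : ℕ) : ℝ), ← div_div]
  push_cast
  rfl

-- One round at block start `i` proceeds with the ratio of the weights of `i + n` and `i`, and
-- proposes `i + o` with the ratio of the weights of `i + o` and `i`, divided by 8 (z + 1). The
-- failure half of the fair coin inside the chain is spent on the proposals.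
set_option maxHeartbeats 1000000 in
lemma Bounded.halfBody (hw : 100 * (m + z + 2) ^ 2 < 2 ^ M.w) (h40 : s.reg 40 = m)
    (h41 : s.reg 41 = z) (h42 : s.reg 42 = i) (h44 : s.reg 44 = 1)
    (hk : HalfCont M k F m z s xr y) (hi : i ≤ m) (hn : blockSize m z i = n)
    (hs : m + i + 1 ≤ 4 * (z + 1) * (2 * i + n))
    (hc : i + n ≤ m → ∀ s', HalfPost m z s s' → s'.reg 42 = i + n → s'.reg 44 = 1 →
      Bounded M k F s' xc)
    (ht : 700 + (vn ((2 * i + n : ℕ) : ℝ) ((m + i + 1 : ℕ) : ℝ) n 0 * xc +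
      (1 - vn ((2 * i + n : ℕ) : ℝ) ((m + i + 1 : ℕ) : ℝ) n 0) * xr +
      1 / (8 * (z + 1)) * ∑ o ∈ Finset.range n, vn ((2 * i + o : ℕ) : ℝ) ((m + i + 1 : ℕ) : ℝ) o 0 *
        (symH m y (i + o) - symH m (fun _ => 1) (i + o) * xr)) ≤ t) :
    Bounded M (halfBody :: k) F s t := by
  have hw' : 100 * (m + z + 2) < 2 ^ M.w := by nlinarith
  have hna : n * (2 * i + n) ≤ m + i + 1 := hn ▸ blockSize_mul_le hi
  have hin : i + n ≤ m + 1 := hn ▸ (add_blockSize_le hi).1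
  have hin' : i < m → i + n ≤ m := hn ▸ (add_blockSize_le hi).2
  have hself : i = m → n = 1 := by rintro rfl; rw [← hn, blockSize_self]
  have hn1 : 1 ≤ n := hn ▸ one_le_blockSize
  set q := (m - i) / (2 * i + z + 2) with hq
  have hqm : q ≤ m := (Nat.div_le_self _ _).trans (by omega)
  have hz2 : (2 * i + z + 2) < 2 ^ M.w := by omega
  refine .seq <| .blk_cons trivial (Instr.detExec_const (by omega)) <|
    .blk_cons trivial (Instr.detExec_const (by omega)) <|
    .blk_cons trivial (Instr.detExec_bin (v := z + 1) h41 rfl rfl (by omega)) <|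
    .blk_cons trivial (Instr.detExec_bin (v := 2 * i) rfl h42 rfl (by omega)) <|
    .blk_cons trivial (Instr.detExec_bin (v := 2 * i + z + 1) rfl rfl
      (show 2 * i + (z + 1) = _ by omega) (by omega)) <|
    .blk_cons trivial (Instr.detExec_bin (v := 2 * i + z + 2) rfl rfl rfl (by omega)) <|
    .blk_cons trivial (Instr.detExec_bin (v := m - i) h40 h42 rfl (by omega)) <|
    .blk_cons trivial (Instr.detExec_bin (v := q) rfl rfl rfl (by omega)) <|
    .blk_cons trivial (Instr.detExec_const (by omega)) <|
    .blk_one trivial (Instr.detExec_bin (b := z) (v := if q < z then 1 else 0) rfl h41 rfl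
      (by split_ifs <;> omega)) ?_
  generalize hS : State.put _ 49 _ = S
  have hA : Agree 20 60 s S := by
    rw [← hS]
    repeat' refine Agree.put ?_ (by omega)
    exact Agree.refl _ _ _
  have s40 : S.reg 40 = m := by rw [← hS]; exact h40
  have s41 : S.reg 41 = z := by rw [← hS]; exact h41
  have s42 : S.reg 42 = i := by rw [← hS]; exact h42
  have s43 : S.reg 43 = q := by rw [← hS]; rfl
  have s44 : S.reg 44 = 1 := by rw [← hS]; exact h44
  have s45 : S.reg 45 = z + 1 := by rw [← hS]; rfl
  have s47 : S.reg 47 = 2 * i := by rw [← hS]; rfl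
  have s49 : S.reg 49 = if q < z then 1 else 0 := by rw [← hS]; rfl
  have s50 : S.reg 50 = 1 := by rw [← hS]; rfl
  have s52 : S.reg 52 = 0 := by rw [← hS]; rfl
  clear hS
  have key : ∀ S', Agree 20 60 s S' → HalfSt m z i (n - 1) S' →
      Bounded M (.seq (HeatWalk.blk (.bin .add 43 43 50) [.bin .add 31 47 43, .bin .add 32 40 42,
          .bin .add 32 32 50, .bin .add 20 32 52])
        (.seq HeatWalk.unif (.seq (HeatWalk.blk (.bin .mul 35 43 31) [.bin .lt 36 21 35])
          (.ite 36 (.seq (HeatWalk.blk (.const 20 2) []) (.seq HeatWalk.unif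
            (.ite 21 HeatWalk.contBranch HeatWalk.stopBranch))) HeatWalk.advance))) :: k) F S'
        (t - 40) := by
    intro S' hA' h'
    refine .seq <| .blk_cons trivial (Instr.detExec_bin (v := n) h'.r43 h'.r50
        (show n - 1 + 1 = n by omega) (by omega)) <|
      .blk_cons trivial (Instr.detExec_bin (v := 2 * i + n) h'.r47 rfl rfl (by omega)) <|
      .blk_cons trivial (Instr.detExec_bin (v := m + i) h'.r40 h'.r42 rfl (by omega)) <|
      .blk_cons trivial (Instr.detExec_bin (v := m + i + 1) rfl h'.r50 rfl (by omega)) <|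
      .blk_one trivial (Instr.detExec_bin (v := m + i + 1) rfl h'.r52 rfl (by omega)) ?_
    generalize hT : State.put _ 20 _ = T
    have tA : Agree 20 60 s T := by
      rw [← hT]
      repeat' refine Agree.put ?_ (by omega)
      exact hA'
    have t31 : T.reg 31 = 2 * i + n := by rw [← hT]; rfl
    have t32 : T.reg 32 = m + i + 1 := by rw [← hT]; rfl
    have t20 : T.reg 20 = m + i + 1 := by rw [← hT]; rfl
    have hTs : HalfSt m z i n T := by
      rw [← hT]
      exact ⟨h'.r40, h'.r41, h'.r42, rfl, h'.r44, h'.r45, h'.r47, h'.r50, h'.r52⟩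
    clear hT
    set p : ℝ := (n * (2 * i + n) : ℕ) / (m + i + 1 : ℕ) with hp
    set p2 : ℝ := ((n - 1) * (2 * i + n + 1) : ℕ) / (m + i + 1 + 1 : ℕ) with hp2
    set V2 := vn ((2 * i + n : ℕ) : ℝ) ((m + i + 1 : ℕ) : ℝ) (n - 2) 2 with hV2
    set p3 : ℝ := (m + i + 1 : ℕ) / (4 * (z + 1) * (2 * i + n) : ℕ) with hp3
    set S₁ := (∑ o ∈ Finset.range n, (vn ((2 * i + o : ℕ) : ℝ) ((m + i + 1 : ℕ) : ℝ) o 0 *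
        (symH m y (i + o) + (1 - symH m (fun _ => 1) (i + o)) * xr) +
      (1 - vn ((2 * i + o : ℕ) : ℝ) ((m + i + 1 : ℕ) : ℝ) o 0) * xr)) / n with hS₁
    refine .seq (.unif_coin t20 (by omega) hna (by omega)
      (x := 60 + (1 / 2 * (501 + (p3 * S₁ + (1 - p3) * xr)) +
        (1 - 1 / 2) * (501 + (p2 * (V2 * xc + (1 - V2) * xr) + (1 - p2) * xr))))
      (y := 560 + xc) ?_ ?_ ?_)
    · intro r hr U hU h21
      have uA : Agree 20 60 s U := tA.trans hU (by omega) (by omega)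
      have hUs : HalfSt m z i n U := hTs.agree ⟨hU.mem, hU.real, fun x hx => hU.reg x (by omega)⟩
      have u31 : U.reg 31 = 2 * i + n := (hU.reg 31 (by omega)).trans t31
      have u32 : U.reg 32 = m + i + 1 := (hU.reg 32 (by omega)).trans t32
      refine .seq <| .blk_cons trivial (Instr.detExec_bin (v := n * (2 * i + n)) hUs.r43 u31 rfl
          (by omega)) <|
        .blk_one trivial (Instr.detExec_bin (v := 1) h21 rfl (if_pos hr) (by omega)) <|
        .ite (fun _ => .seq <| .blk_one trivial (Instr.detExec_const (by omega)) ?_)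
          (fun hc => absurd hc one_ne_zero)
      refine .seq (.unif_coin (a := 1) (b := 2) rfl (by norm_num) (by norm_num) (by omega)
        (x := 501 + (p3 * S₁ + (1 - p3) * xr))
        (y := 501 + (p2 * (V2 * xc + (1 - V2) * xr) + (1 - p2) * xr)) ?_ ?_ ?_)
      · intro r hr W hW h21
        have wA : Agree 20 60 s W := Agree.trans (lo := 20) (hi := 60)
          (((uA.put (by omega)).put (by omega)).put (by omega)) hW (by omega) (by omega)
        have hWs : HalfSt m z i n W := (((hUs.put (by decide)).put (by decide)).put
          (by decide)).agree ⟨hW.mem, hW.real, fun x hx => hW.reg x (by omega)⟩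
        refine .ite (fun hc => absurd (by omega) hc) fun _ => ?_
        exact .stopBranch hw hWs (hk.trans wA) ((hW.reg 31 (by omega)).trans u31)
          ((hW.reg 32 (by omega)).trans u32) hn1 hin hna hs (by rw [← hp3, ← hS₁]; linarith)
      · intro r hr _ W hW h21
        have wA : Agree 20 60 s W := Agree.trans (lo := 20) (hi := 60)
          (((uA.put (by omega)).put (by omega)).put (by omega)) hW (by omega) (by omega)
        have hWs : HalfSt m z i n W := (((hUs.put (by decide)).put (by decide)).put
          (by decide)).agree ⟨hW.mem, hW.real, fun x hx => hW.reg x (by omega)⟩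
        refine .ite (fun _ => ?_) (fun hc => absurd hc (by omega))
        exact .contBranch hw hWs (hk.trans wA) ((hW.reg 31 (by omega)).trans u31)
          ((hW.reg 32 (by omega)).trans u32) hn1 hin (by omega) hna
          (fun hle s' hs' => hc hle s' ⟨wA.trans hs'.agree (by omega) (by omega), hs'.r40, hs'.r41⟩)
          (by rw [← hp2, ← hV2]; linarith)
      · norm_num
        linarith
    · intro r hr hr2 U hU h21
      have uA : Agree 20 60 s U := tA.trans hU (by omega) (by omega)
      have hUs : HalfSt m z i n U := hTs.agree ⟨hU.mem, hU.real, fun x hx => hU.reg x (by omega)⟩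
      have u31 : U.reg 31 = 2 * i + n := (hU.reg 31 (by omega)).trans t31
      -- At i = m the first coin has bias (2 m + 1)/(2 m + 1), so it never fails and the sampler
      -- cannot run past the last block.
      have him : i + n ≤ m := by
        rcases hi.lt_or_eq with hlt | rfl
        · exact hin' hlt
        · rw [hself rfl] at hr
          omega
      refine .seq <| .blk_cons trivial (Instr.detExec_bin (v := n * (2 * i + n)) hUs.r43 u31 rfl
          (by omega)) <|
        .blk_one trivial (Instr.detExec_bin (b := n * (2 * i + n)) (v := 0) h21 rfl
          (if_neg (not_lt.2 hr)) (by omega)) <|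
        .ite (fun hc => absurd rfl hc) (fun _ => ?_)
      exact .advance (by omega) ((hUs.put (by decide)).put (by decide))
        (fun s' hs' => hc him s' ⟨((uA.put (by omega)).put (by omega)).trans hs'.agree (by omega)
          (by omega), hs'.r40, hs'.r41⟩) (by linarith)
    · rw [← hp]
      have hR := vn_zero_eq_sub (i := i) hn1 (m + i + 1)
      rw [← hp, ← hp2, ← hV2] at hR
      have hn0 : (0 : ℝ) < n := by exact_mod_cast hn1
      -- First coin, fair coin, correcting coin and uniform offset multiply to a rate that does not
      -- depend on the block.
      have hlam : p * p3 / 2 / n = 1 / (8 * (z + 1)) := by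
        have h1 : (0 : ℝ) < 2 * i + n := by positivity
        rw [hp, hp3]
        push_cast
        field_simp
        norm_num
      have hsum : p * (1 / 2) * p3 * S₁ = p * (1 / 2) * p3 * xr +
          1 / (8 * (z + 1)) * ∑ o ∈ Finset.range n,
            vn ((2 * i + o : ℕ) : ℝ) ((m + i + 1 : ℕ) : ℝ) o 0 *
              (symH m y (i + o) - symH m (fun _ => 1) (i + o) * xr) := by
        have e : ∀ o, vn ((2 * i + o : ℕ) : ℝ) ((m + i + 1 : ℕ) : ℝ) o 0 *
            (symH m y (i + o) + (1 - symH m (fun _ => 1) (i + o)) * xr) +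
            (1 - vn ((2 * i + o : ℕ) : ℝ) ((m + i + 1 : ℕ) : ℝ) o 0) * xr =
            xr + vn ((2 * i + o : ℕ) : ℝ) ((m + i + 1 : ℕ) : ℝ) o 0 *
              (symH m y (i + o) - symH m (fun _ => 1) (i + o) * xr) := fun o => by ring
        rw [hS₁, Finset.sum_congr rfl fun o _ => e o, Finset.sum_add_distrib, ← hlam]
        simp only [Finset.sum_const, Finset.card_range, nsmul_eq_mul]
        field_simp
      rw [hR] at ht
      -- The two outcomes of the first coin were charged 561 and 560, so the constant part of the
      -- mean is 560 + p.
      have hp1 : p ≤ 1 := div_le_one_of_le₀ (by exact_mod_cast hna) (by positivity)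
      linear_combination ht + hsum + hp1
  refine .seq (.ite (fun hc => ?_) (fun hc => ?_))
  · have hqz : q < z := by
      by_contra hqz
      rw [s49, if_neg hqz] at hc
      exact hc rfl
    have hn' : n - 1 = q := by rw [← hn, blockSize, ← hq]; omega
    refine .blk_one trivial (Instr.detExec_const (by omega)) ((key _ (hA.put (by omega))
      ⟨by exact s40, by exact s41, by exact s42, by exact s43.trans hn'.symm,
        by exact s44, by exact s45, by exact s47, by exact s50, by exact s52⟩).mono ?_)
    norm_num
    linarith
  · have hqz : ¬ q < z := by
      intro hqz
      rw [s49, if_pos hqz] at hc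
      exact one_ne_zero hc
    have hn' : n - 1 = z := by rw [← hn, blockSize, ← hq]; omega
    refine .blk_one trivial (Instr.detExec_bin (v := z) s41 s52 rfl (by omega))
      ((key _ (hA.put (by omega))
        ⟨by exact s40, by exact s41, by exact s42, by exact hn'.symm, by exact s44, by exact s45,
          by exact s47, by exact s50, by exact s52⟩).mono ?_)
    norm_num
    linarith

end half

/-! ### The potential function of the symmetric sampler. -/

section half
variable {M : Env} {k : List Prog} {F : State → ℝ≥0∞} {s s' : State} {t : ℝ}
  {m z i n : ℕ} {f g : ℕ → ℝ}

lemma symH_one_mem (m j : ℕ) : 1 / 2 ≤ symH m (fun _ => 1) j ∧ symH m (fun _ => 1) j ≤ 1 := by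
  rw [symH]
  split_ifs <;> norm_num

lemma symH_nonneg {G : ℕ → ℝ} {j : ℕ} (hG : ∀ v ≤ 2 * m, 0 ≤ G v) (hj : j ≤ m) :
    0 ≤ symH m G j := by
  rw [symH]
  split_ifs
  · linarith [hG m (by omega)]
  · linarith [hG (m + j) (by omega), hG (m - j) (by omega)]

/-- The weighted sum of `f` over the points from `i` on, relative to the weight of `i`. -/
def tailAvg (m z : ℕ) (f : ℕ → ℝ) (i : ℕ) : ℝ :=
  (∑ j ∈ Finset.Ico i (m + 1), cwt m j * f j) / (8 * (z + 1) * cwt m i)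

/-- `tailAvg` is the expected value of `f` collected before the next restart. It satisfies the
first-block recursion because the weights relative to `i` are the probabilities used by the sampler.
-/
lemma tailAvg_step (hi : i ≤ m) (hin : i + n ≤ m + 1) : tailAvg m z f i =
    1 / (8 * (z + 1)) * ∑ o ∈ Finset.range n,
      vn ((2 * i + o : ℕ) : ℝ) ((m + i + 1 : ℕ) : ℝ) o 0 * f (i + o) +
    vn ((2 * i + n : ℕ) : ℝ) ((m + i + 1 : ℕ) : ℝ) n 0 * tailAvg m z f (i + n) := by
  have hz : (0 : ℝ) < z + 1 := by positivity
  have hw := cwt_pos hi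
  rw [tailAvg, tailAvg, ← Finset.sum_Ico_consecutive _ (Nat.le_add_right i n) hin, add_div]
  congr 1
  · rw [Finset.sum_Ico_eq_sum_range, Nat.add_sub_cancel_left, Finset.sum_div, Finset.mul_sum]
    refine Finset.sum_congr rfl fun o _ => ?_
    rw [vn_eq_cwt_div hi]
    field_simp
  · rw [vn_eq_cwt_div hi]
    rcases Nat.lt_or_ge m (i + n) with h | h
    · rw [Finset.Ico_eq_empty (by omega)]
      simp
    · have := cwt_pos h
      field_simp

lemma tailAvg_sub_mul (c : ℝ) :
    tailAvg m z (fun j => f j - g j * c) i = tailAvg m z f i - tailAvg m z g i * c := by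
  simp only [tailAvg, mul_sub, Finset.sum_sub_distrib, ← mul_assoc, ← Finset.sum_mul]
  ring

lemma tailAvg_nonneg (hf : ∀ j ≤ m, 0 ≤ f j) (hi : i ≤ m) : 0 ≤ tailAvg m z f i := by
  have := cwt_pos hi
  refine div_nonneg (Finset.sum_nonneg fun j hj => ?_) (by positivity)
  have hj := Finset.mem_Ico.1 hj
  exact mul_nonneg (cwt_pos (by omega)).le (hf j (by omega))

lemma vn_range_mem {o : ℕ} (hna : n * (2 * i + n) ≤ m + i + 1) (ho : o ≤ n) :
    0 ≤ vn ((2 * i + o : ℕ) : ℝ) ((m + i + 1 : ℕ) : ℝ) o 0 ∧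
      vn ((2 * i + o : ℕ) : ℝ) ((m + i + 1 : ℕ) : ℝ) o 0 ≤ 1 := by
  have : o * (2 * i + o) ≤ m + i + 1 := (Nat.mul_le_mul ho (by omega)).trans hna
  exact vn_mem (by positivity) (by exact_mod_cast (by omega : o + 0 ≤ 2 * i + o))
    (by exact_mod_cast this)

/-- Dropping all coins after the second gives R ≤ 1 - p/2, where p is the bias of the first coin.
The first bound controls the number of blocks; the second says that proposing and proceeding have
total probability at most one. -/
lemma BlockStart.vn_le (h : BlockStart m z i) (h1 : (z + 1) * (z + 1) ≤ m + 1)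
    (h2 : m + 1 ≤ 4 * ((z + 1) * (z + 1))) (hn : blockSize m z i = n) :
    vn ((2 * i + n : ℕ) : ℝ) ((m + i + 1 : ℕ) : ℝ) n 0 ≤ 7 / 8 ∧
    vn ((2 * i + n : ℕ) : ℝ) ((m + i + 1 : ℕ) : ℝ) n 0 ≤ 1 - n / (8 * (z + 1)) := by
  have hn1 : 1 ≤ n := hn ▸ one_le_blockSize
  have hna : n * (2 * i + n) ≤ m + i + 1 := hn ▸ blockSize_mul_le h.1
  have h3 : m + i + 1 ≤ 4 * (n * (2 * i + n)) := hn ▸ h.le_four_mul h1 h2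
  have h4 : m + i + 1 ≤ 4 * (z + 1) * (2 * i + n) := hn ▸ h.le_mul h1 h2
  have hc0 : (0 : ℝ) < (m + i + 1 : ℕ) := by positivity
  have hV : 0 ≤ vn ((2 * i + n : ℕ) : ℝ) ((m + i + 1 : ℕ) : ℝ) (n - 2) 2 ∧
      vn ((2 * i + n : ℕ) : ℝ) ((m + i + 1 : ℕ) : ℝ) (n - 2) 2 ≤ 1 := by
    rcases Nat.lt_or_ge n 2 with h5 | h5
    · rw [Nat.sub_eq_zero_of_le h5.le, vn]
      norm_num
    · refine vn_mem hc0 ?_ ?_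
      · exact_mod_cast (by omega : n - 2 + 2 ≤ 2 * i + n)
      · rw [Nat.sub_add_cancel h5]
        exact_mod_cast hna
  have hp2 : (((n - 1) * (2 * i + n + 1) : ℕ) : ℝ) / (m + i + 1 + 1 : ℕ) ≤ 1 :=
    div_le_one_of_le₀ (Nat.cast_le.2 (coin_le (n := n) (a := 2 * i + n) (c := m + i + 1) (j := 1)
      hn1 (by omega) hna)) (by positivity)
  have hp0 : 0 ≤ (((n - 1) * (2 * i + n + 1) : ℕ) : ℝ) / (m + i + 1 + 1 : ℕ) := by positivity
  have hR := vn_zero_eq_sub (i := i) hn1 (m + i + 1)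
  have key : vn ((2 * i + n : ℕ) : ℝ) ((m + i + 1 : ℕ) : ℝ) n 0 ≤
      1 - ((n * (2 * i + n) : ℕ) : ℝ) / (m + i + 1 : ℕ) / 2 := by
    have hp : (0 : ℝ) ≤ ((n * (2 * i + n) : ℕ) : ℝ) / (m + i + 1 : ℕ) := by positivity
    have := mul_le_one₀ hp2 hV.1 hV.2
    rw [hR]
    nlinarith
  constructor
  · have : (1 : ℝ) / 4 ≤ ((n * (2 * i + n) : ℕ) : ℝ) / (m + i + 1 : ℕ) := by
      rw [le_div_iff₀ hc0]
      have : ((m + i + 1 : ℕ) : ℝ) ≤ (4 * (n * (2 * i + n)) : ℕ) := by exact_mod_cast h3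
      push_cast at this ⊢
      linarith
    linarith
  · have : (n : ℝ) / (4 * (z + 1)) ≤ ((n * (2 * i + n) : ℕ) : ℝ) / (m + i + 1 : ℕ) := by
      rw [div_le_div_iff₀ (by positivity) hc0]
      have : n * (m + i + 1) ≤ n * (2 * i + n) * (4 * (z + 1)) := by nlinarith
      exact_mod_cast this
    have e : (n : ℝ) / (8 * (z + 1)) = n / (4 * (z + 1)) / 2 := by field_simp; norm_num
    linarith

/-- The quantity is a probability of acceptance before the next restart; the induction runs
backwards over the block starts. -/
lemma BlockStart.tailAvg_le_one (h1 : (z + 1) * (z + 1) ≤ m + 1)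
    (h2 : m + 1 ≤ 4 * ((z + 1) * (z + 1))) {i : ℕ} (h : BlockStart m z i) :
    tailAvg m z (symH m fun _ => 1) i ≤ 1 := by
  induction hd : m - i using Nat.strong_induction_on generalizing i with
  | _ d ih =>
    have hn1 : 1 ≤ blockSize m z i := one_le_blockSize
    have hna := blockSize_mul_le (z := z) h.1
    have hin := (add_blockSize_le (z := z) h.1).1
    have hR := (h.vn_le h1 h2 rfl).2
    have hR0 := (vn_range_mem hna le_rfl).1
    have hE : tailAvg m z (symH m fun _ => 1) (i + blockSize m z i) ≤ 1 := by
      rcases Nat.lt_or_ge m (i + blockSize m z i) with h3 | h3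
      · rw [tailAvg, Finset.Ico_eq_empty (by omega)]
        simp
      · exact ih _ (by omega) (h.next h1 h3) rfl
    rw [tailAvg_step h.1 hin]
    generalize blockSize m z i = n at *
    have hs : ∑ o ∈ Finset.range n, vn ((2 * i + o : ℕ) : ℝ) ((m + i + 1 : ℕ) : ℝ) o 0 *
        symH m (fun _ => 1) (i + o) ≤ n := by
      calc _ ≤ ∑ o ∈ Finset.range n, (1 : ℝ) := by
            refine Finset.sum_le_sum fun o ho => mul_le_one₀
              (vn_range_mem hna (Finset.mem_range.1 ho).le).2 ?_ (symH_one_mem m _).2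
            linarith [(symH_one_mem m (i + o)).1]
        _ = n := by simp
    have hs' := mul_le_mul_of_nonneg_left hs (show (0 : ℝ) ≤ 1 / (8 * (z + 1)) by positivity)
    have e : 1 / (8 * (z + 1)) * (n : ℝ) = n / (8 * (z + 1)) := by ring
    nlinarith

/-- The first block alone is accepted with probability at least 1/32: its weights are at least 1 -
o/(z + 1), the factor `symH` is at least 1/2, and the sum of these bounds is (z + 2)/4. -/
lemma le_sum_cwt_symH_one (h1 : (z + 1) * (z + 1) ≤ m + 1) : 1 / 32 ≤
    1 / (8 * (z + 1)) * ∑ o ∈ Finset.range (z + 1),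
      vn ((2 * 0 + o : ℕ) : ℝ) ((m + 0 + 1 : ℕ) : ℝ) o 0 * symH m (fun _ => 1) (0 + o) := by
  have hz : (0 : ℝ) < z + 1 := by positivity
  have h1' : ((z : ℝ) + 1) * (z + 1) ≤ m + 1 := by exact_mod_cast h1
  have key : ∀ o ∈ Finset.range (z + 1), (1 - (o : ℝ) / (z + 1)) / 2 ≤
      vn ((2 * 0 + o : ℕ) : ℝ) ((m + 0 + 1 : ℕ) : ℝ) o 0 * symH m (fun _ => 1) (0 + o) := by
    intro o ho
    have ho := Finset.mem_range.1 ho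
    have ho' : (o : ℝ) ≤ z := by exact_mod_cast (by omega : o ≤ z)
    have h3 : o * o ≤ m + 1 := (Nat.mul_le_mul ho.le ho.le).trans h1
    have h4 := one_sub_le_cwt h3
    have h5 : (o : ℝ) * o / (m + 1) ≤ o / (z + 1) := by
      rw [div_le_div_iff₀ (by positivity) hz]
      have : (o : ℝ) * (z + 1) ≤ m + 1 := by nlinarith
      nlinarith [show (0 : ℝ) ≤ o by positivity]
    have h6 : (o : ℝ) / (z + 1) ≤ 1 := div_le_one_of_le₀ (by linarith) hz.le
    rw [vn_eq_cwt_div (Nat.zero_le _), cwt_zero, div_one, zero_add]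
    nlinarith [symH_one_mem m o]
  have hsum : ∑ o ∈ Finset.range (z + 1), (1 - (o : ℝ) / (z + 1)) / 2 = (z + 2) / 4 := by
    rw [← Finset.sum_div, Finset.sum_sub_distrib, ← Finset.sum_div]
    have : ∑ o ∈ Finset.range (z + 1), (o : ℝ) = (z + 1) * z / 2 := by
      rw [eq_div_iff two_ne_zero]
      have := Finset.sum_range_id_mul_two (z + 1)
      rw [Nat.add_sub_cancel] at this
      have := congrArg (Nat.cast : ℕ → ℝ) this
      push_cast at this
      exact this
    rw [this]
    simp
    field_simp
    ring
  have h6 := Finset.sum_le_sum key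
  rw [hsum] at h6
  have h7 := mul_le_mul_of_nonneg_left h6 (show (0 : ℝ) ≤ 1 / (8 * (z + 1)) by positivity)
  refine le_trans ?_ h7
  rw [div_mul_div_comm, div_le_div_iff₀ (by positivity) (by positivity)]
  linarith

/-- A block start `i` is reached with probability `cwt m i`, so between restarts every deviation j
is proposed with probability `cwt m j / (8 (z + 1))`. The output is therefore exactly binomial, and
the time is bounded by a constant. -/
lemma Bounded.half (hw : 100 * (m + z + 2) ^ 2 < 2 ^ M.w) (h40 : s.reg 40 = m)
    (h41 : s.reg 41 = z) (h1 : (z + 1) * (z + 1) ≤ m + 1) (h2 : m + 1 ≤ 4 * ((z + 1) * (z + 1)))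
    (G : ℕ → ℝ) (hk : ∀ v ≤ 2 * m, ∀ s', HalfPost m z s s' → s'.reg 46 = v → Bounded M k F s' (G v))
    (ht : 190010 + bex (1 / 2) (2 * m) G ≤ t) : Bounded M (half :: k) F s t := by
  have hw' : 100 * (m + z + 2) < 2 ^ M.w := by nlinarith
  have hG : ∀ v ≤ 2 * m, 0 ≤ G v := fun v hv =>
    (hk v hv (s.put 46 v) ⟨(Agree.refl _ _ _).put (by omega), by exact h40, by exact h41⟩ rfl).1
  set H := bex (1 / 2) (2 * m) G with hH
  have hH0 : 0 ≤ H := by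
    rw [hH, ← bex_const (1 / 2) (2 * m) 0]
    exact bex_mono (by norm_num) (by norm_num) hG
  -- Accepting replaces the value H of a restart by the reward; the tail average of `D` is the
  -- expected change, and it is zero at i = 0.
  set D : ℕ → ℝ := fun j => symH m G j - symH m (fun _ => 1) j * H with hD
  have hD0 : tailAvg m z D 0 = 0 := by
    rw [tailAvg, Nat.Ico_zero_eq_range, sum_cwt_symH_sub, zero_div]
  -- The surplus 5680 pays about 700 per block, since at least one eighth of it is released whenever
  -- a block is processed. At i = 0 this is paid by the acceptance probability 1/32, which releases
  -- 189999/32.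
  set T : ℕ → ℝ := fun i => if i = 0 then 190000 else 190000 + 5680 with hT
  have hT0 : ∀ i, 0 ≤ T i := fun i => by simp only [hT]; split_ifs <;> norm_num
  have hT1 : ∀ i, T i ≤ 190000 + 5680 := fun i => by simp only [hT]; split_ifs <;> norm_num
  have hval : ∀ i, BlockStart m z i → 0 ≤ H + tailAvg m z D i + T i := by
    intro i hi
    rw [hD, tailAvg_sub_mul]
    have e1 := tailAvg_nonneg (z := z) (fun j hj => symH_nonneg hG hj) hi.1
    have e2 := hi.tailAvg_le_one h1 h2
    nlinarith [hT0 i]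
  set I : State → Prop := fun s' => HalfPost m z s s' ∧
    (s'.reg 44 = 0 ∧ s'.reg 46 ≤ 2 * m ∨ s'.reg 44 = 1 ∧ BlockStart m z (s'.reg 42)) with hI
  set V : State → ℝ := fun s' => if s'.reg 44 = 0 then 1 + G (s'.reg 46) else
    H + tailAvg m z D (s'.reg 42) + T (s'.reg 42) with hV
  refine .seq (.blk_cons trivial (Instr.detExec_const (by omega)) <|
    .blk_one trivial (Instr.detExec_const (by omega)) ?_)
  refine .while I V ?_ ?_ ?_ ?_
  · rintro S ⟨hS, ⟨h44, -⟩ | ⟨h44, hB⟩⟩ hne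
    · exact absurd h44 hne
    have hB' := hB
    generalize h42 : S.reg 42 = i at hB
    have hin := (add_blockSize_le (z := z) hB.1).1
    have hna := blockSize_mul_le (z := z) hB.1
    have hVS : V S = H + tailAvg m z D i + T i := by
      simp only [hV, if_neg hne, h42]
    rw [hVS]
    refine .halfBody (m := m) (z := z) (i := i) (n := blockSize m z i) (xr := H + 190000)
      (y := fun v => G v + 1)
      (xc := H + tailAvg m z D (i + blockSize m z i) + T (i + blockSize m z i))
      hw hS.r40 hS.r41 h42 h44 ⟨?_, ?_⟩ hB.1 rfl (hB.le_mul h1 h2) ?_ ?_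
    · intro S' hS' h42' h44'
      have hb : BlockStart m z 0 := ⟨Nat.zero_le _, Or.inl rfl⟩
      have e : V S' = H + 190000 := by
        simp [hV, h44', h42', hD0, hT]
      exact .nil_boundOn ⟨⟨hS.agree.trans hS'.agree (by omega) (by omega), hS'.r40, hS'.r41⟩,
        Or.inr ⟨h44', by rw [h42']; exact hb⟩⟩ (by rw [e]; positivity) e.le
    · intro v hv S' hS' h46' h44'
      have e : V S' = 1 + G v := by
        simp [hV, h44', h46']
      exact .nil_boundOn ⟨⟨hS.agree.trans hS'.agree (by omega) (by omega), hS'.r40, hS'.r41⟩,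
        Or.inl ⟨h44', by rw [h46']; exact hv⟩⟩ (by rw [e]; linarith [hG v hv]) (by rw [e]; linarith)
    · intro hle S' hS' h42' h44'
      have e : V S' = H + tailAvg m z D (i + blockSize m z i) + T (i + blockSize m z i) := by
        simp [hV, h44', h42']
      exact .nil_boundOn ⟨⟨hS.agree.trans hS'.agree (by omega) (by omega), hS'.r40, hS'.r41⟩,
        Or.inr ⟨h44', by rw [h42']; exact hB.next h1 hle⟩⟩
        (by rw [e]; exact hval _ (hB.next h1 hle)) e.le
    · have hstep := tailAvg_step (z := z) (f := D) hB.1 hin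
      have hR := (hB.vn_le h1 h2 rfl).1
      have hR0 := (vn_range_mem hna le_rfl).1
      have h0 : blockSize m z 0 = z + 1 := blockSize_zero h1
      have hT' := hT1 (i + blockSize m z i)
      have hlow := le_sum_cwt_symH_one h1
      have hTi : T i = if i = 0 then 190000 else 190000 + 5680 := rfl
      have e0 : i = 0 → 1 / 32 ≤ 1 / (8 * ((z : ℝ) + 1)) * ∑ o ∈ Finset.range (blockSize m z i),
          vn ((2 * i + o : ℕ) : ℝ) ((m + i + 1 : ℕ) : ℝ) o 0 * symH m (fun _ => 1) (i + o) := by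
        rintro rfl
        rw [h0]
        exact hlow
      generalize blockSize m z i = n at *
      generalize T (i + n) = T' at *
      have esum : ∑ o ∈ Finset.range n, vn ((2 * i + o : ℕ) : ℝ) ((m + i + 1 : ℕ) : ℝ) o 0 *
            (symH m (fun v => G v + 1) (i + o) - symH m (fun _ => 1) (i + o) * (H + 190000)) =
          ∑ o ∈ Finset.range n, vn ((2 * i + o : ℕ) : ℝ) ((m + i + 1 : ℕ) : ℝ) o 0 * D (i + o) -
          189999 * ∑ o ∈ Finset.range n, vn ((2 * i + o : ℕ) : ℝ) ((m + i + 1 : ℕ) : ℝ) o 0 *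
            symH m (fun _ => 1) (i + o) := by
        rw [Finset.mul_sum, ← Finset.sum_sub_distrib]
        refine Finset.sum_congr rfl fun o _ => ?_
        have : symH m (fun v => G v + 1) (i + o) = symH m G (i + o) + symH m (fun _ => 1) (i + o) := by
          simp only [symH]
          split_ifs <;> ring
        rw [this, hD]
        ring
      have e1 : 0 ≤ 1 / (8 * ((z : ℝ) + 1)) * ∑ o ∈ Finset.range n,
          vn ((2 * i + o : ℕ) : ℝ) ((m + i + 1 : ℕ) : ℝ) o 0 * symH m (fun _ => 1) (i + o) := by
        refine mul_nonneg (by positivity) (Finset.sum_nonneg fun o ho => mul_nonneg ?_ ?_)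
        · exact (vn_range_mem hna (Finset.mem_range.1 ho).le).1
        · linarith [(symH_one_mem m (i + o)).1]
      rw [esum, mul_sub, mul_left_comm, hstep]
      generalize 1 / (8 * ((z : ℝ) + 1)) * ∑ o ∈ Finset.range n,
          vn ((2 * i + o : ℕ) : ℝ) ((m + i + 1 : ℕ) : ℝ) o 0 * symH m (fun _ => 1) (i + o) = E at *
      generalize 1 / (8 * ((z : ℝ) + 1)) * ∑ o ∈ Finset.range n,
          vn ((2 * i + o : ℕ) : ℝ) ((m + i + 1 : ℕ) : ℝ) o 0 * D (i + o) = E' at *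
      generalize vn ((2 * i + n : ℕ) : ℝ) ((m + i + 1 : ℕ) : ℝ) n 0 = R at *
      have hRT : R * T' ≤ R * (190000 + 5680) := mul_le_mul_of_nonneg_left hT' hR0
      rw [hTi]
      split_ifs with hi0
      · nlinarith [e0 hi0]
      · nlinarith
  · rintro S ⟨hS, ⟨h44, h46⟩ | ⟨h44, -⟩⟩ h0
    · have : V S - 1 = G (S.reg 46) := by simp [hV, h44]
      rw [this]
      exact hk _ h46 S hS rfl
    · omega
  · exact ⟨⟨((Agree.refl _ _ _).put (by omega)).put (by omega), by exact h40, by exact h41⟩,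
      Or.inr ⟨rfl, Nat.zero_le _, Or.inl rfl⟩⟩
  · have : V ((s.put 42 0).put 44 1) = H + tailAvg m z D 0 + T 0 := rfl
    rw [this, hD0]
    simp only [hT, if_true]
    linarith

end half

/-! ### Sampling from the binomial distribution -/

/-- The potential of the binomial sampler. -/
def lpot (l : ℕ) : ℝ := Real.log (1 + l) / Real.log (4 / 3)

lemma log_four_thirds : 1 / 4 ≤ Real.log (4 / 3) := by
  have := Real.one_sub_inv_le_log_of_pos (show (0 : ℝ) < 4 / 3 by norm_num)
  norm_num at this ⊢
  linarith

lemma lpot_mono {l l' : ℕ} (h : l ≤ l') : lpot l ≤ lpot l' := by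
  have h' : (l : ℝ) ≤ l' := by exact_mod_cast h
  exact div_le_div_of_nonneg_right (Real.log_le_log (by positivity) (by linarith))
    (by linarith [log_four_thirds])

lemma lpot_nonneg (l : ℕ) : 0 ≤ lpot l :=
  div_nonneg (Real.log_nonneg (by linarith [show (0 : ℝ) ≤ l by positivity]))
    (by linarith [log_four_thirds])

lemma lpot_le (l : ℕ) : lpot l ≤ 4 * Real.log (2 + l) := by
  have h : Real.log (1 + l) ≤ Real.log (2 + l) := Real.log_le_log (by positivity) (by linarith)
  have h0 : 0 ≤ Real.log (1 + l) := Real.log_nonneg (by linarith [show (0 : ℝ) ≤ l by positivity])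
  rw [lpot, div_le_iff₀ (by linarith [log_four_thirds])]
  nlinarith [log_four_thirds]

/-- The tangent of the logarithm at l/2, together with (1 + l/2)(4/3) ≤ 1 + l for l ≥ 1. This
inequality is the reason for the base 4/3: halving lowers the potential by at least one. -/
lemma lpot_tangent {l : ℕ} (hl : 1 ≤ l) (x : ℝ) (hx : 0 ≤ x) :
    Real.log (1 + x) / Real.log (4 / 3) ≤
      lpot l - 1 + (x - l / 2) / (1 + l / 2) / Real.log (4 / 3) := by
  have hq : 0 < Real.log (4 / 3) := by linarith [log_four_thirds]
  have hl' : (1 : ℝ) ≤ l := by exact_mod_cast hl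
  have h1 : Real.log (1 + x) ≤ Real.log (1 + l / 2) + (x - l / 2) / (1 + l / 2) := by
    have h2 := Real.log_le_sub_one_of_pos (show (0 : ℝ) < (1 + x) / (1 + l / 2) by positivity)
    rw [Real.log_div (by positivity) (by positivity)] at h2
    have : (1 + x) / (1 + (l : ℝ) / 2) - 1 = (x - l / 2) / (1 + l / 2) := by
      field_simp
      ring
    linarith
  have h2 : Real.log (1 + l / 2) ≤ Real.log (1 + l) - Real.log (4 / 3) := by
    rw [← Real.log_div (by positivity) (by norm_num)]
    exact Real.log_le_log (by positivity) (by linarith)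
  calc _ ≤ (Real.log (1 + l) - Real.log (4 / 3) + (x - l / 2) / (1 + l / 2)) / Real.log (4 / 3) :=
        div_le_div_of_nonneg_right (by linarith) hq.le
    _ = _ := by rw [lpot]; field_simp

lemma lpot_half {l : ℕ} (hl : 1 ≤ l) : lpot (l / 2) ≤ lpot l - 1 := by
  have h := lpot_tangent hl ((l / 2 : ℕ) : ℝ) (by positivity)
  have h1 : ((l / 2 : ℕ) : ℝ) ≤ l / 2 := Nat.cast_div_le
  have h2 : (((l / 2 : ℕ) : ℝ) - l / 2) / (1 + l / 2) / Real.log (4 / 3) ≤ 0 :=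
    div_nonpos_of_nonpos_of_nonneg (div_nonpos_of_nonpos_of_nonneg (by linarith) (by positivity))
      (by linarith [log_four_thirds])
  exact h.trans (by linarith)

/-- Jensen's inequality: the linear term of the tangent vanishes at the mean l/2. -/
lemma bex_lpot {l : ℕ} (hl : 1 ≤ l) : bex (1 / 2) l lpot ≤ lpot l - 1 := by
  set c := 1 / (1 + (l : ℝ) / 2) / Real.log (4 / 3) with hc
  calc _ ≤ bex (1 / 2) l (fun v => (lpot l - 1 - l / 2 * c) + c * v) := by
        refine bex_mono (by norm_num) (by norm_num) fun v _ => ?_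
        refine (lpot_tangent hl v (by positivity)).trans (le_of_eq ?_)
        rw [hc]
        ring
    _ = _ := by
        rw [bex_add, bex_const, bex_const_mul, bex_id]
        ring

lemma bex_lpot_sub {l : ℕ} (hl : 1 ≤ l) : bex (1 / 2) l (fun v => lpot (l - v)) ≤ lpot l - 1 := by
  set c := 1 / (1 + (l : ℝ) / 2) / Real.log (4 / 3) with hc
  calc _ ≤ bex (1 / 2) l (fun v => (lpot l - 1 + l / 2 * c) + (-c) * v) := by
        refine bex_mono (by norm_num) (by norm_num) fun v hv => ?_
        refine (lpot_tangent hl ((l - v : ℕ) : ℝ) (by positivity)).trans (le_of_eq ?_)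
        rw [Nat.cast_sub hv, hc]
        ring
    _ = _ := by
        rw [bex_add, bex_const, bex_const_mul, bex_id]
        ring

/-- Halve `reg 41`. -/
def shrinkBody : Prog := blk (.bin .div 41 41 51) [.bin .add 56 41 50, .bin .mul 56 56 56,
  .bin .lt 58 57 56]

/-- Reduce the problem by the value of a symmetric binomial number. -/
def splitStep : Prog := .seq (blk (.bin .mul 5 5 51) [.bin .lt 58 5 6])
  (.ite 58 (blk (.bin .add 4 46 52) []) (blk (.bin .add 7 7 46) [.bin .sub 4 4 46, .bin .sub 5 5 6]))

/-- Add a fair coin if `reg 4` is odd. -/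
def oddStep : Prog := .ite 53 (.seq (blk (.const 20 2) []) (.seq unif (blk (.bin .add 46 46 21) [])))
  (blk (.const 52 0) [])

/-- One round of the binomial sampler. -/
def binomBody : Prog :=
  .seq (blk (.const 50 1) [.const 51 2, .bin .div 40 4 51, .bin .add 56 41 50, .bin .mul 56 56 56,
      .bin .add 57 40 50, .bin .lt 58 57 56])
    (.seq (.while 58 shrinkBody) (.seq half
      (.seq (blk (.const 51 2) [.const 52 0, .bin .mod 53 4 51]) (.seq oddStep splitStep))))

/-- `reg 7 :=` a binomial random number with parameters `reg 4` and `reg 5 / reg 6`. -/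
def binom : Prog :=
  .seq (blk (.const 7 0) [.const 52 0, .bin .add 41 4 52]) (.while 4 binomBody)

/-- The states that differ from `s` only in the registers that are changed by `binom`. -/
structure BinomAgree (s s' : State) : Prop where
  mem : s'.mem = s.mem
  real : s'.real = s.real
  reg : ∀ x, (x < 4 ∨ x = 6 ∨ 8 ≤ x) → (x < 20 ∨ 60 ≤ x) → s'.reg x = s.reg x

section binom
variable {M : Env} {k : List Prog} {F : State → ℝ≥0∞} {s s' s'' : State} {t : ℝ}
  {m z l a b v r : ℕ}

lemma BinomAgree.refl (s : State) : BinomAgree s s := ⟨rfl, rfl, fun _ _ _ => rfl⟩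

lemma BinomAgree.agree {lo hi : ℕ} (h : BinomAgree s s') (h' : Agree lo hi s' s'')
    (hlo : 20 ≤ lo) (hhi : hi ≤ 60) : BinomAgree s s'' where
  mem := h'.mem.trans h.mem
  real := h'.real.trans h.real
  reg x h1 h2 := (h'.reg x (by omega)).trans (h.reg x h1 h2)

lemma BinomAgree.put (h : BinomAgree s s') {x : ℕ}
    (hx : x = 4 ∨ x = 5 ∨ x = 7 ∨ (20 ≤ x ∧ x < 60)) : BinomAgree s (s'.put x v) where
  mem := h.mem
  real := h.real
  reg y h1 h2 := by rw [State.put_reg, if_neg (by omega), h.reg y h1 h2]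

/-- Register 41 only ever decreases, so the halvings of all rounds together are paid by one
potential 10 · `lpot z`. A halving happens only if (z + 1)² is too large, which preserves the lower
bound on 4 (z + 1)². -/
lemma Bounded.shrink (hw : (z + 1) * (z + 1) + m + 2 < 2 ^ M.w) (h40 : s.reg 40 = m)
    (h41 : s.reg 41 = z) (h50 : s.reg 50 = 1) (h51 : s.reg 51 = 2) (h57 : s.reg 57 = m + 1)
    (h58 : s.reg 58 = if m + 1 < (z + 1) * (z + 1) then 1 else 0)
    (h2 : m + 1 ≤ 4 * ((z + 1) * (z + 1))) (X : ℝ)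
    (hk : ∀ z' ≤ z, (z' + 1) * (z' + 1) ≤ m + 1 → m + 1 ≤ 4 * ((z' + 1) * (z' + 1)) →
      ∀ s', Agree 41 60 s s' → s'.reg 41 = z' → Bounded M k F s' (X + 10 * lpot z')) (hX : 0 ≤ X)
    (ht : X + 10 * lpot z + 1 ≤ t) : Bounded M (.while 58 shrinkBody :: k) F s t := by
  refine .while (fun s' => Agree 41 60 s s' ∧ s'.reg 41 ≤ z ∧ s'.reg 50 = 1 ∧ s'.reg 51 = 2 ∧
      s'.reg 57 = m + 1 ∧
      s'.reg 58 = (if m + 1 < (s'.reg 41 + 1) * (s'.reg 41 + 1) then 1 else 0) ∧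
      m + 1 ≤ 4 * ((s'.reg 41 + 1) * (s'.reg 41 + 1))) (fun s' => X + 10 * lpot (s'.reg 41) + 1)
    ?_ ?_ ⟨.refl _ _ _, h41.le, h50, h51, h57, by rw [h41]; exact h58, by rw [h41]; exact h2⟩
    (by simp only [h41]; exact ht)
  · rintro S ⟨hA, hz, S50, S51, S57, S58, hm⟩ hx
    generalize hz' : S.reg 41 = y at *
    have hlt : m + 1 < (y + 1) * (y + 1) := by
      by_contra hc
      rw [if_neg hc] at S58
      exact hx S58
    have hy : 1 ≤ y := by
      by_contra hy
      have : y = 0 := by omega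
      subst this
      omega
    have hb : (y / 2 + 1) * (y / 2 + 1) ≤ (z + 1) * (z + 1) := Nat.mul_le_mul (by omega) (by omega)
    have hb1 : (z + 1) ≤ (z + 1) * (z + 1) := Nat.le_mul_self _
    refine .blk_cons trivial (Instr.detExec_bin (v := y / 2) hz' S51 rfl (by omega)) <|
      .blk_cons trivial (Instr.detExec_bin (v := y / 2 + 1) rfl S50 rfl (by omega)) <|
      .blk_cons trivial (Instr.detExec_bin (v := (y / 2 + 1) * (y / 2 + 1)) rfl rfl rfl (by omega)) <|
      .blk_one trivial (Instr.detExec_bin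
        (v := if m + 1 < (y / 2 + 1) * (y / 2 + 1) then 1 else 0) S57 rfl rfl
        (by split_ifs <;> omega)) <| .nil_boundOn ⟨?_, ?_, by exact S50, by exact S51, by exact S57, rfl, ?_⟩ ?_ ?_
    · repeat' refine Agree.put ?_ (by omega)
      exact hA
    · exact (Nat.div_le_self y 2).trans hz
    · change m + 1 ≤ 4 * ((y / 2 + 1) * (y / 2 + 1))
      have : y + 1 ≤ 2 * (y / 2 + 1) := by omega
      nlinarith
    · have := lpot_nonneg (y / 2)
      change 0 ≤ X + 10 * lpot (y / 2) + 1
      linarith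
    · change X + 10 * lpot (y / 2) + 1 ≤ _
      linarith [lpot_half hy]
  · rintro S ⟨hA, hz, S50, S51, S57, S58, hm⟩ hx
    rw [add_sub_cancel_right]
    refine hk _ hz ?_ hm S hA rfl
    by_contra hc
    rw [if_pos (by omega)] at S58
    omega

/-- The bound after a symmetric binomial number `v` has been used to split off a part. -/
def splitVal (G : ℕ → ℝ) (b l a r : ℕ) (v : ℕ) : ℝ :=
  if 2 * a < b then 200000 * lpot v + bex ((2 * a : ℕ) / b) v (fun k => G (r + k))
  else 200000 * lpot (l - v) + bex ((2 * a - b : ℕ) / b) (l - v) (fun k => G (r + v + k))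

/-- The leading binary digit of a/b decides between `bex_half_mul` and `bex_half_add`. In both cases
the remaining number of trials is a fair binomial, so the potential drops by one on average. -/
lemma bex_splitVal (G : ℕ → ℝ) (hl : 1 ≤ l) (hb : 1 ≤ b) :
    bex (1 / 2) l (splitVal G b l a r) ≤
      200000 * (lpot l - 1) + bex (a / b) l (fun k => G (r + k)) := by
  have hb0 : (0 : ℝ) < b := by exact_mod_cast hb
  by_cases h : 2 * a < b
  · have e : splitVal G b l a r = fun v =>
        200000 * lpot v + bex ((2 * a : ℕ) / b) v (fun k => G (r + k)) :=
      funext fun v => by rw [splitVal, if_pos h]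
    rw [e, bex_add, bex_const_mul, ← bex_half_mul]
    have : ((2 * a : ℕ) : ℝ) / b / 2 = a / b := by push_cast; field_simp
    rw [this]
    linarith [bex_lpot hl]
  · have e' : splitVal G b l a r = fun v =>
        200000 * lpot (l - v) + bex ((2 * a - b : ℕ) / b) (l - v) (fun k => G (r + v + k)) :=
      funext fun v => by rw [splitVal, if_neg h]
    have e : bex (1 / 2) l (fun v => bex ((2 * a - b : ℕ) / b) (l - v) fun k => G (r + v + k)) =
        bex (a / b) l (fun k => G (r + k)) := by
      simp only [add_assoc]
      rw [← bex_half_add ((2 * a - b : ℕ) / b) l fun k => G (r + k), Nat.cast_sub (not_lt.1 h)]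
      congr 1
      push_cast
      field_simp
      ring
    rw [e', bex_add, bex_const_mul, e]
    linarith [bex_lpot_sub hl]

/-- The invariant of the main loop of `binom`. -/
structure BinomInv (b l : ℕ) (s s' : State) : Prop where
  agree : BinomAgree s s'
  r5 : s'.reg 5 ≤ b
  r47 : s'.reg 4 + s'.reg 7 ≤ l
  r41 : s'.reg 41 ≤ l
  root : s'.reg 4 / 2 + 1 ≤ 4 * ((s'.reg 41 + 1) * (s'.reg 41 + 1))

/-- The bound in the main loop of `binom`. -/
def binomVal (G : ℕ → ℝ) (b : ℕ) (s : State) : ℝ :=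
  1 + 200000 * lpot (s.reg 4) + 10 * lpot (s.reg 41) +
    bex (s.reg 5 / b) (s.reg 4) fun k => G (s.reg 7 + k)

lemma bex_nonneg {p : ℝ} (h0 : 0 ≤ p) (h1 : p ≤ 1) {G : ℕ → ℝ} (hG : ∀ v ≤ l, 0 ≤ G v) :
    0 ≤ bex p l G := by
  rw [← bex_const p l 0]
  exact bex_mono h0 h1 hG

lemma binomVal_nonneg {G : ℕ → ℝ} (hG : ∀ v ≤ l, 0 ≤ G v) (h : BinomInv b l s s') :
    0 ≤ binomVal G b s' := by
  have h1 := lpot_nonneg (s'.reg 4)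
  have h2 := lpot_nonneg (s'.reg 41)
  have h3 : 0 ≤ bex (s'.reg 5 / b) (s'.reg 4) fun k => G (s'.reg 7 + k) :=
    bex_nonneg (by positivity) (div_le_one_of_le₀ (by exact_mod_cast h.r5) (by positivity))
      fun v hv => hG _ (by linarith [h.r47])
  rw [binomVal]
  linarith

lemma Bounded.splitStep {l₀ : ℕ} {G : ℕ → ℝ} (hG : ∀ v ≤ l₀, 0 ≤ G v) (hw : l₀ + 2 * b + 2 < 2 ^ M.w)
    (hs : BinomAgree s s') (h4 : s'.reg 4 = l) (h5 : s'.reg 5 = a) (h6 : s'.reg 6 = b)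
    (h7 : s'.reg 7 = r) (h41 : s'.reg 41 = z) (h46 : s'.reg 46 = v) (h51 : s'.reg 51 = 2)
    (h52 : s'.reg 52 = 0) (hab : a ≤ b) (hlr : l + r ≤ l₀) (hz : z ≤ l₀) (hv : v ≤ l)
    (hroot : l / 2 + 1 ≤ 4 * ((z + 1) * (z + 1)))
    (ht : splitVal G b l a r v + 10 * lpot z + 20 ≤ t) :
    Bounded M [splitStep] (boundOn (BinomInv b l₀ s) (binomVal G b)) s' t := by
  refine .seq <| .blk_cons trivial (Instr.detExec_bin (v := 2 * a) h5 h51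
      (show a * 2 = 2 * a by omega) (by omega)) <|
    .blk_one trivial (Instr.detExec_bin (v := if 2 * a < b then 1 else 0) rfl h6 rfl
      (by split_ifs <;> omega)) ?_
  rcases lt_or_ge (2 * a) b with hc | hc
  · refine .ite (fun _ => ?_) (fun h => absurd ((if_pos hc).symm.trans h) one_ne_zero)
    have hI : BinomInv b l₀ s (((s'.put 5 (2 * a)).put 58 (if 2 * a < b then 1 else 0)).put 4 v) := by
      refine ⟨((hs.put (by omega)).put (by omega)).put (by omega), ?_, ?_, ?_, ?_⟩
      · exact hc.le
      · change v + s'.reg 7 ≤ l₀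
        omega
      · change s'.reg 41 ≤ l₀
        omega
      · change v / 2 + 1 ≤ 4 * ((s'.reg 41 + 1) * (s'.reg 41 + 1))
        rw [h41]
        omega
    refine .blk_one trivial (Instr.detExec_bin (v := v) h46 h52 rfl (by omega)) <|
      .nil_boundOn hI (binomVal_nonneg hG hI) ?_
    have e : binomVal G b (((s'.put 5 (2 * a)).put 58 (if 2 * a < b then 1 else 0)).put 4 v) =
      1 + 200000 * lpot v + 10 * lpot (s'.reg 41) +
        bex ((2 * a : ℕ) / b) v fun k => G (s'.reg 7 + k) := rfl
    rw [e, h41, h7]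
    rw [splitVal, if_pos hc] at ht
    linarith
  · refine .ite (fun h => absurd (if_neg (not_lt.2 hc)) h) (fun _ => ?_)
    have hI : BinomInv b l₀ s (((((s'.put 5 (2 * a)).put 58 (if 2 * a < b then 1 else 0)).put 7
        (r + v)).put 4 (l - v)).put 5 (2 * a - b)) := by
      refine ⟨((((hs.put (by omega)).put (by omega)).put (by omega)).put (by omega)).put (by omega),
        ?_, ?_, ?_, ?_⟩
      · change 2 * a - b ≤ b
        omega
      · change l - v + (r + v) ≤ l₀
        omega
      · change s'.reg 41 ≤ l₀
        omega
      · change (l - v) / 2 + 1 ≤ 4 * ((s'.reg 41 + 1) * (s'.reg 41 + 1))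
        rw [h41]
        omega
    refine .blk_cons trivial (Instr.detExec_bin (v := r + v) h7 h46 rfl (by omega)) <|
      .blk_cons trivial (Instr.detExec_bin (v := l - v) h4 h46 rfl (by omega)) <|
      .blk_one trivial (Instr.detExec_bin (v := 2 * a - b) rfl h6 rfl (by omega)) <|
      .nil_boundOn hI (binomVal_nonneg hG hI) ?_
    have e : binomVal G b (((((s'.put 5 (2 * a)).put 58 (if 2 * a < b then 1 else 0)).put 7
        (r + v)).put 4 (l - v)).put 5 (2 * a - b)) =
      1 + 200000 * lpot (l - v) + 10 * lpot (s'.reg 41) +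
        bex ((2 * a - b : ℕ) / b) (l - v) fun k => G (r + v + k) := rfl
    rw [e, h41]
    rw [splitVal, if_neg (not_lt.2 hc)] at ht
    linarith

lemma Bounded.binomBody {l₀ : ℕ} {G : ℕ → ℝ} (hG : ∀ v ≤ l₀, 0 ≤ G v)
    (hw : 1000 * (l₀ + b + 2) ^ 2 ≤ 2 ^ M.w) (hb : 1 ≤ b) (h6 : s.reg 6 = b)
    (hI : BinomInv b l₀ s s') (h4 : s'.reg 4 ≠ 0) :
    Bounded M [binomBody] (boundOn (BinomInv b l₀ s) (binomVal G b)) s' (binomVal G b s' - 1) := by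
  have s6 : s'.reg 6 = b := (hI.agree.reg 6 (by omega) (by omega)).trans h6
  obtain ⟨hA, h5, h47, h41, hroot⟩ := hI
  rw [binomVal]
  generalize e4 : s'.reg 4 = l at *
  generalize e5 : s'.reg 5 = a at *
  generalize e7 : s'.reg 7 = r at *
  generalize e41 : s'.reg 41 = z at *
  have hw1 : 1000 * (l₀ + b + 2) ≤ 2 ^ M.w := by nlinarith
  have hzz : (z + 1) * (z + 1) ≤ (l₀ + b + 2) ^ 2 := by
    rw [sq]; exact Nat.mul_le_mul (by omega) (by omega)
  have hb2 : l₀ + b + 2 ≤ (l₀ + b + 2) ^ 2 := Nat.le_self_pow two_ne_zero _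
  -- The drop of 200000 per round covers the constant cost of `half` and the straight-line code.
  set X := 190100 + (200000 * (lpot l - 1) + bex (a / b) l (fun k => G (r + k))) with hX
  have hX0 : 0 ≤ X := by
    have h1 : 0 ≤ bex (a / b) l (fun k => G (r + k)) :=
      bex_nonneg (by positivity) (div_le_one_of_le₀ (by exact_mod_cast h5) (by positivity))
        fun v hv => hG _ (by linarith)
    have h2 := lpot_half (l := l) (by omega)
    have h3 := lpot_nonneg (l / 2)
    rw [hX]
    linarith
  set m := l / 2 with hm
  refine .seq <| .blk_cons trivial (Instr.detExec_const (by omega)) <|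
    .blk_cons trivial (Instr.detExec_const (by omega)) <|
    .blk_cons trivial (Instr.detExec_bin (v := m) e4 rfl rfl (by omega)) <|
    .blk_cons trivial (Instr.detExec_bin (v := z + 1) e41 rfl rfl (by omega)) <|
    .blk_cons trivial (Instr.detExec_bin (v := (z + 1) * (z + 1)) rfl rfl rfl (by omega)) <|
    .blk_cons trivial (Instr.detExec_bin (v := m + 1) rfl rfl rfl (by omega)) <|
    .blk_one trivial (Instr.detExec_bin (v := if m + 1 < (z + 1) * (z + 1) then 1 else 0) rfl rfl rfl
      (by split_ifs <;> omega)) ?_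
  refine .seq <| .shrink (m := m) (z := z) (by omega) rfl (by exact e41) rfl rfl rfl rfl hroot X ?_
    hX0 (by rw [hX]; linarith)
  intro z' hz' h1 h2 S hS S41
  have sA : BinomAgree s S := BinomAgree.agree (lo := 41) (hi := 60)
    (((((((hA.put (by omega)).put (by omega)).put (by omega)).put (by omega)).put (by omega)).put
      (by omega)).put (by omega)) hS (by omega) (by omega)
  have s4 : S.reg 4 = l := (hS.reg 4 (by omega)).trans e4
  have s5 : S.reg 5 = a := (hS.reg 5 (by omega)).trans e5
  have s7 : S.reg 7 = r := (hS.reg 7 (by omega)).trans e7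
  have s6' : S.reg 6 = b := (hS.reg 6 (by omega)).trans s6
  have s40 : S.reg 40 = m := hS.reg 40 (by omega)
  have hhw : 100 * (m + z' + 2) ^ 2 < 2 ^ M.w := by
    have : (m + z' + 2) ^ 2 ≤ (2 * (l₀ + b + 2)) ^ 2 := Nat.pow_le_pow_left (by omega) 2
    nlinarith
  -- For odd l, the fair binomial with l - 1 trials is completed by one further fair coin.
  set G' : ℕ → ℝ := fun v => 80 + 10 * lpot z' + if l % 2 = 0 then splitVal G b l a r v else
    (splitVal G b l a r v + splitVal G b l a r (v + 1)) / 2 with hG'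
  refine .seq (.half hhw s40 S41 h1 h2 G' (fun v hv U hU U46 => ?_) ?_)
  · have uA := sA.agree hU.agree (by omega) (by omega)
    have u4 : U.reg 4 = l := (hU.agree.reg 4 (by omega)).trans s4
    have u5 : U.reg 5 = a := (hU.agree.reg 5 (by omega)).trans s5
    have u6 : U.reg 6 = b := (hU.agree.reg 6 (by omega)).trans s6'
    have u7 : U.reg 7 = r := (hU.agree.reg 7 (by omega)).trans s7
    refine .seq <| .blk_cons trivial (Instr.detExec_const (by omega)) <|
      .blk_cons trivial (Instr.detExec_const (by omega)) <|
      .blk_one trivial (Instr.detExec_bin (v := l % 2) u4 rfl rfl (by omega)) <| .seq <| .ite ?_ ?_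
    · intro hodd
      have hodd : l % 2 ≠ 0 := hodd
      refine .seq <| .blk_one trivial (Instr.detExec_const (by omega)) <| .seq <|
        .unif_coin (a := 1) (b := 2) rfl (by norm_num) (by norm_num) (by omega)
        (x := splitVal G b l a r v + 10 * lpot z' + 21)
        (y := splitVal G b l a r (v + 1) + 10 * lpot z' + 21) ?_ ?_ ?_
      · intro q hq W hW h21
        refine .blk_one trivial (Instr.detExec_bin (v := v) ((hW.reg 46 (by omega)).trans U46) h21
          (show v + q = v by omega) (by omega)) ?_
        refine .splitStep (l := l) (a := a) (r := r) (z := z') (v := v) hG (by omega) (.put (.agree (lo := 21) (hi := 26)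
          (.put (.put (.put (.put uA ?_) ?_) ?_) ?_) hW ?_ ?_) ?_)
          ((hW.reg 4 (by omega)).trans u4) ((hW.reg 5 (by omega)).trans u5)
          ((hW.reg 6 (by omega)).trans u6) ((hW.reg 7 (by omega)).trans u7)
          ((hW.reg 41 (by omega)).trans hU.r41) rfl (hW.reg 51 (by omega)) (hW.reg 52 (by omega))
          h5 h47 (by omega) (by omega) (by omega) (by linarith) <;> omega
      · intro q hq hq' W hW h21
        refine .blk_one trivial (Instr.detExec_bin (v := v + 1) ((hW.reg 46 (by omega)).trans U46) h21
          (show v + q = v + 1 by omega) (by omega)) ?_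
        refine .splitStep (l := l) (a := a) (r := r) (z := z') (v := v + 1) hG (by omega) (.put (.agree (lo := 21) (hi := 26)
          (.put (.put (.put (.put uA ?_) ?_) ?_) ?_) hW ?_ ?_) ?_)
          ((hW.reg 4 (by omega)).trans u4) ((hW.reg 5 (by omega)).trans u5)
          ((hW.reg 6 (by omega)).trans u6) ((hW.reg 7 (by omega)).trans u7)
          ((hW.reg 41 (by omega)).trans hU.r41) rfl (hW.reg 51 (by omega)) (hW.reg 52 (by omega))
          h5 h47 (by omega) (by omega) (by omega) (by linarith) <;> omega
      · simp only [hG', if_neg hodd]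
        norm_num
        linarith
    · intro heven
      have heven : l % 2 = 0 := heven
      refine .blk_one trivial (Instr.detExec_const (by omega)) ?_
      refine .splitStep (l := l) (a := a) (r := r) (z := z') (v := v) hG (by omega)
        (.put (.put (.put (.put uA ?_) ?_) ?_) ?_)
        u4 u5 u6 u7 hU.r41 U46 rfl rfl h5 h47 (by omega) (by omega) (by omega) ?_
      iterate 4 omega
      simp only [hG', if_pos heven]
      linarith
  · have hs := bex_splitVal (a := a) (r := r) G (by omega : 1 ≤ l) hb
    have e : bex (1 / 2) (2 * m) G' = 80 + 10 * lpot z' + bex (1 / 2) l (splitVal G b l a r) := by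
      rw [hG', bex_add, bex_const]
      congr 1
      split_ifs with hpar
      · rw [show 2 * m = l by omega]
      · have e' : bex (1 / 2) l (splitVal G b l a r) = bex (1 / 2) (2 * m + 1) (splitVal G b l a r) := by
          congr 1
          omega
        rw [e', bex, show (1 - 1 / 2 : ℝ) = 1 / 2 by norm_num, ← bex_const_mul, ← bex_const_mul,
          ← bex_add]
        exact bex_congr fun v _ => by ring
    rw [e, hX]
    linarith

/-- The initial guess l for the square root is crude, but correcting it costs only `10 * lpot l`
over the entire run. -/
lemma Bounded.binom (hw : 1000 * (l + b + 2) ^ 2 ≤ 2 ^ M.w) (h4 : s.reg 4 = l) (h5 : s.reg 5 = a)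
    (h6 : s.reg 6 = b) (hab : a ≤ b) (hb : 1 ≤ b) (G : ℕ → ℝ)
    (hk : ∀ v ≤ l, ∀ s', BinomAgree s s' → s'.reg 7 = v → Bounded M k F s' (G v))
    (ht : 10 + 200010 * lpot l + bex (a / b) l G ≤ t) : Bounded M (binom :: k) F s t := by
  have hw1 : 1000 * (l + b + 2) ≤ 2 ^ M.w := by nlinarith
  have hG : ∀ v ≤ l, 0 ≤ G v := fun v hv =>
    (hk v hv (s.put 7 v) ((BinomAgree.refl _).put (by omega)) rfl).1
  refine .seq <| .blk_cons trivial (Instr.detExec_const (by omega)) <|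
    .blk_cons trivial (Instr.detExec_const (by omega)) <|
    .blk_one trivial (Instr.detExec_bin (v := l) h4 rfl rfl (by omega)) ?_
  refine .while (BinomInv b l s) (binomVal G b) (fun S hS hx => .binomBody hG hw hb h6 hS hx)
    ?_ ⟨?_, ?_, ?_, ?_, ?_⟩ ?_
  · intro S hS h0
    have e : binomVal G b S - 1 = 200000 * lpot 0 + 10 * lpot (S.reg 41) + G (S.reg 7) := by
      rw [binomVal, h0, bex]
      simp only [add_zero]
      ring
    rw [e]
    exact (hk _ (by linarith [hS.r47]) S hS.agree rfl).mono
      (by linarith [lpot_nonneg 0, lpot_nonneg (S.reg 41)])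
  · exact (((BinomAgree.refl s).put (by omega)).put (by omega)).put (by omega)
  · exact (show s.reg 5 ≤ b by omega)
  · exact (show s.reg 4 + 0 ≤ l by omega)
  · exact le_rfl
  · change s.reg 4 / 2 + 1 ≤ 4 * ((l + 1) * (l + 1))
    rw [h4]
    nlinarith [Nat.div_le_self l 2]
  · have e : binomVal G b (((s.put 7 0).put 52 0).put 41 l) = 1 + 200000 * lpot (s.reg 4) +
      10 * lpot l + bex (s.reg 5 / b) (s.reg 4) fun k => G (0 + k) := rfl
    rw [e, h4, h5]
    simp only [zero_add]
    linarith

end binom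

/-! ### Binomial laws -/

lemma binomialLaw_apply {p : ℝ} (h0 : 0 ≤ p) (h1 : p ≤ 1) (l k : ℕ) :
    binomialLaw l p k = ENNReal.ofReal (l.choose k * p ^ k * (1 - p) ^ (l - k)) := by
  rw [binomialLaw, MeasureTheory.Measure.toPMF_apply, ProbabilityTheory.binomial_singleton,
    Set.projIcc_of_mem zero_le_one ⟨h0, h1⟩]

lemma avg_binomialLaw {p : ℝ} (h0 : 0 ≤ p) (h1 : p ≤ 1) (l : ℕ) {G : ℕ → ℝ} {g : ℕ → ℝ≥0∞}
    (hG : ∀ v ≤ l, 0 ≤ G v) (hg : ∀ v ≤ l, g v = ENNReal.ofReal (G v)) :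
    avg (binomialLaw l p) g = ENNReal.ofReal (bex p l G) := by
  have h2 : 0 ≤ 1 - p := sub_nonneg.2 h1
  rw [avg, tsum_eq_sum (s := Finset.range (l + 1)), bex_eq_sum, ENNReal.ofReal_sum_of_nonneg]
  · refine Finset.sum_congr rfl fun k hk => ?_
    have hk : k ≤ l := by have := Finset.mem_range.1 hk; omega
    rw [binomialLaw_apply h0 h1, hg k hk, ← ENNReal.ofReal_mul (by positivity)]
  · intro k hk
    have := hG k (by have := Finset.mem_range.1 hk; omega)
    positivity
  · intro k hk
    rw [binomialLaw_apply h0 h1, Nat.choose_eq_zero_of_lt (by simpa using hk)]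
    simp

lemma binomialLaw_eq_bex {p : ℝ} (h0 : 0 ≤ p) (h1 : p ≤ 1) (l k : ℕ) :
    binomialLaw l p k = ENNReal.ofReal (bex p l fun v => if v = k then 1 else 0) := by
  rw [← avg_indicator, avg_binomialLaw h0 h1 l (G := fun v => if v = k then 1 else 0)]
  · intro v _; split_ifs <;> norm_num
  · intro v _; split_ifs <;> simp

/-- The real-valued bound is evaluated at multiples of indicators of single outcomes, which yields
the point masses without the running time. -/
lemma samples_binom {M : Env} {s : State} {l a b : ℕ} (hw : 1000 * (l + b + 2) ^ 2 ≤ 2 ^ M.w)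
    (h4 : s.reg 4 = l) (h5 : s.reg 5 = a) (h6 : s.reg 6 = b) (hab : a ≤ b) (hb : 1 ≤ b) :
    Samples M binom s (binomialLaw l (a / b)) (fun v s' => BinomAgree s s' ∧ s'.reg 7 = v ∧ v ≤ l)
      (ENNReal.ofReal (10 + 200010 * lpot l)) := by
  have hp1 : (a : ℝ) / b ≤ 1 := div_le_one_of_le₀ (by exact_mod_cast hab) (by positivity)
  have hT := lpot_nonneg l
  refine .of_forall_singleton ?_ (fun v v' s' h h' => h.2.1.symm.trans h'.2.1) ?_
  · refine (Bounded.binom (k := []) (F := 0) hw h4 h5 h6 hab hb (fun _ => 0)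
      (fun v _ s' _ _ => .nil le_rfl (by simp)) ?_).2
    rw [bex_const, add_zero]
  · intro v F hF hF'
    refine le_of_forall_nat_mul_le (T := ENNReal.ofReal (10 + 200010 * lpot l))
      ENNReal.ofReal_ne_top fun n => ?_
    rw [← ex_zero_const_mul]
    have h := (Bounded.binom (k := []) (F := fun s => n * F s) hw h4 h5 h6 hab hb
      (fun v' => n * if v' = v then 1 else 0) (fun v' hv' s' hs' h7 => .nil ?_ ?_) le_rfl).2
    · rw [bex_const_mul, ENNReal.ofReal_add (by positivity), ENNReal.ofReal_mul (by positivity),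
        ENNReal.ofReal_natCast, ← binomialLaw_eq_bex (by positivity) hp1] at h
      · refine le_trans ?_ h
        rw [ex_eq_cost_add (γ := unitCost)]
        exact le_add_self
      · refine mul_nonneg (by positivity) (bex_nonneg (by positivity) hp1 fun v _ => ?_)
        split_ifs <;> norm_num
    · split_ifs <;> positivity
    · split_ifs with hv
      · subst hv
        simpa using mul_le_mul_right (hF s' ⟨hs', h7, hv'⟩) (n : ℝ≥0∞)
      · rw [hF' v' s' hv ⟨hs', h7, hv'⟩]
        simp

/-! ### Nested binomial sampling and the simple random walk -/

section nested
variable {d n : ℕ}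

/-- The shift of the first of the last `r + 1` coordinates in `nestedBinomial`. -/
def shiftLast (r s h : ℕ) (x : Fin d → ZMod n) : Fin d → ZMod n :=
  fun j => if (j : ℕ) + (r + 1) = d then x j + (h - ((s - h : ℕ) : ZMod n)) else x j

/-- The expected value of `Φ` under `nestedBinomial`. -/
def nex (Φ : (Fin d → ZMod n) → ℝ) : ℕ → ℕ → (Fin d → ZMod n) → ℝ
  | 0, _, x => Φ x
  | r + 1, m, x => bex (1 / (r + 1)) m fun s => bex (1 / 2) s fun h =>
      nex Φ r (m - s) (shiftLast r s h x)

lemma one_div_succ_mem (r : ℕ) : (0 : ℝ) ≤ 1 / (r + 1) ∧ (1 : ℝ) / (r + 1) ≤ 1 :=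
  ⟨by positivity, div_le_one_of_le₀ (by linarith [show (0 : ℝ) ≤ r by positivity]) (by positivity)⟩

lemma nex_nonneg {Φ : (Fin d → ZMod n) → ℝ} (hΦ : ∀ x, 0 ≤ Φ x) (r m : ℕ) (x : Fin d → ZMod n) :
    0 ≤ nex Φ r m x := by
  induction r generalizing m x with
  | zero => exact hΦ x
  | succ r ih =>
    exact bex_nonneg (one_div_succ_mem r).1 (one_div_succ_mem r).2 fun s _ =>
      bex_nonneg (by norm_num) (by norm_num) fun h _ => ih _ _

lemma avg_nestedBinomial {Φ : (Fin d → ZMod n) → ℝ} (hΦ : ∀ x, 0 ≤ Φ x) (r m : ℕ)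
    (x : Fin d → ZMod n) :
    avg (nestedBinomial d n r m x) (fun y => ENNReal.ofReal (Φ y)) =
      ENNReal.ofReal (nex Φ r m x) := by
  induction r generalizing m x with
  | zero => exact avg_pure _ _
  | succ r ih =>
    rw [nestedBinomial, avg_bind, nex]
    refine avg_binomialLaw (one_div_succ_mem r).1 (one_div_succ_mem r).2 m (fun s _ =>
      bex_nonneg (by norm_num) (by norm_num) fun h _ => nex_nonneg hΦ _ _ _) fun s _ => ?_
    rw [avg_bind]
    exact avg_binomialLaw (by norm_num) (by norm_num) s (fun h _ => nex_nonneg hΦ _ _ _)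
      fun h _ => ih _ _

lemma nex_zero (Φ : (Fin d → ZMod n) → ℝ) (r : ℕ) (x : Fin d → ZMod n) : nex Φ r 0 x = Φ x := by
  induction r generalizing x with
  | zero => rfl
  | succ r ih =>
    rw [nex, bex, bex, ih]
    congr 1
    ext j
    simp [shiftLast]

/-- One step of the walk in coordinate `j`. -/
def bump (x : Fin d → ZMod n) (j : Fin d) (b : Bool) : Fin d → ZMod n :=
  Function.update x j (x j + if b then 1 else -1)

lemma shiftLast_bump_of_ne {r s h : ℕ} {x : Fin d → ZMod n} {j : Fin d} (hj : (j : ℕ) + (r + 1) ≠ d)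
    (b : Bool) : shiftLast r s h (bump x j b) = bump (shiftLast r s h x) j b := by
  ext i
  by_cases hi : i = j
  · subst hi; simp [shiftLast, bump, hj]
  · simp [shiftLast, bump, hi]

lemma shiftLast_bump_false {r s h : ℕ} {x : Fin d → ZMod n} {j : Fin d} (hj : (j : ℕ) + (r + 1) = d)
    (hs : h ≤ s) : shiftLast r (s + 1) h x = shiftLast r s h (bump x j false) := by
  ext i
  by_cases hi : i = j
  · subst hi
    simp [shiftLast, bump, hj, Nat.succ_sub hs]
    ring
  · have : (i : ℕ) + (r + 1) ≠ d := fun h => hi (Fin.ext (by omega))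
    simp [shiftLast, bump, hi, this]

lemma shiftLast_bump_true {r s h : ℕ} {x : Fin d → ZMod n} {j : Fin d} (hj : (j : ℕ) + (r + 1) = d) :
    shiftLast r (s + 1) (h + 1) x = shiftLast r s h (bump x j true) := by
  ext i
  by_cases hi : i = j
  · subst hi
    simp [shiftLast, bump, hj]
    ring
  · have : (i : ℕ) + (r + 1) ≠ d := fun h => hi (Fin.ext (by omega))
    simp [shiftLast, bump, hi, this]

lemma bex_sum {ι : Type*} (p : ℝ) (l : ℕ) (S : Finset ι) (f : ι → ℕ → ℝ) :
    bex p l (fun v => ∑ i ∈ S, f i v) = ∑ i ∈ S, bex p l (f i) := by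
  classical
  induction S using Finset.induction_on with
  | empty => simp [bex_const]
  | insert i S hi ih => simp only [Finset.sum_insert hi]; rw [bex_add, ih]

lemma bex_mul_const (p : ℝ) (l : ℕ) (c : ℝ) (G : ℕ → ℝ) :
    bex p l (fun v => G v * c) = bex p l G * c := by
  simp only [mul_comm _ c]
  exact bex_const_mul _ _ _ _

/-- The nested law obeys the recursion of the walk: one of the m + 1 steps is singled out and is a
uniformly random step in the last r coordinates. Multiplying by r makes the case r = 0 harmless. -/
lemma mul_nex_succ (Φ : (Fin d → ZMod n) → ℝ) (r : ℕ) (hr : r ≤ d) (m : ℕ) (x : Fin d → ZMod n) :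
    r * nex Φ r (m + 1) x = ∑ j ∈ Finset.univ.filter fun j : Fin d => d ≤ (j : ℕ) + r,
      (nex Φ r m (bump x j true) + nex Φ r m (bump x j false)) / 2 := by
  induction r generalizing m x with
  | zero =>
    rw [Finset.sum_eq_zero]
    · simp
    · intro j hj
      have := (Finset.mem_filter.1 hj).2
      have := j.2
      omega
  | succ r ih =>
    have hr1 : (0 : ℝ) < r + 1 := by positivity
    set j₀ : Fin d := ⟨d - (r + 1), by omega⟩ with hj₀
    have hj₀r : (j₀ : ℕ) + (r + 1) = d := by simp [hj₀]; omega
    have hset : (Finset.univ.filter fun j : Fin d => d ≤ j + (r + 1)) =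
        insert j₀ (Finset.univ.filter fun j : Fin d => d ≤ j + r) := by
      ext j
      simp only [Finset.mem_filter, Finset.mem_univ, true_and, Finset.mem_insert, Fin.ext_iff]
      omega
    have h1 : bex (1 / 2) 0 = fun G => G 0 := rfl
    -- The singled-out step avoids the first coordinate: the induction hypothesis applies, and
    -- shifts in different coordinates commute.
    have hA : r * bex (1 / (r + 1)) m (fun s => bex (1 / 2) s fun h =>
        nex Φ r (m + 1 - s) (shiftLast r s h x)) = ∑ j ∈ Finset.univ.filter fun j : Fin d => d ≤ (j : ℕ) + r,
          (nex Φ (r + 1) m (bump x j true) + nex Φ (r + 1) m (bump x j false)) / 2 := by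
      simp only [nex]
      rw [← bex_const_mul]
      simp only [← bex_mul_const, div_eq_mul_inv, ← bex_add]
      rw [← bex_sum]
      refine bex_congr fun s hs => ?_
      rw [← bex_const_mul, ← bex_sum]
      refine bex_congr fun h hh => ?_
      rw [Nat.succ_sub hs, Nat.succ_eq_add_one, ih (by omega)]
      refine Finset.sum_congr rfl fun j hj => ?_
      have hj : (j : ℕ) + (r + 1) ≠ d := by
        have := (Finset.mem_filter.1 hj).2
        omega
      rw [shiftLast_bump_of_ne hj, shiftLast_bump_of_ne hj]
      ring
    -- The singled-out step falls into the first coordinate: the additional fair trial of the inner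
    -- binomial is its sign.
    have hB : bex (1 / (r + 1)) m (fun s => bex (1 / 2) (s + 1) fun h =>
        nex Φ r (m + 1 - (s + 1)) (shiftLast r (s + 1) h x)) =
          (nex Φ (r + 1) m (bump x j₀ true) + nex Φ (r + 1) m (bump x j₀ false)) / 2 := by
      simp only [nex]
      simp only [← bex_mul_const, div_eq_mul_inv, ← bex_add]
      refine bex_congr fun s hs => ?_
      rw [bex, ← bex_const_mul, ← bex_const_mul, ← bex_add]
      refine bex_congr fun h hh => ?_
      rw [Nat.add_sub_add_right, shiftLast_bump_false hj₀r hh, shiftLast_bump_true hj₀r]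
      ring
    rw [hset, Finset.sum_insert (by simp; omega), ← hA, ← hB, nex, bex]
    push_cast
    field_simp
    ring

lemma nex_succ [NeZero d] (Φ : (Fin d → ZMod n) → ℝ) (m : ℕ) (x : Fin d → ZMod n) :
    nex Φ d (m + 1) x = (d : ℝ)⁻¹ * ∑ j : Fin d,
      (nex Φ d m (bump x j true) + nex Φ d m (bump x j false)) / 2 := by
  have hd : (d : ℝ) ≠ 0 := Nat.cast_ne_zero.2 (NeZero.ne d)
  have h := mul_nex_succ Φ d le_rfl m x
  rw [Finset.filter_true_of_mem fun j _ => by omega] at h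
  rw [← h]
  field_simp

lemma avg_simpleWalk [NeZero d] {Φ : (Fin d → ZMod n) → ℝ} (hΦ : ∀ x, 0 ≤ Φ x) (m : ℕ)
    (x : Fin d → ZMod n) :
    avg (simpleWalk d n m x) (fun y => ENNReal.ofReal (Φ y)) = ENNReal.ofReal (nex Φ d m x) := by
  induction m generalizing x with
  | zero => rw [nex_zero]; exact avg_pure _ _
  | succ m ih =>
    have hd : (0 : ℝ) < d := Nat.cast_pos.2 (Nat.pos_of_neZero d)
    have e : ∀ p : Fin d × Bool, Function.update x p.1 (x p.1 + if p.2 then 1 else -1) =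
      bump x p.1 p.2 := fun p => rfl
    simp only [simpleWalk, avg_bind, ih, e]
    rw [avg_uniform, ← ENNReal.ofReal_sum_of_nonneg fun p _ => nex_nonneg hΦ _ _ _, nex_succ,
      Fintype.sum_prod_type]
    simp only [Fintype.sum_bool, Fintype.card_prod, Fintype.card_fin, Fintype.card_bool]
    rw [← ENNReal.ofReal_natCast, ← ENNReal.ofReal_inv_of_pos (by push_cast; positivity),
      ← ENNReal.ofReal_mul (by positivity), ← Finset.sum_div]
    congr 1
    push_cast
    field_simp

/-- Both laws give every indicator the expectation computed by `nex`. -/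
theorem nestedBinomial_eq_simpleWalk (d n m : ℕ) [NeZero d] (x : Fin d → ZMod n) :
    nestedBinomial d n d m x = simpleWalk d n m x := by
  classical
  ext y
  have h0 : ∀ z : Fin d → ZMod n, (0 : ℝ) ≤ if z = y then 1 else 0 :=
    fun z => by split_ifs <;> norm_num
  have e : (fun z : Fin d → ZMod n => if z = y then (1 : ℝ≥0∞) else 0) =
      fun z => ENNReal.ofReal (if z = y then 1 else 0) := by
    ext z; split_ifs <;> simp
  rw [← avg_indicator, ← avg_indicator, e, avg_nestedBinomial h0, avg_simpleWalk h0]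

end nested

/-! ### Exact accounting for straight-line code -/

section exact
variable {M : Env} {γ : Prog → ℝ≥0∞} {k : List Prog} {F : State → ℝ≥0∞} {s s' s'' : State}

/-- The instructions `is` lead from `s` to `s'`. -/
def Runs (M : Env) (s : State) (is : List Instr) (s' : State) : Prop :=
  (∀ i ∈ is, i.IsDet) ∧ is.foldl (Instr.detExec M) s = s'

lemma Runs.nil : Runs M s [] s := ⟨by simp, rfl⟩

lemma Runs.cons {i : Instr} {is : List Instr} (hi : i.IsDet) (hs : i.detExec M s = s')
    (h : Runs M s' is s'') : Runs M s (i :: is) s'' :=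
  ⟨by simpa [hi] using h.1, by rw [List.foldl_cons, hs]; exact h.2⟩

lemma ex_runs {i : Instr} {is : List Instr} (h : Runs M s (i :: is) s') :
    ex M γ (blk i is :: k) F s = blkCost γ i is + ex M γ k F s' := by
  rw [ex_blk h.1, h.2]

/-- Assignment to a memory cell. -/
def State.poke (s : State) (a v : ℕ) : State := { s with mem := Function.update s.mem a v }

/-- Assignment to a real cell. -/
def State.ask (s : State) (r : ℕ) (v : ℝ) : State :=
  { s with real := Function.update s.real r v }

lemma State.poke_mem (s : State) (a v b : ℕ) :
    (s.poke a v).mem b = if b = a then v else s.mem b := by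
  simp [State.poke, Function.update_apply]

@[simp] lemma State.poke_reg (s : State) (a v : ℕ) : (s.poke a v).reg = s.reg := rfl

lemma Instr.detExec_store {x y a v : ℕ} (hx : s.reg x = a) (hy : s.reg y = v) :
    (Instr.store x y).detExec M s = s.poke a v := by
  rw [Instr.detExec, hx, hy, State.poke]

lemma Instr.detExec_query {r y a : ℕ} {v : ℝ} (hy : s.reg y = a)
    (hv : M.boxSum (fun j => s.mem (a + j)) (fun j => s.mem (a + M.d + j)) = v) :
    (Instr.query r y).detExec M s = s.ask r v := by
  rw [Instr.detExec, hy, hv, State.ask]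

lemma State.setReg_of_lt {x v : ℕ} (h : v < 2 ^ M.w) : s.setReg M x v = s.put x v := by
  rw [State.setReg, Nat.mod_eq_of_lt h, State.put]

lemma avg_coin {p : ℝ} (h0 : 0 ≤ p) (h1 : p ≤ 1) (f : ℕ → ℝ≥0∞) :
    avg (coin p) f = ENNReal.ofReal p * f 1 + ENNReal.ofReal (1 - p) * f 0 := by
  rw [avg, coin, tsum_eq_sum (s := {0, 1}), Finset.sum_pair (by norm_num), add_comm]
  · simp only [MeasureTheory.Measure.toPMF_apply]
    rw [ProbabilityTheory.bernoulliMeasure_apply_of_mem_of_notMem _ (by simp) (by simp) (by simp),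
      ProbabilityTheory.bernoulliMeasure_apply_of_notMem_of_mem _ (by simp) (by simp) (by simp)]
    congr 2
    · rw [ENNReal.ofReal]
      congr 1
      exact NNReal.eq (by simp [unitInterval.toNNReal, Set.coe_projIcc, h0, h1]; rfl)
    · rw [ENNReal.ofReal]
      congr 1
      exact NNReal.eq (by simp [unitInterval.toNNReal, Set.coe_projIcc, h0, h1]; rfl)
  · intro k hk
    simp only [Finset.mem_insert, Finset.mem_singleton, not_or] at hk
    rw [MeasureTheory.Measure.toPMF_apply,
      ProbabilityTheory.bernoulliMeasure_apply_of_notMem_of_notMem _ (by simp)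
        (by simpa using fun h => hk.2 h.symm) (by simpa using fun h => hk.1 h.symm), zero_mul]

/-- Multiplied by the mass of the box, a toss becomes additive. Boxes of mass zero, where the bias
is 0/0, need no exception, and the scale σ cancels. -/
lemma mul_avg_coin {P P₁ P₂ : ℝ≥0∞} {σ : ℝ} (hσ : 0 < σ) (hP : P₁ + P₂ = P) (hP' : P ≠ ∞)
    (f : ℕ → ℝ≥0∞) :
    P * avg (coin (σ * P₁.toReal / (σ * P.toReal))) f = P₁ * f 1 + P₂ * f 0 := by
  have h1 : P₁ ≠ ∞ := fun h => hP' (by rw [← hP, h]; simp)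
  have h2 : P₂ ≠ ∞ := fun h => hP' (by rw [← hP, h]; simp)
  rcases eq_or_ne P 0 with h0 | h0
  · have h3 := add_eq_zero.1 (hP.trans h0)
    simp [h0, h3.1, h3.2]
  have hPr : 0 < P.toReal := ENNReal.toReal_pos h0 hP'
  have hsum : P₁.toReal + P₂.toReal = P.toReal := by rw [← ENNReal.toReal_add h1 h2, hP]
  have e : σ * P₁.toReal / (σ * P.toReal) = P₁.toReal / P.toReal := by field_simp
  have e' : 1 - P₁.toReal / P.toReal = P₂.toReal / P.toReal := by field_simp; linarith
  have hm : ∀ Q : ℝ≥0∞, Q ≠ ∞ → P * ENNReal.ofReal (Q.toReal / P.toReal) = Q := fun Q hQ => by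
    rw [ENNReal.ofReal_div_of_pos hPr, ENNReal.ofReal_toReal hQ, ENNReal.ofReal_toReal hP',
      ENNReal.mul_div_cancel h0 hP']
  have p2 : 0 ≤ P₂.toReal := ENNReal.toReal_nonneg
  rw [e, avg_coin (by positivity) (div_le_one_of_le₀ (by linarith) hPr.le), e', mul_add, ← mul_assoc,
    ← mul_assoc, hm _ h1, hm _ h2]

end exact

/-! ### Sampling the starting point -/

/-- Initialise the box at one coordinate. -/
def initBody : Prog := blk (.store 15 11) [.bin .add 17 15 0, .store 17 1, .bin .add 15 15 10,
  .bin .sub 14 14 10]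

/-- Initialise the box. -/
def initBox : Prog := .seq (blk (.const 10 1) [.const 11 0, .bin .add 12 0 0, .bin .add 15 12 11,
  .bin .add 14 0 11]) (.while 14 initBody)

/-- Pass to the half of the box that is given by `reg 61`. -/
def chooseHalf : Prog := .seq (.ite 61 (blk (.bin .add 19 60 11) [])
  (blk (.bin .add 18 60 11) [.store 15 60, .store 17 19]))
  (blk (.bin .sub 61 19 18) [.bin .lt 16 10 61])

/-- Choose one half of the box in one coordinate. -/
def bisect : Prog :=
  .seq (blk (.query 0 12) [.bin .add 60 18 19, .const 61 2, .bin .div 60 60 61, .store 17 60,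
      .query 1 12])
    (.seq (.instr (.flip 61 1 0)) chooseHalf)

/-- Determine one coordinate. -/
def searchBody : Prog :=
  .seq (blk (.bin .add 17 15 0) [.load 18 15, .load 19 17, .bin .sub 61 19 18, .bin .lt 16 10 61])
    (.seq (.while 16 bisect) (blk (.bin .add 15 15 10) [.bin .sub 14 14 10]))

/-- Determine all coordinates. -/
def search : Prog := .seq (blk (.bin .add 15 12 11) [.bin .add 14 0 11]) (.while 14 searchBody)

/-- Sample a grid point from the initial data, and store it from address `2 (reg 0)` on. -/
def locate : Prog := .seq initBox search

/-- The states during the execution of `walk`, with a box at the addresses from `2 d` on. -/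
structure GridSt (d n : ℕ) (s : State) (lo hi : Fin d → ℕ) (s' : State) : Prop where
  mem_lo : ∀ j : Fin d, s'.mem (2 * d + j) = lo j
  mem_hi : ∀ j : Fin d, s'.mem (3 * d + j) = hi j
  mem : ∀ a < 2 * d, s'.mem a = s.mem a
  reg : ∀ x, (x < 4 ∨ x = 8 ∨ x = 9 ∨ 70 ≤ x) → s'.reg x = s.reg x
  r0 : s'.reg 0 = d
  r1 : s'.reg 1 = n
  r10 : s'.reg 10 = 1
  r11 : s'.reg 11 = 0
  r12 : s'.reg 12 = 2 * d

section locate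
variable {d n : ℕ} {s s' : State} {lo hi : Fin d → ℕ}

lemma GridSt.put (h : GridSt d n s lo hi s') {x v : ℕ}
    (hx : (4 ≤ x ∧ x < 8) ∨ (13 ≤ x ∧ x < 70)) : GridSt d n s lo hi (s'.put x v) where
  mem_lo := h.mem_lo
  mem_hi := h.mem_hi
  mem := h.mem
  reg y hy := by rw [State.put_reg, if_neg (by omega), h.reg y hy]
  r0 := by rw [State.put_reg, if_neg (by omega), h.r0]
  r1 := by rw [State.put_reg, if_neg (by omega), h.r1]
  r10 := by rw [State.put_reg, if_neg (by omega), h.r10]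
  r11 := by rw [State.put_reg, if_neg (by omega), h.r11]
  r12 := by rw [State.put_reg, if_neg (by omega), h.r12]

lemma GridSt.ask (h : GridSt d n s lo hi s') {r : ℕ} {v : ℝ} : GridSt d n s lo hi (s'.ask r v) :=
  ⟨h.mem_lo, h.mem_hi, h.mem, h.reg, h.r0, h.r1, h.r10, h.r11, h.r12⟩

lemma GridSt.poke_lo (h : GridSt d n s lo hi s') {j : Fin d} {a v : ℕ} (ha : a = 2 * d + j) :
    GridSt d n s (Function.update lo j v) hi (s'.poke a v) where
  mem_lo i := by
    subst ha
    rw [State.poke_mem, Function.update_apply]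
    by_cases hi : i = j
    · rw [if_pos (by rw [hi]), if_pos hi]
    · rw [if_neg (fun e => hi (Fin.ext (by omega))), if_neg hi, h.mem_lo]
  mem_hi i := by rw [State.poke_mem, if_neg (by omega), h.mem_hi]
  mem b hb := by rw [State.poke_mem, if_neg (by omega), h.mem b hb]
  reg := h.reg
  r0 := h.r0
  r1 := h.r1
  r10 := h.r10
  r11 := h.r11
  r12 := h.r12

lemma GridSt.poke_hi (h : GridSt d n s lo hi s') {j : Fin d} {a v : ℕ} (ha : a = 3 * d + j) :
    GridSt d n s lo (Function.update hi j v) (s'.poke a v) where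
  mem_hi i := by
    subst ha
    rw [State.poke_mem, Function.update_apply]
    by_cases hi : i = j
    · rw [if_pos (by rw [hi]), if_pos hi]
    · rw [if_neg (fun e => hi (Fin.ext (by omega))), if_neg hi, h.mem_hi]
  mem_lo i := by rw [State.poke_mem, if_neg (by omega), h.mem_lo]
  mem b hb := by rw [State.poke_mem, if_neg (by omega), h.mem b hb]
  reg := h.reg
  r0 := h.r0
  r1 := h.r1
  r10 := h.r10
  r11 := h.r11
  r12 := h.r12

variable [NeZero n] (p₀ : PMF (Fin d → ZMod n))

/-- The integral of `g` over a box. -/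
def boxE (lo hi : Fin d → ℕ) (g : (Fin d → ZMod n) → ℝ≥0∞) : ℝ≥0∞ :=
  ∑ k with ∀ j, lo j ≤ (k j).val ∧ (k j).val < hi j, p₀ k * g k

variable {p₀}

lemma boxE_add (lo hi : Fin d → ℕ) (g g' : (Fin d → ZMod n) → ℝ≥0∞) :
    boxE p₀ lo hi (fun x => g x + g' x) = boxE p₀ lo hi g + boxE p₀ lo hi g' := by
  simp only [boxE, mul_add, Finset.sum_add_distrib]

lemma boxE_const (lo hi : Fin d → ℕ) (c : ℝ≥0∞) :
    boxE p₀ lo hi (fun _ => c) = boxE p₀ lo hi (fun _ => 1) * c := by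
  simp only [boxE, mul_one, Finset.sum_mul]

lemma boxE_one_ne_top (lo hi : Fin d → ℕ) : boxE p₀ lo hi (fun _ => 1) ≠ ∞ :=
  ENNReal.sum_ne_top.2 fun k _ => by rw [mul_one]; exact p₀.apply_ne_top k

lemma boxE_split {j : Fin d} {a b c : ℕ} (hab : a ≤ b) (hbc : b ≤ c)
    (g : (Fin d → ZMod n) → ℝ≥0∞) :
    boxE p₀ (Function.update lo j a) (Function.update hi j b) g +
      boxE p₀ (Function.update lo j b) (Function.update hi j c) g =
    boxE p₀ (Function.update lo j a) (Function.update hi j c) g := by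
  rw [boxE, boxE, boxE, ← Finset.sum_union]
  · congr 1
    ext k
    simp only [Finset.mem_union, Finset.mem_filter, Finset.mem_univ, true_and]
    constructor
    · rintro (h | h) <;> intro i <;> have := h i <;> by_cases hi : i = j
      all_goals simp only [Function.update_apply, hi, if_true, if_false] at this ⊢; omega
    · intro h
      have hj := h j
      simp only [Function.update_self] at hj
      rcases lt_or_ge (k j).val b with hc | hc
      · left
        intro i
        have := h i
        by_cases hi : i = j
        · subst hi; simp only [Function.update_self]; omega
        · simpa [Function.update_apply, hi] using this
      · right
        intro i
        have := h i
        by_cases hi : i = j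
        · subst hi; simp only [Function.update_self]; omega
        · simpa [Function.update_apply, hi] using this
  · rw [Finset.disjoint_left]
    intro k hk hk'
    have h1 := (Finset.mem_filter.1 hk).2 j
    have h2 := (Finset.mem_filter.1 hk').2 j
    simp only [Function.update_self] at h1 h2
    omega

lemma gridEnv_boxSum (w : ℕ) (σ : ℝ) (lo hi : Fin d → ℕ) :
    (gridEnv w fun k => σ * (p₀ k).toReal).boxSum lo hi =
      σ * (boxE p₀ lo hi fun _ => 1).toReal := by
  change ∑ k : Fin d → ZMod n with ∀ j, lo j ≤ (k j).val ∧ (k j).val < hi j, σ * (p₀ k).toReal = _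
  rw [boxE, ENNReal.toReal_sum fun k _ => by rw [mul_one]; exact p₀.apply_ne_top k,
    Finset.mul_sum]
  simp

/-- The states during the search in coordinate `j`. -/
structure BisectSt (d n : ℕ) (s : State) (lo hi : Fin d → ℕ) (j : Fin d) (r a b : ℕ)
    (s' : State) : Prop where
  grid : GridSt d n s (Function.update lo j a) (Function.update hi j b) s'
  r14 : s'.reg 14 = r
  r15 : s'.reg 15 = 2 * d + j
  r17 : s'.reg 17 = 3 * d + j
  r18 : s'.reg 18 = a
  r19 : s'.reg 19 = b
  r16 : s'.reg 16 = if 1 < b - a then 1 else 0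

variable {w : ℕ} {σ : ℝ} {k : List Prog} {F : State → ℝ≥0∞}

/-- Even the larger half has a rounded-up logarithm that is smaller by one. -/
lemma clog_half {a b c : ℕ} (h : 2 ≤ b) (h1 : a ≤ (b + 1) / 2) (hc : Nat.clog 2 b ≤ c) :
    Nat.clog 2 a + 1 ≤ c := by
  rw [Nat.clog_of_two_le (by norm_num) h] at hc
  have := Nat.clog_mono_right 2 (show a ≤ (b + 2 - 1) / 2 by omega)
  omega

/-- Bisection in one coordinate. The bound is weighted by the mass of the current box, so
conditional probabilities never appear and the two halves add up to the whole box. -/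
lemma ex_bisect_le (hσ : 0 < σ) (hw : 4 * (d + n + 2) < 2 ^ w) {j : Fin d} {r : ℕ}
    (g : (Fin d → ZMod n) → ℝ≥0∞)
    (hk : ∀ y < n, ∀ s', BisectSt d n s lo hi j r y (y + 1) s' →
      boxE p₀ (Function.update lo j y) (Function.update hi j (y + 1)) (fun _ => 1) *
        ex (gridEnv w fun k => σ * (p₀ k).toReal) unitCost k F s' ≤
      boxE p₀ (Function.update lo j y) (Function.update hi j (y + 1)) g)
    {c : ℕ} {a b : ℕ} (hab : a < b) (hb : b ≤ n) (hc : Nat.clog 2 (b - a) ≤ c)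
    (hs : BisectSt d n s lo hi j r a b s') :
    boxE p₀ (Function.update lo j a) (Function.update hi j b) (fun _ => 1) *
        ex (gridEnv w fun k => σ * (p₀ k).toReal) unitCost (.while 16 bisect :: k) F s' ≤
      boxE p₀ (Function.update lo j a) (Function.update hi j b) (fun _ => 1) * (25 * c + 1 : ℕ) +
      boxE p₀ (Function.update lo j a) (Function.update hi j b) g := by
  set M := gridEnv w fun k => σ * (p₀ k).toReal with hM
  have hMw : 4 * (d + n + 2) < 2 ^ M.w := hw
  induction c generalizing a b s' with
  | zero =>
    have h1 : b - a ≤ 1 := by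
      by_contra h
      have := Nat.clog_pos (b := 2) (by norm_num) (show 1 < b - a by omega)
      omega
    obtain rfl : b = a + 1 := by omega
    rw [ex_while, hs.r16, if_neg (by omega : ¬ 1 < a + 1 - a), if_neg (not_not.2 rfl), mul_add]
    exact add_le_add (by simp [unitCost]) (hk a (by omega) s' hs)
  | succ c ih =>
    rcases Nat.lt_or_ge 1 (b - a) with h1 | h1
    swap
    · refine (ih hab hb ?_ hs).trans ?_
      · rw [Nat.clog_of_right_le_one (by omega)]
        omega
      · gcongr
        omega
    rw [ex_while, hs.r16, if_pos h1, if_pos one_ne_zero,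
      show ex M unitCost (bisect :: .while 16 bisect :: k) F s' = _ from ex_seq _ _ _ _]
    set mid := (a + b) / 2 with hmid
    have hg := hs.grid
    have hj := j.2
    set P := boxE p₀ (Function.update lo j a) (Function.update hi j b) (fun _ => 1) with hP
    set P₁ := boxE p₀ (Function.update lo j a) (Function.update hi j mid) (fun _ => 1) with hP₁
    set P₂ := boxE p₀ (Function.update lo j mid) (Function.update hi j b) (fun _ => 1) with hP₂
    have hPs : P₁ + P₂ = P := boxE_split (by omega) (by omega) _
    have hup : ∀ {S : State} {u v : ℕ}, GridSt d n s (Function.update lo j u)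
        (Function.update (Function.update hi j v) j mid) S →
        GridSt d n s (Function.update lo j u) (Function.update hi j mid) S := fun h => by
      rwa [Function.update_idem] at h
    have e0 : M.boxSum (fun j => s'.mem (2 * d + j)) (fun j => s'.mem (2 * d + M.d + j)) =
        σ * P.toReal := by
      rw [← gridEnv_boxSum w σ]
      congr 1
      · exact funext hg.mem_lo
      · exact funext fun i => by
          rw [show 2 * d + M.d + (i : ℕ) = 3 * d + i by
            change 2 * d + d + (i : ℕ) = _; omega]
          exact hg.mem_hi i
    generalize hT : (((((s'.ask 0 (σ * P.toReal)).put 60 (a + b)).put 61 2).put 60 mid).poke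
      (3 * d + j) mid) = T
    have gT : GridSt d n s (Function.update lo j a) (Function.update hi j mid) T := by
      rw [← hT]
      exact hup ((((hg.ask.put (by omega)).put (by omega)).put (by omega)).poke_hi rfl)
    have e1 : M.boxSum (fun j => T.mem (2 * d + j)) (fun j => T.mem (2 * d + M.d + j)) =
        σ * P₁.toReal := by
      rw [← gridEnv_boxSum w σ]
      congr 1
      · exact funext gT.mem_lo
      · exact funext fun i => by
          rw [show 2 * d + M.d + (i : ℕ) = 3 * d + i by
            change 2 * d + d + (i : ℕ) = _; omega]
          exact gT.mem_hi i
    have t14 : T.reg 14 = r := by rw [← hT]; exact hs.r14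
    have t15 : T.reg 15 = 2 * d + j := by rw [← hT]; exact hs.r15
    have t17 : T.reg 17 = 3 * d + j := by rw [← hT]; exact hs.r17
    have t18 : T.reg 18 = a := by rw [← hT]; exact hs.r18
    have t19 : T.reg 19 = b := by rw [← hT]; exact hs.r19
    have t60 : T.reg 60 = mid := by rw [← hT]; rfl
    have hr : Runs M s' [.query 0 12, .bin .add 60 18 19, .const 61 2, .bin .div 60 60 61,
        .store 17 60, .query 1 12] (T.ask 1 (σ * P₁.toReal)) := by
      refine .cons trivial (Instr.detExec_query hg.r12 e0) <|
        .cons trivial (Instr.detExec_bin (v := a + b) (by exact hs.r18) (by exact hs.r19) rfl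
          (by omega)) <|
        .cons trivial (Instr.detExec_const (by omega)) <|
        .cons trivial (Instr.detExec_bin (v := mid) rfl rfl rfl (by omega)) <|
        .cons trivial (Instr.detExec_store (v := mid) (by exact hs.r17) rfl) <|
        .cons trivial (Instr.detExec_query (v := σ * P₁.toReal) (a := 2 * d) (by exact hg.r12) ?_) ?_
      · rw [hT]; exact e1
      · rw [hT]; exact .nil
    rw [ex_runs hr, ex_seq, ex_instr, Instr.exec, avg_map]
    set S := T.ask 1 (σ * P₁.toReal) with hS
    have q1 : S.real 1 = σ * P₁.toReal := rfl
    have q0 : S.real 0 = σ * P.toReal := by rw [hS, ← hT]; rfl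
    have c1 : Nat.clog 2 (mid - a) ≤ c := by
      have := clog_half (a := mid - a) (b := b - a) (by omega) (by omega) hc
      omega
    have c2 : Nat.clog 2 (b - mid) ≤ c := by
      have := clog_half (a := b - mid) (b := b - a) (by omega) (by omega) hc
      omega
    have h1' : P₁ * ex M unitCost (chooseHalf :: .while 16 bisect :: k) F
          (S.setReg M 61 1) ≤ P₁ * (25 * c + 7 : ℕ) +
        boxE p₀ (Function.update lo j a) (Function.update hi j mid) g := by
      have hr1 : Runs M (S.setReg M 61 1) [.bin .add 19 60 11] _ :=
        .cons trivial (Instr.detExec_bin (v := mid) (by exact t60) (by exact gT.r11) rfl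
          (by omega)) .nil
      have hr2 : Runs M ((S.setReg M 61 1).put 19 mid) [.bin .sub 61 19 18, .bin .lt 16 10 61] _ :=
        .cons trivial (Instr.detExec_bin (v := mid - a) rfl (by exact t18) rfl (by omega)) <|
        .cons trivial (Instr.detExec_bin (v := if 1 < mid - a then 1 else 0) (by exact gT.r10) rfl rfl
          (by split_ifs <;> omega)) .nil
      rw [chooseHalf, ex_seq, ex_ite, if_pos (by rw [State.setReg_of_lt (by omega)]; exact one_ne_zero),
        ex_runs hr1, ex_runs hr2]
      have := ih (a := a) (b := mid) (by omega) (by omega) c1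
        (s' := (((S.setReg M 61 1).put 19 mid).put 61 (mid - a)).put 16
          (if 1 < mid - a then 1 else 0)) ⟨?_, ?_, ?_, ?_, ?_, rfl, rfl⟩
      · simp only [mul_add]
        calc _ ≤ P₁ * unitCost _ + (P₁ * unitCost _ + (P₁ * blkCost unitCost _ _ +
              (P₁ * blkCost unitCost _ _ + (P₁ * (25 * c + 1 : ℕ) + _)))) := by gcongr
          _ = _ := by
            simp only [blkCost_unitCost, unitCost]
            push_cast
            simp only [List.length_nil, List.length_cons]
            push_cast
            ring
      · rw [State.setReg_of_lt (by omega)]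
        exact (((gT.ask.put (by omega)).put (by omega)).put (by omega)).put (by omega)
      · exact t14
      · exact t15
      · exact t17
      · exact t18
    have h2' : P₂ * ex M unitCost (chooseHalf :: .while 16 bisect :: k) F
          (S.setReg M 61 0) ≤ P₂ * (25 * c + 11 : ℕ) +
        boxE p₀ (Function.update lo j mid) (Function.update hi j b) g := by
      have hr1 : Runs M (S.setReg M 61 0) [.bin .add 18 60 11, .store 15 60, .store 17 19] _ :=
        .cons trivial (Instr.detExec_bin (v := mid) (by exact t60) (by exact gT.r11) rfl
          (by omega)) <|
        .cons trivial (Instr.detExec_store (by exact t15) (by exact t60)) <|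
        .cons trivial (Instr.detExec_store (by exact t17) (by exact t19)) .nil
      have hr2 : Runs M ((((S.setReg M 61 0).put 18 mid).poke (2 * d + j) mid).poke (3 * d + j) b)
          [.bin .sub 61 19 18, .bin .lt 16 10 61] _ :=
        .cons trivial (Instr.detExec_bin (v := b - mid) (by exact t19) rfl rfl (by omega)) <|
        .cons trivial (Instr.detExec_bin (v := if 1 < b - mid then 1 else 0) (by exact gT.r10) rfl rfl
          (by split_ifs <;> omega)) .nil
      rw [chooseHalf, ex_seq, ex_ite, if_neg (by rw [State.setReg_of_lt (by omega)]; exact not_not.2 rfl),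
        ex_runs hr1, ex_runs hr2]
      have := ih (a := mid) (b := b) (by omega) (by omega) c2
        (s' := (((((S.setReg M 61 0).put 18 mid).poke (2 * d + j) mid).poke (3 * d + j) b).put 61
          (b - mid)).put 16 (if 1 < b - mid then 1 else 0)) ⟨?_, ?_, ?_, ?_, rfl, ?_, rfl⟩
      · simp only [mul_add]
        calc _ ≤ P₂ * unitCost _ + (P₂ * unitCost _ + (P₂ * blkCost unitCost _ _ +
              (P₂ * blkCost unitCost _ _ + (P₂ * (25 * c + 1 : ℕ) + _)))) := by gcongr
          _ = _ := by
            simp only [blkCost_unitCost, unitCost]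
            push_cast
            simp only [List.length_nil, List.length_cons]
            push_cast
            ring
      · rw [State.setReg_of_lt (by omega)]
        have := (((((gT.ask (r := 1) (v := σ * P₁.toReal)).put (x := 61) (v := 0) (by omega)).put
          (x := 18) (v := mid) (by omega)).poke_lo (j := j) (v := mid) rfl).poke_hi (j := j) (v := b) rfl).put
          (x := 61) (v := b - mid) (by omega) |>.put (x := 16)
          (v := if 1 < b - mid then 1 else 0) (by omega)
        rw [Function.update_idem, Function.update_idem] at this
        exact this
      · exact t14
      · exact t15
      · exact t17
      · exact t19
    -- The coin has the conditional probability of the lower half, so the weighted value splits into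
    -- the values of the halves.
    have hcoin := mul_avg_coin hσ hPs (boxE_one_ne_top _ _) fun v => ex M unitCost
      (chooseHalf :: .while 16 bisect :: k) F (S.setReg M 61 v)
    rw [q1, q0]
    simp only [mul_add]
    rw [hcoin, ← boxE_split (lo := lo) (hi := hi) (j := j) (by omega : a ≤ mid)
      (by omega : mid ≤ b) g]
    calc _ ≤ P * unitCost _ + (P * unitCost _ + (P * blkCost unitCost _ _ + (P * unitCost _ +
          (P * unitCost _ + ((P₁ * (25 * c + 7 : ℕ) + _) + (P₂ * (25 * c + 11 : ℕ) + _)))))) := by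
          gcongr
      _ ≤ P * unitCost _ + (P * unitCost _ + (P * blkCost unitCost _ _ + (P * unitCost _ +
          (P * unitCost _ + ((P₁ * (25 * c + 11 : ℕ) +
            boxE p₀ (Function.update lo j a) (Function.update hi j mid) g) +
            (P₂ * (25 * c + 11 : ℕ) +
            boxE p₀ (Function.update lo j mid) (Function.update hi j b) g)))))) := by
          gcongr
          omega
      _ = _ := by
        rw [← hPs]
        simp only [blkCost_unitCost, unitCost, List.length_nil, List.length_cons]
        push_cast
        ring

end locate

section locate
variable {d n : ℕ} {s s' : State} {lo hi : Fin d → ℕ} [NeZero n] {p₀ : PMF (Fin d → ZMod n)}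
  {w : ℕ} {σ : ℝ} {k : List Prog} {F : State → ℝ≥0∞}

/-- The states during the search when `r` coordinates are left. -/
structure SearchSt (d n : ℕ) (s : State) (lo hi : Fin d → ℕ) (r : ℕ) (s' : State) : Prop where
  grid : GridSt d n s lo hi s'
  r14 : s'.reg 14 = r
  r15 : s'.reg 15 + r = 3 * d
  todo : ∀ j : Fin d, d ≤ j + r → lo j = 0 ∧ hi j = n
  done : ∀ j : Fin d, j + r < d → hi j = lo j + 1 ∧ lo j < n

/-- The states in which the grid point `x` is stored at the addresses from `2 d` on. -/
def PointSt (d n : ℕ) (s : State) (x : Fin d → ZMod n) (s' : State) : Prop :=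
  ∃ hi, GridSt d n s (fun j => (x j).val) hi s'

lemma boxE_natCast (lo hi : Fin d → ℕ) (c : ℕ) :
    boxE p₀ lo hi (fun _ => (c : ℝ≥0∞)) = boxE p₀ lo hi (fun _ => 1) * c :=
  boxE_const lo hi _

lemma boxE_point {x : Fin d → ZMod n} (g : (Fin d → ZMod n) → ℝ≥0∞) :
    boxE p₀ (fun j => (x j).val) (fun j => (x j).val + 1) g = p₀ x * g x := by
  rw [boxE]
  refine Finset.sum_eq_single_of_mem x (by simp) fun y hy hne => absurd ?_ hne
  funext j
  have := (Finset.mem_filter.1 hy).2 j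
  exact ZMod.val_injective n (by omega : (y j).val = (x j).val)

/-- Finished coordinates have width one and the others full width. In the end the box is a single
point, weighted by its probability. -/
lemma ex_search_le (hσ : 0 < σ) (hw : 4 * (d + n + 2) < 2 ^ w) (G : (Fin d → ZMod n) → ℝ≥0∞)
    (hk : ∀ x s', PointSt d n s x s' →
      ex (gridEnv w fun k => σ * (p₀ k).toReal) unitCost k F s' ≤ G x)
    {r : ℕ} (hr : r ≤ d) (hs : SearchSt d n s lo hi r s') :
    boxE p₀ lo hi (fun _ => 1) *
        ex (gridEnv w fun k => σ * (p₀ k).toReal) unitCost (.while 14 searchBody :: k) F s' ≤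
      boxE p₀ lo hi (fun x => (r * (25 * Nat.clog 2 n + 16) + 1 : ℕ) + G x) := by
  set M := gridEnv w fun k => σ * (p₀ k).toReal with hM
  have hMw : 4 * (d + n + 2) < 2 ^ M.w := hw
  induction r generalizing lo hi s' with
  | zero =>
    rw [ex_while, hs.r14, if_neg (not_not.2 rfl)]
    have hlo : ∀ j, lo j < n := fun j => (hs.done j (by omega)).2
    obtain ⟨x, rfl⟩ : ∃ x : Fin d → ZMod n, lo = fun j => (x j).val :=
      ⟨fun j => (lo j : ZMod n), funext fun j => by
        rw [ZMod.val_natCast, Nat.mod_eq_of_lt (hlo j)]⟩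
    obtain rfl : hi = fun j => (x j).val + 1 := funext fun j => (hs.done j (by omega)).1
    rw [boxE_point, boxE_point, mul_one]
    gcongr
    · simp [unitCost]
    · exact hk x s' ⟨_, hs.grid⟩
  | succ r ih =>
    rw [ex_while, hs.r14, if_pos (Nat.succ_ne_zero r),
      show ex M unitCost (searchBody :: .while 14 searchBody :: k) F s' = _ from ex_seq _ _ _ _]
    set j : Fin d := ⟨d - (r + 1), by omega⟩ with hj
    have hjr : (j : ℕ) + (r + 1) = d := by simp only [hj]; omega
    have hg := hs.grid
    have hn : 0 < n := Nat.pos_of_neZero n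
    have r15 : s'.reg 15 = 2 * d + j := by have := hs.r15; omega
    obtain ⟨hlo, hhi⟩ := hs.todo j (by omega)
    have hr1 : Runs M s' [.bin .add 17 15 0, .load 18 15, .load 19 17, .bin .sub 61 19 18,
        .bin .lt 16 10 61] _ :=
      .cons trivial (Instr.detExec_bin (v := 3 * d + j) r15 hg.r0
        (show 2 * d + j + d = 3 * d + j by omega) (by omega)) <|
      .cons trivial (Instr.detExec_load (v := 0) (by exact r15) (by exact (hg.mem_lo j).trans hlo)
        (by omega)) <|
      .cons trivial (Instr.detExec_load (v := n) rfl (by exact (hg.mem_hi j).trans hhi)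
        (by omega)) <|
      .cons trivial (Instr.detExec_bin (v := n) rfl rfl rfl (by omega)) <|
      .cons trivial (Instr.detExec_bin (v := if 1 < n - 0 then 1 else 0) (by exact hg.r10) rfl rfl
        (by split_ifs <;> omega)) .nil
    rw [ex_runs hr1, ex_seq]
    generalize hS : State.put _ 16 _ = S
    have hup : ∀ v : ℕ, Function.update lo j (lo j) = lo := fun _ => Function.update_eq_self _ _
    have eb : Function.update lo j 0 = lo ∧ Function.update hi j n = hi := by
      rw [← hlo, ← hhi]
      exact ⟨Function.update_eq_self _ _, Function.update_eq_self _ _⟩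
    have hB : BisectSt d n s lo hi j (r + 1) 0 n S := by
      refine ⟨?_, ?_, ?_, ?_, ?_, ?_, ?_⟩
      · rw [eb.1, eb.2, ← hS]
        exact ((((hg.put (by omega)).put (by omega)).put (by omega)).put (by omega)).put (by omega)
      · rw [← hS]; exact hs.r14
      · rw [← hS]; exact r15
      all_goals rw [← hS]; rfl
    have key := ex_bisect_le (p₀ := p₀) (lo := lo) (hi := hi) (s := s) (F := F) (σ := σ) (w := w)
      (k := blk (.bin .add 15 15 10) [.bin .sub 14 14 10] :: .while 14 searchBody :: k)
      hσ hw (j := j) (r := r + 1)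
      (fun x => (3 : ℕ) + ((r * (25 * Nat.clog 2 n + 16) + 1 : ℕ) + G x)) ?_ hn le_rfl le_rfl hB
    · rw [eb.1, eb.2] at key
      simp only [mul_add]
      calc _ ≤ boxE p₀ lo hi (fun _ => 1) * unitCost _ + (boxE p₀ lo hi (fun _ => 1) * unitCost _ +
            (boxE p₀ lo hi (fun _ => 1) * blkCost unitCost _ _ +
              (boxE p₀ lo hi (fun _ => 1) * unitCost _ +
              (boxE p₀ lo hi (fun _ => 1) * (25 * Nat.clog 2 (n - 0) + 1 : ℕ) + _)))) := by gcongr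
        _ = _ := by
          simp only [boxE_add, boxE_natCast]
          simp only [blkCost_unitCost, unitCost, List.length_nil, List.length_cons, Nat.sub_zero]
          push_cast
          ring
    · intro y hy U hU
      have u15 : U.reg 15 = 2 * d + j := hU.r15
      have hr2 : Runs M U [.bin .add 15 15 10, .bin .sub 14 14 10] _ :=
        .cons trivial (Instr.detExec_bin (v := 2 * d + j + 1) hU.r15 hU.grid.r10 rfl (by omega)) <|
        .cons trivial (Instr.detExec_bin (v := r) (by exact hU.r14) (by exact hU.grid.r10) rfl
          (by omega)) .nil
      rw [ex_runs hr2, mul_add, boxE_add]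
      refine add_le_add ?_ (ih (by omega) ⟨(hU.grid.put (by omega)).put (by omega), rfl, ?_, ?_, ?_⟩)
      · rw [boxE_natCast, blkCost_unitCost]
        refine mul_le_mul_right ?_ _
        norm_num
      · change 2 * d + j + 1 + r = 3 * d
        omega
      · intro i hi'
        have hne : i ≠ j := fun h => by subst h; omega
        rw [Function.update_of_ne hne, Function.update_of_ne hne]
        exact hs.todo i (by omega)
      · intro i hi'
        by_cases hij : i = j
        · subst hij
          simp [hy]
        · rw [Function.update_of_ne hij, Function.update_of_ne hij]
          refine hs.done i ?_
          have : (i : ℕ) ≠ j := fun h => hij (Fin.ext h)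
          omega

/-- The states during the initialisation when `r` coordinates are left. -/
structure InitSt (d n : ℕ) (s : State) (r : ℕ) (s' : State) : Prop where
  mem_lo : ∀ j : Fin d, j + r < d → s'.mem (2 * d + j) = 0
  mem_hi : ∀ j : Fin d, j + r < d → s'.mem (3 * d + j) = n
  mem : ∀ a < 2 * d, s'.mem a = s.mem a
  reg : ∀ x, (x < 4 ∨ x = 8 ∨ x = 9 ∨ 70 ≤ x) → s'.reg x = s.reg x
  r0 : s'.reg 0 = d
  r1 : s'.reg 1 = n
  r10 : s'.reg 10 = 1
  r11 : s'.reg 11 = 0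
  r12 : s'.reg 12 = 2 * d
  r14 : s'.reg 14 = r
  r15 : s'.reg 15 + r = 3 * d

omit [NeZero n] in
lemma InitSt.ex_le {M : Env} (hw : 4 * (d + n + 2) < 2 ^ M.w) {t : ℝ≥0∞}
    (hk : ∀ s', GridSt d n s (fun _ => 0) (fun _ => n) s' → ex M unitCost k F s' ≤ t) {r : ℕ}
    (hr : r ≤ d) (hs : InitSt d n s r s') :
    ex M unitCost (.while 14 initBody :: k) F s' ≤ (10 * r + 1 : ℕ) + t := by
  induction r generalizing s' with
  | zero =>
    rw [ex_while, hs.r14, if_neg (not_not.2 rfl)]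
    refine add_le_add (by simp [unitCost]) (hk s' ⟨fun j => hs.mem_lo j (by omega), fun j =>
      hs.mem_hi j (by omega), hs.mem, hs.reg, hs.r0, hs.r1, hs.r10, hs.r11, hs.r12⟩)
  | succ r ih =>
    obtain ⟨y, hy⟩ : ∃ y, s'.reg 15 = y := ⟨_, rfl⟩
    have hyr := hs.r15
    rw [hy] at hyr
    have hr1 : Runs M s' [.store 15 11, .bin .add 17 15 0, .store 17 1, .bin .add 15 15 10,
        .bin .sub 14 14 10] _ :=
      .cons trivial (Instr.detExec_store hy hs.r11) <|
      .cons trivial (Instr.detExec_bin (v := y + d) (by exact hy) (by exact hs.r0) rfl (by omega)) <|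
      .cons trivial (Instr.detExec_store (a := y + d) (v := n) rfl (by exact hs.r1)) <|
      .cons trivial (Instr.detExec_bin (v := y + 1) (by exact hy) (by exact hs.r10) rfl (by omega)) <|
      .cons trivial (Instr.detExec_bin (v := r) (by exact hs.r14) (by exact hs.r10) rfl
        (by omega)) .nil
    rw [ex_while, hs.r14, if_pos (Nat.succ_ne_zero r),
      show ex M unitCost (initBody :: .while 14 initBody :: k) F s' = _ from ex_runs hr1]
    have := ih (by omega) (s' := ((((s'.poke y 0).put 17 (y + d)).poke (y + d) n).put 15
      (y + 1)).put 14 r) ⟨?_, ?_, ?_, ?_, hs.r0, hs.r1, hs.r10, hs.r11, hs.r12, rfl, ?_⟩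
    · calc _ ≤ unitCost _ + (blkCost unitCost _ _ + ((10 * r + 1 : ℕ) + t)) := by gcongr
        _ = _ := by
          simp only [blkCost_unitCost, unitCost, List.length_nil, List.length_cons]
          push_cast
          ring
    · intro j hj
      simp only [State.put_mem]
      rw [State.poke_mem, if_neg (by omega), State.put_mem, State.poke_mem]
      split_ifs with h
      · rfl
      · exact hs.mem_lo j (by omega)
    · intro j hj
      simp only [State.put_mem]
      rw [State.poke_mem, State.put_mem, State.poke_mem]
      split_ifs with h h'
      · rfl
      · omega
      · exact hs.mem_hi j (by omega)
    · intro a ha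
      simp only [State.put_mem]
      rw [State.poke_mem, if_neg (by omega), State.put_mem, State.poke_mem, if_neg (by omega)]
      exact hs.mem a ha
    · intro x hx
      simp only [State.put_reg, State.poke_reg]
      rw [if_neg (by omega), if_neg (by omega), if_neg (by omega)]
      exact hs.reg x hx
    · change y + 1 + r = _
      omega

lemma boxE_all (g : (Fin d → ZMod n) → ℝ≥0∞) :
    boxE p₀ (fun _ => 0) (fun _ => n) g = avg p₀ g := by
  rw [boxE, Finset.filter_true_of_mem fun x _ j => ⟨Nat.zero_le _, ZMod.val_lt _⟩, avg,
    tsum_fintype]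

lemma samples_locate (hσ : 0 < σ) (hw : 4 * (d + n + 2) < 2 ^ w) (h0 : s.reg 0 = d)
    (h1 : s.reg 1 = n) :
    Samples (gridEnv w fun k => σ * (p₀ k).toReal) locate s p₀ (PointSt d n s)
      (d * (25 * Nat.clog 2 n + 26) + 20 : ℕ) := by
  intro F G hFG
  set M := gridEnv w fun k => σ * (p₀ k).toReal with hM
  have hMw : 4 * (d + n + 2) < 2 ^ M.w := hw
  have hr1 : Runs M s [.const 10 1, .const 11 0, .bin .add 12 0 0, .bin .add 15 12 11,
      .bin .add 14 0 11] _ :=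
    .cons trivial (Instr.detExec_const (by omega)) <|
    .cons trivial (Instr.detExec_const (by omega)) <|
    .cons trivial (Instr.detExec_bin (v := 2 * d) (by exact h0) (by exact h0)
      (show d + d = 2 * d by omega) (by omega)) <|
    .cons trivial (Instr.detExec_bin (v := 2 * d) rfl rfl rfl (by omega)) <|
    .cons trivial (Instr.detExec_bin (v := d) (by exact h0) rfl rfl (by omega)) .nil
  have hinit : InitSt d n s d (((((s.put 10 1).put 11 0).put 12 (2 * d)).put 15 (2 * d)).put 14 d) := by
    refine ⟨fun j hj => by omega, fun j hj => by omega, fun a _ => rfl, fun x hx => ?_, h0, h1, rfl,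
      rfl, rfl, rfl, ?_⟩
    · simp only [State.put_reg]
      repeat rw [if_neg (by omega)]
    · change 2 * d + d = _
      omega
  have hsearch : ∀ s', GridSt d n s (fun _ => 0) (fun _ => n) s' →
      ex M unitCost [search] F s' ≤ (d * (25 * Nat.clog 2 n + 16) + 5 : ℕ) + avg p₀ G := by
    intro s' hs'
    have hr2 : Runs M s' [.bin .add 15 12 11, .bin .add 14 0 11] _ :=
      .cons trivial (Instr.detExec_bin (v := 2 * d) hs'.r12 hs'.r11 rfl (by omega)) <|
      .cons trivial (Instr.detExec_bin (v := d) (by exact hs'.r0) (by exact hs'.r11) rfl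
        (by omega)) .nil
    have key := ex_search_le (p₀ := p₀) (k := []) (F := F) hσ hw G
      (fun x S hS => by rw [ex_nil]; exact hFG x S hS)
      le_rfl (s := s) (lo := fun _ => 0) (hi := fun _ => n) (s' := (s'.put 15 (2 * d)).put 14 d)
      ⟨(hs'.put (by omega)).put (by omega), rfl, show 2 * d + d = 3 * d by omega,
        fun _ _ => ⟨rfl, rfl⟩, fun j hj => by omega⟩
    rw [boxE_all, boxE_all, avg_const, one_mul, avg_add, avg_const] at key
    rw [search, ex_seq, ex_runs hr2]
    calc _ ≤ unitCost _ + (blkCost unitCost _ _ +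
          ((d * (25 * Nat.clog 2 n + 16) + 1 : ℕ) + avg p₀ G)) := by gcongr
      _ = _ := by
        simp only [blkCost_unitCost, unitCost, List.length_nil, List.length_cons]
        push_cast
        ring
  have key := InitSt.ex_le (k := [search]) (F := F) hMw hsearch le_rfl hinit
  rw [locate, ex_seq, initBox, ex_seq, ex_runs hr1]
  calc _ ≤ unitCost _ + (unitCost _ + (blkCost unitCost _ _ + ((10 * d + 1 : ℕ) +
        ((d * (25 * Nat.clog 2 n + 16) + 5 : ℕ) + avg p₀ G)))) := by gcongr
    _ = (d * (25 * Nat.clog 2 n + 26) + 17 : ℕ) + avg p₀ G := by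
      simp only [blkCost_unitCost, unitCost, List.length_nil, List.length_cons]
      push_cast
      ring
    _ ≤ _ := by
      gcongr
      omega

end locate

/-! ### Counting calls -/

/-- The number of nodes of a program. -/
def Prog.size : Prog → ℕ
  | .instr _ => 1
  | .seq p q => p.size + q.size + 1
  | .ite _ p q => p.size + q.size + 1
  | .while _ p => p.size + 1

open Classical in
/-- The cost that counts the calls of `Q`. -/
def callCost (Q : Prog) : Prog → ℝ≥0∞ := fun p => if p = Q then 1 else 0

section calls
variable {M : Env} {k : List Prog} {F : State → ℝ≥0∞} {s : State} {Q P : Prog} {c : ℝ≥0∞}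

lemma expectedCalls_eq (P : Prog) (s : State) (Q : Prog) :
    expectedCalls M P s Q = ex M (callCost Q) [P] 0 s := by
  rw [expectedCalls_eq_ex]
  congr 1

lemma callCost_of_size_ne (h : P.size ≠ Q.size) : callCost Q P = 0 :=
  if_neg fun e => h (by rw [e])

/-- Code that is smaller than `Q` does not contain `Q`. This reduces the absence of calls to a
computation of sizes. -/
lemma ex_callCost_of_size_lt (hk : ∀ p ∈ k, p.size < Q.size) (s : State) :
    ex M (callCost Q) k 0 s = 0 := by
  rw [ex_congr_cost (γ' := 0) {p | p.size < Q.size} ?_ ?_ ?_ ?_ k hk]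
  · exact ex_zero_zero k s
  · intro p q h
    simp only [Set.mem_ofPred_eq, Prog.size] at h ⊢
    omega
  · intro x p q h
    simp only [Set.mem_ofPred_eq, Prog.size] at h ⊢
    omega
  · intro x p h
    simp only [Set.mem_ofPred_eq, Prog.size] at h ⊢
    omega
  · intro p (h : p.size < Q.size)
    exact callCost_of_size_ne h.ne

/-- A run of `Q` counts itself once; both of its halves are smaller than `Q`. -/
lemma ex_callCost_seq (p q : Prog) (s : State) :
    ex M (callCost (.seq p q)) [.seq p q] 0 s = 1 := by
  have hp : p.size < (Prog.seq p q).size := by simp only [Prog.size]; omega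
  have hq : q.size < (Prog.seq p q).size := by simp only [Prog.size]; omega
  rw [ex_seq, ex_callCost_of_size_lt (by simp [hp, hq]), add_zero, callCost, if_pos rfl]

lemma blkCost_callCost {i : Instr} {is : List Instr} (h : (blk i is).size < Q.size) :
    blkCost (callCost Q) i is = 0 := by
  induction is generalizing i with
  | nil => exact callCost_of_size_ne h.ne
  | cons j js ih =>
    rw [blkCost]
    rw [blk] at h
    have h' := h
    simp only [Prog.size] at h'
    rw [callCost_of_size_ne h.ne, callCost_of_size_ne (by simp only [Prog.size]; omega),
      ih (by omega)]
    simp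

end calls

/-! ### The endpoint of the walk -/

/-- Walk in one coordinate. -/
def moveBody : Prog :=
  .seq (blk (.bin .add 4 62 11) [.bin .add 5 10 11, .bin .add 6 63 11]) (.seq binom
    (.seq (blk (.bin .add 64 7 11) [.bin .add 4 7 11, .bin .add 5 10 11, .const 6 2]) (.seq binom
      (blk (.bin .sub 62 62 64) [.bin .sub 64 64 7, .bin .sub 65 1 10, .bin .mul 64 64 65,
        .load 66 15, .bin .add 66 66 7, .bin .add 66 66 64, .bin .mod 66 66 1, .store 15 66,
        .bin .add 15 15 10, .bin .sub 63 63 10]))))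

/-- Walk in all coordinates. -/
def move : Prog := .seq (blk (.bin .add 62 2 11) [.bin .add 63 0 11, .bin .add 15 12 11])
  (.while 63 moveBody)

/-- Sample the endpoint of a random walk of length `reg 2`, and store it from address
`2 (reg 0)` on. -/
def walk : Prog := .seq locate move

section walk
variable {d n m : ℕ} {s s' s'' : State} {lo hi : Fin d → ℕ} {x : Fin d → ZMod n} {r rem a h : ℕ}
  {M : Env} {k : List Prog} {F : State → ℝ≥0∞}

lemma GridSt.binom (h : GridSt d n s lo hi s') (hB : BinomAgree s' s'') :
    GridSt d n s lo hi s'' where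
  mem_lo j := by rw [hB.mem, h.mem_lo]
  mem_hi j := by rw [hB.mem, h.mem_hi]
  mem a ha := by rw [hB.mem, h.mem a ha]
  reg x hx := by rw [hB.reg x (by omega) (by omega), h.reg x hx]
  r0 := by rw [hB.reg 0 (by omega) (by omega), h.r0]
  r1 := by rw [hB.reg 1 (by omega) (by omega), h.r1]
  r10 := by rw [hB.reg 10 (by omega) (by omega), h.r10]
  r11 := by rw [hB.reg 11 (by omega) (by omega), h.r11]
  r12 := by rw [hB.reg 12 (by omega) (by omega), h.r12]

/-- The states during `move` when `r` coordinates and `rem` steps are left. -/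
structure MoveSt (d n m : ℕ) (s : State) (r rem : ℕ) (x : Fin d → ZMod n) (s' : State) : Prop where
  grid : PointSt d n s x s'
  r62 : s'.reg 62 = rem
  r63 : s'.reg 63 = r
  r15 : s'.reg 15 + r = 3 * d
  rem_le : rem ≤ m
  r_le : r ≤ d

lemma MoveSt.binom (h : MoveSt d n m s r rem x s') (hB : BinomAgree s' s'') :
    MoveSt d n m s r rem x s'' where
  grid := h.grid.imp fun _ hg => hg.binom hB
  r62 := by rw [hB.reg 62 (by omega) (by omega), h.r62]
  r63 := by rw [hB.reg 63 (by omega) (by omega), h.r63]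
  r15 := by rw [hB.reg 15 (by omega) (by omega), h.r15]
  rem_le := h.rem_le
  r_le := h.r_le

lemma MoveSt.put (h : MoveSt d n m s r rem x s') {y v : ℕ}
    (hy : (4 ≤ y ∧ y < 8) ∨ (64 ≤ y ∧ y < 70)) : MoveSt d n m s r rem x (s'.put y v) where
  grid := h.grid.imp fun _ hg => hg.put (by omega)
  r62 := by rw [State.put_reg, if_neg (by omega), h.r62]
  r63 := by rw [State.put_reg, if_neg (by omega), h.r63]
  r15 := by rw [State.put_reg, if_neg (by omega), h.r15]
  rem_le := h.rem_le
  r_le := h.r_le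

lemma MoveSt.runs_first (hw : 1000 * (d + n + m + 2) ^ 2 ≤ 2 ^ M.w)
    (hs : MoveSt d n m s r rem x s') :
    ∃ S, Runs M s' [.bin .add 4 62 11, .bin .add 5 10 11, .bin .add 6 63 11] S ∧
      MoveSt d n m s r rem x S ∧ S.reg 4 = rem ∧ S.reg 5 = 1 ∧ S.reg 6 = r := by
  have hw' : 1000 * (d + n + m + 2) ≤ 2 ^ M.w := by nlinarith
  obtain ⟨hi, hg⟩ := hs.grid
  have h1 := hs.rem_le
  have h2 := hs.r_le
  exact ⟨_, .cons trivial (Instr.detExec_bin (v := rem) hs.r62 hg.r11 rfl (by omega)) <|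
    .cons trivial (Instr.detExec_bin (v := 1) (by exact hg.r10) (by exact hg.r11) rfl (by omega)) <|
    .cons trivial (Instr.detExec_bin (v := r) (by exact hs.r63) (by exact hg.r11) rfl (by omega))
      .nil, ((hs.put (by omega)).put (by omega)).put (by omega), rfl, rfl, rfl⟩

lemma MoveSt.runs_second (hw : 1000 * (d + n + m + 2) ^ 2 ≤ 2 ^ M.w)
    (hs : MoveSt d n m s r rem x s') (h7 : s'.reg 7 = a) (ha : a ≤ rem) :
    ∃ S, Runs M s' [.bin .add 64 7 11, .bin .add 4 7 11, .bin .add 5 10 11, .const 6 2] S ∧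
      MoveSt d n m s r rem x S ∧ S.reg 4 = a ∧ S.reg 5 = 1 ∧ S.reg 6 = 2 ∧ S.reg 64 = a := by
  have hw' : 1000 * (d + n + m + 2) ≤ 2 ^ M.w := by nlinarith
  obtain ⟨hi, hg⟩ := hs.grid
  have h1 := hs.rem_le
  exact ⟨_, .cons trivial (Instr.detExec_bin (v := a) h7 hg.r11 rfl (by omega)) <|
    .cons trivial (Instr.detExec_bin (v := a) (by exact h7) (by exact hg.r11) rfl (by omega)) <|
    .cons trivial (Instr.detExec_bin (v := 1) (by exact hg.r10) (by exact hg.r11) rfl (by omega)) <|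
    .cons trivial (Instr.detExec_const (by omega)) .nil,
    (((hs.put (by omega)).put (by omega)).put (by omega)).put (by omega), rfl, rfl, rfl, rfl⟩

lemma MoveSt.runs_third [NeZero n] (hw : 1000 * (d + n + m + 2) ^ 2 ≤ 2 ^ M.w)
    (hs : MoveSt d n m s (r + 1) rem x s') (h7 : s'.reg 7 = h) (h64 : s'.reg 64 = a) (ha : a ≤ rem)
    (hh : h ≤ a) :
    ∃ S, Runs M s' [.bin .sub 62 62 64, .bin .sub 64 64 7, .bin .sub 65 1 10, .bin .mul 64 64 65,
        .load 66 15, .bin .add 66 66 7, .bin .add 66 66 64, .bin .mod 66 66 1, .store 15 66,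
        .bin .add 15 15 10, .bin .sub 63 63 10] S ∧
      MoveSt d n m s r (rem - a) (shiftLast r a h x) S := by
  have hw' : 1000 * (d + n + m + 2) ≤ 2 ^ M.w := by nlinarith
  obtain ⟨hi, hg⟩ := hs.grid
  have h1 := hs.rem_le
  have h2 := hs.r_le
  have h15 := hs.r15
  have hn : 0 < n := Nat.pos_of_neZero n
  set j : Fin d := ⟨d - (r + 1), by omega⟩ with hj
  have hjr : (j : ℕ) + (r + 1) = d := by simp only [hj]; omega
  have r15 : s'.reg 15 = 2 * d + j := by omega
  have hxn : (x j).val < n := ZMod.val_lt _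
  have hmul : (a - h) * (n - 1) ≤ (d + n + m + 2) ^ 2 := by
    rw [sq]; exact Nat.mul_le_mul (by omega) (by omega)
  have hb2 : d + n + m + 2 ≤ (d + n + m + 2) ^ 2 := Nat.le_self_pow two_ne_zero _
  set v := ((x j).val + h + (a - h) * (n - 1)) % n with hv
  have hvn : v < n := Nat.mod_lt _ hn
  -- Modulo n a decrement is the addition of n - 1, which keeps all intermediate values natural
  -- numbers.
  have hval : (shiftLast r a h x j).val = v := by
    have e : shiftLast r a h x j = (((x j).val + h + (a - h) * (n - 1) : ℕ) : ZMod n) := by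
      rw [shiftLast, if_pos hjr]
      push_cast [Nat.cast_sub hn]
      rw [ZMod.natCast_zmod_val, ZMod.natCast_self]
      ring
    rw [e, ZMod.val_natCast]
  refine ⟨_, .cons trivial (Instr.detExec_bin (v := rem - a) hs.r62 h64 rfl (by omega)) <|
    .cons trivial (Instr.detExec_bin (v := a - h) (by exact h64) (by exact h7) rfl (by omega)) <|
    .cons trivial (Instr.detExec_bin (v := n - 1) (by exact hg.r1) (by exact hg.r10) rfl (by omega)) <|
    .cons trivial (Instr.detExec_bin (v := (a - h) * (n - 1)) rfl rfl rfl (by omega)) <|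
    .cons trivial (Instr.detExec_load (v := (x j).val) (by exact r15) (by exact hg.mem_lo j)
      (by omega)) <|
    .cons trivial (Instr.detExec_bin (v := (x j).val + h) rfl (by exact h7) rfl (by omega)) <|
    .cons trivial (Instr.detExec_bin (v := (x j).val + h + (a - h) * (n - 1)) rfl rfl rfl
      (by omega)) <|
    .cons trivial (Instr.detExec_bin (v := v) rfl (by exact hg.r1) rfl (by omega)) <|
    .cons trivial (Instr.detExec_store (a := 2 * d + j) (v := v) (by exact r15) rfl) <|
    .cons trivial (Instr.detExec_bin (v := 2 * d + j + 1) (by exact r15) (by exact hg.r10) rfl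
      (by omega)) <|
    .cons trivial (Instr.detExec_bin (v := r) (by exact hs.r63) (by exact hg.r10) rfl
      (by omega)) .nil, ?_, rfl, rfl, ?_, ?_, ?_⟩
  · refine ⟨hi, ?_⟩
    have e : (fun i => (shiftLast r a h x i).val) = Function.update (fun i => (x i).val) j v := by
      funext i
      by_cases hij : i = j
      · subst hij
        rw [hval, Function.update_self]
      · have : (i : ℕ) + (r + 1) ≠ d := fun h => hij (Fin.ext (by omega))
        rw [Function.update_of_ne hij, shiftLast, if_neg this]
    rw [e]
    refine GridSt.put (GridSt.put (GridSt.poke_lo ?_ rfl) (by omega)) (by omega)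
    repeat' refine GridSt.put ?_ (by omega)
    exact hg
  · change 2 * d + j + 1 + r = 3 * d
    omega
  · omega
  · omega

/-- A bound for the time of a binomial sample with at most `m` trials. -/
def binomTime (m : ℕ) : ℝ≥0∞ := ENNReal.ofReal (10 + 200010 * lpot m)

lemma samples_binom_le (hw : 1000 * (d + n + m + 2) ^ 2 ≤ 2 ^ M.w) {l a b : ℕ}
    (h4 : s.reg 4 = l) (h5 : s.reg 5 = a) (h6 : s.reg 6 = b) (hab : a ≤ b) (hb : 1 ≤ b)
    (hl : l ≤ m) (hbd : b ≤ d + n) :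
    Samples M HeatWalk.binom s (binomialLaw l (a / b))
      (fun v s' => BinomAgree s s' ∧ s'.reg 7 = v ∧ v ≤ l) (binomTime m) := by
  have hw' : 1000 * (l + b + 2) ^ 2 ≤ 2 ^ M.w :=
    (Nat.mul_le_mul_left _ (Nat.pow_le_pow_left (by omega) 2)).trans hw
  intro F G hFG
  refine (samples_binom hw' h4 h5 h6 hab hb F G hFG).trans ?_
  gcongr
  exact ENNReal.ofReal_le_ofReal (by linarith [lpot_mono hl])

lemma binomTime_ne_top (m : ℕ) : binomTime m ≠ ∞ := ENNReal.ofReal_ne_top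

lemma MoveSt.samples_first (hw : 1000 * (d + n + m + 2) ^ 2 ≤ 2 ^ M.w)
    (hs : MoveSt d n m s (r + 1) rem x s') (h4 : s'.reg 4 = rem) (h5 : s'.reg 5 = 1)
    (h6 : s'.reg 6 = r + 1) :
    Samples M HeatWalk.binom s' (binomialLaw rem (1 / (r + 1)))
      (fun v S => BinomAgree s' S ∧ S.reg 7 = v ∧ v ≤ rem) (binomTime m) := by
  have := samples_binom_le hw h4 h5 h6 (by omega) (by omega) hs.rem_le (by have := hs.r_le; omega)
  push_cast at this
  exact this

lemma MoveSt.samples_second [NeZero n] (hw : 1000 * (d + n + m + 2) ^ 2 ≤ 2 ^ M.w)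
    (hs : MoveSt d n m s (r + 1) rem x s') (h4 : s'.reg 4 = a) (h5 : s'.reg 5 = 1)
    (h6 : s'.reg 6 = 2) (ha : a ≤ rem) :
    Samples M HeatWalk.binom s' (binomialLaw a (1 / 2))
      (fun v S => BinomAgree s' S ∧ S.reg 7 = v ∧ v ≤ a) (binomTime m) := by
  have := samples_binom_le hw h4 h5 h6 (by omega) (by omega) (ha.trans hs.rem_le)
    (by have := hs.r_le; have := Nat.pos_of_neZero n; omega)
  push_cast at this
  exact this

lemma MoveSt.ex_le [NeZero n] (hw : 1000 * (d + n + m + 2) ^ 2 ≤ 2 ^ M.w)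
    (hs : MoveSt d n m s (r + 1) rem x s') (G : ℕ → ℕ → ℝ≥0∞)
    (hk : ∀ a ≤ rem, ∀ h ≤ a, ∀ S, MoveSt d n m s r (rem - a) (shiftLast r a h x) S →
      ex M unitCost k F S ≤ G a h) :
    ex M unitCost (moveBody :: k) F s' ≤ 40 + 2 * binomTime m +
      avg (binomialLaw rem (1 / (r + 1))) fun a => avg (binomialLaw a (1 / 2)) (G a) := by
  obtain ⟨S₁, hr1, hS1, h4, h5, h6⟩ := hs.runs_first hw
  rw [moveBody, ex_seq, ex_runs hr1, ex_seq, ex_cons]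
  have key := hS1.samples_first hw h4 h5 h6 (ex M unitCost (.seq (blk (.bin .add 64 7 11)
      [.bin .add 4 7 11, .bin .add 5 10 11, .const 6 2]) (.seq HeatWalk.binom
      (blk (.bin .sub 62 62 64) [.bin .sub 64 64 7, .bin .sub 65 1 10, .bin .mul 64 64 65,
        .load 66 15, .bin .add 66 66 7, .bin .add 66 66 64, .bin .mod 66 66 1, .store 15 66,
        .bin .add 15 15 10, .bin .sub 63 63 10])) :: k) F) (fun a => 30 + binomTime m +
    avg (binomialLaw a (1 / 2)) (G a)) ?_
  · rw [avg_add, avg_const] at key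
    refine (add_le_add le_rfl (add_le_add le_rfl (add_le_add le_rfl key))).trans ?_
    simp only [blkCost_unitCost, unitCost, List.length_nil, List.length_cons]
    push_cast
    set c := avg (binomialLaw rem (1 / (r + 1))) fun a => avg (binomialLaw a (1 / 2)) (G a)
    calc _ = 37 + 2 * binomTime m + c := by ring
      _ ≤ _ := by gcongr; norm_num
  · rintro a U ⟨hU, h7, ha⟩
    obtain ⟨S₂, hr2, hS2, h4, h5, h6, h64⟩ := (hS1.binom hU).runs_second hw h7 ha
    rw [ex_seq, ex_runs hr2, ex_seq, ex_cons]
    have key := hS2.samples_second hw h4 h5 h6 ha (ex M unitCost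
      ((blk (.bin .sub 62 62 64) [.bin .sub 64 64 7, .bin .sub 65 1 10, .bin .mul 64 64 65,
        .load 66 15, .bin .add 66 66 7, .bin .add 66 66 64, .bin .mod 66 66 1, .store 15 66,
        .bin .add 15 15 10, .bin .sub 63 63 10]) :: k) F) (fun h => (21 : ℕ) + G a h) ?_
    · rw [avg_add, avg_const] at key
      refine (add_le_add le_rfl (add_le_add le_rfl (add_le_add le_rfl key))).trans_eq ?_
      simp only [blkCost_unitCost, unitCost, List.length_nil, List.length_cons]
      push_cast
      ring
    · rintro h V ⟨hV, h7, hh⟩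
      obtain ⟨S₃, hr3, hS3⟩ := (hS2.binom hV).runs_third hw h7
        ((hV.reg 64 (by omega) (by omega)).trans h64) ha hh
      rw [ex_runs hr3]
      refine add_le_add (le_of_eq ?_) (hk a ha h hh S₃ hS3)
      simp only [blkCost_unitCost, List.length_nil, List.length_cons]
      norm_num

lemma MoveSt.while_le [NeZero n] (hw : 1000 * (d + n + m + 2) ^ 2 ≤ 2 ^ M.w)
    (hs : MoveSt d n m s r rem x s') (G : (Fin d → ZMod n) → ℝ≥0∞)
    (hk : ∀ y S, PointSt d n s y S → ex M unitCost k F S ≤ G y) :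
    ex M unitCost (.while 63 moveBody :: k) F s' ≤ r * (41 + 2 * binomTime m) + 1 +
      avg (nestedBinomial d n r rem x) G := by
  induction r generalizing rem x s' with
  | zero =>
    rw [ex_while, hs.r63, if_neg (not_not.2 rfl), nestedBinomial, avg_pure]
    refine add_le_add (by simp [unitCost]) (hk x s' hs.grid)
  | succ r ih =>
    rw [ex_while, hs.r63, if_pos (Nat.succ_ne_zero r)]
    have key := hs.ex_le hw (k := .while 63 moveBody :: k) (F := F)
      (fun a h => r * (41 + 2 * binomTime m) + 1 +
        avg (nestedBinomial d n r (rem - a) (shiftLast r a h x)) G)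
      (fun a _ h _ S hS => ih hS)
    refine (add_le_add le_rfl key).trans_eq ?_
    simp only [avg_add, avg_const, nestedBinomial, avg_bind, unitCost]
    unfold shiftLast
    push_cast
    ring

lemma samples_move [NeZero n] (hw : 1000 * (d + n + m + 2) ^ 2 ≤ 2 ^ M.w) (h2 : s.reg 2 = m)
    (hs : PointSt d n s x s') :
    Samples M move s' (nestedBinomial d n d m x) (PointSt d n s)
      (d * (41 + 2 * binomTime m) + 10) := by
  intro F G hFG
  have hw' : 1000 * (d + n + m + 2) ≤ 2 ^ M.w := by nlinarith
  obtain ⟨hi, hg⟩ := hs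
  have hr : Runs M s' [.bin .add 62 2 11, .bin .add 63 0 11, .bin .add 15 12 11] _ :=
    .cons trivial (Instr.detExec_bin (v := m) ((hg.reg 2 (by omega)).trans h2) hg.r11 rfl
      (by omega)) <|
    .cons trivial (Instr.detExec_bin (v := d) (by exact hg.r0) (by exact hg.r11) rfl (by omega)) <|
    .cons trivial (Instr.detExec_bin (v := 2 * d) (by exact hg.r12) (by exact hg.r11) rfl
      (by omega)) .nil
  have hM : MoveSt d n m s d m x (((s'.put 62 m).put 63 d).put 15 (2 * d)) :=
    ⟨⟨hi, ((hg.put (by omega)).put (by omega)).put (by omega)⟩, rfl, rfl,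
      show 2 * d + d = 3 * d by omega, le_rfl, le_rfl⟩
  rw [move, ex_seq, ex_runs hr]
  have key := hM.while_le hw (k := []) (F := F) G fun y S hS => by rw [ex_nil]; exact hFG y S hS
  refine (add_le_add le_rfl (add_le_add le_rfl key)).trans ?_
  calc
    _ = d * (41 + 2 * binomTime m) + 7 + avg (nestedBinomial d n d m x) G := by
      simp only [blkCost_unitCost, unitCost, List.length_nil, List.length_cons]
      push_cast
      ring
    _ ≤ _ := by gcongr; norm_num

/-- A bound for the time of one endpoint of the walk. -/
def walkTime (d n m : ℕ) : ℝ≥0∞ :=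
  (d * (25 * Nat.clog 2 n + 26) + 20 : ℕ) + (d * (41 + 2 * binomTime m) + 10) + 1

lemma walkTime_ne_top (d n m : ℕ) : walkTime d n m ≠ ∞ := by
  have := binomTime_ne_top m
  simp [walkTime, ENNReal.add_eq_top, ENNReal.mul_eq_top, this]

variable [NeZero n] {p₀ : PMF (Fin d → ZMod n)} {w : ℕ} {σ : ℝ}

lemma samples_walk (hσ : 0 < σ) (hw : 1000 * (d + n + m + 2) ^ 2 ≤ 2 ^ w) (h0 : s.reg 0 = d)
    (h1 : s.reg 1 = n) (h2 : s.reg 2 = m) :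
    Samples (gridEnv w fun k => σ * (p₀ k).toReal) walk s (p₀.bind (nestedBinomial d n d m))
      (PointSt d n s) (walkTime d n m) := by
  intro F G hFG
  have hw' : 4 * (d + n + 2) < 2 ^ w := by nlinarith
  set M := gridEnv w fun k => σ * (p₀ k).toReal with hM
  have hMw : 1000 * (d + n + m + 2) ^ 2 ≤ 2 ^ M.w := hw
  rw [walk, ex_seq, ex_cons]
  have key := samples_locate (p₀ := p₀) hσ hw' h0 h1 (ex M unitCost [move] F)
    (fun x => (d * (41 + 2 * binomTime m) + 10) + avg (nestedBinomial d n d m x) G)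
    fun x S hS => samples_move hMw h2 hS F G hFG
  refine (add_le_add le_rfl key).trans_eq ?_
  rw [avg_add, avg_const, avg_bind, walkTime, unitCost]
  ring

/-- Hence the search for the starting point contributes no calls of `binom`. -/
lemma size_locate_lt : locate.size < binom.size := by decide

lemma ex_callCost_binom {c : ℝ≥0∞} {l : ℕ} {p : ℝ} {good : ℕ → State → Prop} {T : ℝ≥0∞}
    (hS : Samples M binom s (binomialLaw l p) good T) (hT : T ≠ ∞)
    (hF : ∀ v S, good v S → ex M (callCost binom) k F S = c) :
    ex M (callCost binom) (binom :: k) F s = 1 + c := by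
  rw [ex_cons, hS.ex_const hT hF]
  congr 1
  exact ex_callCost_seq _ _ _

/-- The count is deterministic: after any outcome of a binomial sample the remaining code makes the
same number of calls, so `Samples.ex_const` applies twice per coordinate. -/
lemma MoveSt.while_calls (hw : 1000 * (d + n + m + 2) ^ 2 ≤ 2 ^ M.w)
    (hs : MoveSt d n m s r rem x s') :
    ex M (callCost HeatWalk.binom) [.while 63 moveBody] 0 s' = 2 * r := by
  induction r generalizing rem x s' with
  | zero =>
    rw [ex_while, hs.r63, if_neg (not_not.2 rfl), callCost_of_size_ne (by decide)]
    simp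
  | succ r ih =>
    obtain ⟨S₁, hr1, hS1, h4, h5, h6⟩ := hs.runs_first hw
    rw [ex_while, hs.r63, if_pos (Nat.succ_ne_zero r), callCost_of_size_ne (by decide),
      show ex M (callCost HeatWalk.binom) (moveBody :: [.while 63 moveBody]) 0 s' = _
        from ex_seq _ _ _ _, callCost_of_size_ne (by decide), ex_runs hr1,
      blkCost_callCost (by decide), ex_seq, callCost_of_size_ne (by decide),
      ex_callCost_binom (hS1.samples_first hw h4 h5 h6) (binomTime_ne_top m)
        (c := 1 + 2 * r) ?_]
    · push_cast
      ring
    · rintro a U ⟨hU, h7, ha⟩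
      obtain ⟨S₂, hr2, hS2, h4, h5, h6, h64⟩ := (hS1.binom hU).runs_second hw h7 ha
      rw [ex_seq, callCost_of_size_ne (by decide), ex_runs hr2, blkCost_callCost (by decide), ex_seq,
        callCost_of_size_ne (by decide),
        ex_callCost_binom (hS2.samples_second hw h4 h5 h6 ha) (binomTime_ne_top m)
        (c := 2 * r) ?_]
      · ring
      · rintro h V ⟨hV, h7, hh⟩
        obtain ⟨S₃, hr3, hS3⟩ := (hS2.binom hV).runs_third hw h7
          ((hV.reg 64 (by omega) (by omega)).trans h64) ha hh
        rw [ex_runs hr3, blkCost_callCost (by decide), ih hS3, zero_add]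

lemma move_calls (hw : 1000 * (d + n + m + 2) ^ 2 ≤ 2 ^ M.w) (h2 : s.reg 2 = m)
    (hs : PointSt d n s x s') : ex M (callCost binom) [move] 0 s' = 2 * d := by
  have hw' : 1000 * (d + n + m + 2) ≤ 2 ^ M.w := by nlinarith
  obtain ⟨hi, hg⟩ := hs
  have hr : Runs M s' [.bin .add 62 2 11, .bin .add 63 0 11, .bin .add 15 12 11] _ :=
    .cons trivial (Instr.detExec_bin (v := m) ((hg.reg 2 (by omega)).trans h2) hg.r11 rfl
      (by omega)) <|
    .cons trivial (Instr.detExec_bin (v := d) (by exact hg.r0) (by exact hg.r11) rfl (by omega)) <|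
    .cons trivial (Instr.detExec_bin (v := 2 * d) (by exact hg.r12) (by exact hg.r11) rfl
      (by omega)) .nil
  have hM : MoveSt d n m s d m x (((s'.put 62 m).put 63 d).put 15 (2 * d)) :=
    ⟨⟨hi, ((hg.put (by omega)).put (by omega)).put (by omega)⟩, rfl, rfl,
      show 2 * d + d = 3 * d by omega, le_rfl, le_rfl⟩
  rw [move, ex_seq, ex_runs hr, hM.while_calls hw, callCost_of_size_ne (by decide),
    blkCost_callCost (by decide)]
  simp

lemma walk_calls (hσ : 0 < σ) (hw : 1000 * (d + n + m + 2) ^ 2 ≤ 2 ^ w) (h0 : s.reg 0 = d)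
    (h1 : s.reg 1 = n) (h2 : s.reg 2 = m) :
    ex (gridEnv w fun k => σ * (p₀ k).toReal) (callCost binom) [walk] 0 s = 2 * d := by
  have hw' : 4 * (d + n + 2) < 2 ^ w := by nlinarith
  set M := gridEnv w fun k => σ * (p₀ k).toReal with hM
  have hMw : 1000 * (d + n + m + 2) ^ 2 ≤ 2 ^ M.w := hw
  rw [walk, ex_seq, ex_cons, (samples_locate (p₀ := p₀) hσ hw' h0 h1).ex_const
    (ENNReal.natCast_ne_top _) fun x S hS => move_calls hMw h2 hS,
    ex_callCost_of_size_lt (by simpa using size_locate_lt), callCost_of_size_ne (by decide)]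
  simp

end walk

/-! ### Counting hits -/

/-- Compare one coordinate of the endpoint with the region. -/
def checkBody : Prog := blk (.load 77 74) [.bin .add 78 74 0, .load 78 78, .bin .add 79 74 12,
  .load 79 79, .bin .lt 80 77 79, .bin .lt 81 78 79, .bin .sub 81 10 81, .bin .mul 73 73 80,
  .bin .mul 73 73 81, .bin .add 74 74 10, .bin .sub 75 75 10]

/-- Sample one endpoint and compare it with the region. -/
def estBody : Prog := .seq walk (.seq (blk (.bin .add 73 10 11) [.bin .add 74 11 11,
  .bin .add 75 0 11]) (.seq (.while 75 checkBody) (blk (.bin .add 8 8 73) [.bin .sub 71 71 10])))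

/-- Count in `reg 8` the hits of the region among `reg 3` endpoints. -/
def est : Prog := .seq (blk (.const 8 0) [.const 70 0, .bin .add 71 3 70]) (.while 71 estBody)

section est
variable {d n m K h r i b w : ℕ} {s s' s'' : State} {lo hi : Fin d → ℕ} {x : Fin d → ZMod n}
  {M : Env} {k : List Prog} {F : State → ℝ≥0∞}

/-- The states during `est`, with `h` hits so far and `r` samples left. -/
structure EstSt (d n m K : ℕ) (lo hi : Fin d → ℕ) (h r : ℕ) (s : State) : Prop where
  mem_lo : ∀ j : Fin d, s.mem j = lo j
  mem_hi : ∀ j : Fin d, s.mem (d + j) = hi j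
  r0 : s.reg 0 = d
  r1 : s.reg 1 = n
  r2 : s.reg 2 = m
  r8 : s.reg 8 = h
  r71 : s.reg 71 = r
  le : h + r ≤ K

lemma EstSt.put (hs : EstSt d n m K lo hi h r s) {y v : ℕ} (hy : 72 ≤ y) :
    EstSt d n m K lo hi h r (s.put y v) where
  mem_lo := hs.mem_lo
  mem_hi := hs.mem_hi
  r0 := by rw [State.put_reg, if_neg (by omega), hs.r0]
  r1 := by rw [State.put_reg, if_neg (by omega), hs.r1]
  r2 := by rw [State.put_reg, if_neg (by omega), hs.r2]
  r8 := by rw [State.put_reg, if_neg (by omega), hs.r8]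
  r71 := by rw [State.put_reg, if_neg (by omega), hs.r71]
  le := hs.le

/-- The region, in terms of indices. -/
def cell (lo hi : Fin d → ℕ) : Set (Fin d → ZMod n) :=
  {k | ∀ j, lo j < (k j).val ∧ (k j).val ≤ hi j}

/-- The states during the comparison of `x` with the region, after `i` coordinates. -/
structure CheckSt (d n m K : ℕ) (lo hi : Fin d → ℕ) (h r : ℕ) (x : Fin d → ZMod n) (i : ℕ)
    (s : State) : Prop where
  est : EstSt d n m K lo hi h r s
  mem : ∀ j : Fin d, s.mem (2 * d + j) = (x j).val
  r10 : s.reg 10 = 1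
  r11 : s.reg 11 = 0
  r12 : s.reg 12 = 2 * d
  r73 : s.reg 73 = open Classical in
    if ∀ j : Fin d, (j : ℕ) < i → lo j < (x j).val ∧ (x j).val ≤ hi j then 1 else 0
  r74 : s.reg 74 = i
  r75 : s.reg 75 = d - i

lemma EstSt.point (hs : EstSt d n m K lo hi h r s) (hx : PointSt d n s x s') :
    EstSt d n m K lo hi h r s' := by
  obtain ⟨_, hx⟩ := hx
  exact ⟨fun j => (hx.mem _ (by omega)).trans (hs.mem_lo j),
    fun j => (hx.mem _ (by omega)).trans (hs.mem_hi j), hx.r0, hx.r1,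
    (hx.reg 2 (by omega)).trans hs.r2, (hx.reg 8 (by omega)).trans hs.r8,
    (hx.reg 71 (by omega)).trans hs.r71, hs.le⟩

lemma CheckSt.runs_start (hw : 10 * (d + n + m + K + 2) ≤ 2 ^ M.w)
    (hs : EstSt d n m K lo hi h r s) (hx : PointSt d n s x s') :
    ∃ S, Runs M s' [.bin .add 73 10 11, .bin .add 74 11 11, .bin .add 75 0 11] S ∧
      CheckSt d n m K lo hi h r x 0 S := by
  have hE := hs.point hx
  obtain ⟨_, hx⟩ := hx
  refine ⟨_, .cons trivial (Instr.detExec_bin (v := 1) hx.r10 hx.r11 rfl (by omega)) <|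
    .cons trivial (Instr.detExec_bin (v := 0) (by exact hx.r11) (by exact hx.r11) rfl (by omega)) <|
    .cons trivial (Instr.detExec_bin (v := d) (by exact hx.r0) (by exact hx.r11) rfl (by omega))
      .nil, ((hE.put (by omega)).put (by omega)).put (by omega), hx.mem_lo, hx.r10, hx.r11, hx.r12,
      ?_, rfl, rfl⟩
  rw [if_pos fun j hj => absurd hj (Nat.not_lt_zero _)]
  rfl

lemma CheckSt.runs_body [NeZero n] (hw : 10 * (d + n + m + K + 2) ≤ 2 ^ M.w)
    (hlo : ∀ j, lo j < n ∧ hi j < n) (hi' : i < d) (hs : CheckSt d n m K lo hi h r x i s) :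
    ∃ S, Runs M s [.load 77 74, .bin .add 78 74 0, .load 78 78, .bin .add 79 74 12,
      .load 79 79, .bin .lt 80 77 79, .bin .lt 81 78 79, .bin .sub 81 10 81, .bin .mul 73 73 80,
      .bin .mul 73 73 81, .bin .add 74 74 10, .bin .sub 75 75 10] S ∧
      CheckSt d n m K lo hi h r x (i + 1) S := by
  classical
  set j : Fin d := ⟨i, hi'⟩ with hj
  have h1 := hlo j
  have hxn : (x j).val < n := ZMod.val_lt _
  set p := if ∀ j : Fin d, (j : ℕ) < i → lo j < (x j).val ∧ (x j).val ≤ hi j then 1 else 0 with hp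
  have hp1 : p ≤ 1 := by rw [hp]; split_ifs <;> simp
  set u := if lo j < (x j).val then 1 else 0 with hu
  have hu1 : u ≤ 1 := by rw [hu]; split_ifs <;> simp
  set v := if hi j < (x j).val then 1 else 0 with hv
  have hv1 : v ≤ 1 := by rw [hv]; split_ifs <;> simp
  have hpu : p * u ≤ 1 := Nat.mul_le_mul hp1 hu1
  have hpuv : p * u * (1 - v) ≤ 1 := Nat.mul_le_mul hpu (Nat.sub_le _ _)
  have r73 : s.reg 73 = p := by rw [hs.r73]
  refine ⟨_, .cons trivial (Instr.detExec_load (v := lo j) hs.r74 (hs.est.mem_lo j) (by omega)) <|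
    .cons trivial (Instr.detExec_bin (v := d + i) (by exact hs.r74) (by exact hs.est.r0)
      (Nat.add_comm _ _) (by omega)) <|
    .cons trivial (Instr.detExec_load (v := hi j) rfl (by exact hs.est.mem_hi j) (by omega)) <|
    .cons trivial (Instr.detExec_bin (v := 2 * d + i) (by exact hs.r74) (by exact hs.r12)
      (Nat.add_comm _ _) (by omega)) <|
    .cons trivial (Instr.detExec_load (v := (x j).val) rfl (by exact hs.mem j) (by omega)) <|
    .cons trivial (Instr.detExec_bin (v := u) rfl rfl rfl (by omega)) <|
    .cons trivial (Instr.detExec_bin (v := v) rfl rfl rfl (by omega)) <|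
    .cons trivial (Instr.detExec_bin (v := 1 - v) (by exact hs.r10) rfl rfl (by omega)) <|
    .cons trivial (Instr.detExec_bin (v := p * u) (by exact r73) rfl rfl (by omega)) <|
    .cons trivial (Instr.detExec_bin (v := p * u * (1 - v)) rfl rfl rfl (by omega)) <|
    .cons trivial (Instr.detExec_bin (v := i + 1) (by exact hs.r74) (by exact hs.r10) rfl
      (by omega)) <|
    .cons trivial (Instr.detExec_bin (v := d - i - 1) (by exact hs.r75) (by exact hs.r10) rfl
      (by omega)) .nil, ?_, hs.mem, hs.r10, hs.r11, hs.r12, ?_, rfl, rfl⟩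
  · repeat' refine EstSt.put ?_ (by omega)
    exact hs.est
  · change p * u * (1 - v) = _
    have e : (∀ j : Fin d, (j : ℕ) < i + 1 → lo j < (x j).val ∧ (x j).val ≤ hi j) ↔
        (∀ j : Fin d, (j : ℕ) < i → lo j < (x j).val ∧ (x j).val ≤ hi j) ∧
          lo j < (x j).val ∧ (x j).val ≤ hi j := by
      constructor
      · exact fun H => ⟨fun j' hj' => H j' (by omega), H j (Nat.lt_succ_self i)⟩
      · rintro ⟨H, H'⟩ j' hj'
        rcases Nat.lt_succ_iff_lt_or_eq.1 hj' with hlt | heq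
        · exact H j' hlt
        · rwa [show j' = j from Fin.ext heq]
    rw [hp, hu, hv]
    simp only [e]
    by_cases ha : ∀ j : Fin d, (j : ℕ) < i → lo j < (x j).val ∧ (x j).val ≤ hi j <;>
    by_cases hb : lo j < (x j).val <;> by_cases hc : hi j < (x j).val <;>
    simp [ha, hb, hc, not_le.2, not_lt.1]

/-- The comparison loop is deterministic, so an exact identity holds for every cost function; it
serves both the running time and the count of calls. -/
lemma CheckSt.while_eq [NeZero n] (hw : 10 * (d + n + m + K + 2) ≤ 2 ^ M.w)
    (hlo : ∀ j, lo j < n ∧ hi j < n) (hs : CheckSt d n m K lo hi h r x i s) (hi' : i ≤ d) :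
    ∃ S, CheckSt d n m K lo hi h r x d S ∧ ∀ γ k F,
      ex M γ (.while 75 checkBody :: k) F s = (d - i : ℕ) * (γ (.while 75 checkBody) +
        blkCost γ (.load 77 74) [.bin .add 78 74 0, .load 78 78, .bin .add 79 74 12,
      .load 79 79, .bin .lt 80 77 79, .bin .lt 81 78 79, .bin .sub 81 10 81, .bin .mul 73 73 80,
      .bin .mul 73 73 81, .bin .add 74 74 10, .bin .sub 75 75 10]) + γ (.while 75 checkBody) +
        ex M γ k F S := by
  obtain ⟨t, ht⟩ : ∃ t, d - i = t := ⟨_, rfl⟩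
  induction t generalizing i s with
  | zero =>
    obtain rfl : i = d := by omega
    exact ⟨s, hs, fun γ k F => by rw [ex_while, hs.r75, ht]; simp⟩
  | succ t ih =>
    obtain ⟨S, hr, hS⟩ := hs.runs_body hw hlo (by omega)
    obtain ⟨S', hS', H⟩ := ih hS (by omega) (by omega)
    refine ⟨S', hS', fun γ k F => ?_⟩
    rw [ex_while, hs.r75, ht, if_pos (Nat.succ_ne_zero t), checkBody, ex_runs hr, ← checkBody, H,
      show d - (i + 1) = t by omega]
    push_cast
    ring

open Classical in
lemma CheckSt.runs_end (hw : 10 * (d + n + m + K + 2) ≤ 2 ^ M.w)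
    (hs : CheckSt d n m K lo hi h (r + 1) x d s) :
    ∃ S, Runs M s [.bin .add 8 8 73, .bin .sub 71 71 10] S ∧
      EstSt d n m K lo hi (h + if x ∈ cell lo hi then 1 else 0) r S := by
  have e : s.reg 73 = if x ∈ cell lo hi then 1 else 0 := by
    rw [hs.r73]
    simp only [cell, Set.mem_ofPred_eq, Fin.is_lt, forall_const]
    congr
  have hE := hs.est
  have hle := hE.le
  set b := if x ∈ cell lo hi then 1 else 0 with hb
  have hb1 : b ≤ 1 := by rw [hb]; split_ifs <;> simp
  exact ⟨_, .cons trivial (Instr.detExec_bin (v := h + b) hE.r8 e rfl (by omega)) <|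
    .cons trivial (Instr.detExec_bin (v := r) (by exact hE.r71) (by exact hs.r10) rfl (by omega))
      .nil, hE.mem_lo, hE.mem_hi, hE.r0, hE.r1, hE.r2, rfl, rfl, by omega⟩

open Classical in
/-- What happens after sampling the endpoint. -/
lemma EstSt.tail [NeZero n] (hw : 10 * (d + n + m + K + 2) ≤ 2 ^ M.w)
    (hlo : ∀ j, lo j < n ∧ hi j < n) (hs : EstSt d n m K lo hi h (r + 1) s)
    (hx : PointSt d n s x s') :
    ∃ S, EstSt d n m K lo hi (h + if x ∈ cell lo hi then 1 else 0) r S ∧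
    (∀ k F, ex M unitCost (.seq (blk (.bin .add 73 10 11) [.bin .add 74 11 11,
      .bin .add 75 0 11]) (.seq (.while 75 checkBody) (blk (.bin .add 8 8 73)
        [.bin .sub 71 71 10])) :: k) F s' = (24 * d + 11 : ℕ) + ex M unitCost k F S) ∧
    (∀ k F, ex M (callCost walk) (.seq (blk (.bin .add 73 10 11) [.bin .add 74 11 11,
      .bin .add 75 0 11]) (.seq (.while 75 checkBody) (blk (.bin .add 8 8 73)
        [.bin .sub 71 71 10])) :: k) F s' = ex M (callCost walk) k F S) := by
  obtain ⟨S₁, hr1, hS1⟩ := CheckSt.runs_start hw hs hx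
  obtain ⟨S₂, hS2, H⟩ := hS1.while_eq hw hlo (Nat.zero_le _)
  obtain ⟨S₃, hr3, hS3⟩ := hS2.runs_end hw
  refine ⟨S₃, hS3, fun k F => ?_, fun k F => ?_⟩
  · rw [ex_seq, ex_runs hr1, ex_seq, H, ex_runs hr3]
    simp only [blkCost_unitCost, unitCost, List.length_nil, List.length_cons]
    rw [Nat.sub_zero]
    push_cast
    ring
  · rw [ex_seq, ex_runs hr1, ex_seq, H, ex_runs hr3]
    rw [blkCost_callCost (by decide), blkCost_callCost (by decide), blkCost_callCost (by decide)]
    rw [callCost_of_size_ne (by decide), callCost_of_size_ne (by decide),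
      callCost_of_size_ne (by decide)]
    simp

variable [NeZero n] {p₀ : PMF (Fin d → ZMod n)} {σ : ℝ}

lemma EstSt.while_le (hσ : 0 < σ) (hw : 1000 * (d + n + m + K + 2) ^ 2 ≤ 2 ^ w)
    (hlo : ∀ j, lo j < n ∧ hi j < n) (hs : EstSt d n m K lo hi h r s) (G : ℕ → ℝ≥0∞)
    (hFG : ∀ v s', s'.reg 8 = v → F s' ≤ G v) :
    ex (gridEnv w fun k => σ * (p₀ k).toReal) unitCost [.while 71 estBody] F s ≤
      r * (walkTime d n m + (24 * d + 13 : ℕ)) + 1 +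
      avg (hitCount (p₀.bind (nestedBinomial d n d m)) (cell lo hi) r) fun v => G (h + v) := by
  classical
  have hw1 : 1000 * (d + n + m + 2) ^ 2 ≤ 2 ^ w :=
    (Nat.mul_le_mul_left _ (Nat.pow_le_pow_left (by omega) 2)).trans hw
  set M := gridEnv w fun k => σ * (p₀ k).toReal with hM
  have hw2 : 10 * (d + n + m + K + 2) ≤ 2 ^ M.w := by change _ ≤ 2 ^ w; nlinarith
  induction r generalizing h s with
  | zero =>
    rw [ex_while, hs.r71, if_neg (not_not.2 rfl), hitCount, avg_pure, ex_nil]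
    refine add_le_add (by simp [unitCost]) (hFG _ _ (by rw [hs.r8, add_zero]))
  | succ r ih =>
    rw [ex_while, hs.r71, if_pos (Nat.succ_ne_zero r),
      show ex M unitCost [estBody, .while 71 estBody] F s = _ from ex_seq _ _ _ _, ex_cons]
    have key := samples_walk (p₀ := p₀) hσ hw1 hs.r0 hs.r1 hs.r2
      (ex M unitCost (.seq (blk (.bin .add 73 10 11) [.bin .add 74 11 11,
      .bin .add 75 0 11]) (.seq (.while 75 checkBody) (blk (.bin .add 8 8 73)
        [.bin .sub 71 71 10])) :: [.while 71 estBody]) F)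
      (fun x => (24 * d + 11 : ℕ) + (r * (walkTime d n m + (24 * d + 13 : ℕ)) + 1 +
      avg (hitCount (p₀.bind (nestedBinomial d n d m)) (cell lo hi) r) fun v =>
        G (h + (if x ∈ cell lo hi then 1 else 0) + v))) ?_
    · refine (add_le_add le_rfl (add_le_add le_rfl key)).trans_eq ?_
      rw [avg_add, avg_const, avg_add, avg_const, hitCount]
      simp only [avg_bind, avg_map, unitCost]
      simp only [add_comm _ (if _ ∈ cell lo hi then 1 else 0), ← add_assoc]
      push_cast
      ring
    · intro x S hx
      obtain ⟨S', hS', H, -⟩ := hs.tail hw2 hlo hx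
      rw [H]
      exact add_le_add le_rfl (ih hS')

lemma EstSt.while_calls (hσ : 0 < σ) (hw : 1000 * (d + n + m + K + 2) ^ 2 ≤ 2 ^ w)
    (hlo : ∀ j, lo j < n ∧ hi j < n) (hs : EstSt d n m K lo hi h r s) :
    ex (gridEnv w fun k => σ * (p₀ k).toReal) (callCost walk) [.while 71 estBody] 0 s = r := by
  classical
  have hw1 : 1000 * (d + n + m + 2) ^ 2 ≤ 2 ^ w :=
    (Nat.mul_le_mul_left _ (Nat.pow_le_pow_left (by omega) 2)).trans hw
  set M := gridEnv w fun k => σ * (p₀ k).toReal with hM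
  have hw2 : 10 * (d + n + m + K + 2) ≤ 2 ^ M.w := by change _ ≤ 2 ^ w; nlinarith
  induction r generalizing h s with
  | zero =>
    rw [ex_while, hs.r71, if_neg (not_not.2 rfl), callCost_of_size_ne (by decide)]
    simp
  | succ r ih =>
    rw [ex_while, hs.r71, if_pos (Nat.succ_ne_zero r), callCost_of_size_ne (by decide),
      show ex M (callCost walk) [estBody, .while 71 estBody] 0 s = _ from ex_seq _ _ _ _,
      callCost_of_size_ne (by decide), ex_cons,
      (samples_walk (p₀ := p₀) hσ hw1 hs.r0 hs.r1 hs.r2).ex_const (walkTime_ne_top d n m)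
        (c := r) ?_]
    · rw [show ex _ (callCost walk) [walk] 0 s = 1 from ex_callCost_seq _ _ _]
      push_cast
      ring
    · intro x S hx
      obtain ⟨S', hS', -, H⟩ := hs.tail hw2 hlo hx
      rw [H, ih hS']

omit [NeZero n] in
lemma est_start (hw : 1000 * (d + n + m + K + 2) ^ 2 ≤ 2 ^ M.w) :
    ∃ S, Runs M (walkInput d n m K lo hi) [.const 8 0, .const 70 0, .bin .add 71 3 70] S ∧
      EstSt d n m K lo hi 0 K S := by
  have hw2 : 10 * (d + n + m + K + 2) ≤ 2 ^ M.w := by nlinarith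
  refine ⟨_, .cons trivial (Instr.detExec_const (by omega)) <|
    .cons trivial (Instr.detExec_const (by omega)) <|
    .cons trivial (Instr.detExec_bin (v := K) rfl rfl rfl (by omega)) .nil, fun j => ?_,
      fun j => ?_, rfl, rfl, rfl, rfl, rfl, by omega⟩
  · change (walkInput d n m K lo hi).mem j = _
    simp [walkInput]
  · change (walkInput d n m K lo hi).mem (d + j) = _
    simp [walkInput]

/-- A bound for the time of counting the hits. -/
def estTime (d n m K : ℕ) : ℝ≥0∞ := K * (walkTime d n m + (24 * d + 13 : ℕ)) + 7

lemma estTime_ne_top (d n m K : ℕ) : estTime d n m K ≠ ∞ := by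
  have := walkTime_ne_top d n m
  simp [estTime, ENNReal.add_eq_top, ENNReal.mul_eq_top, this]

lemma samples_est (hσ : 0 < σ) (hw : 1000 * (d + n + m + K + 2) ^ 2 ≤ 2 ^ w)
    (hlo : ∀ j, lo j < n ∧ hi j < n) :
    Samples (gridEnv w fun k => σ * (p₀ k).toReal) est (walkInput d n m K lo hi)
      (hitCount (p₀.bind (nestedBinomial d n d m)) (cell lo hi) K) (fun v s' => s'.reg 8 = v)
      (estTime d n m K) := by
  intro F G hFG
  obtain ⟨S, hr, hS⟩ := est_start (M := gridEnv w fun k => σ * (p₀ k).toReal) (lo := lo) (hi := hi)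
    (d := d) (n := n) (m := m) (K := K) hw
  rw [est, ex_seq, ex_runs hr]
  refine (add_le_add le_rfl (add_le_add le_rfl (hS.while_le hσ hw hlo G hFG))).trans_eq ?_
  simp only [blkCost_unitCost, unitCost, List.length_nil, List.length_cons, zero_add, estTime]
  push_cast
  ring

lemma est_calls (hσ : 0 < σ) (hw : 1000 * (d + n + m + K + 2) ^ 2 ≤ 2 ^ w)
    (hlo : ∀ j, lo j < n ∧ hi j < n) :
    ex (gridEnv w fun k => σ * (p₀ k).toReal) (callCost walk) [est] 0 (walkInput d n m K lo hi) =
      K := by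
  obtain ⟨S, hr, hS⟩ := est_start (M := gridEnv w fun k => σ * (p₀ k).toReal) (lo := lo) (hi := hi)
    (d := d) (n := n) (m := m) (K := K) hw
  rw [est, ex_seq, ex_runs hr, hS.while_calls hσ hw hlo, callCost_of_size_ne (by decide),
    blkCost_callCost (by decide)]
  simp

end est

/-! ### Words and running times -/

/-- The exponent 10 suffices because the quadratic bounds only concern x ≥ 3 and 3 ^ 8 > 1000. -/
lemma mul_sq_le_pow_ten {x : ℕ} (hx : 3 ≤ x) : 1000 * x ^ 2 ≤ x ^ 10 := by
  have h : 3 ^ 8 ≤ x ^ 8 := Nat.pow_le_pow_left hx 8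
  calc 1000 * x ^ 2 ≤ x ^ 8 * x ^ 2 := Nat.mul_le_mul_right _ (by omega)
    _ = x ^ 10 := by ring

/-- Additive constants in the running times are absorbed into the logarithms by this bound. -/
lemma half_lt_log_add_two (x : ℝ) (hx : 0 ≤ x) : 1 / 2 < Real.log (2 + x) := by
  have h1 := Real.log_two_gt_d9
  have h2 : Real.log 2 ≤ Real.log (2 + x) := Real.log_le_log (by norm_num) (by linarith)
  linarith

lemma clog_two_le (n : ℕ) (hn : 1 ≤ n) : (Nat.clog 2 n : ℝ) ≤ 1 + 2 * Real.log (2 + n) := by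
  have hn' : (1 : ℝ) ≤ n := by exact_mod_cast hn
  have h0 : 0 ≤ Real.logb 2 n := Real.logb_nonneg (by norm_num) hn'
  have h1 : (Nat.clog 2 n : ℝ) < Real.logb 2 n + 1 := by
    have h := Nat.ceil_lt_add_one h0
    have e := Real.natCeil_logb_natCast 2 n
    push_cast at e
    rwa [e] at h
  have h2 : Real.logb 2 n ≤ 2 * Real.log (2 + n) := by
    rw [Real.logb, div_le_iff₀ (Real.log_pos (by norm_num))]
    have h3 := Real.log_two_gt_d9
    have h4 : Real.log n ≤ Real.log (2 + n) := Real.log_le_log (by linarith) (by linarith)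
    have h5 : 0 ≤ Real.log n := Real.log_nonneg hn'
    nlinarith
  linarith

lemma binomTime_le (m : ℕ) : binomTime m ≤ ENNReal.ofReal (900000 * Real.log (2 + m)) := by
  refine ENNReal.ofReal_le_ofReal ?_
  have h1 := lpot_le m
  have h2 := half_lt_log_add_two m (Nat.cast_nonneg m)
  linarith

lemma walkTime_le (d n m : ℕ) (hd : 1 ≤ d) (hn : 1 ≤ n) :
    walkTime d n m ≤ ENNReal.ofReal (1900000 * d * (Real.log (2 + n) + Real.log (2 + m))) := by
  have h1 := clog_two_le n hn
  have h2 := half_lt_log_add_two m (Nat.cast_nonneg m)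
  have h3 := half_lt_log_add_two n (Nat.cast_nonneg n)
  have hd' : (1 : ℝ) ≤ d := by exact_mod_cast hd
  have e : walkTime d n m ≤ ENNReal.ofReal ((d * (25 * Nat.clog 2 n + 26) + 20) +
      (d * (41 + 2 * (900000 * Real.log (2 + m))) + 10) + 1) := by
    have hb := binomTime_le m
    rw [ENNReal.ofReal_add (by positivity) (by norm_num), ENNReal.ofReal_add (by positivity)
      (by positivity), ENNReal.ofReal_add (by positivity) (by norm_num),
      ENNReal.ofReal_add (p := _ * (41 + _)) (by positivity) (by norm_num),
      ENNReal.ofReal_mul (q := 41 + _) (by positivity), ENNReal.ofReal_add (p := 41) (by norm_num)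
      (by positivity), ENNReal.ofReal_mul (p := 2) (by norm_num), ENNReal.ofReal_natCast, walkTime,
      ← ENNReal.ofReal_add (by positivity) (by positivity)]
    gcongr
    · rw [← ENNReal.ofReal_natCast]
      exact ENNReal.ofReal_le_ofReal (by push_cast; rfl)
    all_goals norm_num
  refine e.trans (ENNReal.ofReal_le_ofReal ?_)
  nlinarith

/-- A bound for `estTime`. -/
lemma estTime_le (d n m K : ℕ) (hd : 1 ≤ d) (hn : 1 ≤ n) (hK : 1 ≤ K) :
    estTime d n m K ≤
      ENNReal.ofReal (2000000 * K * d * (Real.log (2 + n) + Real.log (2 + m))) := by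
  have h2 := half_lt_log_add_two m (Nat.cast_nonneg m)
  have h3 := half_lt_log_add_two n (Nat.cast_nonneg n)
  have hd' : (1 : ℝ) ≤ d := by exact_mod_cast hd
  have hK' : (1 : ℝ) ≤ K := by exact_mod_cast hK
  have e : estTime d n m K ≤ ENNReal.ofReal (K * (1900000 * d *
      (Real.log (2 + n) + Real.log (2 + m)) + (24 * d + 13)) + 7) := by
    rw [ENNReal.ofReal_add (by positivity) (by norm_num), ENNReal.ofReal_mul (by positivity),
      ENNReal.ofReal_add (by positivity) (by positivity), ENNReal.ofReal_natCast, estTime]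
    gcongr
    · exact walkTime_le d n m hd hn
    · rw [← ENNReal.ofReal_natCast]
      exact ENNReal.ofReal_le_ofReal (by push_cast; rfl)
    · norm_num
  refine e.trans (ENNReal.ofReal_le_ofReal ?_)
  set ℓ := Real.log (2 + n) + Real.log (2 + m)
  have h4 : 24 * (d : ℝ) + 20 ≤ 44 * d * ℓ := by nlinarith
  nlinarith [mul_le_mul_of_nonneg_left h4 (show (0 : ℝ) ≤ K by linarith),
    mul_nonneg (mul_nonneg (show (0 : ℝ) ≤ K by linarith) (show (0 : ℝ) ≤ d by linarith))
      (show (0 : ℝ) ≤ ℓ by linarith)]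

/-! ### The three programs -/

lemma binom_spec (M : Env) (l a b : ℕ) (hb : 1 ≤ b) (hab : a ≤ b) (hw : (l + b + 2) ^ 10 ≤ 2 ^ M.w) :
    (∀ k, haltProb M binom (binomInput l a b) {s | s.reg 7 = k} = binomialLaw l (a / b) k) ∧
    expectedTime M binom (binomInput l a b) ≤ ENNReal.ofReal (2000000 * Real.log (2 + l)) := by
  have h := samples_binom (M := M) (s := binomInput l a b) (l := l) (a := a) (b := b)
    ((mul_sq_le_pow_ten (by omega)).trans hw) rfl rfl rfl hab hb
  refine ⟨fun k => ?_, ?_⟩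
  · rw [h.haltProb_eq ENNReal.ofReal_ne_top _ {k} fun v s' hg => by
      rw [Set.mem_ofPred_eq, hg.2.1, Set.mem_singleton_iff], PMF.toOuterMeasure_apply_singleton]
  · rw [expectedTime_eq_ex]
    refine h.time_le.trans ((binomTime_le l).trans (ENNReal.ofReal_le_ofReal ?_))
    have := half_lt_log_add_two l (Nat.cast_nonneg l)
    linarith

section
variable (d n m K w : ℕ) [NeZero d] [NeZero n] (p₀ : PMF (Fin d → ZMod n)) (σ : ℝ)
  (lo hi : Fin d → ℕ)

lemma walk_spec (hσ : 0 < σ) (hw : (d + n + m + K + 2) ^ 10 ≤ 2 ^ w) :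
    (∀ x : Fin d → ZMod n, haltProb (gridEnv w fun k => σ * (p₀ k).toReal) walk
      (walkInput d n m K lo hi) {s | ∀ j : Fin d, s.mem (2 * d + j) = (x j).val} =
        p₀.bind (nestedBinomial d n d m) x) ∧
    expectedTime (gridEnv w fun k => σ * (p₀ k).toReal) walk (walkInput d n m K lo hi) ≤
      ENNReal.ofReal (2000000 * d * (Real.log (2 + n) + Real.log (2 + m))) ∧
    expectedCalls (gridEnv w fun k => σ * (p₀ k).toReal) walk (walkInput d n m K lo hi) binom =
      2 * d := by
  have hd := Nat.pos_of_neZero d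
  have hn := Nat.pos_of_neZero n
  have hw1 : 1000 * (d + n + m + 2) ^ 2 ≤ 2 ^ w :=
    (Nat.mul_le_mul_left _ (Nat.pow_le_pow_left (by omega) 2)).trans
      ((mul_sq_le_pow_ten (x := d + n + m + K + 2) (by omega)).trans hw)
  have h := samples_walk (p₀ := p₀) (s := walkInput d n m K lo hi) hσ hw1 rfl rfl rfl
  refine ⟨fun x => ?_, ?_, ?_⟩
  · rw [h.haltProb_eq (walkTime_ne_top d n m) _ {x} fun v s' hg => ?_,
      PMF.toOuterMeasure_apply_singleton]
    obtain ⟨_, hg⟩ := hg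
    rw [Set.mem_ofPred_eq, Set.mem_singleton_iff, funext_iff]
    refine forall_congr' fun j => ?_
    rw [hg.mem_lo]
    exact (ZMod.val_injective n).eq_iff
  · rw [expectedTime_eq_ex]
    refine h.time_le.trans ((walkTime_le d n m hd hn).trans (ENNReal.ofReal_le_ofReal ?_))
    have h2 := half_lt_log_add_two m (Nat.cast_nonneg m)
    have h3 := half_lt_log_add_two n (Nat.cast_nonneg n)
    gcongr
    norm_num
  · rw [expectedCalls_eq, walk_calls hσ hw1 rfl rfl rfl]

lemma est_spec (hσ : 0 < σ) (hlo : ∀ j, lo j < n ∧ hi j < n)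
    (hw : (d + n + m + K + 2) ^ 10 ≤ 2 ^ w) :
    (∀ h, haltProb (gridEnv w fun k => σ * (p₀ k).toReal) est (walkInput d n m K lo hi)
      {s | s.reg 8 = h} = hitCount (p₀.bind (nestedBinomial d n d m))
        {k | ∀ j, lo j < (k j).val ∧ (k j).val ≤ hi j} K h) ∧
    expectedCalls (gridEnv w fun k => σ * (p₀ k).toReal) est (walkInput d n m K lo hi) walk =
      K := by
  have hd := Nat.pos_of_neZero d
  have hw1 : 1000 * (d + n + m + K + 2) ^ 2 ≤ 2 ^ w :=
    (mul_sq_le_pow_ten (x := d + n + m + K + 2) (by omega)).trans hw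
  have h := samples_est (p₀ := p₀) (m := m) hσ hw1 hlo
  refine ⟨fun k => ?_, ?_⟩
  · rw [h.haltProb_eq (estTime_ne_top d n m K) _ {k} fun v s' hg => by
      rw [Set.mem_ofPred_eq, hg, Set.mem_singleton_iff], PMF.toOuterMeasure_apply_singleton]
    rfl
  · rw [expectedCalls_eq, est_calls hσ hw1 hlo]

end

/-! ### Iterated directional derivatives -/

section directional
variable {E : Type*} [NormedAddCommGroup E] [NormedSpace ℝ E] {U : Set E} {f g : E → ℝ} {k : ℕ}
  {p v w : E} {m : Fin k → E}

lemma hasFDerivWithinAt_iterated (h : DifferentiableOn ℝ (iteratedFDerivWithin ℝ k f U) U)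
    (hp : p ∈ U) (m : Fin k → E) :
    HasFDerivWithinAt (fun q => iteratedFDerivWithin ℝ k f U q m)
      ((ContinuousMultilinearMap.apply ℝ (fun _ : Fin k => E) ℝ m).comp
        (fderivWithin ℝ (iteratedFDerivWithin ℝ k f U) U p)) U p :=
  (ContinuousMultilinearMap.apply ℝ (fun _ : Fin k => E) ℝ m).hasFDerivAt.comp_hasFDerivWithinAt p
    (h p hp).hasFDerivWithinAt

lemma fderivWithin_iterated (hU : UniqueDiffOn ℝ U)
    (h : DifferentiableOn ℝ (iteratedFDerivWithin ℝ k f U) U) (hp : p ∈ U) (m : Fin k → E) (v : E) :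
    fderivWithin ℝ (fun q => iteratedFDerivWithin ℝ k f U q m) U p v =
      iteratedFDerivWithin ℝ (k + 1) f U p (Fin.cons v m) := by
  rw [(hasFDerivWithinAt_iterated h hp m).fderivWithin (hU p hp), iteratedFDerivWithin_succ_apply_left]
  simp

/-- Symmetry of second derivatives also holds at boundary times, since every point of the slab is a
limit of interior points. -/
lemma fderivWithin_comm (hU : UniqueDiffOn ℝ U) (hU' : U ⊆ closure (interior U))
    (hg : ContDiffOn ℝ 2 g U) (hp : p ∈ U) :
    fderivWithin ℝ (fun q => fderivWithin ℝ g U q w) U p v =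
      fderivWithin ℝ (fun q => fderivWithin ℝ g U q v) U p w := by
  have h1 : DifferentiableOn ℝ (fderivWithin ℝ g U) U :=
    (hg.fderivWithin hU (m := 1) (by norm_num)).differentiableOn (by norm_num)
  have h2 : ∀ w, HasFDerivWithinAt (fun q => fderivWithin ℝ g U q w)
      ((ContinuousLinearMap.apply ℝ ℝ w).comp (fderivWithin ℝ (fderivWithin ℝ g U) U p)) U p :=
    fun w => (ContinuousLinearMap.apply ℝ ℝ w).hasFDerivAt.comp_hasFDerivWithinAt p (h1 p hp).hasFDerivWithinAt
  rw [(h2 w).fderivWithin (hU p hp), (h2 v).fderivWithin (hU p hp)]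
  exact ((hg p hp).isSymmSndFDerivWithinAt (by simp) hU (hU' hp) hp) v w

/-- In a third derivative, the first direction may be moved to the end. -/
lemma iteratedFDerivWithin_three_comm (hU : UniqueDiffOn ℝ U) (hU' : U ⊆ closure (interior U))
    (hf : ContDiffOn ℝ 3 f U) (hp : p ∈ U) :
    iteratedFDerivWithin ℝ 3 f U p ![v, w, w] = iteratedFDerivWithin ℝ 3 f U p ![w, w, v] := by
  have hd : ∀ k : ℕ, (k : WithTop ℕ∞) < 3 → DifferentiableOn ℝ (iteratedFDerivWithin ℝ k f U) U :=
    fun k hk => hf.differentiableOn_iteratedFDerivWithin hk hU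
  have h0 := hd 0 (by norm_num)
  have h1 := hd 1 (by norm_num)
  have h2 := hd 2 (by norm_num)
  have e1 : ∀ w, ∀ q ∈ U, iteratedFDerivWithin ℝ 1 f U q ![w] = fderivWithin ℝ f U q w := fun w q hq => by
    have := fderivWithin_iterated hU h0 hq ![] w
    simp only [iteratedFDerivWithin_zero_apply] at this
    exact this.symm
  have e2 : ∀ v w, ∀ q ∈ U, iteratedFDerivWithin ℝ 2 f U q ![v, w] =
      fderivWithin ℝ (fun q => fderivWithin ℝ f U q w) U q v := fun v w q hq => by
    rw [← fderivWithin_congr (e1 w) (e1 w q hq)]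
    exact (fderivWithin_iterated hU h1 hq ![w] v).symm
  have e3 : ∀ z v w, ∀ q ∈ U, iteratedFDerivWithin ℝ 3 f U q ![z, v, w] =
      fderivWithin ℝ (fun q => fderivWithin ℝ (fun q => fderivWithin ℝ f U q w) U q v) U q z :=
    fun z v w q hq => by
      rw [← fderivWithin_congr (e2 v w) (e2 v w q hq)]
      exact (fderivWithin_iterated hU h2 hq ![v, w] z).symm
  have hw : ContDiffOn ℝ 2 (fun q => fderivWithin ℝ f U q w) U :=
    (hf.fderivWithin hU (m := 2) (by norm_num)).clm_apply contDiffOn_const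
  rw [e3 v w w p hp, e3 w w v p hp, fderivWithin_comm hU hU' hw hp]
  have hc : ∀ q ∈ U, fderivWithin ℝ (fun q => fderivWithin ℝ f U q w) U q v =
      fderivWithin ℝ (fun q => fderivWithin ℝ f U q v) U q w :=
    fun q hq => fderivWithin_comm hU hU' (hf.of_le (by norm_num)) hq
  rw [fderivWithin_congr hc (hc p hp)]

end directional

/-! ### Derivatives of solutions of the heat equation -/

/-- Space-time. -/
def slab (d : ℕ) (T : ℝ) : Set ((Fin d → ℝ) × ℝ) := Set.univ ×ˢ Set.Icc 0 T

lemma uniqueDiffOn_slab (d : ℕ) {T : ℝ} (hT : 0 < T) : UniqueDiffOn ℝ (slab d T) :=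
  uniqueDiffOn_univ.prod (uniqueDiffOn_Icc hT)

lemma slab_subset (d : ℕ) {T : ℝ} (hT : 0 < T) : slab d T ⊆ closure (interior (slab d T)) := by
  rw [slab, interior_prod_eq, closure_prod_eq, interior_univ, closure_univ, interior_Icc,
    closure_Ioo hT.ne]

/-- Derivatives of `u` in the given directions of space-time. -/
def der {d : ℕ} (T : ℝ) (u : (Fin d → ℝ) → ℝ → ℝ) {k : ℕ} (m : Fin k → (Fin d → ℝ) × ℝ)
    (x : Fin d → ℝ) (t : ℝ) : ℝ :=
  iteratedFDerivWithin ℝ k (fun p : (Fin d → ℝ) × ℝ => u p.1 p.2) (slab d T) (x, t) m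

/-- The direction of a spatial coordinate. -/
def spaceDir {d : ℕ} (i : Fin d) : (Fin d → ℝ) × ℝ := (Pi.single i 1, 0)

/-- The direction of time. -/
def timeDir {d : ℕ} : (Fin d → ℝ) × ℝ := (0, 1)

section heat
variable {d : ℕ} {L T α ζ : ℝ} {u₀ : (Fin d → ℝ) → ℝ} {u : (Fin d → ℝ) → ℝ → ℝ} {k : ℕ}
  {x : Fin d → ℝ} {t : ℝ} {i j : Fin d}

lemma IsHeatSolution.hasDerivAt_space (h : IsHeatSolution d L T α ζ u₀ u) (hk : k < 4)
    (ht : t ∈ Set.Icc 0 T) (m : Fin k → (Fin d → ℝ) × ℝ) (x : Fin d → ℝ) (i : Fin d) (s : ℝ) :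
    HasDerivAt (fun s => der T u m (x + s • Pi.single i 1) t)
      (der T u (Fin.cons (spaceDir i) m) (x + s • Pi.single i 1) t) s := by
  have hp : ∀ s : ℝ, (x + s • Pi.single i 1, t) ∈ slab d T := fun s => ⟨trivial, ht⟩
  have hl : HasDerivAt (fun s : ℝ => ((x + s • Pi.single i 1, t) : (Fin d → ℝ) × ℝ)) (spaceDir i) s :=
    HasDerivAt.prodMk (by simpa using ((hasDerivAt_id s).smul_const (Pi.single i (1 : ℝ))).const_add x)
      (hasDerivAt_const s t)
  have h1 := (hasFDerivWithinAt_iterated (h.differentiable k hk) (hp s) m)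
  have h2 := h1.comp_hasDerivWithinAt s (hl.hasDerivWithinAt (s := Set.univ)) fun s _ => hp s
  rw [hasDerivWithinAt_univ] at h2
  convert! h2 using 1

lemma IsHeatSolution.pd_der (h : IsHeatSolution d L T α ζ u₀ u) (hk : k < 4)
    (ht : t ∈ Set.Icc 0 T) (m : Fin k → (Fin d → ℝ) × ℝ) (x : Fin d → ℝ) (i : Fin d) :
    pd i (fun y => der T u m y t) x = der T u (Fin.cons (spaceDir i) m) x t := by
  have := (h.hasDerivAt_space hk ht m x i 0).deriv
  rwa [zero_smul, add_zero] at this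

lemma IsHeatSolution.hasDerivWithinAt_time (h : IsHeatSolution d L T α ζ u₀ u)
    (hk : k < 4) (ht : t ∈ Set.Icc 0 T) (m : Fin k → (Fin d → ℝ) × ℝ) (x : Fin d → ℝ) :
    HasDerivWithinAt (fun s => der T u m x s) (der T u (Fin.cons timeDir m) x t) (Set.Icc 0 T) t := by
  have hl : HasDerivAt (fun s : ℝ => ((x, s) : (Fin d → ℝ) × ℝ)) timeDir t :=
    HasDerivAt.prodMk (hasDerivAt_const t x) (hasDerivAt_id t)
  have h1 := (hasFDerivWithinAt_iterated (h.differentiable k hk)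
    (show (x, t) ∈ slab d T from ⟨trivial, ht⟩) m)
  have h2 := h1.comp_hasDerivWithinAt t (hl.hasDerivWithinAt (s := Set.Icc 0 T))
    fun s hs => ⟨trivial, hs⟩
  convert! h2 using 1

lemma der_zero (m : Fin 0 → (Fin d → ℝ) × ℝ) (x : Fin d → ℝ) (t : ℝ) : der T u m x t = u x t := by
  simp [der]

lemma IsHeatSolution.contDiffOn (h : IsHeatSolution d L T α ζ u₀ u) :
    ContDiffOn ℝ 3 (fun p : (Fin d → ℝ) × ℝ => u p.1 p.2) (slab d T) := by
  refine contDiffOn_of_differentiableOn (n := 3) fun m hm => h.differentiable m ?_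
  have : m ≤ 3 := by exact_mod_cast hm
  omega

lemma IsHeatSolution.der_three (h : IsHeatSolution d L T α ζ u₀ u) (hT : 0 < T)
    (ht : t ∈ Set.Icc 0 T) (x : Fin d → ℝ) (i : Fin d) :
    der T u ![timeDir, spaceDir i, spaceDir i] x t =
      der T u ![spaceDir i, spaceDir i, timeDir] x t :=
  iteratedFDerivWithin_three_comm (uniqueDiffOn_slab d hT) (slab_subset d hT) h.contDiffOn
    ⟨trivial, ht⟩

lemma IsHeatSolution.pd_one (h : IsHeatSolution d L T α ζ u₀ u)
    (ht : t ∈ Set.Icc 0 T) (i : Fin d) :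
    pd i (fun y => u y t) = fun x => der T u ![spaceDir i] x t := by
  funext x
  have := h.pd_der (by norm_num) ht ![] x i
  simp only [der_zero] at this
  exact this

lemma IsHeatSolution.pd_two (h : IsHeatSolution d L T α ζ u₀ u)
    (ht : t ∈ Set.Icc 0 T) (i : Fin d) :
    pd i (pd i (fun y => u y t)) = fun x => der T u ![spaceDir i, spaceDir i] x t := by
  rw [h.pd_one ht]
  exact funext fun x => h.pd_der (by norm_num) ht ![spaceDir i] x i

lemma IsHeatSolution.pd_four (h : IsHeatSolution d L T α ζ u₀ u)
    (ht : t ∈ Set.Icc 0 T) (i j : Fin d) :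
    pd i (pd i (pd j (pd j (fun y => u y t)))) =
      fun x => der T u ![spaceDir i, spaceDir i, spaceDir j, spaceDir j] x t := by
  have e : pd i (pd j (pd j (fun y => u y t))) =
      fun x => der T u ![spaceDir i, spaceDir j, spaceDir j] x t := by
    rw [h.pd_two ht]
    exact funext fun x => h.pd_der (by norm_num) ht ![spaceDir j, spaceDir j] x i
  rw [e]
  exact funext fun x => h.pd_der (by norm_num) ht ![spaceDir i, spaceDir j, spaceDir j] x i

/-- The heat equation in terms of directional derivatives. -/
lemma IsHeatSolution.der_time (h : IsHeatSolution d L T α ζ u₀ u)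
    (ht : t ∈ Set.Ioo 0 T) (x : Fin d → ℝ) :
    der T u ![timeDir] x t = α * ∑ i, der T u ![spaceDir i, spaceDir i] x t := by
  have ht' := Set.Ioo_subset_Icc_self ht
  have h1 := (h.hasDerivWithinAt_time (by norm_num) ht' ![] x).hasDerivAt (Icc_mem_nhds ht.1 ht.2)
  simp only [der_zero] at h1
  have h2 := h.heat x t ht
  rw [h1.deriv] at h2
  rw [show (![timeDir] : Fin 1 → (Fin d → ℝ) × ℝ) = Fin.cons timeDir ![] from rfl, h2]
  simp only [h.pd_two ht']

/-- The time derivative is moved to the innermost place. There the heat equation replaces it for all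
x at the fixed time, and two differentiations in space follow. -/
lemma IsHeatSolution.der_time_space (h : IsHeatSolution d L T α ζ u₀ u) (hT : 0 < T)
    (ht : t ∈ Set.Ioo 0 T) (x : Fin d → ℝ) (i : Fin d) :
    der T u ![timeDir, spaceDir i, spaceDir i] x t =
      α * ∑ j, pd i (pd i (pd j (pd j (fun y => u y t)))) x := by
  have ht' := Set.Ioo_subset_Icc_self ht
  rw [h.der_three hT ht']
  have e1 : ∀ y s, HasDerivAt (fun s => α * ∑ j, der T u ![spaceDir j, spaceDir j] (y + s • Pi.single i 1) t)
      (α * ∑ j, der T u ![spaceDir i, spaceDir j, spaceDir j] (y + s • Pi.single i 1) t) s :=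
    fun y s => (HasDerivAt.fun_sum fun j _ =>
      h.hasDerivAt_space (by norm_num) ht' ![spaceDir j, spaceDir j] y i s).const_mul α
  have e2 : ∀ y s, HasDerivAt (fun s => α * ∑ j, der T u ![spaceDir i, spaceDir j, spaceDir j] (y + s • Pi.single i 1) t)
      (α * ∑ j, der T u ![spaceDir i, spaceDir i, spaceDir j, spaceDir j] (y + s • Pi.single i 1) t) s :=
    fun y s => (HasDerivAt.fun_sum fun j _ =>
      h.hasDerivAt_space (by norm_num) ht' ![spaceDir i, spaceDir j, spaceDir j] y i s).const_mul α
  have f1 : ∀ y, der T u ![spaceDir i, timeDir] y t =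
      α * ∑ j, der T u ![spaceDir i, spaceDir j, spaceDir j] y t := fun y => by
    have := h.hasDerivAt_space (by norm_num) ht' ![timeDir] y i 0
    simp only [h.der_time ht] at this
    have := this.unique (e1 y 0)
    rwa [zero_smul, add_zero] at this
  have := h.hasDerivAt_space (by norm_num) ht' ![spaceDir i, timeDir] x i 0
  simp only [f1] at this
  have := this.unique (e2 x 0)
  rw [zero_smul, add_zero] at this
  simp only [h.pd_four ht']
  exact this

/-! ### Periodicity -/

lemma periodic_pd {g : (Fin d → ℝ) → ℝ} {c : Fin d → ℝ} (hg : Function.Periodic g c) (i : Fin d) :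
    Function.Periodic (pd i g) c := fun x => by
  simp only [pd, lineDeriv]
  congr 1
  funext s
  rw [add_right_comm, hg]

lemma IsHeatSolution.periodic_lattice (h : IsHeatSolution d L T α ζ u₀ u) (ht : t ∈ Set.Icc 0 T)
    (z : Fin d → ℤ) : Function.Periodic (fun y => u y t) (fun i => z i * L) := by
  have e : (fun i => z i * L) = ∑ i, z i • (Pi.single i L : Fin d → ℝ) := by
    funext j
    simp [Finset.sum_apply, Pi.single_apply]
  rw [e]
  refine Finset.sum_induction _ (fun c => Function.Periodic (fun y => u y t) c)
    (fun a b ha hb => ha.add_period hb) (fun x => by simp) fun i _ => ?_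
  exact Function.Periodic.zsmul (fun x => h.periodic t ht x i) (z i)

lemma exists_lattice_mem_Icc (hL : 0 < L) (x : Fin d → ℝ) :
    ∃ z : Fin d → ℤ, (x + fun i => z i * L) ∈ Set.Icc (0 : Fin d → ℝ) (fun _ => L) := by
  refine ⟨fun i => -⌊x i / L⌋, fun i => ?_, fun i => ?_⟩
  · have := mul_le_mul_of_nonneg_right (Int.floor_le (x i / L)) hL.le
    rw [div_mul_cancel₀ _ hL.ne'] at this
    simp
    linarith
  · have := mul_le_mul_of_nonneg_right (Int.lt_floor_add_one (x i / L)).le hL.le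
    rw [div_mul_cancel₀ _ hL.ne'] at this
    simp
    linarith

/-- The bounds are assumed on one period cell only, while the difference quotients leave it. -/
lemma bound_of_periodic {g : (Fin d → ℝ) → ℝ} {c : ℝ} (hL : 0 < L)
    (hg : ∀ z : Fin d → ℤ, Function.Periodic g fun i => z i * L)
    (hb : ∀ x ∈ Set.Icc (0 : Fin d → ℝ) (fun _ => L), |g x| ≤ c) (x : Fin d → ℝ) : |g x| ≤ c := by
  obtain ⟨z, hz⟩ := exists_lattice_mem_Icc hL x
  rw [← hg z x]
  exact hb _ hz

lemma IsHeatSolution.abs_four_le (h : IsHeatSolution d L T α ζ u₀ u) (hL : 0 < L)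
    (ht : t ∈ Set.Icc 0 T) (x : Fin d → ℝ) (i j : Fin d) :
    |pd i (pd i (pd j (pd j (fun y => u y t)))) x| ≤ ζ / L ^ d :=
  bound_of_periodic hL (fun z => periodic_pd (periodic_pd (periodic_pd (periodic_pd
    (h.periodic_lattice ht z) j) j) i) i) (fun x hx => by simpa using h.bound_four x hx t ht i j) x

lemma IsHeatSolution.abs_two_le (h : IsHeatSolution d L T α ζ u₀ u) (hL : 0 < L)
    (ht : t ∈ Set.Icc 0 T) (x : Fin d → ℝ) (i : Fin d) :
    |pd i (pd i (fun y => u y t)) x| ≤ ζ * L ^ 2 / L ^ d :=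
  bound_of_periodic hL (fun z => periodic_pd (periodic_pd (h.periodic_lattice ht z) i) i)
    (fun x hx => by
      have := h.bound_two x hx t ht i
      rw [zpow_sub₀ hL.ne'] at this
      convert! this using 1
      simp only [zpow_natCast, zpow_ofNat]
      field_simp) x

end heat

/-! ### Taylor estimates -/

lemma abs_le_of_abs_deriv_le {ψ ψ' : ℝ → ℝ} {c : ℝ} {k : ℕ} (hd : ∀ s, HasDerivAt ψ (ψ' s) s)
    (h0 : ψ 0 = 0) (hb : ∀ s, 0 ≤ s → |ψ' s| ≤ c * s ^ k) {s : ℝ} (hs : 0 ≤ s) :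
    |ψ s| ≤ c / (k + 1) * s ^ (k + 1) := by
  have hB : ∀ x, HasDerivAt (fun x : ℝ => c / (k + 1) * x ^ (k + 1)) (c * x ^ k) x := fun x => by
    convert! (hasDerivAt_pow (k + 1) x).const_mul (c / (k + 1)) using 1
    push_cast
    field_simp
  refine image_norm_le_of_norm_deriv_right_le_deriv_boundary (a := 0) (b := s)
    (fun x _ => (hd x).continuousAt.continuousWithinAt) (fun x _ => (hd x).hasDerivWithinAt)
    (B := fun x => c / (k + 1) * x ^ (k + 1)) (B' := fun x => c * x ^ k) (by simp [h0]) hB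
    (fun x hx => hb x hx.1) ⟨hs, le_rfl⟩

lemma hasDerivAt_comp_neg {g g' : ℝ → ℝ} (hg : ∀ s, HasDerivAt g (g' s) s) (s : ℝ) :
    HasDerivAt (fun s => g (-s)) (-g' (-s)) s := by
  convert! (hg (-s)).comp s (hasDerivAt_neg s) using 1
  ring

/-- Two applications of the mean value inequality; they require no continuity of the second
derivative. -/
lemma abs_symmetric_sub_le {φ φ₁ φ₂ : ℝ → ℝ} {M : ℝ} (h1 : ∀ s, HasDerivAt φ (φ₁ s) s)
    (h2 : ∀ s, HasDerivAt φ₁ (φ₂ s) s) (hM : ∀ s, |φ₂ s| ≤ M) {s : ℝ} (hs : 0 ≤ s) :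
    |φ s + φ (-s) - 2 * φ 0| ≤ M * s ^ 2 := by
  have d1 : ∀ s, HasDerivAt (fun s => φ s + φ (-s) - 2 * φ 0) (φ₁ s - φ₁ (-s)) s := fun s => by
    simpa [sub_eq_add_neg] using ((h1 s).fun_add (hasDerivAt_comp_neg h1 s)).sub_const (2 * φ 0)
  have d2 : ∀ s, HasDerivAt (fun s => φ₁ s - φ₁ (-s)) (φ₂ s + φ₂ (-s)) s := fun s => by
    simpa using (h2 s).fun_sub (hasDerivAt_comp_neg h2 s)
  have b2 : ∀ s, 0 ≤ s → |φ₂ s + φ₂ (-s)| ≤ 2 * M * s ^ 0 := fun s _ => by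
    have := abs_add_le (φ₂ s) (φ₂ (-s))
    have := hM s
    have := hM (-s)
    rw [pow_zero]
    linarith
  have b1 : ∀ s, 0 ≤ s → |φ₁ s - φ₁ (-s)| ≤ 2 * M * s ^ 1 := fun s hs => by
    have := abs_le_of_abs_deriv_le d2 (by simp) b2 hs
    simpa using this
  have := abs_le_of_abs_deriv_le d1 (by rw [neg_zero]; ring) b1 hs
  refine this.trans_eq ?_
  push_cast
  ring

/-- The second-order estimate for φ₂ is integrated twice: M s² becomes M s³/3 and then M s⁴/12. -/
lemma abs_second_difference_sub_le {φ φ₁ φ₂ φ₃ φ₄ : ℝ → ℝ} {M : ℝ}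
    (h1 : ∀ s, HasDerivAt φ (φ₁ s) s) (h2 : ∀ s, HasDerivAt φ₁ (φ₂ s) s)
    (h3 : ∀ s, HasDerivAt φ₂ (φ₃ s) s) (h4 : ∀ s, HasDerivAt φ₃ (φ₄ s) s) (hM : ∀ s, |φ₄ s| ≤ M)
    {s : ℝ} (hs : 0 ≤ s) : |φ s + φ (-s) - 2 * φ 0 - s ^ 2 * φ₂ 0| ≤ M / 12 * s ^ 4 := by
  have b2 : ∀ s, 0 ≤ s → |φ₂ s + φ₂ (-s) - 2 * φ₂ 0| ≤ M * s ^ 2 :=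
    fun s hs => abs_symmetric_sub_le h3 h4 hM hs
  have d2 : ∀ s, HasDerivAt (fun s => φ₁ s - φ₁ (-s) - 2 * φ₂ 0 * s)
      (φ₂ s + φ₂ (-s) - 2 * φ₂ 0) s := fun s => by
    simpa using ((h2 s).fun_sub (hasDerivAt_comp_neg h2 s)).fun_sub ((hasDerivAt_id s).const_mul (2 * φ₂ 0))
  have b1 : ∀ s, 0 ≤ s → |φ₁ s - φ₁ (-s) - 2 * φ₂ 0 * s| ≤ M / 3 * s ^ 3 := fun s hs => by
    refine (abs_le_of_abs_deriv_le d2 (by simp) b2 hs).trans_eq ?_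
    push_cast
    ring
  have d1 : ∀ s, HasDerivAt (fun s => φ s + φ (-s) - 2 * φ 0 - s ^ 2 * φ₂ 0)
      (φ₁ s - φ₁ (-s) - 2 * φ₂ 0 * s) s := fun s => by
    have := (((h1 s).add (hasDerivAt_comp_neg h1 s)).sub_const (2 * φ 0)).sub
      ((hasDerivAt_pow 2 s).mul_const (φ₂ 0))
    convert! this using 1
    push_cast
    ring
  refine (abs_le_of_abs_deriv_le d1 (by rw [neg_zero]; ring) b1 hs).trans_eq ?_
  push_cast
  ring

/-! ### Consistency of the finite difference scheme. -/

section heat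
variable {d : ℕ} {L T α ζ : ℝ} {u₀ : (Fin d → ℝ) → ℝ} {u : (Fin d → ℝ) → ℝ → ℝ} {t : ℝ}

lemma IsHeatSolution.hasDerivAt_line (h : IsHeatSolution d L T α ζ u₀ u) (ht : t ∈ Set.Icc 0 T)
    (x : Fin d → ℝ) (i : Fin d) (s : ℝ) : HasDerivAt (fun s => u (x + s • Pi.single i 1) t)
      (der T u ![spaceDir i] (x + s • Pi.single i 1) t) s := by
  have := h.hasDerivAt_space (by norm_num) ht ![] x i s
  simp only [der_zero] at this
  exact this

lemma IsHeatSolution.abs_symmetric_sub_le (h : IsHeatSolution d L T α ζ u₀ u) (hL : 0 < L)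
    (ht : t ∈ Set.Icc 0 T) (x : Fin d → ℝ) (i : Fin d) {s : ℝ} (hs : 0 ≤ s) :
    |u (x + s • Pi.single i 1) t + u (x - s • Pi.single i 1) t - 2 * u x t| ≤
      ζ * L ^ 2 / L ^ d * s ^ 2 := by
  have := HeatWalk.abs_symmetric_sub_le (h.hasDerivAt_line ht x i)
    (h.hasDerivAt_space (by norm_num) ht ![spaceDir i] x i) (M := ζ * L ^ 2 / L ^ d) (fun s => by
      have := h.abs_two_le hL ht (x + s • Pi.single i 1) i
      rwa [h.pd_two ht] at this) hs
  rwa [neg_smul, ← sub_eq_add_neg, zero_smul, add_zero] at this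

lemma IsHeatSolution.abs_second_difference_sub_le (h : IsHeatSolution d L T α ζ u₀ u) (hL : 0 < L)
    (ht : t ∈ Set.Icc 0 T) (x : Fin d → ℝ) (i : Fin d) {s : ℝ} (hs : 0 ≤ s) :
    |u (x + s • Pi.single i 1) t + u (x - s • Pi.single i 1) t - 2 * u x t -
      s ^ 2 * der T u ![spaceDir i, spaceDir i] x t| ≤ ζ / L ^ d / 12 * s ^ 4 := by
  have := HeatWalk.abs_second_difference_sub_le (h.hasDerivAt_line ht x i)
    (h.hasDerivAt_space (by norm_num) ht ![spaceDir i] x i)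
    (h.hasDerivAt_space (by norm_num) ht ![spaceDir i, spaceDir i] x i)
    (h.hasDerivAt_space (by norm_num) ht ![spaceDir i, spaceDir i, spaceDir i] x i)
    (M := ζ / L ^ d) (fun s => by
      have := h.abs_four_le hL ht (x + s • Pi.single i 1) i i
      rwa [h.pd_four ht] at this) hs
  rw [neg_smul, ← sub_eq_add_neg, zero_smul, add_zero] at this
  exact this

/-- The mean value theorem is used twice, for u and for α Δu. It needs derivatives at interior times
only, so t = 0 is allowed although the equation is assumed for 0 < t < T. -/
lemma IsHeatSolution.abs_time_step_le (h : IsHeatSolution d L T α ζ u₀ u) (hL : 0 < L)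
    (hT : 0 < T) (hα : 0 < α) {s : ℝ} (ht : 0 ≤ t) (hs : 0 < s) (hts : t + s ≤ T) (x : Fin d → ℝ) :
    |u x (t + s) - u x t - s * (α * ∑ i, der T u ![spaceDir i, spaceDir i] x t)| ≤
      s ^ 2 * (α ^ 2 * d ^ 2 * (ζ / L ^ d)) := by
  set g : ℝ → ℝ := fun r => α * ∑ i, der T u ![spaceDir i, spaceDir i] x r with hg
  have hu : ∀ r ∈ Set.Icc 0 T, HasDerivWithinAt (u x) (der T u ![timeDir] x r) (Set.Icc 0 T) r :=
    fun r hr => by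
      have := h.hasDerivWithinAt_time (by norm_num) hr ![] x
      simp only [der_zero] at this
      exact this
  have hg' : ∀ r ∈ Set.Icc 0 T, HasDerivWithinAt g
      (α * ∑ i, der T u ![timeDir, spaceDir i, spaceDir i] x r) (Set.Icc 0 T) r := fun r hr =>
    (HasDerivWithinAt.fun_sum fun i _ =>
      h.hasDerivWithinAt_time (by norm_num) hr ![spaceDir i, spaceDir i] x).const_mul α
  have hsub : Set.Icc t (t + s) ⊆ Set.Icc 0 T := Set.Icc_subset_Icc ht hts
  have hio : ∀ r ∈ Set.Ioo t (t + s), r ∈ Set.Ioo 0 T := fun r hr =>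
    ⟨ht.trans_lt hr.1, hr.2.trans_le hts⟩
  obtain ⟨ξ, hξ, e1⟩ := exists_hasDerivAt_eq_slope (u x) (fun r => der T u ![timeDir] x r)
    (show t < t + s by linarith) (fun r hr => (hu r (hsub hr)).continuousWithinAt.mono hsub)
    fun r hr => (hu r (Set.Ioo_subset_Icc_self (hio r hr))).hasDerivAt
      (Icc_mem_nhds (hio r hr).1 (hio r hr).2)
  have hsub' : Set.Icc t ξ ⊆ Set.Icc 0 T := Set.Icc_subset_Icc ht (hξ.2.le.trans hts)
  have hio' : ∀ r ∈ Set.Ioo t ξ, r ∈ Set.Ioo 0 T := fun r hr => hio r ⟨hr.1, hr.2.trans hξ.2⟩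
  obtain ⟨η, hη, e2⟩ := exists_hasDerivAt_eq_slope g _ hξ.1
    (fun r hr => (hg' r (hsub' hr)).continuousWithinAt.mono hsub')
    fun r hr => (hg' r (Set.Ioo_subset_Icc_self (hio' r hr))).hasDerivAt
      (Icc_mem_nhds (hio' r hr).1 (hio' r hr).2)
  rw [h.der_time (hio ξ hξ), show α * ∑ i, der T u ![spaceDir i, spaceDir i] x ξ = g ξ from rfl,
    add_sub_cancel_left, eq_div_iff hs.ne'] at e1
  rw [eq_div_iff (sub_pos.2 hξ.1).ne'] at e2
  have hb : |α * ∑ i, der T u ![timeDir, spaceDir i, spaceDir i] x η| ≤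
      α ^ 2 * d ^ 2 * (ζ / L ^ d) := by
    rw [abs_mul, abs_of_pos hα]
    calc _ ≤ α * ∑ i : Fin d, α * (d * (ζ / L ^ d)) := by
          refine mul_le_mul_of_nonneg_left ((Finset.abs_sum_le_sum_abs _ _).trans
            (Finset.sum_le_sum fun i _ => ?_)) hα.le
          rw [h.der_time_space hT (hio' η hη), abs_mul, abs_of_pos hα]
          refine mul_le_mul_of_nonneg_left ((Finset.abs_sum_le_sum_abs _ _).trans
            ((Finset.sum_le_sum fun j _ => h.abs_four_le hL
              (Set.Ioo_subset_Icc_self (hio' η hη)) x i j).trans_eq ?_)) hα.le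
          simp
      _ = _ := by
        simp
        ring
  have hc := (abs_nonneg _).trans hb
  rw [← e1, show α * ∑ i, der T u ![spaceDir i, spaceDir i] x t = g t from rfl,
    show g ξ * s - s * g t = s * (g ξ - g t) by ring, ← e2, abs_mul, abs_mul, abs_of_pos hs,
    abs_of_pos (sub_pos.2 hξ.1), sq s, mul_assoc]
  refine mul_le_mul_of_nonneg_left ?_ hs.le
  rw [mul_comm]
  exact mul_le_mul (by linarith [hξ.2]) hb (abs_nonneg _) hs.le

/-- The local error of the finite difference scheme. -/
lemma IsHeatSolution.abs_scheme_le (h : IsHeatSolution d L T α ζ u₀ u) (hd : 0 < d) (hL : 0 < L)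
    (hT : 0 < T) (hα : 0 < α) {Δx Δt : ℝ} (hx : 0 < Δx) (hΔ : Δt = Δx ^ 2 / (2 * d * α))
    (ht : 0 ≤ t) (hts : t + Δt ≤ T) (x : Fin d → ℝ) :
    |u x (t + Δt) - (∑ i, (u (x + Δx • Pi.single i 1) t + u (x - Δx • Pi.single i 1) t)) / (2 * d)| ≤
      7 / 24 * Δx ^ 4 * (ζ / L ^ d) := by
  have hd' : (0 : ℝ) < d := by exact_mod_cast hd
  have hΔ0 : 0 < Δt := by rw [hΔ]; positivity
  have ht' : t ∈ Set.Icc 0 T := ⟨ht, by linarith⟩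
  have h1 := h.abs_time_step_le hL hT hα ht hΔ0 hts x
  set w : Fin d → ℝ := fun i => der T u ![spaceDir i, spaceDir i] x t with hw
  set R : Fin d → ℝ := fun i => u (x + Δx • Pi.single i 1) t + u (x - Δx • Pi.single i 1) t -
    2 * u x t - Δx ^ 2 * w i with hR
  have h2 : |∑ i, R i| ≤ d * (ζ / L ^ d / 12 * Δx ^ 4) :=
    (Finset.abs_sum_le_sum_abs _ _).trans ((Finset.sum_le_sum fun i _ =>
      h.abs_second_difference_sub_le hL ht' x i hx.le).trans_eq (by simp))
  -- The choice of Δt makes Δt α equal to Δx²/(2 d), so the terms with `u x t` and with the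
  -- Laplacian cancel.
  have e : u x (t + Δt) -
      (∑ i, (u (x + Δx • Pi.single i 1) t + u (x - Δx • Pi.single i 1) t)) / (2 * d) =
      (u x (t + Δt) - u x t - Δt * (α * ∑ i, w i)) - (∑ i, R i) / (2 * d) := by
    have : ∑ i, (u (x + Δx • Pi.single i 1) t + u (x - Δx • Pi.single i 1) t) =
        ∑ i, R i + d * (2 * u x t) + Δx ^ 2 * ∑ i, w i := by
      simp only [hR, Finset.sum_sub_distrib, Finset.mul_sum, Finset.sum_const, Finset.card_univ,
        Fintype.card_fin, nsmul_eq_mul]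
      ring
    rw [this, hΔ]
    field_simp
    ring
  rw [e]
  refine (abs_sub _ _).trans ?_
  rw [abs_div, abs_of_pos (show (0 : ℝ) < 2 * d by positivity)]
  have h3 : |∑ i, R i| / (2 * d) ≤ ζ / L ^ d / 24 * Δx ^ 4 := by
    rw [div_le_iff₀ (by positivity)]
    refine h2.trans_eq (by ring)
  -- Time contributes 1/4 and space 1/24, which gives 7/24.
  have h4 : Δt ^ 2 * (α ^ 2 * d ^ 2 * (ζ / L ^ d)) = Δx ^ 4 / 4 * (ζ / L ^ d) := by
    rw [hΔ]
    field_simp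
    ring
  rw [h4] at h1
  linarith

end heat

/-! ### The finite difference scheme and the random walk -/

section scheme
variable {d n : ℕ}

/-- The mean over the neighbours in the grid. -/
def neighbourMean (g : (Fin d → ZMod n) → ℝ) (k : Fin d → ZMod n) : ℝ :=
  (∑ i, (g (k + Pi.single i 1) + g (k - Pi.single i 1))) / (2 * d)

/-- Self-adjointness, by translation invariance of sums over the torus. -/
lemma sum_mul_neighbourMean [NeZero n] (g e : (Fin d → ZMod n) → ℝ) :
    ∑ k, g k * neighbourMean e k = ∑ k, neighbourMean g k * e k := by
  have h : ∀ c : Fin d → ZMod n, ∑ k, g k * e (k + c) = ∑ k, g (k - c) * e k := fun c => by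
    rw [← Equiv.sum_comp (Equiv.addRight c) fun k => g (k - c) * e k]
    simp
  have h' : ∀ c : Fin d → ZMod n, ∑ k, g k * e (k - c) = ∑ k, g (k + c) * e k := fun c => by
    simpa [sub_eq_add_neg] using h (-c)
  simp only [neighbourMean, mul_div_assoc', div_mul_eq_mul_div, ← Finset.sum_div]
  congr 1
  simp only [Finset.mul_sum, Finset.sum_mul]
  rw [Finset.sum_comm]
  conv_rhs => rw [Finset.sum_comm]
  refine Finset.sum_congr rfl fun i _ => ?_
  simp only [mul_add, add_mul, Finset.sum_add_distrib]
  rw [h, h', add_comm]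

/-- The probability that the walk from `x` ends in `A`. -/
def hitProb [NeZero d] (A : Set (Fin d → ZMod n)) (m : ℕ) (x : Fin d → ZMod n) : ℝ :=
  ((simpleWalk d n m x).toOuterMeasure A).toReal

variable [NeZero d] {A : Set (Fin d → ZMod n)}

lemma toOuterMeasure_le_one {X : Type*} (p : PMF X) (A : Set X) : p.toOuterMeasure A ≤ 1 := by
  classical
  rw [toOuterMeasure_eq_avg]
  exact (avg_mono fun a => by split_ifs <;> simp).trans (avg_const p 1).le

lemma hitProb_nonneg (m : ℕ) (x : Fin d → ZMod n) : 0 ≤ hitProb A m x := ENNReal.toReal_nonneg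

lemma hitProb_le_one (m : ℕ) (x : Fin d → ZMod n) : hitProb A m x ≤ 1 :=
  ENNReal.toReal_le_of_le_ofReal zero_le_one (by simpa using toOuterMeasure_le_one _ _)

lemma hitProb_zero (x : Fin d → ZMod n) : hitProb A 0 x = A.indicator (fun _ => 1) x := by
  by_cases hx : x ∈ A <;> simp [hitProb, simpleWalk, PMF.toOuterMeasure_pure_apply, hx]

/-- First-step analysis: the hitting probabilities evolve by the same averaging as the scheme. -/
lemma hitProb_succ (m : ℕ) (x : Fin d → ZMod n) :
    hitProb A (m + 1) x = neighbourMean (hitProb A m) x := by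
  have hu : ∀ (i : Fin d) (c : ZMod n), Function.update x i (x i + c) = x + Pi.single i c :=
    fun i c => by
      funext j
      by_cases h : j = i
      · subst h
        simp
      · simp [h]
  have hd : (d : ℝ) ≠ 0 := by exact_mod_cast NeZero.ne d
  rw [hitProb, simpleWalk, PMF.toOuterMeasure_bind_apply, tsum_fintype, ENNReal.toReal_sum]
  · simp only [ENNReal.toReal_mul, PMF.uniformOfFintype_apply, ENNReal.toReal_inv,
      ENNReal.toReal_natCast, Fintype.card_prod, Fintype.card_fin, Fintype.card_bool,
      Fintype.sum_prod_type, Fintype.sum_bool, if_true, hu, neighbourMean, Finset.sum_div]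
    refine Finset.sum_congr rfl fun i _ => ?_
    simp only [Bool.false_eq_true, if_false, Pi.single_neg, ← sub_eq_add_neg, hitProb]
    push_cast
    field_simp
  · intro p _
    exact ENNReal.mul_ne_top (PMF.apply_ne_top _ _)
      ((toOuterMeasure_le_one _ _).trans_lt ENNReal.one_lt_top).ne

/-- Stability of the finite difference scheme, by duality with the random walk. -/
lemma abs_sum_sub_le [NeZero n] {U : ℕ → (Fin d → ZMod n) → ℝ} {δ : ℝ} {N : ℕ}
    (hU : ∀ i < N, ∀ k, |U (i + 1) k - neighbourMean (U i) k| ≤ δ) (j : ℕ) :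
    ∀ i, i + j ≤ N → |∑ k, U (i + j) k * A.indicator (fun _ => 1) k - ∑ k, U i k * hitProb A j k| ≤
      j * (n ^ d * δ) := by
  induction j with
  | zero => simp [hitProb_zero]
  | succ j ih =>
    intro i hi
    have h1 := ih (i + 1) (by omega)
    -- Self-adjointness moves one step from the walk to `U`. The local error is then tested against
    -- a function with values in [0, 1].
    have h2 : |∑ k, U (i + 1) k * hitProb A j k - ∑ k, U i k * hitProb A (j + 1) k| ≤
        n ^ d * δ := by
      simp only [hitProb_succ]
      rw [sum_mul_neighbourMean, ← Finset.sum_sub_distrib]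
      calc _ ≤ ∑ k : Fin d → ZMod n, δ := by
            refine (Finset.abs_sum_le_sum_abs _ _).trans (Finset.sum_le_sum fun k _ => ?_)
            rw [← sub_mul, abs_mul, abs_of_nonneg (hitProb_nonneg j k)]
            have := hU i (by omega) k
            exact (mul_le_mul this (hitProb_le_one j k) (hitProb_nonneg j k)
              ((abs_nonneg _).trans this)).trans_eq (mul_one δ)
        _ = _ := by simp [ZMod.card]
    rw [show i + (j + 1) = i + 1 + j by ring]
    refine (abs_sub_le _ (∑ k, U (i + 1) k * hitProb A j k) _).trans ((add_le_add h1 h2).trans_eq ?_)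
    push_cast
    ring

variable {L T α ζ : ℝ} {u₀ : (Fin d → ℝ) → ℝ} {u : (Fin d → ℝ) → ℝ → ℝ} {t : ℝ}

omit [NeZero d] in
-- Grid points use representatives in [0, n); wrapping around changes coordinates by multiples of
-- the period.
lemma IsHeatSolution.eq_gridPoint [NeZero n] (h : IsHeatSolution d L T α ζ u₀ u)
    (ht : t ∈ Set.Icc 0 T) {k : Fin d → ZMod n} {z : Fin d → ℤ} (hz : ∀ j, (z j : ZMod n) = k j) :
    u (fun j => z j * (L / n)) t = u (gridPoint L k) t := by
  have hn : (n : ℝ) ≠ 0 := by exact_mod_cast NeZero.ne n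
  have hq : ∀ j, ∃ q : ℤ, z j = (k j).val + n * q := fun j => by
    have : ((z j - (k j).val : ℤ) : ZMod n) = 0 := by
      push_cast
      rw [hz, ZMod.natCast_zmod_val, sub_self]
    obtain ⟨q, hq⟩ := (ZMod.intCast_zmod_eq_zero_iff_dvd _ n).1 this
    exact ⟨q, by linarith⟩
  choose q hq using hq
  refine Eq.trans ?_ (h.periodic_lattice ht q (gridPoint L k))
  change u _ t = u _ t
  congr 1
  funext j
  simp only [gridPoint, Pi.add_apply, hq]
  push_cast
  field_simp

omit [NeZero d] in
lemma IsHeatSolution.gridPoint_add [NeZero n] (h : IsHeatSolution d L T α ζ u₀ u)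
    (ht : t ∈ Set.Icc 0 T) (k : Fin d → ZMod n) (i : Fin d) (c : ℤ) :
    u (gridPoint L (k + Pi.single i (c : ZMod n))) t =
      u (gridPoint L k + (c * (L / n)) • Pi.single i 1) t := by
  rw [← h.eq_gridPoint ht (z := fun j => (k j).val + (Pi.single i c : Fin d → ℤ) j) fun j => ?_]
  · congr 1
    funext j
    by_cases hj : j = i
    · subst hj
      simp [gridPoint, add_mul]
    · simp [gridPoint, hj]
  · by_cases hj : j = i
    · subst hj
      simp
    · simp [hj]

/-- The law of the endpoint of the walk approximates the solution. -/
lemma IsHeatSolution.abs_hit_sub_le [NeZero n] (h : IsHeatSolution d L T α ζ u₀ u) (hL : 0 < L)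
    (hT : 0 < T) (hα : 0 < α) {Δx Δt : ℝ} (hx : Δx = L / n) (hΔ : Δt = Δx ^ 2 / (2 * d * α)) {m : ℕ}
    (hm : m * Δt ≤ T) {p₀ : PMF (Fin d → ZMod n)}
    (hp : ∀ k, (p₀ k).toReal = u₀ (gridPoint L k) * Δx ^ d) (A : Set (Fin d → ZMod n)) :
    |Δx ^ d * ∑ k, u (gridPoint L k) (m * Δt) * A.indicator (fun _ => 1) k -
      ((p₀.bind (simpleWalk d n m)).toOuterMeasure A).toReal| ≤ m * (7 / 24 * Δx ^ 4 * ζ) := by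
  have hd : 0 < d := Nat.pos_of_neZero d
  have hd' : (0 : ℝ) < d := by exact_mod_cast hd
  have hn : (0 : ℝ) < n := by exact_mod_cast Nat.pos_of_neZero n
  have hx0 : 0 < Δx := by rw [hx]; positivity
  have hΔ0 : 0 < Δt := by rw [hΔ]; positivity
  have key := abs_sum_sub_le (A := A) (U := fun i k => u (gridPoint L k) (i * Δt)) (N := m)
    (δ := 7 / 24 * Δx ^ 4 * (ζ / L ^ d)) (fun i hi k => ?_) m 0 (by omega)
  · have e : ((p₀.bind (simpleWalk d n m)).toOuterMeasure A).toReal =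
        Δx ^ d * ∑ k, u (gridPoint L k) ((0 : ℕ) * Δt) * hitProb A m k := by
      rw [PMF.toOuterMeasure_bind_apply, tsum_fintype, ENNReal.toReal_sum, Finset.mul_sum]
      · refine Finset.sum_congr rfl fun k _ => ?_
        rw [ENNReal.toReal_mul, hp, Nat.cast_zero, zero_mul, h.initial, hitProb]
        ring
      · exact fun k _ => ENNReal.mul_ne_top (PMF.apply_ne_top _ _)
          ((toOuterMeasure_le_one _ _).trans_lt ENNReal.one_lt_top).ne
    rw [e, ← mul_sub, abs_mul, abs_of_pos (pow_pos hx0 d)]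
    rw [zero_add] at key
    refine (mul_le_mul_of_nonneg_left key (pow_pos hx0 d).le).trans_eq ?_
    rw [hx, div_pow]
    field_simp
  · have hi' : (i : ℝ) + 1 ≤ m := by exact_mod_cast hi
    have hle : i * Δt + Δt ≤ T := by nlinarith
    have ht : i * Δt ∈ Set.Icc 0 T := ⟨by positivity, by linarith⟩
    have := h.abs_scheme_le hd hL hT hα hx0 hΔ ht.1 hle (gridPoint L k)
    have ea : ∀ j, u (gridPoint L (k + Pi.single j 1)) (i * Δt) =
        u (gridPoint L k + Δx • Pi.single j 1) (i * Δt) := fun j => by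
      simpa [hx] using h.gridPoint_add ht k j 1
    have eb : ∀ j, u (gridPoint L (k - Pi.single j 1)) (i * Δt) =
        u (gridPoint L k - Δx • Pi.single j 1) (i * Δt) := fun j => by
      simpa [hx, Pi.single_neg, ← sub_eq_add_neg] using h.gridPoint_add ht k j (-1)
    simp only [neighbourMean, ea, eb]
    push_cast
    rwa [add_mul, one_mul]

end scheme

/-! ### Midpoint quadrature -/

section quadrature
open MeasureTheory
variable {d : ℕ} {g : (Fin d → ℝ) → ℝ} {M h : ℝ}

/-- Change of sign of one coordinate. -/
def negCoord (i : Fin d) (y : Fin d → ℝ) : Fin d → ℝ := fun k => (if k = i then Neg.neg else id) (y k)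

lemma negCoord_self (i : Fin d) (y : Fin d → ℝ) : negCoord i y i = -y i := by simp [negCoord]

lemma negCoord_of_ne {i k : Fin d} (hk : k ≠ i) (y : Fin d → ℝ) : negCoord i y k = y k := by
  simp [negCoord, hk]

lemma negCoord_involutive (i : Fin d) : Function.Involutive (negCoord i) := fun y => by
  funext k
  by_cases hk : k = i
  · subst hk
    simp [negCoord_self]
  · simp [negCoord_of_ne hk]

lemma measurePreserving_negCoord (i : Fin d) : MeasurePreserving (negCoord i) volume volume :=
  volume_preserving_pi fun k => by
    by_cases hk : k = i
    · rw [if_pos hk]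
      exact Measure.measurePreserving_neg _
    · rw [if_neg hk]
      exact .id _

lemma integral_negCoord (i : Fin d) (f : (Fin d → ℝ) → ℝ) :
    ∫ y in Set.Icc (fun _ => -(h / 2)) (fun _ => h / 2), f (negCoord i y) =
      ∫ y in Set.Icc (fun _ => -(h / 2)) (fun _ => h / 2), f y := by
  have e : negCoord i ⁻¹' Set.Icc (fun _ : Fin d => -(h / 2)) (fun _ => h / 2) =
      Set.Icc (fun _ => -(h / 2)) (fun _ => h / 2) := by
    ext y
    simp only [Set.mem_preimage, Set.mem_Icc, Pi.le_def, ← forall_and]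
    refine forall_congr' fun k => ?_
    by_cases hk : k = i
    · subst hk
      rw [negCoord_self]
      constructor <;> rintro ⟨h1, h2⟩ <;> constructor <;> linarith
    · rw [negCoord_of_ne hk]
  have := (measurePreserving_negCoord i).setIntegral_preimage_emb
    (MeasurableEquiv.ofInvolutive _ (negCoord_involutive i)
      (measurePreserving_negCoord i).measurable).measurableEmbedding f
    (Set.Icc (fun _ => -(h / 2)) (fun _ => h / 2))
  rwa [e] at this

/-- Set the first `j` coordinates to zero. -/
def cut (j : ℕ) (y : Fin d → ℝ) : Fin d → ℝ := fun k => if (k : ℕ) < j then 0 else y k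

lemma continuous_cut (j : ℕ) : Continuous (cut j : (Fin d → ℝ) → Fin d → ℝ) :=
  continuous_pi fun k => by
    by_cases hk : (k : ℕ) < j
    · simp only [cut, if_pos hk]
      exact continuous_const
    · simp only [cut, if_neg hk]
      exact continuous_apply k

/-- One coordinate is moved to the centre of the cube. Averaging with the reflected point cancels
the first-order term and leaves a second difference with |s| ≤ h/2. -/
lemma abs_integral_cut_sub_le (hg : Continuous g)
    (hM : ∀ x i s, |g (x + s • Pi.single i 1) + g (x - s • Pi.single i 1) - 2 * g x| ≤ M * s ^ 2)
    (hM0 : 0 ≤ M) (hh : 0 ≤ h) (c : Fin d → ℝ) {j : ℕ} (hj : j < d) :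
    |(∫ y in Set.Icc (fun _ => -(h / 2)) (fun _ => h / 2), g (c + cut j y)) -
      ∫ y in Set.Icc (fun _ => -(h / 2)) (fun _ => h / 2), g (c + cut (j + 1) y)| ≤
      M * h ^ 2 / 8 * h ^ d := by
  set i : Fin d := ⟨j, hj⟩ with hi
  set Q : Set (Fin d → ℝ) := Set.Icc (fun _ => -(h / 2)) (fun _ => h / 2) with hQ
  have e1 : ∀ y, cut j y = cut (j + 1) y + y i • Pi.single i 1 := fun y => by
    funext k
    by_cases hk : k = i
    · subst hk
      simp [cut, hi]
    · have : (k : ℕ) ≠ j := fun e => hk (Fin.ext e)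
      simp only [cut, Pi.add_apply, Pi.smul_apply, Pi.single_eq_of_ne hk, smul_zero, add_zero]
      split_ifs <;> first | rfl | omega
  have e2 : ∀ y, cut j (negCoord i y) = cut (j + 1) y - y i • Pi.single i 1 := fun y => by
    rw [e1 (negCoord i y), negCoord_self, neg_smul, ← sub_eq_add_neg]
    congr 1
    funext k
    by_cases hk : k = i
    · subst hk
      simp [cut, hi]
    · simp [cut, negCoord_of_ne hk]
  have hint : ∀ {f : (Fin d → ℝ) → Fin d → ℝ}, Continuous f →
      IntegrableOn (fun y => g (c + f y)) Q := fun hf =>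
    (hg.comp (continuous_const.add hf)).integrableOn_Icc
  have i1 := hint (continuous_cut (d := d) j)
  have i2 := hint (continuous_cut (d := d) (j + 1))
  have i3 : IntegrableOn (fun y => g (c + cut j (negCoord i y))) Q :=
    hint ((continuous_cut j).comp (continuous_pi fun k => by
      by_cases hk : k = i
      · subst hk
        simp only [negCoord_self]
        exact (continuous_apply _).neg
      · simp only [negCoord_of_ne hk]
        exact continuous_apply k))
  have i4 : IntegrableOn (fun y => g (c + cut j y) + g (c + cut j (negCoord i y))) Q := i1.add i3
  have key : 2 * ((∫ y in Q, g (c + cut j y)) - ∫ y in Q, g (c + cut (j + 1) y)) =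
      ∫ y in Q, (g (c + cut j y) + g (c + cut j (negCoord i y)) - 2 * g (c + cut (j + 1) y)) := by
    rw [integral_sub i4 (i2.const_mul 2), integral_add i1 i3, integral_const_mul,
      integral_negCoord i fun y => g (c + cut j y)]
    ring
  have hvol : volume.real Q = h ^ d := by
    rw [Measure.real, Real.volume_Icc_pi_toReal fun _ => by linarith]
    simp
  have hb := norm_setIntegral_le_of_norm_le_const (μ := volume) (s := Q) (C := M * h ^ 2 / 4)
    (f := fun y => g (c + cut j y) + g (c + cut j (negCoord i y)) - 2 * g (c + cut (j + 1) y))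
    isCompact_Icc.measure_lt_top fun y hy => by
      rw [Real.norm_eq_abs, e1, e2, ← add_assoc, ← add_sub_assoc]
      refine (hM _ i (y i)).trans ?_
      have h1 : -(h / 2) ≤ y i := hy.1 i
      have h2 : y i ≤ h / 2 := hy.2 i
      have h3 : y i ^ 2 ≤ h ^ 2 / 4 := by nlinarith
      nlinarith
  rw [hvol, ← key, Real.norm_eq_abs, abs_mul, abs_two] at hb
  linarith

/-- Telescoping over the coordinates, which are moved to the centre one after the other. -/
lemma abs_integral_sub_le (hg : Continuous g)
    (hM : ∀ x i s, |g (x + s • Pi.single i 1) + g (x - s • Pi.single i 1) - 2 * g x| ≤ M * s ^ 2)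
    (hM0 : 0 ≤ M) (hh : 0 ≤ h) (c : Fin d → ℝ) :
    |(∫ y in Set.Icc (fun _ => -(h / 2)) (fun _ => h / 2), g (c + y)) - h ^ d * g c| ≤
      d * (M * h ^ 2 / 8 * h ^ d) := by
  set Q : Set (Fin d → ℝ) := Set.Icc (fun _ => -(h / 2)) (fun _ => h / 2) with hQ
  have key : ∀ j ≤ d, |(∫ y in Q, g (c + y)) - ∫ y in Q, g (c + cut j y)| ≤
      j * (M * h ^ 2 / 8 * h ^ d) := by
    intro j
    induction j with
    | zero =>
      have : ∀ y : Fin d → ℝ, cut 0 y = y := fun y => funext fun k => by simp [cut]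
      simp [this]
    | succ j ih =>
      intro hj
      have h1 := ih (by omega)
      have h2 := abs_integral_cut_sub_le hg hM hM0 hh c (show j < d by omega)
      refine (abs_sub_le _ (∫ y in Q, g (c + cut j y)) _).trans ((add_le_add h1 h2).trans_eq ?_)
      push_cast
      ring
  have hvol : volume.real Q = h ^ d := by
    rw [Measure.real, Real.volume_Icc_pi_toReal fun _ => by linarith]
    simp
  have e : ∀ y : Fin d → ℝ, cut d y = 0 := fun y => by
    funext k
    simp [cut]
  have := key d le_rfl
  simp only [e, add_zero, setIntegral_const, hvol, smul_eq_mul] at this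
  exact this

variable {n : ℕ} [NeZero n] {L : ℝ} {lo hi : Fin d → ℕ}

open Classical in
/-- A region of the grid is a union of translated cubes. -/
lemma integral_region (hL : 0 < L) (hg : Continuous g) (hhi : ∀ j, lo j ≤ hi j ∧ hi j < n) :
    ∫ x in Set.Icc (fun j => ((lo j : ℝ) + 1 / 2) * (L / n))
      (fun j => ((hi j : ℝ) + 1 / 2) * (L / n)), g x =
    ∑ k : Fin d → ZMod n with k ∈ cell lo hi,
      ∫ y in Set.Icc (fun _ => -(L / n / 2)) (fun _ => L / n / 2), g (gridPoint L k + y) := by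
  have hn : (0 : ℝ) < n := by exact_mod_cast Nat.pos_of_neZero n
  have hx : 0 < L / n := by positivity
  set Δ := L / n with hΔ
  set C : (Fin d → ZMod n) → Set (Fin d → ℝ) := fun k => Set.univ.pi fun j =>
    Set.Ioc (gridPoint L k j - Δ / 2) (gridPoint L k j + Δ / 2) with hC
  have hCint : ∀ k, ∫ x in C k, g x =
      ∫ y in Set.Icc (fun _ => -(Δ / 2)) (fun _ => Δ / 2), g (gridPoint L k + y) := fun k => by
    have e1 : C k =ᵐ[volume] Set.Icc (fun j => gridPoint L k j - Δ / 2)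
        (fun j => gridPoint L k j + Δ / 2) := Measure.univ_pi_Ioc_ae_eq_Icc
    rw [setIntegral_congr_set e1, ← (measurePreserving_add_left volume
      (gridPoint L k)).setIntegral_preimage_emb (measurableEmbedding_addLeft _) g]
    congr 2
    rw [Set.preimage_const_add_Icc]
    congr 1 <;> funext j <;> simp
  have hmem : ∀ (k : Fin d → ZMod n) (x : Fin d → ℝ), x ∈ C k ↔
      ∀ j, (((k j).val : ℝ) - 1 / 2) * Δ < x j ∧ x j ≤ (((k j).val : ℝ) + 1 / 2) * Δ := fun k x => by
    simp only [hC, Set.mem_pi, Set.mem_univ, true_imp_iff, Set.mem_Ioc, gridPoint, ← hΔ]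
    refine forall_congr' fun j => ?_
    rw [sub_mul, add_mul]
    ring_nf
  -- Half-open cubes tile the half-open box exactly; they differ from the closed ones by null sets.
  have hS : (Set.univ.pi fun j => Set.Ioc (((lo j : ℝ) + 1 / 2) * Δ) (((hi j : ℝ) + 1 / 2) * Δ)) =
      ⋃ k ∈ Finset.univ.filter (· ∈ cell lo hi), C k := by
    ext x
    simp only [Set.mem_pi, Set.mem_univ, true_imp_iff, Set.mem_Ioc, Set.mem_iUnion, Finset.mem_filter,
      Finset.mem_univ, true_and, exists_prop, hmem]
    constructor
    · intro H
      have hz : ∀ j, ∃ z : ℕ, lo j < z ∧ z ≤ hi j ∧ ((z : ℝ) - 1 / 2) * Δ < x j ∧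
          x j ≤ ((z : ℝ) + 1 / 2) * Δ := fun j => by
        have h1 : (lo j : ℝ) < x j / Δ - 1 / 2 := by
          rw [lt_sub_iff_add_lt, lt_div_iff₀ hx]
          exact (H j).1
        have h2 : x j / Δ - 1 / 2 ≤ hi j := by
          rw [sub_le_iff_le_add, div_le_iff₀ hx]
          exact (H j).2
        have h0 : 0 ≤ x j / Δ - 1 / 2 := (Nat.cast_nonneg _).trans h1.le
        refine ⟨⌈x j / Δ - 1 / 2⌉₊, Nat.lt_ceil.2 h1, Nat.ceil_le.2 h2, ?_, ?_⟩
        · have := Nat.ceil_lt_add_one h0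
          rw [← lt_div_iff₀ hx]
          linarith
        · have := Nat.le_ceil (x j / Δ - 1 / 2)
          rw [← div_le_iff₀ hx]
          linarith
      choose z hz using hz
      have hv : ∀ j, ((z j : ℕ) : ZMod n).val = z j := fun j =>
        ZMod.val_natCast_of_lt ((hz j).2.1.trans_lt (hhi j).2)
      refine ⟨fun j => (z j : ZMod n), fun j => ?_, fun j => ?_⟩
      · rw [hv]
        exact ⟨(hz j).1, (hz j).2.1⟩
      · rw [hv]
        exact (hz j).2.2
    · rintro ⟨k, hk, H⟩ j
      have h1 : (lo j : ℝ) + 1 ≤ (k j).val := by exact_mod_cast (hk j).1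
      have h2 : ((k j).val : ℝ) ≤ hi j := by exact_mod_cast (hk j).2
      constructor
      · refine lt_of_le_of_lt ?_ (H j).1
        gcongr
        linarith
      · refine (H j).2.trans ?_
        gcongr
  have hdisj : ((Finset.univ.filter (· ∈ cell lo hi) : Finset (Fin d → ZMod n)) :
      Set (Fin d → ZMod n)).Pairwise (Function.onFun Disjoint C) := by
    intro k _ k' _ hkk
    refine Set.disjoint_left.2 fun x hx1 hx2 => hkk ?_
    rw [hmem] at hx1 hx2
    funext j
    have a1 := lt_of_mul_lt_mul_right ((hx1 j).1.trans_le (hx2 j).2) hx.le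
    have a2 := lt_of_mul_lt_mul_right ((hx2 j).1.trans_le (hx1 j).2) hx.le
    have b1 : (k j).val < (k' j).val + 1 := by
      have : ((k j).val : ℝ) < (k' j).val + 1 := by linarith
      exact_mod_cast this
    have b2 : (k' j).val < (k j).val + 1 := by
      have : ((k' j).val : ℝ) < (k j).val + 1 := by linarith
      exact_mod_cast this
    exact ZMod.val_injective n (by omega)
  have e0 : (Set.univ.pi fun j => Set.Ioc (((lo j : ℝ) + 1 / 2) * Δ) (((hi j : ℝ) + 1 / 2) * Δ))
      =ᵐ[volume] Set.Icc (fun j => ((lo j : ℝ) + 1 / 2) * Δ) (fun j => ((hi j : ℝ) + 1 / 2) * Δ) :=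
    Measure.univ_pi_Ioc_ae_eq_Icc
  rw [← setIntegral_congr_set e0, hS, integral_biUnion_finset _
    (fun k _ => MeasurableSet.univ_pi fun j => measurableSet_Ioc) hdisj fun k _ => ?_]
  · exact Finset.sum_congr rfl fun k _ => hCint k
  · refine (hg.integrableOn_Icc (a := fun j => gridPoint L k j - Δ / 2)
      (b := fun j => gridPoint L k j + Δ / 2)).mono_set ?_
    rw [← Set.pi_univ_Icc]
    exact Set.pi_mono fun j _ => Set.Ioc_subset_Icc_self

variable {T α ζ t : ℝ} {u₀ : (Fin d → ℝ) → ℝ} {u : (Fin d → ℝ) → ℝ → ℝ}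

omit [NeZero n] in
lemma IsHeatSolution.continuous_space (h : IsHeatSolution d L T α ζ u₀ u) (ht : t ∈ Set.Icc 0 T) :
    Continuous fun y => u y t := by
  refine continuousOn_univ.1 ?_
  exact h.contDiffOn.continuousOn.comp (f := fun y => (y, t)) (by fun_prop) fun y _ => ⟨trivial, ht⟩

/-- The error of the midpoint rule. -/
lemma IsHeatSolution.abs_integral_region_sub_le (h : IsHeatSolution d L T α ζ u₀ u) (hL : 0 < L)
    (hζ : 0 ≤ ζ) (ht : t ∈ Set.Icc 0 T) (hhi : ∀ j, lo j ≤ hi j ∧ hi j < n) :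
    |(∫ x in Set.Icc (fun j => ((lo j : ℝ) + 1 / 2) * (L / n))
      (fun j => ((hi j : ℝ) + 1 / 2) * (L / n)), u x t) -
      (L / n) ^ d * ∑ k : Fin d → ZMod n, u (gridPoint L k) t *
        (cell lo hi).indicator (fun _ => 1) k| ≤ d * (ζ * L ^ 2 * (L / n) ^ 2 / 8) := by
  classical
  have hn : (0 : ℝ) < n := by exact_mod_cast Nat.pos_of_neZero n
  have hc := h.continuous_space ht
  have hM : ∀ x i s, |u (x + s • Pi.single i 1) t + u (x - s • Pi.single i 1) t - 2 * u x t| ≤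
      ζ * L ^ 2 / L ^ d * s ^ 2 := fun x i s => by
    rcases le_total 0 s with hs | hs
    · exact h.abs_symmetric_sub_le hL ht x i hs
    · have := h.abs_symmetric_sub_le hL ht x i (neg_nonneg.2 hs)
      rw [neg_smul, ← sub_eq_add_neg, sub_neg_eq_add, neg_sq, add_comm (u _ t)] at this
      exact this
  rw [integral_region hL hc hhi]
  have e : (L / n) ^ d * ∑ k : Fin d → ZMod n, u (gridPoint L k) t *
      (cell lo hi).indicator (fun _ => 1) k =
      ∑ k : Fin d → ZMod n with k ∈ cell lo hi, (L / n) ^ d * u (gridPoint L k) t := by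
    rw [Finset.mul_sum, Finset.sum_filter]
    refine Finset.sum_congr rfl fun k _ => ?_
    by_cases hk : k ∈ cell lo hi <;> simp [hk]
  rw [e, ← Finset.sum_sub_distrib]
  have hb := fun k : Fin d → ZMod n => abs_integral_sub_le hc hM (by positivity)
    (show 0 ≤ L / n by positivity) (gridPoint L k)
  calc _ ≤ ∑ k : Fin d → ZMod n with k ∈ cell lo hi,
        d * (ζ * L ^ 2 / L ^ d * (L / n) ^ 2 / 8 * (L / n) ^ d) :=
        (Finset.abs_sum_le_sum_abs _ _).trans (Finset.sum_le_sum fun k _ => hb k)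
    _ ≤ ∑ k : Fin d → ZMod n, d * (ζ * L ^ 2 / L ^ d * (L / n) ^ 2 / 8 * (L / n) ^ d) :=
        Finset.sum_le_sum_of_subset_of_nonneg (Finset.filter_subset _ _) fun _ _ _ => by positivity
    _ = _ := by
        simp only [Finset.sum_const, Finset.card_univ, Fintype.card_pi, ZMod.card, Finset.prod_const,
          Fintype.card_fin, nsmul_eq_mul]
        push_cast
        rw [div_pow L n d]
        field_simp

end quadrature

/-! ### Concentration of the number of hits -/

section hits
variable {X : Type*} {p : PMF X} {A : Set X}

open Classical in
lemma toOuterMeasure_add_compl (p : PMF X) (A : Set X) :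
    p.toOuterMeasure A + p.toOuterMeasure Aᶜ = 1 := by
  rw [toOuterMeasure_eq_avg, toOuterMeasure_eq_avg, ← avg_add]
  refine Eq.trans ?_ (avg_const p 1)
  congr 1
  funext x
  by_cases hx : x ∈ A <;> simp [hx]

open Classical in
lemma avg_ite {a b : ℝ} (ha : 0 ≤ a) (hb : 0 ≤ b) :
    avg p (fun x => ENNReal.ofReal (if x ∈ A then a else b)) = ENNReal.ofReal
      ((p.toOuterMeasure A).toReal * a + (1 - (p.toOuterMeasure A).toReal) * b) := by
  have h1 := toOuterMeasure_add_compl p A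
  have hA := ((toOuterMeasure_le_one p A).trans_lt ENNReal.one_lt_top).ne
  have hB := ((toOuterMeasure_le_one p Aᶜ).trans_lt ENNReal.one_lt_top).ne
  have h2 : 1 - (p.toOuterMeasure A).toReal = (p.toOuterMeasure Aᶜ).toReal := by
    have := congrArg ENNReal.toReal h1
    rw [ENNReal.toReal_add hA hB, ENNReal.toReal_one] at this
    linarith
  rw [h2, ENNReal.ofReal_add (by positivity) (by positivity), ENNReal.ofReal_mul (by positivity),
    ENNReal.ofReal_mul (by positivity), ENNReal.ofReal_toReal hA, ENNReal.ofReal_toReal hB,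
    mul_comm, mul_comm (p.toOuterMeasure Aᶜ), toOuterMeasure_eq_avg, toOuterMeasure_eq_avg,
    ← avg_const_mul, ← avg_const_mul, ← avg_add]
  congr 1
  funext x
  by_cases hx : x ∈ A <;> simp [hx]

/-- Variance plus squared mean. The shift c is arbitrary because conditioning on one sample changes
it by one in the induction. -/
lemma avg_hitCount_sq (K : ℕ) (c : ℝ) :
    avg (hitCount p A K) (fun h => ENNReal.ofReal ((h + c) ^ 2)) = ENNReal.ofReal
      (K * ((p.toOuterMeasure A).toReal * (1 - (p.toOuterMeasure A).toReal)) +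
        (K * (p.toOuterMeasure A).toReal + c) ^ 2) := by
  classical
  set P := (p.toOuterMeasure A).toReal with hP
  have hP0 : 0 ≤ P := ENNReal.toReal_nonneg
  have hP1 : P ≤ 1 :=
    ENNReal.toReal_le_of_le_ofReal zero_le_one (by simpa using toOuterMeasure_le_one p A)
  have hPP : 0 ≤ P * (1 - P) := mul_nonneg hP0 (by linarith)
  induction K generalizing c with
  | zero => simp [hitCount, avg_pure]
  | succ K ih =>
    rw [hitCount, avg_bind]
    simp only [avg_map]
    have e : ∀ x, avg (hitCount p A K) (fun h =>
        ENNReal.ofReal (((h + if x ∈ A then 1 else 0 : ℕ) + c) ^ 2)) =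
        ENNReal.ofReal (if x ∈ A then K * (P * (1 - P)) + (K * P + (1 + c)) ^ 2
          else K * (P * (1 - P)) + (K * P + c) ^ 2) := fun x => by
      by_cases hx : x ∈ A
      · simp only [hx, if_true, ← ih]
        push_cast
        simp only [add_assoc]
      · simp only [hx, if_false, ← ih, add_zero]
    simp only [e]
    rw [avg_ite (by positivity) (by positivity), ← hP]
    congr 1
    push_cast
    ring

/-- Chebyshev's inequality with variance at most 1/4 per sample. -/
lemma hitCount_concentration {K : ℕ} (hK : 0 < K) {η : ℝ} (hη : 0 < η) :
    1 ≤ (hitCount p A K).toOuterMeasure {h | |(h : ℝ) / K - (p.toOuterMeasure A).toReal| ≤ η} +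
      ENNReal.ofReal (1 / (4 * K * η ^ 2)) := by
  classical
  set P := (p.toOuterMeasure A).toReal with hP
  have hK' : (0 : ℝ) < K := by exact_mod_cast hK
  rw [← toOuterMeasure_add_compl (hitCount p A K) {h | |(h : ℝ) / K - P| ≤ η}]
  gcongr
  have key : ENNReal.ofReal ((K * η) ^ 2) *
      (hitCount p A K).toOuterMeasure {h | |(h : ℝ) / K - P| ≤ η}ᶜ ≤ ENNReal.ofReal (K / 4) := by
    rw [toOuterMeasure_eq_avg, ← avg_const_mul]
    refine (avg_mono (g := fun h : ℕ => ENNReal.ofReal ((h + -(K * P)) ^ 2)) fun h => ?_).trans ?_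
    · split_ifs with hh
      · rw [mul_one]
        refine ENNReal.ofReal_le_ofReal ?_
        rw [Set.mem_compl_iff, Set.mem_ofPred_eq, not_le] at hh
        have e : (h : ℝ) + -(K * P) = K * (h / K - P) := by field_simp; ring
        rw [e, mul_pow, mul_pow, ← sq_abs (_ / _ - _)]
        gcongr
      · simp
    · rw [avg_hitCount_sq, ← hP, add_neg_cancel]
      refine ENNReal.ofReal_le_ofReal ?_
      nlinarith [sq_nonneg (P - 1 / 2)]
  have h0 : 0 < (K * η) ^ 2 := by positivity
  rw [mul_comm, ← ENNReal.le_div_iff_mul_le (.inl (ENNReal.ofReal_pos.2 h0).ne') (.inl ENNReal.ofReal_ne_top),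
    ← ENNReal.ofReal_div_of_pos h0] at key
  refine key.trans_eq ?_
  congr 1
  field_simp

end hits

/-! ### Accuracy and running time of the estimator -/

/-- A factor that depends only on `A` inside the logarithm becomes a factor outside, because log (2
+ Q) ≥ log 2. -/
lemma log_two_add_le {A Q x : ℝ} (hA : 1 ≤ A) (hQ : 0 ≤ Q) (hx : 0 ≤ x) (hxQ : x ≤ 2 * A ^ 3 * Q) :
    Real.log (2 + x) ≤ (Real.log (2 * A ^ 3) / Real.log 2 + 1) * Real.log (2 + Q) := by
  have hA3 : 1 ≤ A ^ 3 := one_le_pow₀ hA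
  have h2 : 0 < Real.log 2 := Real.log_pos (by norm_num)
  have h3 : 0 ≤ Real.log (2 * A ^ 3) := Real.log_nonneg (by linarith)
  have h4 : Real.log 2 ≤ Real.log (2 + Q) := Real.log_le_log (by norm_num) (by linarith)
  calc Real.log (2 + x) ≤ Real.log (2 * A ^ 3 * (2 + Q)) :=
        Real.log_le_log (by linarith) (by nlinarith)
    _ = Real.log (2 * A ^ 3) + Real.log (2 + Q) := Real.log_mul (by positivity) (by positivity)
    _ ≤ _ := by
      rw [add_mul, one_mul]
      gcongr
      rw [div_mul_eq_mul_div, le_div_iff₀ h2]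
      gcongr

section accuracy
variable {d n m K w : ℕ} {A L T α ζ ε Δx Δt : ℝ}

/-- The fractional powers combine to the cube of X/L, the quantity to which n/L is comparable. -/
lemma rpow_bound_eq (hζ : 0 ≤ ζ) (hE : 0 ≤ (α * T + L ^ 2) / ε) :
    T * L * α * (d : ℝ) ^ (5 / 2 : ℝ) * ζ ^ (3 / 2 : ℝ) * ((α * T + L ^ 2) / ε) ^ (3 / 2 : ℝ) =
      T * L * α * d * Real.sqrt (d * ζ * (α * T + L ^ 2) / ε) ^ 3 := by
  have e1 : (d : ℝ) ^ (5 / 2 : ℝ) = d * (d : ℝ) ^ (3 / 2 : ℝ) := by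
    rw [show (5 / 2 : ℝ) = 1 + 3 / 2 by norm_num,
      Real.rpow_add_of_nonneg (Nat.cast_nonneg d) (by norm_num) (by norm_num), Real.rpow_one]
  have e2 : Real.sqrt (d * ζ * (α * T + L ^ 2) / ε) ^ 3 =
      (d : ℝ) ^ (3 / 2 : ℝ) * ζ ^ (3 / 2 : ℝ) * ((α * T + L ^ 2) / ε) ^ (3 / 2 : ℝ) := by
    rw [mul_div_assoc, ← Real.mul_rpow (Nat.cast_nonneg d) hζ, ← Real.mul_rpow (by positivity) hE,
      Real.sqrt_eq_rpow, ← Real.rpow_natCast, ← Real.rpow_mul (by positivity)]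
    norm_num
  rw [e1, e2]
  ring

/-- The constant in the running time of the estimator. -/
def timeConst (A : ℝ) : ℝ := 2000000 * 2001 * (2 * (Real.log (2 * A ^ 3) / Real.log 2 + 1))

lemma timeConst_pos (hA : 1 ≤ A) : 0 < timeConst A := by
  have hA3 : 1 ≤ A ^ 3 := one_le_pow₀ hA
  have h2 : 0 < Real.log 2 := Real.log_pos (by norm_num)
  have h3 : 0 ≤ Real.log (2 * A ^ 3) := Real.log_nonneg (by linarith)
  rw [timeConst]
  positivity

variable [NeZero d] [NeZero n]

/-- The parameters that the estimator uses are polynomial in the ones that occur in the bound for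
its running time. -/
lemma estTime_le_timeBound (hA : 1 ≤ A) (hL : 0 < L) (hT : 0 < T) (hα : 0 < α) (hε : 0 < ε)
    (hε1 : ε < 1) (hζ : 0 < ζ)
    (hn : n ≤ A * (Real.sqrt (d * ζ * (α * T + L ^ 2) / ε) * L)) (hx : Δx = L / n)
    (hΔ : Δt = Δx ^ 2 / (2 * d * α)) (hΔT : Δt ≤ T) (hm : m * Δt ≤ T) (hK : K = ⌈2000 / ε ^ 2⌉₊) :
    estTime d n m K ≤ ENNReal.ofReal (timeConst A * timeBound d L T α ζ ε) := by
  have hd : 0 < d := Nat.pos_of_neZero d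
  have hd' : (0 : ℝ) < d := by exact_mod_cast hd
  have hn1 : 0 < n := Nat.pos_of_neZero n
  have hn1' : (1 : ℝ) ≤ n := by exact_mod_cast hn1
  set Y := Real.sqrt (d * ζ * (α * T + L ^ 2) / ε) with hY
  have hY0 : 0 < Y := Real.sqrt_pos.2 (by positivity)
  set Q := T * L * α * (d : ℝ) ^ (5 / 2 : ℝ) * ζ ^ (3 / 2 : ℝ) *
    ((α * T + L ^ 2) / ε) ^ (3 / 2 : ℝ) with hQ
  have hQY : Q = T * L * α * d * Y ^ 3 := rpow_bound_eq hζ.le (by positivity)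
  have hQ0 : 0 ≤ Q := by rw [hQY]; positivity
  have hA0 : 0 < A := by linarith
  have hAYL : 1 ≤ A * (Y * L) := hn1'.trans hn
  have hΔt : Δt = L ^ 2 / (n ^ 2 * (2 * d * α)) := by
    rw [hΔ, hx]
    field_simp
  have hn2 : (n : ℝ) ^ 2 ≤ (A * (Y * L)) ^ 2 := by gcongr
  -- Applied to x = m for the number of time steps, and to x = 1 for n, where Δt ≤ T supplies the
  -- missing factor. Both m and n are then at most 2 A³ Q.
  have step : ∀ x : ℝ, 0 ≤ x → x * Δt ≤ T → x ≤ 2 * d * α * T * (A * Y) ^ 2 := fun x hx0 hxT => by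
    rw [hΔt, mul_div_assoc', div_le_iff₀ (by positivity)] at hxT
    have : x * L ^ 2 ≤ T * ((A * (Y * L)) ^ 2 * (2 * d * α)) := hxT.trans (by gcongr)
    have h2 : x * L ^ 2 ≤ (2 * d * α * T * (A * Y) ^ 2) * L ^ 2 := this.trans_eq (by ring)
    exact le_of_mul_le_mul_right h2 (by positivity)
  have hmQ : (m : ℝ) ≤ 2 * A ^ 3 * Q := by
    have h1 := step m (Nat.cast_nonneg m) hm
    calc (m : ℝ) ≤ 2 * d * α * T * (A * Y) ^ 2 * 1 := by rw [mul_one]; exact h1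
      _ ≤ 2 * d * α * T * (A * Y) ^ 2 * (A * (Y * L)) := by gcongr
      _ = _ := by rw [hQY]; ring
  have hnQ : (n : ℝ) ≤ 2 * A ^ 3 * Q := by
    have h1 := step 1 zero_le_one (by rw [one_mul]; exact hΔT)
    calc (n : ℝ) ≤ 1 * (A * (Y * L)) := by rw [one_mul]; exact hn
      _ ≤ 2 * d * α * T * (A * Y) ^ 2 * (A * (Y * L)) := by gcongr
      _ = _ := by rw [hQY]; ring
  have l1 := log_two_add_le hA hQ0 (Nat.cast_nonneg n) hnQ
  have l2 := log_two_add_le hA hQ0 (Nat.cast_nonneg m) hmQ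
  have hK1 : 1 ≤ K := by
    rw [hK, Nat.one_le_ceil_iff]
    positivity
  have hK2 : (K : ℝ) ≤ 2001 / ε ^ 2 := by
    have h1 : (K : ℝ) < 2000 / ε ^ 2 + 1 := by
      rw [hK]
      exact Nat.ceil_lt_add_one (by positivity)
    have h2 : 1 ≤ 1 / ε ^ 2 := by
      rw [le_div_iff₀ (by positivity)]
      nlinarith
    have h3 : 2001 / ε ^ 2 = 2000 / ε ^ 2 + 1 / ε ^ 2 := by ring
    linarith
  have hlog : 0 ≤ Real.log (2 + n) + Real.log (2 + m) := by
    have h1 := half_lt_log_add_two n (Nat.cast_nonneg n)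
    have h2 := half_lt_log_add_two m (Nat.cast_nonneg m)
    linarith
  refine (estTime_le d n m K hd hn1 hK1).trans (ENNReal.ofReal_le_ofReal ?_)
  calc _ ≤ 2000000 * (2001 / ε ^ 2) * d * ((Real.log (2 * A ^ 3) / Real.log 2 + 1) *
        Real.log (2 + Q) + (Real.log (2 * A ^ 3) / Real.log 2 + 1) * Real.log (2 + Q)) := by gcongr
    _ = _ := by
      rw [timeConst, timeBound, ← hQ]
      ring

/-- Markov's inequality at 200 times the expected time; the rounding is harmless because
`succ_mul_notHalted_le` has the factor N + 1. -/
lemma notHalted_le {M : Env} {P : Prog} {s : State} {τ : ℝ}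
    (h : expectedTime M P s ≤ ENNReal.ofReal τ) :
    notHalted M ⌊200 * τ⌋₊ ([P], s) ≤ ENNReal.ofReal (1 / 200) := by
  have h1 := (succ_mul_notHalted_le (M := M) ⌊200 * τ⌋₊ P s).trans h
  have h2 : ENNReal.ofReal τ ≤ ((⌊200 * τ⌋₊ + 1 : ℕ) : ℝ≥0∞) * ENNReal.ofReal (1 / 200) := by
    rw [← ENNReal.ofReal_natCast, ← ENNReal.ofReal_mul (by positivity)]
    refine ENNReal.ofReal_le_ofReal ?_
    have := Nat.lt_floor_add_one (200 * τ)
    push_cast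
    linarith
  exact (ENNReal.mul_le_mul_iff_right (by simp) (by simp)).1 (h1.trans h2)

variable {u₀ : (Fin d → ℝ) → ℝ} {u : (Fin d → ℝ) → ℝ → ℝ} {lo hi : Fin d → ℕ}

/-- The distance between the hitting probability and the heat in the region. -/
lemma IsHeatSolution.abs_hit_sub_integral_le (h : IsHeatSolution d L T α ζ u₀ u) (hL : 0 < L)
    (hT : 0 < T) (hα : 0 < α) (hζ : 0 ≤ ζ) (hx : Δx = L / n) (hΔ : Δt = Δx ^ 2 / (2 * d * α))
    (hm : m * Δt ≤ T) {p₀ : PMF (Fin d → ZMod n)}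
    (hp : ∀ k, (p₀ k).toReal = u₀ (gridPoint L k) * Δx ^ d) (hhi : ∀ j, lo j ≤ hi j ∧ hi j < n)
    (hε : d * ζ * (α * T + L ^ 2) * Δx ^ 2 ≤ ε) :
    |((p₀.bind (simpleWalk d n m)).toOuterMeasure (cell lo hi)).toReal -
      ∫ x in Set.Icc (fun j => ((lo j : ℝ) + 1 / 2) * Δx)
        (fun j => ((hi j : ℝ) + 1 / 2) * Δx), u x (m * Δt)| ≤ 7 / 12 * ε := by
  have hd' : (0 : ℝ) < d := by exact_mod_cast Nat.pos_of_neZero d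
  have hn1 : (0 : ℝ) < n := by exact_mod_cast Nat.pos_of_neZero n
  have hx0 : 0 < Δx := by rw [hx]; positivity
  have hΔ0 : 0 < Δt := by rw [hΔ]; positivity
  have h1 := h.abs_hit_sub_le hL hT hα hx hΔ hm hp (cell lo hi)
  have h2 := h.abs_integral_region_sub_le hL hζ (t := m * Δt) ⟨by positivity, hm⟩ hhi
  rw [← hx] at h2
  have hmx : m * Δx ^ 2 ≤ T * (2 * d * α) := by
    rw [hΔ, mul_div_assoc', div_le_iff₀ (by positivity)] at hm
    exact hm
  -- The number of steps is at most 2 d α T/Δx², so a local error of order Δx⁴ becomes a global one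
  -- of order Δx².
  have h3 : m * (7 / 24 * Δx ^ 4 * ζ) ≤ 7 / 12 * (d * ζ * (α * T) * Δx ^ 2) := by
    calc _ = 7 / 24 * Δx ^ 2 * ζ * (m * Δx ^ 2) := by ring
      _ ≤ 7 / 24 * Δx ^ 2 * ζ * (T * (2 * d * α)) := by gcongr
      _ = _ := by ring
  have h4 : 0 ≤ d * ζ * L ^ 2 * Δx ^ 2 := by positivity
  have h5 : d * ζ * (α * T + L ^ 2) * Δx ^ 2 =
      d * ζ * (α * T) * Δx ^ 2 + d * ζ * L ^ 2 * Δx ^ 2 := by ring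
  have h6 : d * (ζ * L ^ 2 * Δx ^ 2 / 8) = d * ζ * L ^ 2 * Δx ^ 2 / 8 := by ring
  rw [h6] at h2
  have h7 := abs_le.1 h1
  have h8 := abs_le.1 h2
  rw [abs_le]
  constructor <;> linarith

lemma est_accuracy (hA : 1 ≤ A) (hL : 0 < L) (hT : 0 < T) (hα : 0 < α) (hε : 0 < ε) (hε1 : ε < 1)
    (h : IsHeatSolution d L T α ζ u₀ u)
    (hX : Real.sqrt (d * ζ * (α * T + L ^ 2) / ε) * L ≤ n)
    (hn : n ≤ A * (Real.sqrt (d * ζ * (α * T + L ^ 2) / ε) * L)) (hx : Δx = L / n)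
    (hΔ : Δt = Δx ^ 2 / (2 * d * α)) (hΔT : Δt ≤ T)
    (hsum : ∑ k : Fin d → ZMod n, u₀ (gridPoint L k) = (n / L) ^ d) (hm : m * Δt ≤ T)
    (hhi : ∀ j, lo j ≤ hi j ∧ hi j < n) (hK : K = ⌈2000 / ε ^ 2⌉₊)
    (hw : (d + n + m + K + 2) ^ 10 ≤ 2 ^ w) :
    expectedTime (gridEnv w fun k : Fin d → ZMod n => u₀ (gridPoint L k)) est
      (walkInput d n m K lo hi) ≤ ENNReal.ofReal (200 * timeConst A * timeBound d L T α ζ ε) ∧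
    99 / 100 ≤ haltProbWithin (gridEnv w fun k : Fin d → ZMod n => u₀ (gridPoint L k)) est
      (walkInput d n m K lo hi) ⌊200 * timeConst A * timeBound d L T α ζ ε⌋₊
      {s | |(s.reg 8 : ℝ) / K - ∫ x in Set.Icc (fun j => ((lo j : ℝ) + 1 / 2) * Δx)
        (fun j => ((hi j : ℝ) + 1 / 2) * Δx), u x (m * Δt)| ≤ ε} := by
  have hd : 0 < d := Nat.pos_of_neZero d
  have hd' : (0 : ℝ) < d := by exact_mod_cast hd
  have hn1 : (0 : ℝ) < n := by exact_mod_cast Nat.pos_of_neZero n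
  have hx0 : 0 < Δx := by rw [hx]; positivity
  have hΔ0 : 0 < Δt := by rw [hΔ]; positivity
  have hs0 : 0 < α * T + L ^ 2 := by positivity
  set Y := Real.sqrt (d * ζ * (α * T + L ^ 2) / ε) with hY
  -- A grid has n ≥ 1, so the upper bound on n excludes Y = 0 and hence ζ ≤ 0.
  have hY0 : 0 < Y := by
    by_contra! hneg
    have : A * (Y * L) ≤ 0 := mul_nonpos_of_nonneg_of_nonpos (by linarith)
      (mul_nonpos_of_nonpos_of_nonneg hneg hL.le)
    linarith
  have hB : 0 < d * ζ * (α * T + L ^ 2) / ε := Real.sqrt_pos.1 hY0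
  have hζ : 0 < ζ := by
    by_contra! hneg
    have : d * ζ * (α * T + L ^ 2) / ε ≤ 0 := div_nonpos_of_nonpos_of_nonneg
      (mul_nonpos_of_nonpos_of_nonneg (mul_nonpos_of_nonneg_of_nonpos hd'.le hneg) hs0.le) hε.le
    linarith
  have hY2 : Y ^ 2 = d * ζ * (α * T + L ^ 2) / ε := Real.sq_sqrt hB.le
  have hΔY : d * ζ * (α * T + L ^ 2) * Δx ^ 2 ≤ ε := by
    have h1 : (Y * L) ^ 2 ≤ (n : ℝ) ^ 2 := by gcongr
    rw [mul_pow, hY2, div_mul_eq_mul_div, div_le_iff₀ hε] at h1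
    rw [hx, div_pow, mul_div_assoc', div_le_iff₀ (by positivity)]
    linarith
  -- the initial distribution
  have hp1 : ∑ k : Fin d → ZMod n, ENNReal.ofReal (u₀ (gridPoint L k) * Δx ^ d) = 1 := by
    rw [← ENNReal.ofReal_sum_of_nonneg fun k _ => mul_nonneg (h.nonneg _) (by positivity),
      ← Finset.sum_mul, hsum, hx, ← mul_pow, div_mul_div_cancel₀ hL.ne', div_self hn1.ne', one_pow,
      ENNReal.ofReal_one]
  set p₀ : PMF (Fin d → ZMod n) := PMF.ofFintype _ hp1 with hp₀
  have hp : ∀ k, (p₀ k).toReal = u₀ (gridPoint L k) * Δx ^ d := fun k => by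
    rw [hp₀, PMF.ofFintype_apply,
      ENNReal.toReal_ofReal (mul_nonneg (h.nonneg _) (by positivity))]
  have hσ : 0 < (n / L) ^ d := by positivity
  have hM : (gridEnv w fun k : Fin d → ZMod n => u₀ (gridPoint L k)) =
      gridEnv w fun k => (n / L) ^ d * (p₀ k).toReal := by
    congr 1
    funext k
    rw [hp, hx, mul_left_comm, ← mul_pow, div_mul_div_cancel₀ hL.ne', div_self hn1.ne', one_pow,
      mul_one]
  rw [hM]
  set M := gridEnv w fun k => (n / L) ^ d * (p₀ k).toReal
  have hS := samples_est (p₀ := p₀) (m := m) (K := K) (lo := lo) (hi := hi) hσ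
    ((mul_sq_le_pow_ten (x := d + n + m + K + 2) (by omega)).trans hw)
    fun j => ⟨(hhi j).1.trans_lt (hhi j).2, (hhi j).2⟩
  rw [show p₀.bind (nestedBinomial d n d m) = p₀.bind (simpleWalk d n m) from
    congrArg _ (funext fun x => nestedBinomial_eq_simpleWalk d n m x)] at hS
  -- time
  have hbound : 0 < timeBound d L T α ζ ε := by
    refine mul_pos (by positivity) (Real.log_pos ?_)
    have : 0 ≤ T * L * α * (d : ℝ) ^ (5 / 2 : ℝ) * ζ ^ (3 / 2 : ℝ) *
      ((α * T + L ^ 2) / ε) ^ (3 / 2 : ℝ) := by positivity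
    linarith
  have hτ : 0 < timeConst A * timeBound d L T α ζ ε := mul_pos (timeConst_pos hA) hbound
  have htime : expectedTime M est (walkInput d n m K lo hi) ≤
      ENNReal.ofReal (timeConst A * timeBound d L T α ζ ε) := by
    rw [expectedTime_eq_ex]
    exact hS.time_le.trans (estTime_le_timeBound hA hL hT hα hε hε1 hζ hn hx hΔ hΔT hm hK)
  refine ⟨htime.trans (ENNReal.ofReal_le_ofReal (by nlinarith)), ?_⟩
  -- accuracy
  have hK1 : 2000 / ε ^ 2 ≤ K := by
    rw [hK]
    exact Nat.le_ceil _
  have hK0 : (0 : ℝ) < K := lt_of_lt_of_le (by positivity) hK1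
  set I := ∫ x in Set.Icc (fun j => ((lo j : ℝ) + 1 / 2) * Δx)
    (fun j => ((hi j : ℝ) + 1 / 2) * Δx), u x (m * Δt) with hI
  set P := ((p₀.bind (simpleWalk d n m)).toOuterMeasure (cell lo hi)).toReal with hP
  have hPI : |P - I| ≤ 7 / 12 * ε :=
    h.abs_hit_sub_integral_le hL hT hα hζ.le hx hΔ hm hp hhi hΔY
  have hconc := hitCount_concentration (p := p₀.bind (simpleWalk d n m)) (A := cell lo hi)
    (K := K) (by exact_mod_cast hK0) (η := 5 / 12 * ε) (by positivity)
  rw [← hP] at hconc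
  -- With K ε² ≥ 2000 the left side is at most 1.44/2000; this fixes the constant κ.
  have hsmall : 1 / (4 * K * (5 / 12 * ε) ^ 2) ≤ (1 / 1000 : ℝ) := by
    have h1 : 2000 ≤ K * ε ^ 2 := by rwa [div_le_iff₀ (by positivity)] at hK1
    rw [div_le_div_iff₀ (by positivity) (by norm_num)]
    nlinarith
  have hhalt : (hitCount (p₀.bind (simpleWalk d n m)) (cell lo hi) K).toOuterMeasure
      {v | |(v : ℝ) / K - P| ≤ 5 / 12 * ε} ≤
      haltProb M est (walkInput d n m K lo hi) {s | |(s.reg 8 : ℝ) / K - I| ≤ ε} := by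
    rw [hS.haltProb_eq (estTime_ne_top d n m K) _ {v : ℕ | |(v : ℝ) / K - I| ≤ ε}
      fun v s' hv => by rw [Set.mem_ofPred_eq, Set.mem_ofPred_eq, hv]]
    refine MeasureTheory.measure_mono fun v (hv : |(v : ℝ) / K - P| ≤ 5 / 12 * ε) => ?_
    have := abs_sub_le ((v : ℝ) / K) P I
    rw [Set.mem_ofPred_eq]
    linarith
  -- The failure probabilities are 1/200 for exceeding the time limit and 1/1000 for the sampling
  -- error, together less than 1/100.
  have hfinal : 1 ≤ haltProbWithin M est (walkInput d n m K lo hi)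
      ⌊200 * (timeConst A * timeBound d L T α ζ ε)⌋₊ {s | |(s.reg 8 : ℝ) / K - I| ≤ ε} +
      (ENNReal.ofReal (1 / 200) + ENNReal.ofReal (1 / 1000)) := by
    rw [← add_assoc]
    refine hconc.trans (add_le_add (hhalt.trans ((haltProb_le_within_add
      ⌊200 * (timeConst A * timeBound d L T α ζ ε)⌋₊ _ _ _).trans ?_))
      (ENNReal.ofReal_le_ofReal hsmall))
    gcongr
    exact notHalted_le htime
  rw [mul_assoc 200]
  rw [← ENNReal.ofReal_add (by norm_num) (by norm_num)] at hfinal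
  refine le_trans ?_ (tsub_le_iff_right.2 hfinal)
  rw [← ENNReal.ofReal_one, ← ENNReal.ofReal_sub _ (by norm_num)]
  calc (99 / 100 : ℝ≥0∞) = ENNReal.ofReal (99 / 100) := by
        rw [ENNReal.ofReal_div_of_pos (by norm_num)]
        norm_num
    _ ≤ _ := ENNReal.ofReal_le_ofReal (by norm_num)

end accuracy

end HeatWalk

end

open HeatWalk in
theorem mainTheorem7 :
    ∃ (binom walk est : Prog) (c : ℕ) (C₀ κ : ℝ), 0 < C₀ ∧ 0 < κ ∧
      -- exact binomial sampling in expected logarithmic time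
      (∀ (M : Env) (l a b : ℕ), 1 ≤ b → a ≤ b → (l + b + 2) ^ c ≤ 2 ^ M.w →
        (∀ k, haltProb M binom (binomInput l a b) {s | s.reg 7 = k} = binomialLaw l (a / b) k) ∧
        expectedTime M binom (binomInput l a b) ≤ ENNReal.ofReal (C₀ * Real.log (2 + l))) ∧
      -- nested binomial sampling yields the endpoint of the simple random walk
      (∀ (d n m : ℕ) [NeZero d] [NeZero n] (x : Fin d → ZMod n),
        nestedBinomial d n d m x = simpleWalk d n m x) ∧
      -- `walk` samples that endpoint, and `est` counts the hits of the region among `K` samples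
      (∀ (d n m K w : ℕ) [NeZero d] [NeZero n] (p₀ : PMF (Fin d → ZMod n)) (σ : ℝ)
        (lo hi : Fin d → ℕ), 0 < σ → (∀ j, lo j < n ∧ hi j < n) →
        (d + n + m + K + 2) ^ c ≤ 2 ^ w →
        let M := gridEnv w fun k => σ * (p₀ k).toReal
        let s₀ := walkInput d n m K lo hi
        let endpoint := p₀.bind (nestedBinomial d n d m)
        (∀ x : Fin d → ZMod n,
          haltProb M walk s₀ {s | ∀ j : Fin d, s.mem (2 * d + j) = (x j).val} = endpoint x) ∧
        expectedTime M walk s₀ ≤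
          ENNReal.ofReal (C₀ * d * (Real.log (2 + n) + Real.log (2 + m))) ∧
        expectedCalls M walk s₀ binom = 2 * d ∧
        (∀ h, haltProb M est s₀ {s | s.reg 8 = h} =
          hitCount endpoint {k | ∀ j, lo j < (k j).val ∧ (k j).val ≤ hi j} K h) ∧
        expectedCalls M est s₀ walk = K) ∧
      -- accuracy and running time of the estimator with `K = ⌈κ / ε²⌉` samples
      ∀ A : ℝ, 1 ≤ A → ∃ C : ℝ, 0 < C ∧
        ∀ (d n m K w : ℕ) [NeZero d] [NeZero n] (L T α ζ ε Δx Δt : ℝ)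
          (u₀ : (Fin d → ℝ) → ℝ) (u : (Fin d → ℝ) → ℝ → ℝ) (lo hi : Fin d → ℕ),
          0 < L → 0 < T → 0 < α → 0 < ε → ε < 1 →
          IsHeatSolution d L T α ζ u₀ u →
          -- the discretisation and its normalisation
          Real.sqrt (d * ζ * (α * T + L ^ 2) / ε) * L ≤ n →
          n ≤ A * (Real.sqrt (d * ζ * (α * T + L ^ 2) / ε) * L) →
          Δx = L / n → Δt = Δx ^ 2 / (2 * d * α) → Δt ≤ T →
          ∑ k : Fin d → ZMod n, u₀ (gridPoint L k) = (n / L) ^ d →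
          -- the time `m Δt`, the region, the number of samples and the word length
          m * Δt ≤ T → (∀ j, lo j ≤ hi j ∧ hi j < n) →
          K = ⌈κ / ε ^ 2⌉₊ → (d + n + m + K + 2) ^ c ≤ 2 ^ w →
          let M := gridEnv w fun k : Fin d → ZMod n => u₀ (gridPoint L k)
          let s₀ := walkInput d n m K lo hi
          expectedTime M est s₀ ≤ ENNReal.ofReal (C * timeBound d L T α ζ ε) ∧
          99 / 100 ≤ haltProbWithin M est s₀ ⌊C * timeBound d L T α ζ ε⌋₊
            {s | |(s.reg 8 : ℝ) / K - ∫ x in Set.Icc (fun j => ((lo j : ℝ) + 1 / 2) * Δx)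
              (fun j => ((hi j : ℝ) + 1 / 2) * Δx), u x (m * Δt)| ≤ ε} := by
  refine ⟨binom, walk, est, 10, 2000000, 2000, by norm_num, by norm_num, binom_spec,
    fun d n m _ _ x => nestedBinomial_eq_simpleWalk d n m x, ?_, ?_⟩
  · intro d n m K w _ _ p₀ σ lo hi hσ hlo hw
    obtain ⟨h1, h2, h3⟩ := walk_spec d n m K w p₀ σ lo hi hσ hw
    obtain ⟨h4, h5⟩ := est_spec d n m K w p₀ σ lo hi hσ hlo hw
    exact ⟨h1, h2, h3, h4, h5⟩
  · intro A hA
    refine ⟨200 * timeConst A, mul_pos (by norm_num) (timeConst_pos hA), ?_⟩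
    intro d n m K w _ _ L T α ζ ε Δx Δt u₀ u lo hi hL hT hα hε hε1 h hX hn hx hΔ hΔT hsum hm hhi
      hK hw
    exact est_accuracy hA hL hT hα hε hε1 h hX hn hx hΔ hΔT hsum hm hhi hK hw
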